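/- **Setting.** Let $(V,q)$ be a non-degenerate real quadratic space of signature $(b^+,b^-)$ and rank $r=b^++b^-$, with bilinear form $(\cdot,\cdot)$ such that $q(x)=\frac12(x,x)$. Let $L\subset V$ be an even lattice of rank $r$ (so $q(L)\subset\mathbb Z$), $L'$ its dual lattice and $\det(L)$ its Gram determinant. Write $e(z)=e^{2\pi i z}$. Let $\mathrm{Mp}_2(\mathbb Z)$ be the group of pairs $(M,\phi)$ with $M=\begin{pmatrix}a&b\\c&d\end{pmatrix}\in \mathrm{SL}_2(\mathbb Z)$ and $\phi$ a holomorphic square root of $c\tau+d$ on the upper half plane $\mathbb H$, generated by $T=(\begin{pmatrix}1&1\\0&1\end{pmatrix},1)$ and $S=(\begin{pmatrix}0&-1\\1&0\end{pmatrix},\sqrt\tau)$, and let $\tilde\Gamma_\infty=\langle T\rangle$. Let $\rho_L$ be the Weil representation of $\mathrm{Mp}_2(\mathbb Z)$ on $\mathbb C[L'/L]$ (standard basis $\mathfrak e_\gamma$), i.e. $\rho_L(T)\mathfrak e_\gamma=e(q(\gamma))\mathfrak e_\gamma$ and $\rho_L(S)\mathfrak e_\gamma=\frac{\sqrt i^{\,b^--b^+}}{\sqrt{|L'/L|}}\sum_{\delta\in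 L'/L}e(-(\gamma,\delta))\mathfrak e_\delta$, and $\rho_L^*$ its dual. Let $\kappa\in\frac12\mathbb Z$, $\kappa\ge 2$, $2\kappa-b^-+b^+\equiv 0\pmod 4$. For $\mathrm{Re}(s)>1-\kappa/2$ the Eisenstein series $$E_0(\tau,s)=\frac12\sum_{(M,\phi)\in\tilde\Gamma_\infty\backslash \mathrm{Mp}_2(\mathbb Z)}\phi(\tau)^{-2\kappa}\,\mathrm{Im}(M\tau)^s\,\rho_L^*(M,\phi)^{-1}\mathfrak e_0$$ converges absolutely and is continuous in $\tau=x+iy$; for $\gamma\in L'/L$ and $n\in\mathbb Z-q(\gamma)$ let $c_0(\gamma,n,s,y)$ be the coefficient of $\mathfrak e_\gamma e(nx)$ in its Fourier expansion. Put $\mathcal W_s(y)=|y|^{-\kappa/2}W_{\mathrm{sgn}(y)\kappa/2,\,(1-\kappa)/2-s}(|y|)$ with the Whittaker function $W_{\nu,\mu}$. For $n\ne0$ one has $c_0(\gamma,n,s,y)=C(\gamma,n,s)\,\mathcal W_s(4\pi ny)$ with a function $C(\gamma,n,s)$ that does not depend on $y$, is holomorphic for $\mathrm{Re}(s)>1-\kappa/2$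 and continues meromorphically to $s\in\mathbb C$. **Notation.** Fix $\gamma\in L'/L$ and $0\neq n\in\mathbb Z-q(\gamma)$. Let $d_\gamma=\min\{b\in\mathbb Z_{>0}: b\gamma\in L\}$, $N_{\gamma,n}(a)=\#\{x\in L/aL:\ q(x-\gamma)+n\equiv0 \pmod a\}$, $w_p=1+2v_p(2nd_\gamma)$, and $$L^{(p)}_{\gamma,n}(X)=N_{\gamma,n}(p^{w_p})X^{w_p}+(1-p^{r-1}X)\sum_{\nu=0}^{w_p-1}N_{\gamma,n}(p^\nu)X^\nu .$$ Let $D=(-1)^{r/2}\det(L)$ if $r$ is even, $D=2(-1)^{(r+1)/2}d_\gamma^2\,n\det(L)$ if $r$ is odd, and write $D=D_0f^2$ with $D_0$ a fundamental discriminant ($D_0=1$ allowed) and $f\in\mathbb Z_{>0}$. Let $\chi_{D_0}$ be the character modulo $|D_0|$ given by the Kronecker symbol, $\delta=0$ if $D_0>0$ and $\delta=1$ if $D_0<0$, and $$\sigma_{\gamma,n}(s)=\begin{cases}\displaystyle\prod_{p\mid 2d_\gamma^2n\det(L)}\frac{L^{(p)}_{\gamma,n}(p^{1-r/2-s})}{1-\chi_{D_0}(p)p^{-s}},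 & r\text{ even},\\[2ex]\displaystyle\prod_{p\mid 2d_\gamma^2n\det(L)}\frac{1-\chi_{D_0}(p)p^{1/2-s}}{1-p^{1-2s}}\,L^{(p)}_{\gamma,n}(p^{1-r/2-s}), & r\text{ odd}.\end{cases}$$ **Theorem.** As meromorphic functions of $s\in\mathbb C$ (and hence at every $s$ with $\mathrm{Re}(s)>1-\kappa/2$ at which the denominators do not vanish): if $n>0$, then $C(\gamma,n,s)$ equals $$2^{2-2s}\pi^{-s}|n|^{\kappa+s-1}\cos\!\big(\pi(s-\tfrac\delta2+\tfrac{b^--b^+}4)\big)\frac{|D_0|^{2s+\kappa-1/2}\,\Gamma(2s+\kappa)}{\sqrt{|L'/L|}\;\Gamma(s+\kappa)}\cdot\frac{\sigma_{\gamma,n}(2s+\kappa)}{L(\chi_{D_0},1-2s-\kappa)}$$ if $r$ is even, and $$2^{2s+2\kappa-1/2}\pi^{-s}|n|^{\kappa+s-1}\frac{\sin(\pi(2s+\kappa))\,|D_0|^{1-\kappa-2s}\,\Gamma(2s+\kappa)}{\cos\!\big(\pi(s-\tfrac\delta2+\tfrac{b^--b^+-1}4)\big)\sqrt{|L'/L|}\;\Gamma(s+\kappa)}\cdot\frac{L(\chi_{D_0},\tfrac32-2s-\kappa)}{\zeta(2-4s-2\kappa)}\,\sigma_{\gamma,n}(2s+\kappa)$$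 if $r$ is odd. If $n<0$, the same formulas hold with $\Gamma(s+\kappa)$ replaced by $\Gamma(s)$. -/

import Mathlib

open scoped Real UpperHalfPlane MatrixGroups Manifold Topology Pointwise

noncomputable section

namespace WeilEisenstein

/-! ### The metaplectic group -/

/-- `Mp₂(ℤ)`: pairs of a matrix `(a b; c d)` in `SL₂(ℤ)` and a holomorphic square root of
`τ ↦ cτ + d` on the upper half plane. -/
@[ext]
structure Mp2Z where
  mat : SL(2, ℤ)
  phi : ℍ → ℂ
  holo : MDifferentiable 𝓘(ℂ) 𝓘(ℂ) phi
  sq : ∀ τ : ℍ, phi τ ^ 2 = (mat 1 0 : ℂ) * τ + (mat 1 1 : ℂ)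

namespace Mp2Z

lemma sq_denom (g : Mp2Z) (τ : ℍ) : g.phi τ ^ 2 = UpperHalfPlane.denom g.mat τ := by
  rw [g.sq, ModularGroup.denom_apply]

lemma phi_ne_zero (g : Mp2Z) (τ : ℍ) : g.phi τ ≠ 0 := by
  intro h
  have := g.sq_denom τ
  rw [h] at this
  exact UpperHalfPlane.denom_ne_zero (g.mat : GL (Fin 2) ℝ) τ (by simpa using! this.symm)

lemma mdiff_smul (M : SL(2, ℤ)) :
    MDifferentiable 𝓘(ℂ) 𝓘(ℂ) (fun τ : ℍ => M • τ) := by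
  have h : (0 : ℝ) < ((M : GL (Fin 2) ℝ)).det.val := by simp
  exact UpperHalfPlane.mdifferentiable_smul h

lemma denom_mul (M N : SL(2, ℤ)) (τ : ℍ) :
    UpperHalfPlane.denom ((M * N : SL(2, ℤ)) : GL (Fin 2) ℝ) τ
      = UpperHalfPlane.denom (M : GL (Fin 2) ℝ) ((N • τ : ℍ) : ℂ) *
          UpperHalfPlane.denom (N : GL (Fin 2) ℝ) τ := by
  have h := UpperHalfPlane.denom_cocycle_σ (M : GL (Fin 2) ℝ) (N : GL (Fin 2) ℝ) τ
  have hdet : (0 : ℝ) < (N : GL (Fin 2) ℝ).det.val := by simp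
  rw [UpperHalfPlane.σ, if_pos hdet] at h
  simpa using! h

/-- The group law `(M, φ)(M', φ') = (MM', φ(M'τ)φ'(τ))`. -/
instance : Mul Mp2Z where
  mul g h :=
    { mat := g.mat * h.mat
      phi := fun τ => g.phi (h.mat • τ) * h.phi τ
      holo := (g.holo.comp (mdiff_smul h.mat)).mul h.holo
      sq := fun τ => by
        rw [mul_pow, sq_denom, sq_denom, ← denom_mul, ModularGroup.denom_apply] }

instance : One Mp2Z where
  one :=
    { mat := 1
      phi := fun _ => 1
      holo := mdifferentiable_const
      sq := fun τ => by simp }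

instance : Inv Mp2Z where
  inv g :=
    { mat := g.mat⁻¹
      phi := fun τ => (g.phi (g.mat⁻¹ • τ))⁻¹
      holo := fun τ =>
        (differentiableAt_inv (g.phi_ne_zero (g.mat⁻¹ • τ))).mdifferentiableAt.comp τ
          ((g.holo.comp (mdiff_smul g.mat⁻¹)) τ)
      sq := fun τ => by
        have h := denom_mul g.mat g.mat⁻¹ τ
        have h1 : UpperHalfPlane.denom ((1 : SL(2, ℤ)) : GL (Fin 2) ℝ) τ = 1 := by
          rw [ModularGroup.denom_apply]; simp
        rw [mul_inv_cancel, h1] at h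
        rw [inv_pow, sq_denom, ← ModularGroup.denom_apply]
        exact (eq_inv_of_mul_eq_one_right h.symm).symm }

instance : Group Mp2Z :=
  Group.ofLeftAxioms
    (fun g h k => by
      apply Mp2Z.ext
      · exact mul_assoc g.mat h.mat k.mat
      · funext τ
        change g.phi (h.mat • (k.mat • τ)) * h.phi (k.mat • τ) * k.phi τ =
          g.phi ((h.mat * k.mat) • τ) * (h.phi (k.mat • τ) * k.phi τ)
        rw [mul_assoc, mul_smul])
    (fun g => by
      apply Mp2Z.ext
      · exact one_mul g.mat
      · funext τ
        exact one_mul (g.phi τ))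
    (fun g => by
      apply Mp2Z.ext
      · exact inv_mul_cancel g.mat
      · funext τ
        change (g.phi (g.mat⁻¹ • (g.mat • τ)))⁻¹ * g.phi τ = 1
        rw [inv_smul_smul]
        exact inv_mul_cancel₀ (g.phi_ne_zero τ))

/-- `T = ((1 1; 0 1), 1)`. -/
def T : Mp2Z where
  mat := ModularGroup.T
  phi := fun _ => 1
  holo := mdifferentiable_const
  sq := fun τ => by simp [ModularGroup.T]

/-- `S = ((0 -1; 1 0), √τ)`, with the principal branch of the square root. -/
def S : Mp2Z where
  mat := ModularGroup.S
  phi := fun τ => (τ : ℂ) ^ (1 / 2 : ℂ)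
  holo := fun τ =>
    (DifferentiableAt.cpow_const differentiableAt_id
      (Or.inr τ.im_ne_zero)).mdifferentiableAt.comp τ
      (UpperHalfPlane.mdifferentiable_coe τ)
  sq := fun τ => by
    rw [← Complex.cpow_nat_mul]
    simp [ModularGroup.S]

end Mp2Z

/-! ### Even lattices, discriminant groups and the Weil representation -/

section Lattice

variable {V : Type*} [AddCommGroup V] [Module ℝ V] (Q : QuadraticForm ℝ V) (L : Submodule ℤ V)

/-- The bilinear form `(x, y)` with `Q(x) = (x, x) / 2`. -/
abbrev bil (x y : V) : ℝ := QuadraticMap.polar Q x y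

/-- The dual lattice `L' = {x ∈ V | (x, L) ⊆ ℤ}`. -/
abbrev dualLattice : Submodule ℤ V := 
  LinearMap.BilinForm.dualSubmodule (QuadraticMap.polarBilin Q) L

/-- The discriminant group `L'/L`. -/
abbrev DiscGroup : Type _ := dualLattice Q L ⧸ L.submoduleOf (dualLattice Q L)

/-- `e(z) = exp(2πiz)`. -/
def e (z : ℂ) : ℂ := Complex.exp (2 * π * Complex.I * z)

variable {Q L} in
open Classical in
/-- The standard basis `(𝔢_γ)` of `ℂ[L'/L]`, realized as the space of functions `L'/L → ℂ`. -/
def basisVec (γ : DiscGroup Q L) : DiscGroup Q L → ℂ := Pi.single γ 1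

/-- The formulas that characterize the Weil representation `ρ_L` on the generators `T`, `S`:
`ρ_L(T) 𝔢_γ = e(Q(γ)) 𝔢_γ` and
`ρ_L(S) 𝔢_γ = √i ^ (b⁻ - b⁺) / √|L'/L| ∑_δ e(-(γ, δ)) 𝔢_δ`, the latter written out as the
`δ`-component, for each `δ`. -/
def IsWeilRep (ρ : Representation ℂ Mp2Z (DiscGroup Q L → ℂ)) : Prop :=
  (∀ γ : dualLattice Q L,
    ρ Mp2Z.T (basisVec (Submodule.Quotient.mk γ))
      = e (Q (γ : V)) • basisVec (Submodule.Quotient.mk γ)) ∧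
  (∀ γ δ : dualLattice Q L,
    ρ Mp2Z.S (basisVec (Submodule.Quotient.mk γ)) (Submodule.Quotient.mk δ)
      = Complex.exp (π * Complex.I / 4) ^
            ((sigNeg Q : ℤ) - (sigPos Q : ℤ))
          / (Real.sqrt (Nat.card (DiscGroup Q L)) : ℂ)
        * e (-(bil Q (γ : V) (δ : V) : ℂ)))

open Classical in
/-- The Weil representation `ρ_L` of `Mp₂(ℤ)` on `ℂ[L'/L]`. It is the unique representation with
the above values on the generators `T`, `S` of `Mp₂(ℤ)`. -/
def weilRep : Representation ℂ Mp2Z (DiscGroup Q L → ℂ) :=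
  if h : ∃ ρ, IsWeilRep Q L ρ then h.choose else 1

/-- The coefficient `ρ_{βγ}(g) = ⟨ρ_L(g) 𝔢_γ, 𝔢_β⟩`. -/
def weilCoeff (β γ : DiscGroup Q L) (g : Mp2Z) : ℂ := weilRep Q L g (basisVec γ) β

/-- The dual representation `ρ_L^*` on `ℂ[L'/L]`; its matrix is the transpose of that of
`ρ_L(g⁻¹)`. (The group `L'/L` is finite.) -/
def weilDual (g : Mp2Z) (v : DiscGroup Q L → ℂ) : DiscGroup Q L → ℂ :=
  fun γ => ∑ᶠ β : DiscGroup Q L, weilCoeff Q L β γ g⁻¹ * v β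

/-! ### Eisenstein series -/

/-- The Petersson slash operator of weight `κ = k/2`,
`(f ∣ (M, φ))(τ) = φ(τ) ^ (-2κ) ρ_L^*(M, φ)⁻¹ f(Mτ)`. -/
def slash (k : ℤ) (f : ℍ → DiscGroup Q L → ℂ) (g : Mp2Z) : ℍ → DiscGroup Q L → ℂ :=
  fun τ => g.phi τ ^ (-k) • weilDual Q L g⁻¹ (f (g.mat • τ))

/-- The coset space of `Mp₂(ℤ)` modulo multiplication by powers of `T` on the left. -/
abbrev CuspCosets : Type :=
  Quotient (QuotientGroup.rightRel (Subgroup.zpowers Mp2Z.T))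

/-- The term `(𝔢_β y^s) ∣ (M, φ)` of the Eisenstein series of weight `κ = k/2`, with `(M, φ)` a
representative of the coset `c`. For `Q(β) ∈ ℤ` it does not depend on the representative. -/
def eisensteinTerm (k : ℤ) (β : DiscGroup Q L) (s : ℂ) (c : CuspCosets) :
    ℍ → DiscGroup Q L → ℂ :=
  slash Q L k (fun τ => ((τ.im : ℂ) ^ s) • basisVec β) c.out

/-- The Eisenstein series `E_β(τ, s)` of weight `κ = k/2`. -/
def eisenstein (k : ℤ) (β : DiscGroup Q L) (s : ℂ) (τ : ℍ) : DiscGroup Q L → ℂ :=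
  (1 / 2 : ℂ) • ∑' c : CuspCosets, eisensteinTerm Q L k β s c τ

variable {Q L} in
/-- The Fourier coefficient of index `(γ, n)` of `f`, at height `y`: the coefficient of
`𝔢_γ e(nx)` in the expansion of `f(x + iy)`. -/
def fourierCoefficient (f : ℍ → DiscGroup Q L → ℂ) (γ : DiscGroup Q L) (n : ℚ) (y : ℝ)
    (hy : 0 < y) : ℂ :=
  ∫ x in (0 : ℝ)..1, f ⟨⟨x, y⟩, hy⟩ γ * e (-(n * x))

end Lattice

/-! ### Whittaker functions -/

/-- The confluent hypergeometric function `U(a, b, z)` of the second kind, for `z > 0`. If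
`Re a > 0`, then `m = 0` and this is the integral
`U(a, b, z) = Γ(a)⁻¹ ∫₀^∞ e^{-zt} t^{a-1} (1+t)^{b-a-1} dt`. In general it is the analytic
continuation in `a`, that one obtains by `m` partial integrations, with `Re (a + m) > 0`. -/
def kummerU (a b : ℂ) (z : ℝ) : ℂ :=
  let m : ℕ := ⌊1 - a.re⌋₊
  (-1) ^ m / Complex.Gamma (a + m) *
    ∫ t in Set.Ioi (0 : ℝ), (t : ℂ) ^ (a + m - 1) *
      iteratedDeriv m
        (fun u : ℝ => Complex.exp (-(z * u)) * (1 + (u : ℂ)) ^ (b - a - 1)) t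

/-- The Whittaker function `W_{ν, μ}(z) = e^{-z/2} z^{1/2-μ} U(1/2 - μ - ν, 1 - 2μ, z)` for
`z > 0`. (It is even in `μ`.) -/
def whittakerW (ν μ : ℂ) (z : ℝ) : ℂ :=
  Complex.exp (-z / 2) * (z : ℂ) ^ (1 / 2 - μ) * kummerU (1 / 2 - μ - ν) (1 - 2 * μ) z

/-- `𝒲_s(y) = |y| ^ (-κ/2) W_{sgn(y) κ/2, (1-κ)/2 - s}(|y|)`. -/
def calW (κ : ℝ) (s : ℂ) (y : ℝ) : ℂ :=
  ((|y| ^ (-κ / 2) : ℝ) : ℂ) * whittakerW (SignType.sign y * κ / 2) ((1 - κ) / 2 - s) |y|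

/-! ### Quadratic characters and their `L`-functions -/

/-- The Kronecker symbol `(D / a)` for a natural number `a`. -/
def kroneckerSymbol (D : ℤ) (a : ℕ) : ℤ :=
  if a = 0 then (if D.natAbs = 1 then 1 else 0)
  else ZMod.χ₈ (D : ZMod 8) ^ padicValNat 2 a * jacobiSym D (a / 2 ^ padicValNat 2 a)

open Classical in
/-- `L(χ_D, s)` for `χ_D` the character modulo `|D|` given by the Kronecker symbol: the meromorphic
continuation of `∑ χ_D(a) a^{-s}`. -/
def kroneckerL (D : ℤ) (s : ℂ) : ℂ :=
  if h : D = 0 then 0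
  else
    haveI : NeZero D.natAbs := ⟨Int.natAbs_ne_zero.mpr h⟩
    ZMod.LFunction (fun a : ZMod D.natAbs => (kroneckerSymbol D a.val : ℂ)) s

/-- Fundamental discriminants: `1` and the discriminants of the quadratic number fields. -/
def IsFundamentalDiscriminant (d : ℤ) : Prop :=
  (d % 4 = 1 ∧ Squarefree d) ∨
    ∃ m : ℤ, d = 4 * m ∧ (m % 4 = 2 ∨ m % 4 = 3) ∧ Squarefree m

/-- `δ = 0` if `D₀ > 0` and `δ = 1` if `D₀ < 0`. -/
def signDelta (D₀ : ℤ) : ℂ := if 0 < D₀ then 0 else 1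

/-! ### Representation numbers and the finite Euler product -/

section Local

variable {V : Type*} [AddCommGroup V] [Module ℝ V] (Q : QuadraticForm ℝ V) (L : Submodule ℤ V)
  {r : ℕ} (b : Module.Basis (Fin r) ℝ V)

/-- The Gram determinant `det ((b_i, b_j))` of the lattice with basis `b`. -/
def gramDet : ℝ := Matrix.det (Matrix.of fun i j => bil Q (b i) (b j))

/-- The level `d_γ = min {m > 0 | mγ ∈ L}`. -/
def level (γ : V) : ℕ := sInf {m : ℕ | 0 < m ∧ m • γ ∈ L}

/-- The representation number
`N_{γ,n}(a) = #{x ∈ L/aL | Q(x - γ) + n ≡ 0 mod a}`. -/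
def repCount (γ : V) (n : ℚ) (a : ℕ) : ℕ :=
  Set.ncard
    ((fun x : L => (Submodule.Quotient.mk x : L ⧸ ((a : ℤ) • (⊤ : Submodule ℤ L)))) ''
      {x : L | ∃ m : ℤ, Q ((x : V) - γ) + n = a * m})

/-- `w_p = 1 + 2 v_p(2 n d_γ)`; here `2 n d_γ` is a nonzero integer. -/
def wExp (γ : V) (n : ℚ) (p : ℕ) : ℕ := 1 + 2 * (padicValRat p (2 * n * level L γ)).toNat

/-- The polynomial
`L_{γ,n}^{(p)}(X) = N(p^w) X^w + (1 - p^{r-1} X) ∑_{ν < w} N(p^ν) X^ν`, with `w = w_p`, as a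
function of `X ∈ ℂ`; here `r` is the rank of `L`. -/
def localPoly (r : ℕ) (γ : V) (n : ℚ) (p : ℕ) (X : ℂ) : ℂ :=
  repCount Q L γ n (p ^ wExp L γ n p) * X ^ wExp L γ n p +
    (1 - (p : ℂ) ^ ((r : ℤ) - 1) * X) *
      ∑ ν ∈ Finset.range (wExp L γ n p), (repCount Q L γ n (p ^ ν) : ℂ) * X ^ ν

/-- The discriminant `D`: `(-1)^{r/2} det L` if `r` is even and
`2 (-1)^{(r+1)/2} d_γ² n det L` if `r` is odd. -/
def latticeDiscriminant (γ : V) (n : ℚ) : ℝ :=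
  if Even r then (-1) ^ (r / 2) * gramDet Q b
  else 2 * (-1) ^ ((r + 1) / 2) * (level L γ : ℝ) ^ 2 * n * gramDet Q b

/-- The set of primes that divide the nonzero integer `2 d_γ² n det L`. -/
def badPrimes (γ : V) (n : ℚ) : Finset ℕ :=
  Nat.primeFactors ⌊|2 * (level L γ : ℝ) ^ 2 * n * gramDet Q b|⌋₊

/-- The generalized divisor sum `σ_{γ,n}(s)`. -/
def sigma (γ : V) (n : ℚ) (D₀ : ℤ) (s : ℂ) : ℂ :=
  if Even r then
    ∏ p ∈ badPrimes Q L b γ n,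
      localPoly Q L r γ n p ((p : ℂ) ^ (1 - r / 2 - s)) /
        (1 - kroneckerSymbol D₀ p * (p : ℂ) ^ (-s))
  else
    ∏ p ∈ badPrimes Q L b γ n,
      (1 - kroneckerSymbol D₀ p * (p : ℂ) ^ (1 / 2 - s)) / (1 - (p : ℂ) ^ (1 - 2 * s)) *
        localPoly Q L r γ n p ((p : ℂ) ^ (1 - r / 2 - s))

/-- The factor `Γ(s + κ)` for `n > 0`, and `Γ(s)` for `n < 0`. -/
def gammaFactor (κ : ℝ) (n : ℚ) (s : ℂ) : ℂ :=
  if 0 < n then Complex.Gamma (s + κ) else Complex.Gamma s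

/-- The closed formula for `C(γ, n, s)` in even rank. -/
def coeffEven (κ : ℝ) (γ : dualLattice Q L) (n : ℚ) (D₀ : ℤ) (s : ℂ) : ℂ :=
  (2 : ℂ) ^ (2 - 2 * s) * (π : ℂ) ^ (-s) * ((|n| : ℚ) : ℂ) ^ (κ + s - 1) *
    Complex.cos (π * (s - signDelta D₀ / 2 +
      ((sigNeg Q : ℂ) - sigPos Q) / 4)) *
    ((D₀.natAbs : ℂ) ^ (2 * s + κ - 1 / 2) * Complex.Gamma (2 * s + κ) /
      ((Real.sqrt (Nat.card (DiscGroup Q L)) : ℂ) * gammaFactor κ n s)) *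
    (sigma Q L b γ n D₀ (2 * s + κ) / kroneckerL D₀ (1 - 2 * s - κ))

/-- The closed formula for `C(γ, n, s)` in odd rank. -/
def coeffOdd (κ : ℝ) (γ : dualLattice Q L) (n : ℚ) (D₀ : ℤ) (s : ℂ) : ℂ :=
  (2 : ℂ) ^ (2 * s + 2 * κ - 1 / 2) * (π : ℂ) ^ (-s) * ((|n| : ℚ) : ℂ) ^ (κ + s - 1) *
    (Complex.sin (π * (2 * s + κ)) * (D₀.natAbs : ℂ) ^ (1 - κ - 2 * s) *
        Complex.Gamma (2 * s + κ) /
      (Complex.cos (π * (s - signDelta D₀ / 2 +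
          ((sigNeg Q : ℂ) - sigPos Q - 1) / 4)) *
        (Real.sqrt (Nat.card (DiscGroup Q L)) : ℂ) * gammaFactor κ n s)) *
    (kroneckerL D₀ (3 / 2 - 2 * s - κ) / riemannZeta (2 - 4 * s - 2 * κ)) *
    sigma Q L b γ n D₀ (2 * s + κ)

end Local

end WeilEisenstein

end

open WeilEisenstein

/-!
Over the coset with bottom row `(c, d)`, the `γ`-component of the Eisenstein series involves the entry
of `ρ_L(M, φ)` at `(0, γ)`. By the transformation law of theta functions this entry is, up to constants,
the Gauss sum `∑ e(d q(x - γ) / c)` over `x ∈ L/cL`. Unfolding the Fourier integral over `d` modulo `c`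
therefore gives, with `S = 2s + κ`,

  `constant * (∑ m, H(m) m^{-r/2-S}) * (archimedean integral)`,

where `H(m)` sums `e(δ (q(x - γ) + n) / m)` over units `δ` modulo `m` and `x ∈ L/mL`
(`weilCoeff_zero_eq`, `fourierCoefficient_eisenstein`).

*The Weil representation.* An orthogonal basis of `V` inside `L` spans a sublattice `M`, so that
`ℂ[L'/L]` embeds in `ℂ[M'/M]`, a tensor product of spaces of rank one. In rank one the representation,
together with its first row, is read off from the theta functions with characteristics, which the
metaplectic group permutes linearly by Poisson summation (`theta_S`, `exists_rankOne_weil`,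
`OrthogonalFrame.exists_isWeilRep`). Weyl's bound for the Gauss sums yields convergence and continuity
for `Re s > 1 - κ/2` (`exists_summable_bound`).

*The Dirichlet series.* `H` is multiplicative. It vanishes at high powers of every prime by an argument
of Hensel type (`unitSum_prime_pow_eq_zero`), so the local factor is the polynomial `L^{(p)}`
(`localPoly_eq`). At a prime `p` not dividing `2 d² n det(L)` only `H(1)` and `H(p)` contribute, and
diagonalizing the form over `ZMod p` expresses `H(p)` by powers of the quadratic Gauss sum. The local
factor is then that of `1 / L(χ, S)` in even and of `L(χ, S - 1/2) / ζ(2S - 1)` in odd rank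
(`unitSum_prime`, `tsum_term_even`, `tsum_term_odd`).

*The archimedean integral.* Writing one of the two powers as a Gamma integral and interchanging the
integrations leaves a Fourier inversion, which turns the integral into the one that defines the
confluent hypergeometric function `U`, that is, into a Whittaker function (`integral_archimedean`).

*The closed formulas.* The functional equations of `ζ` and of `L(χ, ·)` transform the result, which is
holomorphic for `Re s > 1 - κ/2`, into the two formulas. The functional equation of a real primitive
character with the correct sign rests on the evaluation of quadratic Gauss sums, which is once more the
transformation of a theta function (`exists_isRealGaussChar`, `kroneckerL_one_sub`). The identity of
meromorphic functions follows by the identity theorem (`eventuallyEq_codiscrete_of_eqOn`).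
-/

noncomputable section

namespace WeilEisenstein

/-! ### Generators of the metaplectic group -/

namespace Mp2Z

@[simp] lemma mul_mat (g h : Mp2Z) : (g * h).mat = g.mat * h.mat := rfl
@[simp] lemma mul_phi (g h : Mp2Z) (τ : ℍ) : (g * h).phi τ = g.phi (h.mat • τ) * h.phi τ := rfl
@[simp] lemma one_mat : (1 : Mp2Z).mat = 1 := rfl
@[simp] lemma one_phi (τ : ℍ) : (1 : Mp2Z).phi τ = 1 := rfl
@[simp] lemma inv_phi (g : Mp2Z) (τ : ℍ) : (g⁻¹).phi τ = (g.phi (g.mat⁻¹ • τ))⁻¹ := rfl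
@[simp] lemma T_mat : T.mat = ModularGroup.T := rfl
@[simp] lemma T_phi (τ : ℍ) : T.phi τ = 1 := rfl
@[simp] lemma S_mat : S.mat = ModularGroup.S := rfl
lemma S_phi (τ : ℍ) : S.phi τ = (τ : ℂ) ^ (1 / 2 : ℂ) := rfl

/-- The projection `Mp₂(ℤ) → SL₂(ℤ)`. -/
def matHom : Mp2Z →* SL(2, ℤ) where
  toFun := mat
  map_one' := rfl
  map_mul' _ _ := rfl

lemma zpow_mat (g : Mp2Z) (n : ℤ) : (g ^ n).mat = g.mat ^ n := map_zpow matHom g n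

/-- Two holomorphic square roots of `cτ + d` agree up to a global sign, since `ℍ` is connected. -/
lemma phi_eq_or_eq_neg {g h : Mp2Z} (hm : g.mat = h.mat) :
    (∀ τ, g.phi τ = h.phi τ) ∨ (∀ τ, g.phi τ = -h.phi τ) := by
  have hc : Continuous fun τ : ℍ => g.phi τ / h.phi τ :=
    g.holo.continuous.div h.holo.continuous h.phi_ne_zero
  have hsq : ∀ τ : ℍ, (g.phi τ / h.phi τ) ^ 2 = 1 := fun τ => by
    rw [div_pow, g.sq, h.sq, hm, ← h.sq, div_self (pow_ne_zero 2 (h.phi_ne_zero τ))]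
  have hcon : PreconnectedSpace ℍ := inferInstance
  have key : (∀ τ : ℍ, g.phi τ / h.phi τ = 1) ∨ (∀ τ : ℍ, g.phi τ / h.phi τ = -1) := by
    have := (isPreconnected_univ (α := ℍ)).eq_or_eq_neg_of_sq_eq (f := fun τ => g.phi τ / h.phi τ)
      (g := fun _ => (1 : ℂ)) hc.continuousOn continuousOn_const
      (fun τ _ => by simpa using hsq τ) (by simp)
    simpa [Set.EqOn] using this
  refine key.imp (fun h1 τ => ?_) (fun h1 τ => ?_)
  · exact (div_eq_one_iff_eq (h.phi_ne_zero τ)).mp (h1 τ)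
  · have := h1 τ
    rw [div_eq_iff (h.phi_ne_zero τ)] at this
    simpa using this

/-- An element of `Mp₂(ℤ)` is determined by its matrix and the value of `φ` at one point. -/
lemma ext_of_apply {g h : Mp2Z} (hm : g.mat = h.mat) (τ : ℍ) (hτ : g.phi τ = h.phi τ) : g = h := by
  rcases phi_eq_or_eq_neg hm with h1 | h1
  · exact Mp2Z.ext hm (funext h1)
  · exfalso
    have := h1 τ
    rw [hτ] at this
    exact h.phi_ne_zero τ (self_eq_neg.mp this)

/-- The nontrivial element `(1, -1)` of the kernel of `Mp₂(ℤ) → SL₂(ℤ)`. -/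
def negOne : Mp2Z where
  mat := 1
  phi := fun _ => -1
  holo := mdifferentiable_const
  sq := fun τ => by simp

@[simp] lemma negOne_mat : negOne.mat = 1 := rfl
@[simp] lemma negOne_phi (τ : ℍ) : negOne.phi τ = -1 := rfl

lemma smul_S (τ : ℍ) : ((ModularGroup.S • τ : ℍ) : ℂ) = -1 / τ := by
  rw [UpperHalfPlane.modular_S_smul]
  simp [neg_div]

/-- The principal branches satisfy `√(-1/τ) = i / √τ` on `ℍ`, because `arg (-1/τ) = π - arg τ`. -/
lemma cpow_half_neg_inv (τ : ℍ) :
    (-1 / (τ : ℂ)) ^ (1 / 2 : ℂ) = Complex.I / (τ : ℂ) ^ (1 / 2 : ℂ) := by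
  have h0 : (τ : ℂ) ≠ 0 := UpperHalfPlane.ne_zero τ
  have h1 : (-1 / (τ : ℂ)) ≠ 0 := by simp [h0]
  have harg : Complex.arg (-1 / (τ : ℂ)) = π - Complex.arg τ := by
    have h2 : 0 < Complex.arg (τ : ℂ) := by
      rcases (Complex.arg_nonneg_iff.mpr τ.im_pos.le).lt_or_eq with h | h
      · exact h
      · exact absurd (Complex.arg_eq_zero_iff.mp h.symm).2 τ.im_pos.ne'
    have h3 := Complex.arg_lt_pi_iff.mpr (Or.inr τ.im_pos.ne')
    have : (-1 / (τ : ℂ)) = -(τ : ℂ)⁻¹ := by rw [neg_div, one_div]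
    rw [this]
    have hinv : Complex.arg ((τ : ℂ)⁻¹) = -Complex.arg τ := by
      rw [Complex.arg_inv, if_neg h3.ne]
    rw [Complex.arg_neg_eq_arg_add_pi_of_im_neg, hinv]
    · ring
    · rw [Complex.inv_im]
      exact div_neg_of_neg_of_pos (by simpa using τ.im_pos) (Complex.normSq_pos.mpr h0)
  have hlog : Complex.log (-1 / (τ : ℂ)) = π * Complex.I - Complex.log τ := by
    rw [Complex.log, Complex.log, harg, norm_div, norm_neg, norm_one, one_div, Real.log_inv]
    push_cast
    ring
  rw [Complex.cpow_def_of_ne_zero h1, Complex.cpow_def_of_ne_zero h0, hlog, sub_mul,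
    Complex.exp_sub]
  congr 1
  rw [show (π : ℂ) * Complex.I * (1 / 2) = π / 2 * Complex.I by ring, Complex.exp_pi_div_two_mul_I]

lemma S_pow_two_phi (τ : ℍ) : (S * S).phi τ = Complex.I := by
  rw [mul_phi, S_phi, S_phi, S_mat, smul_S, cpow_half_neg_inv, div_mul_cancel₀]
  rw [Complex.cpow_ne_zero_iff]
  left
  exact UpperHalfPlane.ne_zero τ

/-- `S⁴` is the generator of the kernel of `Mp₂(ℤ) → SL₂(ℤ)`, so that generators of `SL₂(ℤ)` lift to
generators of `Mp₂(ℤ)`. -/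
lemma S_pow_four : S * S * (S * S) = negOne := by
  apply Mp2Z.ext
  · change (ModularGroup.S * ModularGroup.S) * (ModularGroup.S * ModularGroup.S) = 1
    decide
  · funext τ
    rw [mul_phi, S_pow_two_phi, S_pow_two_phi, Complex.I_mul_I, negOne_phi]

lemma negOne_mul_phi (g : Mp2Z) (τ : ℍ) : (negOne * g).phi τ = -g.phi τ := by simp

/-- `Mp₂(ℤ)` is generated by `S` and `T`. -/
theorem closure_S_T : Subgroup.closure {S, T} = ⊤ := by
  rw [eq_top_iff]
  intro g _
  have hS : S ∈ Subgroup.closure {S, T} := Subgroup.subset_closure (by simp)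
  have hT : T ∈ Subgroup.closure {S, T} := Subgroup.subset_closure (by simp)
  have hneg : negOne ∈ Subgroup.closure {S, T} := by
    rw [← S_pow_four]
    exact mul_mem (mul_mem hS hS) (mul_mem hS hS)
  have hmap : g.mat ∈ (Subgroup.closure {S, T}).map matHom := by
    rw [MonoidHom.map_closure]
    have : (matHom '' {S, T} : Set SL(2, ℤ)) = {ModularGroup.S, ModularGroup.T} := by
      simp [Set.image_pair, matHom]
    rw [this, SpecialLinearGroup.SL2Z_generators]
    trivial
  obtain ⟨h, hh, hhg⟩ := hmap
  have hm : h.mat = g.mat := hhg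
  rcases phi_eq_or_eq_neg hm with h1 | h1
  · rwa [← Mp2Z.ext hm (funext h1)]
  · have : g = negOne * h := by
      apply Mp2Z.ext
      · simp [hm]
      · funext τ
        simp [h1]
    rw [this]
    exact mul_mem hneg hh

end Mp2Z

/-! ### Representations of a group on an invariant subspace -/

/-- Let `σ` be a representation of a group generated by `s` on a space `E` and `J : W → E` an
injective linear map. If the generators act through `J` by endomorphisms of `W`, so does the
whole group. -/
theorem exists_representation_of_intertwining {G E W : Type*} [Group G] [AddCommGroup E]
    [Module ℂ E] [AddCommGroup W] [Module ℂ W] [FiniteDimensional ℂ W] (σ : Representation ℂ G E)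
    (J : W →ₗ[ℂ] E) (hJ : Function.Injective J) {s : Set G} (hs : Subgroup.closure s = ⊤)
    (h : ∀ g ∈ s, ∃ A : W →ₗ[ℂ] W, ∀ w, σ g (J w) = J (A w)) :
    ∃ ρ : Representation ℂ G W, ∀ g w, σ g (J w) = J (ρ g w) := by
  have key : ∀ g : G, ∃ A : W →ₗ[ℂ] W, ∀ w, σ g (J w) = J (A w) := by
    intro g
    have hg : g ∈ Subgroup.closure s := hs ▸ Subgroup.mem_top g
    induction hg using Subgroup.closure_induction with
    | mem x hx => exact h x hx
    | one => exact ⟨LinearMap.id, fun w => by simp⟩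
    | mul x y _ _ hx hy =>
      obtain ⟨A, hA⟩ := hx
      obtain ⟨B, hB⟩ := hy
      exact ⟨A ∘ₗ B, fun w => by simp [hA, hB]⟩
    -- the block of an inverse is inverse to the block, which is invertible by finite dimension
    | inv x _ hx =>
      obtain ⟨A, hA⟩ := hx
      have hinj : Function.Injective A := fun v w hvw => by
        apply hJ
        have h1 : σ x (J v) = σ x (J w) := by rw [hA, hA, hvw]
        simpa using congrArg (σ x⁻¹) h1
      let e := LinearEquiv.ofInjectiveEndo A hinj
      refine ⟨e.symm, fun w => ?_⟩
      obtain ⟨v, rfl⟩ := e.surjective w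
      have h1 : J (e v) = σ x (J v) := (hA v).symm
      rw [h1]
      simp
  choose A hA using key
  refine ⟨⟨⟨A, ?_⟩, ?_⟩, hA⟩
  · ext w
    apply hJ
    rw [← hA]
    simp
  · intro x y
    ext w
    apply hJ
    rw [← hA]
    simp [hA]

/-! ### Theta functions of one variable with characteristics -/

lemma e_add (z w : ℂ) : e (z + w) = e z * e w := by
  simp only [e]; rw [← Complex.exp_add]; ring_nf

@[simp] lemma e_zero : e 0 = 1 := by simp [e]

@[simp] lemma e_int (n : ℤ) : e n = 1 := by
  rw [e, Complex.exp_eq_one_iff]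
  exact ⟨n, by ring⟩

lemma e_neg (z : ℂ) : e (-z) = (e z)⁻¹ := by
  simp only [e]; rw [← Complex.exp_neg]; ring_nf

lemma e_ne_zero (z : ℂ) : e z ≠ 0 := Complex.exp_ne_zero _

lemma norm_e_ofReal (x : ℝ) : ‖e x‖ = 1 := by
  rw [e, show 2 * (π : ℂ) * Complex.I * x = ((2 * π * x : ℝ) : ℂ) * Complex.I by push_cast; ring,
    Complex.norm_exp_ofReal_mul_I]

lemma e_eq_of_sub_int {z w : ℂ} (n : ℤ) (h : z - w = n) : e z = e w := by
  rw [show z = w + n by rw [← h]; ring, e_add, e_int, mul_one]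

/-- The term `e((k + Nu)² τ / (2N) + kv + Nuv/2)` of the theta series in real coordinates
`z = uτ + v`, for the lattice `ℤ` with the quadratic form `N x² / 2`. -/
def thetaTerm (N : ℕ) (k : ℤ) (τ : ℂ) (u v : ℝ) : ℂ :=
  e ((k + N * u) ^ 2 * τ / (2 * N) + k * v + N * u * v / 2)

/-- The theta series with the coefficient function `f` on the dual lattice `ℤ / N ≅ ℤ`. -/
def theta (N : ℕ) (f : ℤ → ℂ) (τ : ℂ) (u v : ℝ) : ℂ := ∑' k : ℤ, f k * thetaTerm N k τ u v

section

variable {N : ℕ} [NeZero N]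

lemma thetaTerm_eq_jacobi (k : ℤ) (τ : ℂ) (u v : ℝ) :
    thetaTerm N k τ u v =
      e (N * u * (u * τ + v) / 2) * jacobiTheta₂_term k (u * τ + v) (τ / N) := by
  have hN : (N : ℂ) ≠ 0 := NeZero.ne _
  simp only [thetaTerm, e, jacobiTheta₂_term]
  rw [← Complex.exp_add]
  congr 1
  field_simp
  ring

lemma div_natCast_im_pos {τ : ℂ} (hτ : 0 < τ.im) : 0 < (τ / N).im := by
  rw [Complex.div_natCast_im]
  exact div_pos hτ (Nat.cast_pos.mpr (NeZero.pos N))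

lemma summable_thetaTerm {τ : ℂ} (hτ : 0 < τ.im) (u v : ℝ) :
    Summable fun k : ℤ => thetaTerm N k τ u v := by
  simp_rw [thetaTerm_eq_jacobi]
  exact ((summable_jacobiTheta₂_term_iff _ _).mpr (div_natCast_im_pos hτ)).mul_left _

lemma summable_mul_thetaTerm {f : ℤ → ℂ} {B : ℝ} (hf : ∀ k, ‖f k‖ ≤ B) {τ : ℂ} (hτ : 0 < τ.im)
    (u v : ℝ) : Summable fun k : ℤ => f k * thetaTerm N k τ u v := by
  refine Summable.of_norm_bounded ((summable_thetaTerm (N := N) hτ u v).norm.mul_left B) fun k => ?_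
  rw [norm_mul]
  exact mul_le_mul_of_nonneg_right (hf k) (norm_nonneg _)

/-- A periodic function is bounded. -/
lemma exists_bound_comp_cast (f : ZMod N → ℂ) : ∃ B : ℝ, ∀ k : ℤ, ‖f (k : ZMod N)‖ ≤ B :=
  ⟨∑ l, ‖f l‖, fun k => Finset.single_le_sum (f := fun l => ‖f l‖) (fun _ _ => norm_nonneg _)
    (Finset.mem_univ (k : ZMod N))⟩

/-- Translation of `τ` by an integer. -/
lemma theta_add_int (f : ℤ → ℂ) (τ : ℂ) (d : ℤ) (u v : ℝ) :
    theta N f (τ + d) u v = theta N (fun k => f k * e (d * k ^ 2 / (2 * N))) τ u (v + d * u) := by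
  have hN : (N : ℂ) ≠ 0 := NeZero.ne _
  simp only [theta]
  refine tsum_congr fun k => ?_
  rw [mul_assoc]
  congr 1
  rw [thetaTerm, thetaTerm, ← e_add]
  congr 1
  push_cast
  field_simp
  ring

/-- The dependence of the theta series on the scale of the lattice. -/
lemma theta_scale {c : ℕ} [NeZero c] (f : ℤ → ℂ) (τ : ℂ) (u v : ℝ) :
    theta (N * c) f (c * τ) (u / c) v = theta N f τ u v := by
  have hN : (N : ℂ) ≠ 0 := NeZero.ne _
  have hc : (c : ℂ) ≠ 0 := NeZero.ne _
  simp only [theta]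
  refine tsum_congr fun k => ?_
  rw [thetaTerm, thetaTerm]
  congr 2
  push_cast
  field_simp

/-- A sum over the residue class of `l` modulo `N`, parametrized by `ℤ`. -/
lemma tsum_ite_cast_eq (l : ZMod N) (t : ℤ → ℂ) :
    ∑' k : ℤ, (if (k : ZMod N) = l then t k else 0) = ∑' n : ℤ, t (N * n + l.val) := by
  have hinj : Function.Injective fun n : ℤ => (N : ℤ) * n + l.val := fun a b h => by
    have hN : N ≠ 0 := NeZero.ne _
    simpa [hN] using h
  rw [← hinj.tsum_eq]
  · refine tsum_congr fun n => ?_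
    simp
  · intro k hk
    rw [Function.mem_support] at hk
    have h1 : (k : ZMod N) = l := by
      by_contra h
      exact hk (if_neg h)
    have h2 : ((k - l.val : ℤ) : ZMod N) = 0 := by simp [h1]
    obtain ⟨n, hn⟩ := (ZMod.intCast_zmod_eq_zero_iff_dvd _ _).mp h2
    exact ⟨n, by simp only; omega⟩

lemma cpow_half_neg_I_mul {τ : ℂ} (hτ : 0 < τ.im) :
    (-Complex.I * τ) ^ (1 / 2 : ℂ) = e (-1 / 8) * τ ^ (1 / 2 : ℂ) := by
  have h0 : τ ≠ 0 := by rintro rfl; simp at hτ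
  have h1 : -Complex.I * τ ≠ 0 := by simp [h0]
  have hlog : Complex.log (-Complex.I * τ) = Complex.log (-Complex.I) + Complex.log τ := by
    apply Complex.log_mul (by simp) h0
    rw [Complex.arg_neg_I]
    have h2 := Complex.arg_nonneg_iff.mpr hτ.le
    have h3 := Complex.arg_le_pi τ
    constructor <;> linarith [Real.pi_pos]
  rw [Complex.cpow_def_of_ne_zero h1, Complex.cpow_def_of_ne_zero h0, hlog, add_mul,
    Complex.exp_add, Complex.log_neg_I, e]
  congr 2
  ring

lemma cpow_half_div_natCast (z : ℂ) :
    (z / N) ^ (1 / 2 : ℂ) = z ^ (1 / 2 : ℂ) / (Real.sqrt N : ℂ) := by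
  have hN : (0 : ℝ) < N := Nat.cast_pos.mpr (NeZero.pos N)
  have h1 : z / N = ((N : ℝ)⁻¹ : ℝ) * z := by push_cast; rw [mul_comm, div_eq_mul_inv]
  rcases eq_or_ne z 0 with rfl | hz
  · simp
  have h2 : ((N : ℝ)⁻¹ : ℝ) * z ≠ 0 :=
    mul_ne_zero (Complex.ofReal_ne_zero.mpr (inv_pos.mpr hN).ne') hz
  rw [h1, Complex.cpow_def_of_ne_zero h2, Complex.log_ofReal_mul (inv_pos.mpr hN) hz, add_mul, Complex.exp_add,
    Complex.cpow_def_of_ne_zero hz, mul_comm, div_eq_mul_inv]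
  congr 1
  rw [Real.sqrt_eq_rpow, ← Complex.ofReal_inv, ← Real.rpow_neg hN.le, Real.rpow_def_of_pos hN,
    Real.log_inv]
  push_cast
  congr 1
  ring

/-- The transformation of the theta series under `τ ↦ -1/τ`. -/
theorem theta_S (f : ZMod N → ℂ) (τ : ℍ) (u v : ℝ) :
    (-1 / (τ : ℂ)) ^ (1 / 2 : ℂ) * theta N (fun k => f k) (-1 / τ) v (-u) =
      e (1 / 8) / (Real.sqrt N : ℂ) *
        theta N (fun k => ∑ l : ZMod N, f l * ZMod.stdAddChar (l * (k : ZMod N))) τ u v := by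
  have hN : (N : ℂ) ≠ 0 := NeZero.ne _
  have hτ := τ.im_pos
  have hτ0 : (τ : ℂ) ≠ 0 := UpperHalfPlane.ne_zero τ
  have hτ' : 0 < (-1 / (τ : ℂ)).im := by
    rw [← Mp2Z.smul_S]
    exact (ModularGroup.S • τ).im_pos
  -- both sides are linear in `f`, and each residue class is a Jacobi theta function
  have hL : theta N (fun k => f k) (-1 / τ) v (-u) =
      ∑ l : ZMod N, f l * ∑' n : ℤ, thetaTerm N (N * n + l.val) (-1 / τ) v (-u) := by
    have h1 : ∀ l : ZMod N, f l * ∑' n : ℤ, thetaTerm N (N * n + l.val) (-1 / τ) v (-u) =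
        ∑' k : ℤ, (if (k : ZMod N) = l then f l * thetaTerm N k (-1 / τ) v (-u) else 0) := by
      intro l
      rw [tsum_ite_cast_eq, tsum_mul_left]
    simp_rw [h1]
    rw [← Summable.tsum_finsetSum]
    · simp only [theta]
      refine tsum_congr fun k => ?_
      simp
    · intro l _
      refine Summable.of_norm_bounded ((summable_thetaTerm (N := N) hτ' v (-u)).norm.mul_left ‖f l‖)
        fun k => ?_
      split_ifs
      · rw [norm_mul]
      · simpa using mul_nonneg (norm_nonneg _) (norm_nonneg _)
  have hR : theta N (fun k => ∑ l : ZMod N, f l * ZMod.stdAddChar (l * (k : ZMod N))) τ u v =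
      ∑ l : ZMod N, f l * ∑' k : ℤ, ZMod.stdAddChar (l * (k : ZMod N)) * thetaTerm N k τ u v := by
    simp_rw [← tsum_mul_left]
    rw [← Summable.tsum_finsetSum]
    · simp only [theta]
      refine tsum_congr fun k => ?_
      rw [Finset.sum_mul]
      simp_rw [mul_assoc]
    · intro l _
      obtain ⟨B, hB⟩ := exists_bound_comp_cast (N := N) fun k => ZMod.stdAddChar (l * k)
      exact (summable_mul_thetaTerm hB hτ u v).mul_left _
  rw [hL, hR, Finset.mul_sum, Finset.mul_sum]
  refine Finset.sum_congr rfl fun l _ => ?_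
  rw [mul_left_comm, mul_left_comm (_ / _)]
  congr 1
  have hR1 : ∑' k : ℤ, ZMod.stdAddChar (l * (k : ZMod N)) * thetaTerm N k τ u v =
      e (N * u * (u * τ + v) / 2) * jacobiTheta₂ (u * τ + v + l.val / N) (τ / N) := by
    rw [jacobiTheta₂, ← tsum_mul_left]
    refine tsum_congr fun k => ?_
    rw [thetaTerm_eq_jacobi, mul_left_comm]
    congr 1
    have h1 : (l * (k : ZMod N)) = (((l.val : ℤ) * k : ℤ) : ZMod N) := by simp
    rw [h1, ZMod.stdAddChar_coe, jacobiTheta₂_term, jacobiTheta₂_term, ← Complex.exp_add]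
    congr 1
    push_cast
    field_simp
    ring
  have hL1 : ∑' n : ℤ, thetaTerm N (N * n + l.val) (-1 / τ) v (-u) =
      e (-(l.val + N * v) ^ 2 / (2 * N * τ) - l.val * u - N * u * v / 2) *
        jacobiTheta₂ (-((u * τ + v + l.val / N) / (τ / N))) (-1 / (τ / N)) := by
    rw [jacobiTheta₂, ← tsum_mul_left]
    refine tsum_congr fun n => ?_
    simp only [thetaTerm, jacobiTheta₂_term, e]
    rw [← Complex.exp_add]
    congr 1
    push_cast
    field_simp
    ring
  rw [hR1, hL1, jacobiTheta₂_neg_left, jacobiTheta₂_functional_equation (u * τ + v + l.val / N),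
    mul_div_assoc', cpow_half_div_natCast, cpow_half_neg_I_mul hτ, Mp2Z.cpow_half_neg_inv,
    show (-1 / 8 : ℂ) = -(1 / 8) by ring, e_neg]
  have hsq : (Real.sqrt N : ℂ) ≠ 0 := by
    rw [Complex.ofReal_ne_zero]
    exact (Real.sqrt_pos.mpr (Nat.cast_pos.mpr (NeZero.pos N))).ne'
  have hI : Complex.I = e (1 / 8) * e (1 / 8) := by
    rw [← e_add, e, show 2 * (π : ℂ) * Complex.I * (1 / 8 + 1 / 8) = π / 2 * Complex.I by ring,
      Complex.exp_pi_div_two_mul_I]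
  have hp : (τ : ℂ) ^ (1 / 2 : ℂ) ≠ 0 := by
    rw [Complex.cpow_ne_zero_iff]
    exact Or.inl hτ0
  have hexp : e (N * u * (u * τ + v) / 2) *
      Complex.exp (-π * Complex.I * (u * τ + v + l.val / N) ^ 2 / (τ / N)) =
      e (-(l.val + N * v) ^ 2 / (2 * N * τ) - l.val * u - N * u * v / 2) := by
    simp only [e]
    rw [← Complex.exp_add]
    congr 1
    field_simp
    ring
  rw [← hexp]
  nth_rewrite 1 [hI]
  have h8 := e_ne_zero (1 / 8)
  field_simp

/-- The Fourier coefficients of an absolutely convergent trigonometric series are unique. -/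
lemma eq_zero_of_tsum_mul_e_eq_zero {a : ℤ → ℂ} (ha : Summable a)
    (h : ∀ v : ℝ, ∑' k : ℤ, a k * e (k * v) = 0) (l : ℤ) : a l = 0 := by
  -- integrate the series against `e(-lv)` over a period
  let F : ℤ → C(ℝ, ℂ) := fun k =>
    ⟨fun v => a k * e ((k - l) * v), by unfold e; fun_prop⟩
  have hF : ∀ k v, F k v = a k * e (((k - l : ℤ) : ℝ) * v : ℝ) := fun k v => by simp [F]
  have hnorm : Summable fun k => ‖(F k).restrict
      (⟨Set.uIcc (0 : ℝ) 1, isCompact_uIcc⟩ : TopologicalSpace.Compacts ℝ)‖ := by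
    refine Summable.of_nonneg_of_le (fun _ => norm_nonneg _) (fun k => ?_) ha.norm
    rw [ContinuousMap.norm_le _ (norm_nonneg _)]
    intro x
    rw [ContinuousMap.restrict_apply, hF, norm_mul, norm_e_ofReal, mul_one]
  have h1 := intervalIntegral.hasSum_intervalIntegral_of_summable_norm hnorm
  have h2 : ∀ v : ℝ, ∑' k, F k v = 0 := fun v => by
    have : ∀ k, F k v = e (-(l * v)) * (a k * e (k * v)) := fun k => by
      rw [mul_left_comm, ← e_add]
      simp only [F, ContinuousMap.coe_mk]
      ring_nf
    simp_rw [this, tsum_mul_left, h v, mul_zero]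
  simp_rw [h2] at h1
  rw [intervalIntegral.integral_zero] at h1
  have h3 : ∀ k, ∫ x in (0 : ℝ)..1, F k x = if k = l then a l else 0 := by
    intro k
    split_ifs with hk
    · subst hk
      simp [F]
    · have hc : 2 * (π : ℂ) * Complex.I * (k - l) ≠ 0 := by
        have : ((k : ℂ) - l) ≠ 0 := sub_ne_zero.mpr (by exact_mod_cast hk)
        simp [this, Real.pi_ne_zero, Complex.I_ne_zero]
      have h4 : ∀ x : ℝ, F k x = a k * Complex.exp (2 * (π : ℂ) * Complex.I * (k - l) * x) :=
        fun x => by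
          simp only [F, ContinuousMap.coe_mk, e]
          ring_nf
      simp_rw [h4, intervalIntegral.integral_const_mul, integral_exp_mul_complex hc]
      have h5 : Complex.exp (2 * (π : ℂ) * Complex.I * (k - l) * (1 : ℝ)) = 1 := by
        have := e_int (k - l)
        rw [e] at this
        push_cast at this ⊢
        simpa using this
      rw [h5]
      simp
  simp_rw [h3] at h1
  exact (hasSum_ite_eq l (a l)).unique h1

/-- Theta series with different bounded coefficient functions are different. -/
lemma eq_zero_of_theta_eq_zero {f : ℤ → ℂ} {B : ℝ} (hf : ∀ k, ‖f k‖ ≤ B)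
    (h : ∀ (τ : ℍ) (u v : ℝ), theta N f τ u v = 0) (k : ℤ) : f k = 0 := by
  -- at fixed `τ` and `u = 0` the theta series is a Fourier series in `v`
  have h1 := eq_zero_of_tsum_mul_e_eq_zero (a := fun k => f k * thetaTerm N k UpperHalfPlane.I 0 0)
    (summable_mul_thetaTerm hf (UpperHalfPlane.I).im_pos 0 0) (fun v => ?_) k
  · exact (mul_eq_zero.mp h1).resolve_right (e_ne_zero _)
  · rw [← h UpperHalfPlane.I 0 v, theta]
    refine tsum_congr fun k => ?_
    rw [mul_assoc, thetaTerm, thetaTerm, ← e_add]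
    simp

end

/-! ### The Weil representation in rank one -/

/-- The weight `1/2` action of `Mp₂(ℤ)` on functions of `(τ, u, v)`, in which `(u, v)` is
transformed as a row vector. There is no further automorphy factor because `u`, `v` are the real
coordinates of the elliptic variable `z = uτ + v`. -/
def thetaAction : Representation ℂ Mp2Z (ℍ → ℝ → ℝ → ℂ) where
  toFun g :=
    { toFun := fun F τ u v => g.phi (g.mat⁻¹ • τ) *
        F (g.mat⁻¹ • τ) (u * g.mat 0 0 + v * g.mat 1 0) (u * g.mat 0 1 + v * g.mat 1 1)
      map_add' := fun F G => by
        funext τ u v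
        simp only [Pi.add_apply, mul_add]
      map_smul' := fun a F => by
        funext τ u v
        simp only [Pi.smul_apply, smul_eq_mul, RingHom.id_apply, mul_left_comm] }
  map_one' := by
    ext F τ u v
    simp
  map_mul' g h := by
    ext F τ u v
    have h1 : (g.mat * h.mat)⁻¹ • τ = h.mat⁻¹ • g.mat⁻¹ • τ := by
      rw [mul_inv_rev, mul_smul]
    simp only [LinearMap.coe_mk, AddHom.coe_mk, Mp2Z.mul_mat, Mp2Z.mul_phi,
      Module.End.mul_apply, h1, smul_inv_smul, mul_assoc, Matrix.SpecialLinearGroup.coe_mul,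
      Matrix.mul_apply, Fin.sum_univ_two]
    congr 3
    · push_cast; ring
    · push_cast; ring

lemma thetaAction_apply (g : Mp2Z) (F : ℍ → ℝ → ℝ → ℂ) (τ : ℍ) (u v : ℝ) :
    thetaAction g F τ u v = g.phi (g.mat⁻¹ • τ) *
      F (g.mat⁻¹ • τ) (u * g.mat 0 0 + v * g.mat 1 0) (u * g.mat 0 1 + v * g.mat 1 1) := rfl

section

variable (N : ℕ) [NeZero N]

/-- The theta series with coefficients on `ZMod N`, as a linear map. -/
def thetaMap : (ZMod N → ℂ) →ₗ[ℂ] (ℍ → ℝ → ℝ → ℂ) where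
  toFun f τ u v := theta N (fun k => f k) τ u v
  map_add' f g := by
    funext τ u v
    obtain ⟨B, hB⟩ := exists_bound_comp_cast f
    obtain ⟨B', hB'⟩ := exists_bound_comp_cast g
    simp only [theta, Pi.add_apply, add_mul]
    exact (summable_mul_thetaTerm hB τ.im_pos u v).tsum_add
      (summable_mul_thetaTerm hB' τ.im_pos u v)
  map_smul' a f := by
    funext τ u v
    simp only [theta, Pi.smul_apply, smul_eq_mul, RingHom.id_apply, mul_assoc, tsum_mul_left]

variable {N}

lemma thetaMap_apply (f : ZMod N → ℂ) (τ : ℍ) (u v : ℝ) :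
    thetaMap N f τ u v = theta N (fun k => f k) τ u v := rfl

lemma theta_injective {f g : ℤ → ℂ} {B B' : ℝ} (hf : ∀ k, ‖f k‖ ≤ B) (hg : ∀ k, ‖g k‖ ≤ B')
    (h : ∀ (τ : ℍ) (u v : ℝ), theta N f τ u v = theta N g τ u v) (k : ℤ) : f k = g k := by
  rw [← sub_eq_zero]
  refine eq_zero_of_theta_eq_zero (N := N) (f := fun k => f k - g k) (B := B + B')
    (fun k => (norm_sub_le _ _).trans (add_le_add (hf k) (hg k))) (fun τ u v => ?_) k
  have h1 := h τ u v
  simp only [theta] at h1 ⊢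
  simp_rw [sub_mul]
  rw [(summable_mul_thetaTerm hf τ.im_pos u v).tsum_sub (summable_mul_thetaTerm hg τ.im_pos u v),
    h1, sub_self]

/-- Faithfulness of the theta series: it carries the whole space `ℂ[ℤ/N]`. -/
lemma thetaMap_injective : Function.Injective (thetaMap N) := by
  intro f g h
  obtain ⟨B, hB⟩ := exists_bound_comp_cast f
  obtain ⟨B', hB'⟩ := exists_bound_comp_cast g
  funext l
  have := theta_injective (N := N) hB hB' (fun τ u v => congrFun (congrFun (congrFun h τ) u) v)
    (l.val : ℤ)
  simpa using this

/-- For even `N`, the phase `e(d k² / (2N))` depends only on the class of `k` modulo `N`. -/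
lemma e_sq_congr (hN : Even N) (d : ℤ) {k l : ℤ} (h : (k : ZMod N) = l) :
    e (d * k ^ 2 / (2 * N)) = e (d * l ^ 2 / (2 * N)) := by
  obtain ⟨m, hm⟩ := hN
  obtain ⟨j, hj⟩ := (ZMod.intCast_eq_intCast_iff_dvd_sub _ _ _).mp h
  have hm0 : (m : ℂ) ≠ 0 := by
    have := NeZero.ne N
    norm_cast
    omega
  have hl : l = k + (m + m) * j := by
    have : (N : ℤ) = m + m := by exact_mod_cast hm
    rw [← this]; linarith
  apply e_eq_of_sub_int (-(d * (k * j + m * j ^ 2)))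
  rw [hl, hm]
  push_cast
  field_simp
  ring

/-- The phase at a representative of `k` in `{0, …, N - 1}`. -/
lemma e_val_sq (hN : Even N) (d k : ℤ) :
    e (d * ((k : ZMod N).val : ℂ) ^ 2 / (2 * N)) = e (d * k ^ 2 / (2 * N)) := by
  have := e_sq_congr hN d (k := ((k : ZMod N).val : ℤ)) (l := k) (by simp)
  exact_mod_cast this

lemma stdAddChar_eq_e (j : ℤ) : ZMod.stdAddChar (j : ZMod N) = e (j / N) := by
  rw [ZMod.stdAddChar_coe, e]
  ring_nf

lemma thetaAction_T (hN : Even N) (f : ZMod N → ℂ) :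
    thetaAction Mp2Z.T (thetaMap N f) =
      thetaMap N fun l => f l * e ((-1 : ℤ) * (l.val : ℂ) ^ 2 / (2 * N)) := by
  funext τ u v
  have h1 : ((ModularGroup.T⁻¹ • τ : ℍ) : ℂ) = τ + ((-1 : ℤ) : ℂ) := by
    rw [← zpow_neg_one, UpperHalfPlane.modular_T_zpow_smul]
    simp [add_comm]
  rw [thetaAction_apply, thetaMap_apply, thetaMap_apply, Mp2Z.T_mat, h1, theta_add_int]
  have hv : u * ((ModularGroup.T 0 1 : ℤ) : ℝ) + v * ((ModularGroup.T 1 1 : ℤ) : ℝ) +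
      ((-1 : ℤ) : ℝ) * (u * ((ModularGroup.T 0 0 : ℤ) : ℝ) + v * ((ModularGroup.T 1 0 : ℤ) : ℝ)) =
      v := by simp [ModularGroup.T]
  have hu : u * ((ModularGroup.T 0 0 : ℤ) : ℝ) + v * ((ModularGroup.T 1 0 : ℤ) : ℝ) = u := by
    simp [ModularGroup.T]
  rw [hv, hu, Mp2Z.T_phi, one_mul]
  congr 1
  funext k
  rw [e_val_sq hN (-1) k]

lemma thetaAction_S (f : ZMod N → ℂ) :
    thetaAction Mp2Z.S (thetaMap N f) = thetaMap N fun k => e (1 / 8) / (Real.sqrt N : ℂ) *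
      ∑ l : ZMod N, f l * ZMod.stdAddChar (l * k) := by
  funext τ u v
  have h1 : ModularGroup.S⁻¹ • τ = ModularGroup.S • τ := by
    rw [inv_smul_eq_iff, UpperHalfPlane.ext_iff, Mp2Z.smul_S, Mp2Z.smul_S]
    have := UpperHalfPlane.ne_zero τ
    field_simp
  rw [thetaAction_apply, Mp2Z.S_mat, h1, Mp2Z.S_phi, Mp2Z.smul_S, thetaMap_apply, Mp2Z.smul_S]
  have h2 := theta_S f τ u v
  simp only [ModularGroup.S, thetaMap_apply]
  simp
  have h3 : theta N (fun k => e (1 / 8) / (Real.sqrt N : ℂ) *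
      ∑ l : ZMod N, f l * ZMod.stdAddChar (l * (k : ZMod N))) τ u v = e (1 / 8) / (Real.sqrt N : ℂ) *
        theta N (fun k => ∑ l : ZMod N, f l * ZMod.stdAddChar (l * (k : ZMod N))) τ u v := by
    simp only [theta, mul_assoc, tsum_mul_left]
  have h4 := h2.trans h3.symm
  simpa using h4

/-- The first row of the action of a general element with `c > 0`. The theta series of level `N` is
one of level `Nc` at `cτ`, and there the element acts like `T ^ a S T ^ d`. -/
lemma thetaAction_row (hN : Even N) {g : Mp2Z} {c : ℕ} [NeZero c] (hc : g.mat 1 0 = c)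
    (hφ : ∀ τ : ℍ, g.phi τ = (c * (τ : ℂ) + g.mat 1 1) ^ (1 / 2 : ℂ)) {f f' : ZMod N → ℂ}
    (h : thetaAction g (thetaMap N f) = thetaMap N f') :
    f' 0 = e (1 / 8) / (Real.sqrt (N * c : ℕ) : ℂ) *
      ∑ l : ZMod (N * c), f (l.val : ZMod N) *
        e (-(g.mat 1 1) * (l.val : ℂ) ^ 2 / (2 * (N * c : ℕ))) := by
  have hNc : Even (N * c) := hN.mul_right c
  have hc0 : (c : ℂ) ≠ 0 := NeZero.ne _
  have hcR : (c : ℝ) ≠ 0 := NeZero.ne _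
  have hcpos : (0 : ℝ) < c := Nat.cast_pos.mpr (NeZero.pos c)
  set a := g.mat 0 0 with ha
  set d := g.mat 1 1 with hd
  have hdet : a * d - g.mat 0 1 * c = 1 := by
    have := g.mat.det_coe
    rw [Matrix.det_fin_two, hc] at this
    exact this
  -- `f1` and `f2` are the coefficient functions after `T ^ (-d)` and after `T ^ (-a) S T ^ (-d)`
  let f1 : ZMod (N * c) → ℂ := fun l => f (l.val : ZMod N) *
        e ((-d : ℤ) * (l.val : ℂ) ^ 2 / (2 * (N * c : ℕ)))
  have hcast : ∀ k : ℤ, (((k : ZMod (N * c)).val : ℕ) : ZMod N) = (k : ZMod N) := fun k => by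
    have h1 : ((((k : ZMod (N * c)).val : ℕ) : ℤ) : ZMod (N * c)) = ((k : ℤ) : ZMod (N * c)) := by
      simp
    have h2 := (ZMod.intCast_eq_intCast_iff_dvd_sub _ _ _).mp h1
    have h3 : (((((k : ZMod (N * c)).val : ℕ) : ℤ) : ZMod N)) = ((k : ℤ) : ZMod N) :=
      (ZMod.intCast_eq_intCast_iff_dvd_sub _ _ _).mpr
        ((Dvd.intro (c : ℤ) (by push_cast; ring)).trans h2)
    exact_mod_cast h3
  have hf1 : ∀ k : ℤ, f1 k = f (k : ZMod N) * e ((-d : ℤ) * k ^ 2 / (2 * (N * c : ℕ))) := fun k => by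
    simp only [f1]
    rw [hcast, e_val_sq hNc]
  let f2 : ZMod (N * c) → ℂ := fun k => e (1 / 8) / (Real.sqrt (N * c : ℕ) : ℂ) *
    (∑ l : ZMod (N * c), f1 l * ZMod.stdAddChar (l * k)) *
      e ((-a : ℤ) * (k.val : ℂ) ^ 2 / (2 * (N * c : ℕ)))
  -- both sides of the hypothesis, rewritten as theta series of level `Nc`
  have key : ∀ (τ : ℍ) (u v : ℝ), theta (N * c) (fun k => f' k) τ u v =
      theta (N * c) (fun k => f2 k) τ u v := by
    intro τ₁ u₁ v
    -- the point `τ₁ = cτ`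
    let τ : ℍ := ⟨τ₁ / c, div_natCast_im_pos τ₁.im_pos⟩
    have hτ : (τ₁ : ℂ) = c * τ := by
      change (τ₁ : ℂ) = c * (τ₁ / c)
      field_simp
    obtain ⟨u, rfl⟩ : ∃ u, u₁ = u / c := ⟨u₁ * c, by field_simp⟩
    rw [hτ, theta_scale]
    have h1 := congrFun (congrFun (congrFun h τ) u) v
    rw [thetaMap_apply] at h1
    rw [← h1, thetaAction_apply, thetaMap_apply, hφ]
    let τ' : ℍ := ⟨c * τ - a, by
      simpa using mul_pos hcpos τ.im_pos⟩
    have hτ' : (τ' : ℂ) = c * τ - a := rfl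
    set τ₀ : ℍ := g.mat⁻¹ • τ with hτ₀
    have hgτ : g.mat • τ₀ = τ := by rw [hτ₀, smul_inv_smul]
    have hden : (c : ℂ) * τ₀ + d ≠ 0 := by
      have := UpperHalfPlane.denom_ne_zero (g.mat : GL (Fin 2) ℝ) τ₀
      rw [ModularGroup.denom_apply, hc] at this
      simpa using this
    have hcoe := UpperHalfPlane.coe_specialLinearGroup_apply g.mat τ₀
    -- with `τ₀ = g⁻¹τ` and `τ' = cτ - a` one has `(cτ₀ + d) τ' = -1`, so that `S` applies
    have hz : (c : ℂ) * τ₀ + d = -1 / τ' := by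
      rw [eq_div_iff (UpperHalfPlane.ne_zero τ'), hτ']
      rw [hgτ, hc] at hcoe
      rw [hcoe]
      simp only [eq_intCast, Int.cast_natCast, Complex.ofReal_natCast, Complex.ofReal_intCast,
        ← ha, ← hd]
      have hdet' : (a : ℂ) * d - g.mat 0 1 * c = 1 := by exact_mod_cast hdet
      field_simp
      linear_combination -hdet'
    have hz' : (c : ℂ) * τ₀ = -1 / τ' + ((-d : ℤ) : ℂ) := by
      rw [← hz]; push_cast; ring
    rw [hz, ← theta_scale (N := N) (c := c), hz', theta_add_int]
    have hv : u * (g.mat 0 1 : ℝ) + v * d + ((-d : ℤ) : ℝ) * ((u * a + v * (g.mat 1 0 : ℝ)) / c) =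
        -(u / c) := by
      have hdet' : (a : ℝ) * d - g.mat 0 1 * c = 1 := by exact_mod_cast hdet
      rw [hc]
      push_cast
      field_simp
      linear_combination -u * hdet'
    rw [hv]
    simp_rw [← hf1]
    rw [theta_S, hτ', show (c : ℂ) * τ - a = c * τ + ((-a : ℤ) : ℂ) by push_cast; ring,
      theta_add_int]
    have hv' : (u * a + v * (g.mat 1 0 : ℝ)) / c + ((-a : ℤ) : ℝ) * (u / c) = v := by
      rw [hc]
      push_cast
      field_simp
      ring
    rw [hv']
    simp only [theta]
    rw [← tsum_mul_left]
    refine tsum_congr fun k => ?_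
    simp only [f2]
    rw [e_val_sq hNc]
    ring
  obtain ⟨B, hB⟩ := exists_bound_comp_cast f'
  obtain ⟨B', hB'⟩ := exists_bound_comp_cast f2
  have := theta_injective (N := N * c) hB hB' key 0
  simp only [Int.cast_zero] at this
  rw [this]
  simp [f2, f1]

/-- The Weil representation of the lattice `ℤ` with the quadratic form `ε N x² / 2`, `ε = ±1`, as
a homomorphism to matrices, with the first rows of its values. -/
theorem exists_rankOne_weil (hN : Even N) {ε : ℤ} (hε : ε = 1 ∨ ε = -1) :
    ∃ R : Mp2Z →* Matrix (ZMod N) (ZMod N) ℂ,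
      (∀ μ ν, R Mp2Z.T μ ν = if μ = ν then e (ε * (μ.val : ℂ) ^ 2 / (2 * N)) else 0) ∧
      (∀ μ ν, R Mp2Z.S μ ν =
        e (-ε / 8) / (Real.sqrt N : ℂ) * e (-ε * ((μ.val : ℂ) * ν.val) / N)) ∧
      ∀ (g : Mp2Z) (c : ℕ) [NeZero c], g.mat 1 0 = c →
        (∀ τ : ℍ, g.phi τ = (c * (τ : ℂ) + g.mat 1 1) ^ (1 / 2 : ℂ)) → ∀ ν,
        R g 0 ν = e (-ε / 8) / (Real.sqrt (N * c : ℕ) : ℂ) * ∑ l : ZMod (N * c),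
          if (l.val : ZMod N) = ν then
            e (ε * g.mat 1 1 * (l.val : ℂ) ^ 2 / (2 * (N * c : ℕ))) else 0 := by
  classical
  obtain ⟨ρ, hρ⟩ := exists_representation_of_intertwining thetaAction (thetaMap N)
    thetaMap_injective Mp2Z.closure_S_T (by
      rintro g (rfl | rfl)
      · refine ⟨LinearMap.pi fun k => (e (1 / 8) / (Real.sqrt N : ℂ)) •
          ∑ l : ZMod N, (ZMod.stdAddChar (l * k) : ℂ) • LinearMap.proj l, fun w => ?_⟩
        rw [thetaAction_S]
        congr 1
        funext k
        simp [mul_comm]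
      · refine ⟨LinearMap.pi fun l => e ((-1 : ℤ) * (l.val : ℂ) ^ 2 / (2 * N)) •
          LinearMap.proj l, fun w => ?_⟩
        rw [thetaAction_T hN]
        congr 1
        funext l
        simp [mul_comm])
  -- the theta series carries the representation for `ε = -1`
  let R₀ : Mp2Z →* Matrix (ZMod N) (ZMod N) ℂ :=
    (LinearMap.toMatrixAlgEquiv' : _ ≃ₐ[ℂ] Matrix (ZMod N) (ZMod N) ℂ).toMonoidHom.comp ρ
  have hR₀ : ∀ g μ ν, R₀ g μ ν = ρ g (Pi.single ν 1) μ := fun g μ ν => by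
    change LinearMap.toMatrix' (ρ g) μ ν = _
    rw [LinearMap.toMatrix'_apply]
  have hT₀ : ∀ μ ν, R₀ Mp2Z.T μ ν =
      if μ = ν then e (((-1 : ℝ) * (μ.val : ℝ) ^ 2 / (2 * N) : ℝ)) else 0 := fun μ ν => by
    have := thetaMap_injective ((hρ Mp2Z.T (Pi.single ν 1)).symm.trans (thetaAction_T hN _))
    rw [hR₀, this]
    simp [Pi.single_apply, -ZMod.natCast_val]
  have hS₀ : ∀ μ ν, R₀ Mp2Z.S μ ν =
      e ((1 / 8 : ℝ)) / (Real.sqrt N : ℂ) * e ((((μ.val : ℝ) * ν.val) / N : ℝ)) := fun μ ν => by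
    have := thetaMap_injective ((hρ Mp2Z.S (Pi.single ν 1)).symm.trans (thetaAction_S _))
    rw [hR₀, this]
    have h1 : ν * μ = (((μ.val : ℤ) * ν.val : ℤ) : ZMod N) := by simp [mul_comm]
    simp only [Pi.single_apply, ite_mul, one_mul, zero_mul, Finset.sum_ite_eq', Finset.mem_univ,
      if_true]
    rw [h1, stdAddChar_eq_e]
    push_cast
    rfl
  have hrow₀ : ∀ (g : Mp2Z) (c : ℕ) [NeZero c], g.mat 1 0 = c →
        (∀ τ : ℍ, g.phi τ = (c * (τ : ℂ) + g.mat 1 1) ^ (1 / 2 : ℂ)) → ∀ ν,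
        R₀ g 0 ν = e ((1 / 8 : ℝ)) / (Real.sqrt (N * c : ℕ) : ℂ) * ∑ l : ZMod (N * c),
          if (l.val : ZMod N) = ν then
            e ((-(g.mat 1 1) * (l.val : ℝ) ^ 2 / (2 * (N * c : ℕ)) : ℝ)) else 0 := by
    intro g c _ hc hφ ν
    rw [hR₀, thetaAction_row hN hc hφ (hρ g (Pi.single ν 1))]
    simp [Pi.single_apply, -ZMod.natCast_val]
  rcases hε with rfl | rfl
  · -- for `ε = 1` one takes complex conjugates
    have hconj : ∀ x : ℝ, (starRingEnd ℂ) (e x) = e ((-x : ℝ)) := fun x => by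
      simp only [e]
      rw [← Complex.exp_conj]
      congr 1
      simp [Complex.conj_ofNat]
    refine ⟨((starRingEnd ℂ).mapMatrix (m := ZMod N)).toMonoidHom.comp R₀, ?_, ?_, ?_⟩
    · intro μ ν
      change (starRingEnd ℂ) (R₀ Mp2Z.T μ ν) = _
      rw [hT₀]
      split_ifs
      · rw [hconj]
        push_cast
        ring_nf
      · simp
    · intro μ ν
      change (starRingEnd ℂ) (R₀ Mp2Z.S μ ν) = _
      rw [hS₀, map_mul, map_div₀, hconj, hconj, Complex.conj_ofReal]
      push_cast
      ring_nf
    · intro g c _ hc hφ ν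
      change (starRingEnd ℂ) (R₀ g 0 ν) = _
      rw [hrow₀ g c hc hφ, map_mul, map_div₀, hconj, Complex.conj_ofReal, map_sum]
      congr 1
      · push_cast
        ring_nf
      refine Finset.sum_congr rfl fun l _ => ?_
      split_ifs
      · rw [hconj]
        push_cast
        ring_nf
      · simp
  · refine ⟨R₀, ?_, ?_, ?_⟩
    · intro μ ν
      rw [hT₀]
      push_cast
      rfl
    · intro μ ν
      rw [hS₀]
      push_cast
      ring_nf
    · intro g c _ hc hφ ν
      rw [hrow₀ g c hc hφ]
      congr 1
      · push_cast
        ring_nf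
      refine Finset.sum_congr rfl fun l _ => ?_
      split_ifs
      · push_cast
        ring_nf
      · rfl

end

/-! ### Orthogonal frames in a lattice -/

section Frame

variable {V : Type*} [AddCommGroup V] [Module ℝ V]

/-- An orthogonal basis of `V` that consists of vectors `v i` of an even lattice `L`. The norms are
written as `(v i, v i) = ε i * N i` with a sign `ε i` and an even positive integer `N i`. -/
structure OrthogonalFrame (Q : QuadraticForm ℝ V) (L : Submodule ℤ V) (r : ℕ) where
  v : Module.Basis (Fin r) ℝ V
  mem : ∀ i, v i ∈ L
  N : Fin r → ℕ
  ε : Fin r → ℤ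
  N_pos : ∀ i, 0 < N i
  N_even : ∀ i, Even (N i)
  ε_eq : ∀ i, ε i = 1 ∨ ε i = -1
  orth : ∀ i j, i ≠ j → bil Q (v i) (v j) = 0
  norm : ∀ i, bil Q (v i) (v i) = ε i * N i

variable {Q : QuadraticForm ℝ V} {L : Submodule ℤ V} {r : ℕ}

lemma bil_add_left (x y z : V) : bil Q (x + y) z = bil Q x z + bil Q y z :=
  QuadraticMap.polar_add_left Q x y z

lemma bil_add_right (x y z : V) : bil Q x (y + z) = bil Q x y + bil Q x z :=
  QuadraticMap.polar_add_right Q x y z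

lemma bil_smul_left (a : ℝ) (x y : V) : bil Q (a • x) y = a * bil Q x y :=
  QuadraticMap.polar_smul_left Q a x y

lemma bil_smul_right (a : ℝ) (x y : V) : bil Q x (a • y) = a * bil Q x y :=
  QuadraticMap.polar_smul_right Q a x y

lemma bil_sum_left {ι : Type*} (s : Finset ι) (f : ι → V) (y : V) :
    bil Q (∑ i ∈ s, f i) y = ∑ i ∈ s, bil Q (f i) y := by
  have := congrArg (fun g => g y) (map_sum (QuadraticMap.polarBilin Q) f s)
  rwa [LinearMap.sum_apply] at this

lemma bil_sum_right {ι : Type*} (s : Finset ι) (f : ι → V) (x : V) :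
    bil Q x (∑ i ∈ s, f i) = ∑ i ∈ s, bil Q x (f i) := by
  exact map_sum (QuadraticMap.polarBilin Q x) f s

lemma bil_comm (x y : V) : bil Q x y = bil Q y x := QuadraticMap.polar_comm Q x y

lemma bil_self (x : V) : bil Q x x = 2 * Q x := by
  rw [bil, QuadraticMap.polar_self]; simp

lemma map_add_eq (x y : V) : Q (x + y) = Q x + Q y + bil Q x y := QuadraticMap.map_add Q x y

namespace OrthogonalFrame

variable (F : OrthogonalFrame Q L r)

instance (i : Fin r) : NeZero (F.N i) := ⟨(F.N_pos i).ne'⟩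

lemma ε_mul_self (i : Fin r) : (F.ε i : ℝ) * F.ε i = 1 := by
  rcases F.ε_eq i with h | h <;> simp [h]

lemma N_ne_zero (i : Fin r) : (F.N i : ℝ) ≠ 0 := NeZero.ne _

lemma bil_v (x : V) (i : Fin r) : bil Q x (F.v i) = F.v.repr x i * (F.ε i * F.N i) := by
  conv_lhs => rw [← F.v.sum_repr x]
  rw [bil_sum_left, Finset.sum_eq_single i]
  · rw [bil_smul_left, F.norm]
  · intro j _ hj
    rw [bil_smul_left, F.orth j i hj, mul_zero]
  · simp

lemma repr_eq (x : V) (i : Fin r) : F.v.repr x i = F.ε i * bil Q x (F.v i) / F.N i := by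
  have := F.N_ne_zero i
  rw [F.bil_v]
  field_simp
  linear_combination -(F.v.repr x i) * F.ε_mul_self i

lemma bil_eq (x y : V) :
    bil Q x y = ∑ i, F.ε i * (F.ε i * bil Q x (F.v i)) * (F.ε i * bil Q y (F.v i)) / F.N i := by
  conv_lhs => rw [← F.v.sum_repr y]
  rw [bil_sum_right]
  refine Finset.sum_congr rfl fun i _ => ?_
  rw [bil_smul_right, F.repr_eq]
  have := F.ε_mul_self i
  linear_combination -(F.ε i * bil Q y (F.v i) / F.N i * bil Q x (F.v i)) * this

/-- The quadratic form in the integral coordinates `ε i (x, v i)` of the frame. -/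
lemma Q_eq (x : V) : Q x = ∑ i, F.ε i * (F.ε i * bil Q x (F.v i)) ^ 2 / (2 * F.N i) := by
  have h := bil_self (Q := Q) x
  rw [F.bil_eq] at h
  have h1 : Q x = (2 * Q x) / 2 := by ring
  rw [h1, ← h, Finset.sum_div]
  refine Finset.sum_congr rfl fun i _ => ?_
  have := F.N_ne_zero i
  field_simp

/-- The signature is the sum of the signs of a frame. -/
lemma sum_ε : ∑ i, F.ε i = (sigPos Q : ℤ) - sigNeg Q := by
  have hequiv : QuadraticMap.Equivalent Q
      (QuadraticMap.weightedSumSquares ℝ fun i => (F.ε i * F.N i / 2 : ℝ)) := by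
    refine ⟨⟨F.v.equivFun, fun x => ?_⟩⟩
    rw [QuadraticMap.weightedSumSquares_apply, F.Q_eq]
    refine Finset.sum_congr rfl fun i _ => ?_
    have := F.N_ne_zero i
    change (F.ε i * F.N i / 2 : ℝ) * (F.v.repr x i * F.v.repr x i) = _
    rw [F.repr_eq]
    field_simp
  rw [QuadraticForm.sigPos_of_equiv_weightedSumSquares hequiv,
    QuadraticForm.sigNeg_of_equiv_weightedSumSquares hequiv]
  have hpos : {i | 0 < (F.ε i * F.N i / 2 : ℝ)} = ↑(Finset.univ.filter fun i => F.ε i = 1) := by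
    ext i
    have hN : (0 : ℝ) < F.N i := Nat.cast_pos.mpr (F.N_pos i)
    rcases F.ε_eq i with h | h
    · simpa [h] using F.N_pos i
    · simp [h]
  have hneg : {i | (F.ε i * F.N i / 2 : ℝ) < 0} = ↑(Finset.univ.filter fun i => F.ε i = -1) := by
    ext i
    have hN : (0 : ℝ) < F.N i := Nat.cast_pos.mpr (F.N_pos i)
    rcases F.ε_eq i with h | h
    · simpa [h] using by linarith
    · simpa [h] using by linarith
  rw [hpos, hneg, Set.ncard_coe_finset, Set.ncard_coe_finset, Finset.card_filter,
    Finset.card_filter]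
  push_cast
  rw [← Finset.sum_sub_distrib]
  refine Finset.sum_congr rfl fun i _ => ?_
  rcases F.ε_eq i with h | h <;> simp [h]

end OrthogonalFrame

lemma bil_int_of_mem (heven : ∀ x ∈ L, ∃ m : ℤ, Q x = m) {x y : V} (hx : x ∈ L) (hy : y ∈ L) :
    ∃ m : ℤ, bil Q x y = m := by
  obtain ⟨a, ha⟩ := heven x hx
  obtain ⟨b, hb⟩ := heven y hy
  obtain ⟨c, hc⟩ := heven (x + y) (add_mem hx hy)
  have := map_add_eq (Q := Q) x y
  exact ⟨c - a - b, by push_cast; linarith⟩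

/-- Gram–Schmidt over `ℚ`: an even lattice contains an orthogonal frame. -/
theorem exists_orthogonalFrame (hQ : (QuadraticMap.polarBilin Q).Nondegenerate)
    (b : Module.Basis (Fin r) ℝ V) (hL : L = Submodule.span ℤ (Set.range b))
    (heven : ∀ x ∈ L, ∃ m : ℤ, Q x = m) : Nonempty (OrthogonalFrame Q L r) := by
  classical
  have hbL : ∀ i, b i ∈ L := fun i => hL ▸ Submodule.subset_span ⟨i, rfl⟩
  choose G hG using fun i j => bil_int_of_mem heven (hbL i) (hbL j)
  -- the Gram matrix over `ℚ` is symmetric and nondegenerate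
  let Gq : Matrix (Fin r) (Fin r) ℚ := Matrix.of fun i j => (G i j : ℚ)
  let B : LinearMap.BilinForm ℚ (Fin r → ℚ) := Matrix.toBilin' Gq
  have hGsymm : ∀ i j, G i j = G j i := fun i j => by
    have := (hG i j).symm.trans ((bil_comm _ _).trans (hG j i))
    exact_mod_cast this
  have hB : ∀ x y, B x y = ∑ i, ∑ j, x i * G i j * y j := fun x y => by
    simp [B, Gq, Matrix.toBilin'_apply]
  have hsymm : LinearMap.IsSymm B := ⟨fun x y => by
    rw [RingHom.id_apply, hB, hB, Finset.sum_comm]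
    refine Finset.sum_congr rfl fun i _ => Finset.sum_congr rfl fun j _ => ?_
    rw [hGsymm]; ring⟩
  have hdet : Gq.det ≠ 0 := by
    have h1 := (LinearMap.BilinForm.nondegenerate_iff_det_ne_zero b).mp hQ
    have h2 : LinearMap.BilinForm.toMatrix b (QuadraticMap.polarBilin Q) =
        (Rat.castHom ℝ).mapMatrix Gq := by
      ext i j
      simp [Gq, LinearMap.BilinForm.toMatrix_apply]
      exact hG i j
    rw [h2, ← RingHom.map_det] at h1
    intro h
    exact h1 (by rw [h, map_zero])
  have hnd : B.Nondegenerate :=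
    (LinearMap.BilinForm.nondegenerate_toBilin'_iff_det_ne_zero).mpr hdet
  have : Invertible (2 : ℚ) := invertibleOfNonzero two_ne_zero
  obtain ⟨w, hw⟩ := LinearMap.BilinForm.exists_orthogonal_basis hsymm
  have hfr : Module.finrank ℚ (Fin r → ℚ) = r := by simp
  let w' : Module.Basis (Fin r) ℚ (Fin r → ℚ) := w.reindex (finCongr hfr)
  have hw' : ∀ i j, i ≠ j → B (w' i) (w' j) = 0 := fun i j hij => by
    simp only [w', Module.Basis.reindex_apply]
    exact hw (fun h => hij ((finCongr hfr).symm.injective h))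
  have hw0 : ∀ i, B (w' i) (w' i) ≠ 0 := fun i => by
    simp only [w', Module.Basis.reindex_apply]
    exact LinearMap.BilinForm.iIsOrtho.not_isOrtho_basis_self_of_nondegenerate hw hnd _
  -- clear denominators
  let D : Fin r → ℕ := fun i => ∏ j, (w' i j).den
  have hD : ∀ i, D i ≠ 0 := fun i => Finset.prod_ne_zero_iff.mpr fun j _ => (w' i j).den_ne_zero
  have hu : ∀ i j, ∃ u : ℤ, (u : ℚ) = D i * w' i j := fun i j => by
    obtain ⟨k, hk⟩ : (w' i j).den ∣ D i := Finset.dvd_prod_of_mem _ (Finset.mem_univ j)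
    refine ⟨k * (w' i j).num, ?_⟩
    rw [hk]
    push_cast
    nth_rewrite 3 [← Rat.num_div_den (w' i j)]
    have : ((w' i j).den : ℚ) ≠ 0 := by exact_mod_cast (w' i j).den_ne_zero
    field_simp
  choose u hu using hu
  let v : Fin r → V := fun i => ∑ j, (u i j : ℝ) • b j
  have hvL : ∀ i, v i ∈ L := fun i => sum_mem fun j _ => by
    rw [Int.cast_smul_eq_zsmul]
    exact zsmul_mem (hbL j) _
  -- the vectors `v i = D i • w' i` of `L` inherit orthogonality from the rational basis
  have hvB : ∀ i j, bil Q (v i) (v j) = ((D i * D j * B (w' i) (w' j) : ℚ) : ℝ) := fun i j => by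
    simp only [v]
    rw [bil_sum_left, hB]
    push_cast
    rw [Finset.mul_sum]
    refine Finset.sum_congr rfl fun k _ => ?_
    rw [bil_smul_left, bil_sum_right, Finset.mul_sum, Finset.mul_sum]
    refine Finset.sum_congr rfl fun l _ => ?_
    rw [bil_smul_right, hG]
    have h1 : (u i k : ℝ) = D i * w' i k := by exact_mod_cast hu i k
    have h2 : (u j l : ℝ) = D j * w' j l := by exact_mod_cast hu j l
    rw [h1, h2]
    ring
  have hvorth : ∀ i j, i ≠ j → bil Q (v i) (v j) = 0 := fun i j hij => by
    rw [hvB, hw' i j hij]; simp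
  have hvne : ∀ i, bil Q (v i) (v i) ≠ 0 := fun i => by
    rw [hvB, Ne, Rat.cast_eq_zero]
    have hDi : (D i : ℚ) ≠ 0 := Nat.cast_ne_zero.mpr (hD i)
    exact mul_ne_zero (mul_ne_zero hDi hDi) (hw0 i)
  have hind : LinearIndependent ℝ v :=
    LinearMap.linearIndependent_of_isOrthoᵢ (B := QuadraticMap.polarBilin Q)
      (fun i j hij => hvorth i j hij) (fun i => hvne i)
  have : FiniteDimensional ℝ V := b.finiteDimensional_of_finite
  have hcard : Fintype.card (Fin r) = Module.finrank ℝ V := by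
    rw [Module.finrank_eq_card_basis b]
  -- `(v i, v i) = 2 m i`, so that `N i = 2 |m i|` is even and `ε i` is the sign of `m i`
  choose m hm using fun i => heven (v i) (hvL i)
  have hm0 : ∀ i, m i ≠ 0 := fun i h => hvne i (by rw [bil_self, hm, h]; simp)
  refine ⟨⟨basisOfLinearIndependentOfCardEqFinrank' v hind hcard, fun i => by simpa using hvL i,
    fun i => 2 * (m i).natAbs, fun i => (m i).sign, fun i => ?_, fun i => even_two_mul _,
    fun i => ?_, fun i j hij => ?_, fun i => ?_⟩⟩
  · have := Int.natAbs_pos.mpr (hm0 i)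
    omega
  · rcases lt_trichotomy (m i) 0 with h | h | h
    · exact Or.inr (Int.sign_eq_neg_one_of_neg h)
    · exact absurd h (hm0 i)
    · exact Or.inl (Int.sign_eq_one_of_pos h)
  · simpa using hvorth i j hij
  · simp only [coe_basisOfLinearIndependentOfCardEqFinrank']
    rw [bil_self, hm]
    have := Int.sign_mul_natAbs (m i)
    have h2 : ((m i).sign : ℝ) * ((m i).natAbs : ℝ) = m i := by
      rw [← Int.cast_natCast (m i).natAbs, ← Int.cast_mul, this]
    push_cast at h2 ⊢
    linarith

end Frame

/-! ### Existence of the Weil representation -/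

section WeilExistence

variable {V : Type*} [AddCommGroup V] [Module ℝ V] {Q : QuadraticForm ℝ V} {L : Submodule ℤ V}
  {r : ℕ}

lemma mem_dualLattice_iff {x : V} : x ∈ dualLattice Q L ↔ ∀ y ∈ L, ∃ m : ℤ, bil Q x y = m := by
  rw [LinearMap.BilinForm.mem_dualSubmodule]
  refine forall₂_congr fun y _ => ?_
  rw [Submodule.mem_one]
  exact exists_congr fun m => by
    rw [QuadraticMap.polarBilin_apply_apply, eq_comm]
    simp

lemma le_dualLattice (heven : ∀ x ∈ L, ∃ m : ℤ, Q x = m) : L ≤ dualLattice Q L := fun _ hx =>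
  mem_dualLattice_iff.mpr fun _ hy => bil_int_of_mem heven hx hy

lemma mk_eq_mk_iff {x y : dualLattice Q L} :
    (Submodule.Quotient.mk x : DiscGroup Q L) = Submodule.Quotient.mk y ↔ (x : V) - y ∈ L := by
  rw [Submodule.Quotient.eq, Submodule.submoduleOf]
  simp

lemma e_Q_congr (heven : ∀ x ∈ L, ∃ m : ℤ, Q x = m) {x y : V} (hx : x ∈ dualLattice Q L)
    (h : x - y ∈ L) : e (Q x) = e (Q y) := by
  obtain ⟨m, hm⟩ := heven _ h
  obtain ⟨k, hk⟩ := mem_dualLattice_iff.mp hx _ h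
  have h1 : Q y = Q x + Q (x - y) - bil Q x (x - y) := by
    have := map_add_eq (Q := Q) x (-(x - y))
    rw [show x + -(x - y) = y by abel, QuadraticMap.map_neg] at this
    rw [this, bil, bil, QuadraticMap.polar_neg_right]
    ring
  apply e_eq_of_sub_int (k - m)
  rw [h1, hm, hk]
  push_cast
  ring

lemma e_bil_congr {x x' y y' : V} (hx : x ∈ dualLattice Q L) (hy' : y' ∈ dualLattice Q L)
    (h : x - x' ∈ L) (h' : y - y' ∈ L) : e (-(bil Q x y : ℂ)) = e (-(bil Q x' y' : ℂ)) := by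
  obtain ⟨m, hm⟩ := mem_dualLattice_iff.mp hx _ h'
  obtain ⟨k, hk⟩ := mem_dualLattice_iff.mp hy' _ h
  have h1 : bil Q x y = bil Q x' y' + m + k := by
    rw [← hm, ← hk, bil, bil, bil, bil, QuadraticMap.polar_sub_right, QuadraticMap.polar_sub_right,
      QuadraticMap.polar_comm Q y' x, QuadraticMap.polar_comm Q y' x']
    ring
  apply e_eq_of_sub_int (-m - k)
  rw [h1]
  push_cast
  ring

namespace OrthogonalFrame

variable (F : OrthogonalFrame Q L r)

/-- The integral coordinates of a vector `x` of the dual lattice, so that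
`x = ∑ i, (coord x i / N i) • v i`. -/
def coord (x : V) (i : Fin r) : ℤ := ⌊F.ε i * bil Q x (F.v i)⌋

variable {F} in
lemma coord_cast {x : V} (hx : x ∈ dualLattice Q L) (i : Fin r) :
    (F.coord x i : ℝ) = F.ε i * bil Q x (F.v i) := by
  obtain ⟨m, hm⟩ := mem_dualLattice_iff.mp hx _ (F.mem i)
  rw [coord, hm, ← Int.cast_mul, Int.floor_intCast]

variable {F} in
lemma coord_eq {x : V} (hx : x ∈ dualLattice Q L) {i : Fin r} {m : ℤ}
    (h : F.ε i * bil Q x (F.v i) = m) : F.coord x i = m := by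
  have := coord_cast (F := F) hx i
  rw [h] at this
  exact_mod_cast this

lemma sum_coord {x : V} (hx : x ∈ dualLattice Q L) :
    ∑ i, ((F.coord x i : ℝ) / F.N i) • F.v i = x := by
  conv_rhs => rw [← F.v.sum_repr x]
  refine Finset.sum_congr rfl fun i _ => ?_
  rw [F.repr_eq, coord_cast hx]

lemma bil_eq_coord {x y : V} (hx : x ∈ dualLattice Q L) (hy : y ∈ dualLattice Q L) :
    bil Q x y = ∑ i, (F.ε i : ℝ) * F.coord x i * F.coord y i / F.N i := by
  rw [F.bil_eq]
  refine Finset.sum_congr rfl fun i _ => ?_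
  rw [coord_cast hx, coord_cast hy]

lemma Q_eq_coord {x : V} (hx : x ∈ dualLattice Q L) :
    Q x = ∑ i, (F.ε i : ℝ) * (F.coord x i : ℝ) ^ 2 / (2 * F.N i) := by
  rw [F.Q_eq]
  refine Finset.sum_congr rfl fun i _ => ?_
  rw [coord_cast hx]

/-- Reduction of the coordinates modulo `M i`. -/
def red (M : Fin r → ℕ) : dualLattice Q L →+ ∀ i, ZMod (M i) where
  toFun x i := (F.coord (x : V) i : ZMod (M i))
  map_zero' := by
    funext i
    have : F.coord (0 : V) i = 0 := by simp [coord, bil]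
    simp [this]
  map_add' x y := by
    funext i
    have : F.coord ((x + y : dualLattice Q L) : V) i = F.coord (x : V) i + F.coord (y : V) i := by
      apply coord_eq (x + y).2
      push_cast
      rw [coord_cast x.2, coord_cast y.2, bil_add_left]
      ring
    rw [Pi.add_apply, this]
    push_cast
    rfl

lemma red_apply (M : Fin r → ℕ) (x : dualLattice Q L) (i : Fin r) :
    F.red M x i = (F.coord (x : V) i : ZMod (M i)) := rfl

/-- Vectors of `L'` with the same coordinates modulo `N i * c` differ by `c` times a vector of `L`. -/
lemma exists_smul_of_red_eq {c : ℕ} {x y : dualLattice Q L}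
    (h : F.red (fun i => F.N i * c) x = F.red (fun i => F.N i * c) y) :
    ∃ l ∈ L, (x : V) - y = (c : ℝ) • l := by
  have h1 : ∀ i, ∃ k : ℤ, F.coord (x : V) i - F.coord (y : V) i = F.N i * c * k := fun i => by
    have := congrFun h i
    rw [red_apply, red_apply, eq_comm, ZMod.intCast_eq_intCast_iff_dvd_sub] at this
    obtain ⟨k, hk⟩ := this
    exact ⟨k, by rw [hk]; push_cast; ring⟩
  choose k hk using h1
  refine ⟨∑ i, k i • F.v i, sum_mem fun i _ => L.smul_mem _ (F.mem i), ?_⟩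
  rw [← F.sum_coord x.2, ← F.sum_coord y.2, ← Finset.sum_sub_distrib, Finset.smul_sum]
  refine Finset.sum_congr rfl fun i _ => ?_
  rw [← sub_smul, ← Int.cast_smul_eq_zsmul ℝ, smul_smul]
  congr 1
  have := F.N_ne_zero i
  have h2 : (F.coord (x : V) i : ℝ) - F.coord (y : V) i = F.N i * c * k i := by
    exact_mod_cast hk i
  field_simp
  rw [h2]

lemma sub_mem_of_red_eq {x y : dualLattice Q L} (h : F.red F.N x = F.red F.N y) :
    (x : V) - y ∈ L := by
  obtain ⟨l, hl, h1⟩ := F.exists_smul_of_red_eq (c := 1) (x := x) (y := y) (by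
    funext i
    have := congrFun h i
    simp only [red_apply, ZMod.intCast_eq_intCast_iff_dvd_sub, mul_one] at this ⊢
    exact this)
  rw [h1]
  simpa using hl

/-- The discriminant group of the orthogonal sublattice that is spanned by the frame. -/
abbrev A : Type := ∀ i, ZMod (F.N i)

/-- The image of `L` in the discriminant group of the frame. -/
def imL : AddSubgroup F.A := ((L.submoduleOf (dualLattice Q L)).toAddSubgroup).map (F.red F.N)

/-- The image of `L'` in the discriminant group of the frame. -/
def imDual : AddSubgroup F.A := (F.red F.N).range

lemma mem_imL {x : F.A} : x ∈ F.imL ↔ ∃ l : dualLattice Q L, (l : V) ∈ L ∧ F.red F.N l = x := by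
  simp [imL, Submodule.submoduleOf]

lemma mem_imDual {x : F.A} : x ∈ F.imDual ↔ ∃ l : dualLattice Q L, F.red F.N l = x := by
  simp [imDual]

/-- The pairing `(x, y) ↦ e((x, y))` on the discriminant group of the frame. -/
def pairing (x : F.A) : AddChar F.A ℂ where
  toFun y := ∏ i, ZMod.stdAddChar ((F.ε i : ZMod (F.N i)) * x i * y i)
  map_zero_eq_one' := by simp
  map_add_eq_mul' y z := by
    rw [← Finset.prod_mul_distrib]
    refine Finset.prod_congr rfl fun i _ => ?_
    rw [Pi.add_apply, mul_add, AddChar.map_add_eq_mul]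

lemma pairing_apply (x y : F.A) :
    F.pairing x y = ∏ i, ZMod.stdAddChar ((F.ε i : ZMod (F.N i)) * x i * y i) := rfl

lemma pairing_comm (x y : F.A) : F.pairing x y = F.pairing y x := by
  simp only [pairing_apply]
  exact Finset.prod_congr rfl fun i _ => by ring_nf

lemma e_sum {ι : Type*} (s : Finset ι) (f : ι → ℂ) : e (∑ i ∈ s, f i) = ∏ i ∈ s, e (f i) := by
  simp only [e]
  rw [← Complex.exp_sum, Finset.mul_sum]

lemma pairing_intCast (x y : Fin r → ℤ) :
    F.pairing (fun i => (x i : ZMod (F.N i))) (fun i => (y i : ZMod (F.N i))) =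
      e ((∑ i, F.ε i * x i * y i / F.N i : ℝ)) := by
  rw [pairing_apply]
  push_cast
  rw [e_sum]
  refine Finset.prod_congr rfl fun i _ => ?_
  rw [← Int.cast_mul, ← Int.cast_mul, stdAddChar_eq_e]
  push_cast
  rfl

lemma pairing_red (x y : dualLattice Q L) :
    F.pairing (F.red F.N x) (F.red F.N y) = e (bil Q (x : V) y) := by
  rw [F.bil_eq_coord x.2 y.2]
  exact_mod_cast F.pairing_intCast _ _

lemma e_eq_one_iff {z : ℂ} : e z = 1 ↔ ∃ n : ℤ, z = n := by
  constructor
  · intro h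
    obtain ⟨n, hn⟩ := Complex.exp_eq_one_iff.mp h
    refine ⟨n, ?_⟩
    have : 2 * (π : ℂ) * Complex.I ≠ 0 := Complex.two_pi_I_ne_zero
    apply mul_left_cancel₀ this
    rw [hn]; ring
  · rintro ⟨n, rfl⟩
    exact e_int n

/-- The image of `L'` is the orthogonal complement of the image of `L`. -/
lemma mem_imDual_of_pairing {x : F.A} (heven : ∀ x ∈ L, ∃ m : ℤ, Q x = m)
    (h : ∀ y ∈ F.imL, F.pairing x y = 1) : x ∈ F.imDual := by
  -- the vector of `V` with integral coordinates `x i`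
  let l : V := ∑ i, (((x i).val : ℝ) / F.N i) • F.v i
  have hl : ∀ i, F.ε i * bil Q l (F.v i) = (x i).val := fun i => by
    rw [F.bil_v]
    simp only [l, map_sum, map_smul, Finsupp.coe_finsetSum, Finset.sum_apply]
    rw [Finset.sum_eq_single i]
    · have h1 := F.N_ne_zero i
      have h2 := F.ε_mul_self i
      simp only [Finsupp.smul_apply, Module.Basis.repr_self, Finsupp.single_eq_same, smul_eq_mul]
      field_simp
      linear_combination ((x i).val : ℝ) * h2
    · intro j _ hj
      simp [hj]
    · simp
  have hmem : l ∈ dualLattice Q L := by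
    rw [mem_dualLattice_iff]
    intro y hy
    have hy' := le_dualLattice heven hy
    have h1 := h _ (F.mem_imL.mpr ⟨⟨y, hy'⟩, hy, rfl⟩)
    have h2 : x = fun i => (((x i).val : ℤ) : ZMod (F.N i)) := by
      funext i; simp
    have h3 : F.red F.N ⟨y, hy'⟩ = fun i => (F.coord y i : ZMod (F.N i)) := rfl
    rw [h2, h3, pairing_intCast, e_eq_one_iff] at h1
    obtain ⟨n, hn⟩ := h1
    refine ⟨n, ?_⟩
    have hn' : (∑ i, F.ε i * ((x i).val : ℤ) * F.coord y i / F.N i : ℝ) = n := by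
      exact_mod_cast hn
    rw [← hn', F.bil_eq]
    refine Finset.sum_congr rfl fun i _ => ?_
    rw [hl, coord_cast hy']
    simp
  refine F.mem_imDual.mpr ⟨⟨l, hmem⟩, ?_⟩
  funext i
  rw [red_apply, coord_eq (m := (x i).val) hmem (by rw [hl]; simp)]
  simp

lemma pairing_eq_one_of_mem {x y : F.A} (hx : x ∈ F.imDual) (hy : y ∈ F.imL) :
    F.pairing x y = 1 := by
  obtain ⟨a, rfl⟩ := F.mem_imDual.mp hx
  obtain ⟨b, hb, rfl⟩ := F.mem_imL.mp hy
  obtain ⟨m, hm⟩ := mem_dualLattice_iff.mp a.2 _ hb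
  rw [pairing_red, hm]
  exact_mod_cast e_int m

open Classical in
lemma sum_pairing_imL (heven : ∀ x ∈ L, ∃ m : ℤ, Q x = m) (x : F.A) :
    ∑ y : F.imL, F.pairing x y = if x ∈ F.imDual then (Nat.card F.imL : ℂ) else 0 := by
  let ψ : AddChar F.imL ℂ := (F.pairing x).compAddMonoidHom F.imL.subtype
  have h1 := AddChar.sum_eq_ite ψ
  have h2 : ψ = 0 ↔ x ∈ F.imDual := by
    constructor
    · intro h
      refine F.mem_imDual_of_pairing heven fun y hy => ?_
      have := DFunLike.congr_fun h (⟨y, hy⟩ : F.imL)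
      simpa [ψ] using this
    · intro h
      ext y
      simpa [ψ] using F.pairing_eq_one_of_mem h y.2
  simp only [h2] at h1
  rw [← Nat.card_eq_fintype_card] at h1
  exact h1

lemma sum_pairing (y : F.A) : ∑ x : F.A, F.pairing x y = if y = 0 then (Nat.card F.A : ℂ) else 0 := by
  classical
  simp_rw [F.pairing_comm _ y]
  have h1 := AddChar.sum_eq_ite (F.pairing y)
  have h2 : F.pairing y = 0 ↔ y = 0 := by
    constructor
    · intro h
      funext i
      have h3 := DFunLike.congr_fun h (Pi.single i 1)
      rw [pairing_apply, Finset.prod_eq_single i] at h3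
      · have h4 : ZMod.stdAddChar ((F.ε i : ZMod (F.N i)) * y i * 1) =
            ZMod.stdAddChar (0 : ZMod (F.N i)) := by simpa using h3
        have h5 := ZMod.injective_stdAddChar h4
        rcases F.ε_eq i with h | h <;> simpa [h] using h5
      · intro j _ hj
        simp [Pi.single_eq_of_ne hj]
      · simp
    · rintro rfl
      ext x
      simp [pairing_apply]
  simp only [h2] at h1
  rw [← Nat.card_eq_fintype_card] at h1
  exact h1

/-- Double counting of `∑ x, ∑ y ∈ imL, e((x, y))`: a subgroup and its orthogonal complement have
complementary orders. -/
lemma card_A_eq (heven : ∀ x ∈ L, ∃ m : ℤ, Q x = m) :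
    Nat.card F.A = Nat.card F.imL * Nat.card F.imDual := by
  classical
  have h1 : ∑ y : F.imL, ∑ x : F.A, F.pairing x y = Nat.card F.A := by
    simp_rw [F.sum_pairing]
    rw [Finset.sum_eq_single 0]
    · simp
    · intro y _ hy
      rw [if_neg]
      simpa using hy
    · simp
  rw [Finset.sum_comm] at h1
  simp_rw [F.sum_pairing_imL heven] at h1
  rw [← Finset.sum_filter, Finset.sum_const] at h1
  have h2 : (Finset.univ.filter fun x => x ∈ F.imDual).card = Nat.card F.imDual := by
    rw [Nat.card_eq_fintype_card, Fintype.card_subtype]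
  rw [h2, nsmul_eq_mul] at h1
  have h3 : (Nat.card F.A : ℂ) = ((Nat.card F.imL * Nat.card F.imDual : ℕ) : ℂ) := by
    rw [← h1]; push_cast; ring
  exact_mod_cast h3

lemma finite_discGroup (F : OrthogonalFrame Q L r) : Finite (DiscGroup Q L) := by
  refine Finite.of_injective (fun δ : DiscGroup Q L => F.red F.N δ.out) fun δ δ' h => ?_
  have := F.sub_mem_of_red_eq h
  rw [← mk_eq_mk_iff] at this
  rw [← Quotient.out_eq δ, ← Quotient.out_eq δ']
  exact this

open Classical in
/-- The projection from the image of `L'` to `L'/L`, with the value `0` elsewhere. -/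
def proj (x : F.A) : DiscGroup Q L :=
  if h : ∃ l : dualLattice Q L, F.red F.N l = x then Submodule.Quotient.mk h.choose else 0

lemma proj_red (l : dualLattice Q L) : F.proj (F.red F.N l) = Submodule.Quotient.mk l := by
  have h : ∃ l' : dualLattice Q L, F.red F.N l' = F.red F.N l := ⟨l, rfl⟩
  rw [proj, dif_pos h, mk_eq_mk_iff]
  exact F.sub_mem_of_red_eq h.choose_spec

open Classical in
/-- A sum over the image of `L'`, sorted by the cosets of the image of `L`. -/
lemma sum_imDual [Fintype (DiscGroup Q L)] (G : F.A → ℂ) :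
    (∑ x, if x ∈ F.imDual then G x else 0) =
      ∑ δ : DiscGroup Q L, ∑ y : F.imL, G (F.red F.N δ.out + y) := by
  rw [← Finset.sum_filter, ← Finset.sum_fiberwise _ F.proj]
  refine Finset.sum_congr rfl fun δ _ => ?_
  symm
  refine Finset.sum_bij (fun y _ => F.red F.N δ.out + y) ?_ ?_ ?_ (fun _ _ => rfl)
  · intro y _
    obtain ⟨l, hl, hl'⟩ := F.mem_imL.mp y.2
    rw [Finset.mem_filter, Finset.mem_filter, ← hl', ← map_add, proj_red]
    refine ⟨⟨Finset.mem_univ _, F.mem_imDual.mpr ⟨_, rfl⟩⟩, ?_⟩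
    conv_rhs => rw [← Quotient.out_eq δ]
    refine mk_eq_mk_iff.mpr ?_
    simpa using hl
  · intro y _ z _ h
    exact Subtype.ext (add_left_cancel h)
  · intro x hx
    rw [Finset.mem_filter, Finset.mem_filter] at hx
    obtain ⟨⟨_, hx⟩, hδ⟩ := hx
    obtain ⟨l, rfl⟩ := F.mem_imDual.mp hx
    rw [proj_red] at hδ
    have h1 : (l : V) - δ.out ∈ L := by
      rw [← mk_eq_mk_iff, hδ]
      exact (Quotient.out_eq δ).symm
    refine ⟨⟨F.red F.N (l - δ.out), F.mem_imL.mpr ⟨_, by simpa using h1, rfl⟩⟩,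
      Finset.mem_univ _, ?_⟩
    simp

lemma card_imDual (F : OrthogonalFrame Q L r) :
    Nat.card F.imDual = Nat.card (DiscGroup Q L) * Nat.card F.imL := by
  classical
  have := F.finite_discGroup
  have := Fintype.ofFinite (DiscGroup Q L)
  have h := F.sum_imDual fun _ => 1
  rw [← Finset.sum_filter, Finset.sum_const] at h
  have h2 : (Finset.univ.filter fun x => x ∈ F.imDual).card = Nat.card F.imDual := by
    rw [Nat.card_eq_fintype_card, Fintype.card_subtype]
  rw [h2] at h
  simp only [Finset.sum_const, Finset.card_univ, nsmul_eq_mul, mul_one] at h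
  rw [← Nat.card_eq_fintype_card, ← Nat.card_eq_fintype_card] at h
  exact_mod_cast h

/-- The normalizing factor `√|M'/M|` of the frame in terms of that of `L`. -/
lemma prod_sqrt_N (heven : ∀ x ∈ L, ∃ m : ℤ, Q x = m) :
    ∏ i, Real.sqrt (F.N i) = Nat.card F.imL * Real.sqrt (Nat.card (DiscGroup Q L)) := by
  have h1 : (∏ i, (F.N i : ℝ)) = (Nat.card F.imL) ^ 2 * Nat.card (DiscGroup Q L) := by
    have h2 := F.card_A_eq heven
    rw [card_imDual, Nat.card_pi] at h2
    simp only [Nat.card_zmod] at h2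
    have h3 := congrArg (Nat.cast : ℕ → ℝ) h2
    push_cast at h3
    rw [h3]; ring
  have h4 : ∏ i, Real.sqrt (F.N i) = Real.sqrt (∏ i, (F.N i : ℝ)) := by
    rw [Real.sqrt_eq_rpow, ← Real.finsetProd_rpow _ _ (fun i _ => Nat.cast_nonneg _)]
    simp_rw [Real.sqrt_eq_rpow]
  rw [h4, h1, Real.sqrt_mul (by positivity), Real.sqrt_sq (by positivity)]

open Classical in
/-- The embedding of `ℂ[L'/L]` in `ℂ[M'/M]`, with `M` the span of the frame: `𝔢_γ` is mapped to
the sum of the basis vectors over the coset `γ`. -/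
def embed : (DiscGroup Q L → ℂ) →ₗ[ℂ] (F.A → ℂ) where
  toFun f x := if x ∈ F.imDual then f (F.proj x) else 0
  map_add' f g := by
    funext x
    by_cases h : x ∈ F.imDual <;> simp [h]
  map_smul' a f := by
    funext x
    by_cases h : x ∈ F.imDual <;> simp [h]

open Classical in
lemma embed_apply (f : DiscGroup Q L → ℂ) (x : F.A) :
    F.embed f x = if x ∈ F.imDual then f (F.proj x) else 0 := rfl

lemma embed_red (f : DiscGroup Q L → ℂ) (l : dualLattice Q L) :
    F.embed f (F.red F.N l) = f (Submodule.Quotient.mk l) := by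
  rw [embed_apply, if_pos (F.mem_imDual.mpr ⟨l, rfl⟩), proj_red]

lemma embed_injective : Function.Injective F.embed := by
  intro f g h
  funext δ
  obtain ⟨l, rfl⟩ := Submodule.Quotient.mk_surjective _ δ
  have := congrFun h (F.red F.N l)
  rwa [embed_red, embed_red] at this

end OrthogonalFrame

end WeilExistence

section WeilRow

variable {V : Type*} [AddCommGroup V] [Module ℝ V] {Q : QuadraticForm ℝ V} {L : Submodule ℤ V}
  {r : ℕ}

namespace OrthogonalFrame

variable (F : OrthogonalFrame Q L r)

/-- The Weil representation of the orthogonal lattice that is spanned by the frame, as the tensor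
product of representations in rank one. -/
theorem exists_weil : ∃ R : Mp2Z →* Matrix F.A F.A ℂ,
    (∀ x y, R Mp2Z.T x y =
      if x = y then e (∑ i, (F.ε i : ℂ) * ((x i).val : ℂ) ^ 2 / (2 * F.N i)) else 0) ∧
    (∀ x y, R Mp2Z.S x y =
      (∏ i, e (-F.ε i / 8) / (Real.sqrt (F.N i) : ℂ)) * F.pairing x (-y)) ∧
    ∀ (g : Mp2Z) (c : ℕ) [NeZero c], g.mat 1 0 = c →
      (∀ τ : ℍ, g.phi τ = (c * (τ : ℂ) + g.mat 1 1) ^ (1 / 2 : ℂ)) → ∀ y,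
      R g 0 y = (∏ i, e (-F.ε i / 8) / (Real.sqrt (F.N i * c : ℕ) : ℂ)) *
        ∑ l : ∀ i, ZMod (F.N i * c), if (fun i => ((l i).val : ZMod (F.N i))) = y then
          e (∑ i, (F.ε i : ℂ) * g.mat 1 1 * ((l i).val : ℂ) ^ 2 / (2 * (F.N i * c : ℕ))) else 0 := by
  classical
  choose R hT hS hrow using fun i => exists_rankOne_weil (F.N_even i) (F.ε_eq i)
  refine ⟨⟨⟨fun g x y => ∏ i, R i g (x i) (y i), ?_⟩, ?_⟩, ?_, ?_, ?_⟩
  · ext x y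
    rcases eq_or_ne x y with rfl | h
    · simp
    · obtain ⟨i, hi⟩ := Function.ne_iff.mp h
      rw [Matrix.one_apply_ne h]
      exact Finset.prod_eq_zero (Finset.mem_univ i) (by simp [Matrix.one_apply_ne hi])
  · intro g h
    ext x y
    rw [Matrix.mul_apply]
    simp only [map_mul, Matrix.mul_apply]
    rw [Finset.prod_univ_sum, Fintype.piFinset_univ]
    simp_rw [Finset.prod_mul_distrib]
  · intro x y
    change ∏ i, R i Mp2Z.T (x i) (y i) = _
    simp_rw [hT]
    split_ifs with h
    · subst h
      simp [e_sum]
    · obtain ⟨i, hi⟩ := Function.ne_iff.mp h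
      exact Finset.prod_eq_zero (Finset.mem_univ i) (by simp [hi])
  · intro x y
    change ∏ i, R i Mp2Z.S (x i) (y i) = _
    simp_rw [hS]
    rw [Finset.prod_mul_distrib, pairing_apply]
    congr 1
    refine Finset.prod_congr rfl fun i _ => ?_
    have : (F.ε i : ZMod (F.N i)) * x i * (-y) i =
        ((-(F.ε i * (x i).val * (y i).val) : ℤ) : ZMod (F.N i)) := by simp
    rw [this, stdAddChar_eq_e]
    push_cast
    ring_nf
  · intro g c _ hc hφ y
    change ∏ i, R i g ((0 : F.A) i) (y i) = _
    simp_rw [Pi.zero_apply, fun i => hrow i g c hc hφ (y i)]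
    rw [Finset.prod_mul_distrib, Finset.prod_univ_sum, Fintype.piFinset_univ]
    congr 1
    refine Finset.sum_congr rfl fun l _ => ?_
    split_ifs with h
    · subst h
      simp [e_sum]
    · obtain ⟨i, hi⟩ := Function.ne_iff.mp h
      exact Finset.prod_eq_zero (Finset.mem_univ i) (by simp only [if_neg hi])

lemma prod_e_div_sqrt (a : Fin r → ℝ) :
    ∏ i, e (-F.ε i / 8) / (a i : ℂ) =
      Complex.exp (π * Complex.I / 4) ^ ((sigNeg Q : ℤ) - (sigPos Q : ℤ)) / ((∏ i, a i : ℝ) : ℂ) := by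
  rw [Finset.prod_div_distrib, ← e_sum, ← Complex.exp_int_mul]
  congr 1
  · rw [e, ← Finset.sum_div, Finset.sum_neg_distrib]
    have := F.sum_ε
    have h2 : (∑ i, (F.ε i : ℂ)) = (sigPos Q : ℂ) - sigNeg Q := by exact_mod_cast this
    rw [h2]
    congr 1
    push_cast
    ring
  · push_cast; rfl

/-- The constant of `ρ(S)` for the frame, times the number of vectors over which each coefficient is
summed, is the constant of `ρ_L(S)`. -/
lemma prod_e_mul_card (heven : ∀ x ∈ L, ∃ m : ℤ, Q x = m) :
    (∏ i, e (-F.ε i / 8) / (Real.sqrt (F.N i) : ℂ)) * Nat.card F.imL =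
      Complex.exp (π * Complex.I / 4) ^ ((sigNeg Q : ℤ) - (sigPos Q : ℤ)) /
        (Real.sqrt (Nat.card (DiscGroup Q L)) : ℂ) := by
  rw [prod_e_div_sqrt, F.prod_sqrt_N heven]
  have : (Nat.card F.imL : ℂ) ≠ 0 := by exact_mod_cast Nat.card_pos.ne'
  push_cast
  field_simp

lemma e_Q_red (x : dualLattice Q L) :
    e (∑ i, (F.ε i : ℂ) * ((F.red F.N x i).val : ℂ) ^ 2 / (2 * F.N i)) = e (Q (x : V)) := by
  rw [F.Q_eq_coord x.2]
  push_cast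
  rw [e_sum, e_sum]
  refine Finset.prod_congr rfl fun i _ => ?_
  rw [red_apply, e_val_sq (F.N_even i)]

/-- The Weil representation of `L` exists, and is embedded in that of the span of the frame. -/
theorem exists_isWeilRep (heven : ∀ x ∈ L, ∃ m : ℤ, Q x = m) {R : Mp2Z →* Matrix F.A F.A ℂ}
    (hT : ∀ x y, R Mp2Z.T x y =
      if x = y then e (∑ i, (F.ε i : ℂ) * ((x i).val : ℂ) ^ 2 / (2 * F.N i)) else 0)
    (hS : ∀ x y, R Mp2Z.S x y =
      (∏ i, e (-F.ε i / 8) / (Real.sqrt (F.N i) : ℂ)) * F.pairing x (-y)) :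
    ∃ ρ : Representation ℂ Mp2Z (DiscGroup Q L → ℂ), IsWeilRep Q L ρ ∧
      ∀ g f, (R g).mulVec (F.embed f) = F.embed (ρ g f) := by
  classical
  have := F.finite_discGroup
  have := Fintype.ofFinite (DiscGroup Q L)
  let σ : Representation ℂ Mp2Z (F.A → ℂ) :=
    (Matrix.toLinAlgEquiv' : Matrix F.A F.A ℂ ≃ₐ[ℂ] _).toMonoidHom.comp R
  have hσ : ∀ g f, σ g f = (R g).mulVec f := fun g f => rfl
  -- the prescribed values at `T` and `S`, which are to be intertwined with `R` by `F.embed`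
  let AT : (DiscGroup Q L → ℂ) →ₗ[ℂ] (DiscGroup Q L → ℂ) :=
    LinearMap.pi fun δ => e (Q (δ.out : V)) • LinearMap.proj δ
  let AS : (DiscGroup Q L → ℂ) →ₗ[ℂ] (DiscGroup Q L → ℂ) :=
    LinearMap.pi fun δ => (Complex.exp (π * Complex.I / 4) ^ ((sigNeg Q : ℤ) - (sigPos Q : ℤ)) /
        (Real.sqrt (Nat.card (DiscGroup Q L)) : ℂ)) •
      ∑ δ' : DiscGroup Q L, e (-(bil Q (δ.out : V) (δ'.out : V) : ℂ)) • LinearMap.proj δ'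
  have hout : ∀ l : dualLattice Q L,
      (l : V) - (Quotient.out (Submodule.Quotient.mk l : DiscGroup Q L) : dualLattice Q L) ∈ L :=
    fun l => mk_eq_mk_iff.mp (Quotient.out_eq (Submodule.Quotient.mk l : DiscGroup Q L)).symm
  have hAT : ∀ f, σ Mp2Z.T (F.embed f) = F.embed (AT f) := fun f => by
    funext x
    rw [hσ, Matrix.mulVec, dotProduct]
    simp_rw [hT, ite_mul, zero_mul]
    rw [Finset.sum_ite_eq, if_pos (Finset.mem_univ _)]
    by_cases hx : x ∈ F.imDual
    · obtain ⟨l, rfl⟩ := F.mem_imDual.mp hx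
      rw [F.e_Q_red, embed_red, embed_red, e_Q_congr heven l.2 (hout l)]
      simp [AT]
    · simp [embed_apply, hx]
  have hAS : ∀ f, σ Mp2Z.S (F.embed f) = F.embed (AS f) := fun f => by
    funext x
    rw [hσ, Matrix.mulVec, dotProduct]
    simp_rw [hS, embed_apply]
    have h1 : ∀ y, (∏ i, e (-F.ε i / 8) / (Real.sqrt (F.N i) : ℂ)) * F.pairing x (-y) *
        (if y ∈ F.imDual then f (F.proj y) else 0) =
        (∏ i, e (-F.ε i / 8) / (Real.sqrt (F.N i) : ℂ)) *
          (if y ∈ F.imDual then F.pairing x (-y) * f (F.proj y) else 0) := fun y => by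
      split_ifs <;> ring
    simp_rw [h1]
    rw [← Finset.mul_sum, sum_imDual]
    have h2 : ∀ (δ : DiscGroup Q L) (y : F.imL), F.pairing x (-(F.red F.N δ.out + y)) *
        f (F.proj (F.red F.N δ.out + y)) =
        f δ * F.pairing x (-F.red F.N δ.out) * F.pairing x ((-y : F.imL) : F.A) := fun δ y => by
      have h3 : F.proj (F.red F.N δ.out + y) = δ := by
        obtain ⟨l, hl, hl'⟩ := F.mem_imL.mp y.2
        rw [← hl', ← map_add, proj_red]
        conv_rhs => rw [← Quotient.out_eq δ]
        refine mk_eq_mk_iff.mpr ?_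
        simpa using hl
      rw [h3, neg_add, AddChar.map_add_eq_mul]
      push_cast
      ring
    simp_rw [h2, ← Finset.mul_sum]
    -- summation over a coset of `imL` projects to its orthogonal complement `imDual`
    have h4 : ∑ y : F.imL, F.pairing x ((-y : F.imL) : F.A) =
        if x ∈ F.imDual then (Nat.card F.imL : ℂ) else 0 := by
      rw [← F.sum_pairing_imL heven]
      exact Equiv.sum_comp (Equiv.neg F.imL) fun y : F.imL => F.pairing x y
    rw [h4]
    split_ifs with hx
    · obtain ⟨l, rfl⟩ := F.mem_imDual.mp hx
      rw [← Finset.sum_mul, mul_comm (∑ δ, _) (Nat.card F.imL : ℂ), ← mul_assoc,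
        F.prod_e_mul_card heven, proj_red]
      simp only [AS, LinearMap.pi_apply, LinearMap.smul_apply, smul_eq_mul, LinearMap.sum_apply,
        LinearMap.proj_apply]
      congr 1
      refine Finset.sum_congr rfl fun δ _ => ?_
      rw [mul_comm, ← map_neg, pairing_red]
      congr 1
      have h5 : bil Q (l : V) ((-δ.out : dualLattice Q L) : V) = - bil Q (l : V) δ.out := by
        push_cast
        exact QuadraticMap.polar_neg_right Q _ _
      rw [h5]
      push_cast
      exact e_bil_congr l.2 δ.out.2 (hout l) (by simp)
    · simp
  obtain ⟨ρ, hρ⟩ := exists_representation_of_intertwining σ F.embed F.embed_injective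
    Mp2Z.closure_S_T (by
      rintro g (rfl | rfl)
      · exact ⟨AS, hAS⟩
      · exact ⟨AT, hAT⟩)
  refine ⟨ρ, ⟨fun γ => ?_, fun γ δ => ?_⟩, hρ⟩
  · have h1 := F.embed_injective ((hρ Mp2Z.T (basisVec (Submodule.Quotient.mk γ))).symm.trans
      (hAT _))
    rw [h1]
    funext δ
    simp only [AT, LinearMap.pi_apply, LinearMap.smul_apply, LinearMap.proj_apply, basisVec,
      Pi.smul_apply, Pi.single_apply]
    split_ifs with h
    · subst h
      rw [e_Q_congr heven γ.2 (hout γ)]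
    · simp
  · have h1 := F.embed_injective ((hρ Mp2Z.S (basisVec (Submodule.Quotient.mk γ))).symm.trans
      (hAS _))
    rw [h1]
    simp only [AS, LinearMap.pi_apply, LinearMap.smul_apply, LinearMap.proj_apply, basisVec,
      LinearMap.sum_apply, Pi.single_apply, smul_eq_mul, mul_ite, mul_one, mul_zero,
      Finset.sum_ite_eq', Finset.mem_univ, if_true]
    rw [e_bil_congr γ.2 (Quotient.out (Submodule.Quotient.mk δ : DiscGroup Q L)).2 (hout γ) (hout δ),
      bil_comm]

end OrthogonalFrame

/-- The values on the generators determine the Weil representation. -/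
lemma IsWeilRep.unique {ρ ρ' : Representation ℂ Mp2Z (DiscGroup Q L → ℂ)}
    [Finite (DiscGroup Q L)] (h : IsWeilRep Q L ρ) (h' : IsWeilRep Q L ρ') : ρ = ρ' := by
  classical
  have hgen : ∀ g ∈ ({Mp2Z.S, Mp2Z.T} : Set Mp2Z), ρ g = ρ' g := by
    have hb : ∀ {A B : (DiscGroup Q L → ℂ) →ₗ[ℂ] (DiscGroup Q L → ℂ)},
        (∀ γ : dualLattice Q L, A (basisVec (Submodule.Quotient.mk γ)) =
          B (basisVec (Submodule.Quotient.mk γ))) → A = B := by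
      intro A B hAB
      refine (Pi.basisFun ℂ (DiscGroup Q L)).ext fun δ => ?_
      obtain ⟨γ, rfl⟩ := Submodule.Quotient.mk_surjective _ δ
      have := hAB γ
      rw [basisVec] at this
      rw [Pi.basisFun_apply]
      convert this
    rintro g (rfl | rfl)
    · refine hb fun γ => funext fun δ => ?_
      obtain ⟨δ, rfl⟩ := Submodule.Quotient.mk_surjective _ δ
      rw [h.2, h'.2]
    · exact hb fun γ => by rw [h.1, h'.1]
  have := MonoidHom.eq_of_eqOn_dense Mp2Z.closure_S_T (f := ρ) (g := ρ') hgen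
  exact this

lemma isWeilRep_weilRep (h : ∃ ρ, IsWeilRep Q L ρ) : IsWeilRep Q L (weilRep Q L) := by
  rw [weilRep, dif_pos h]
  exact h.choose_spec

/-! ### The first row of the Weil representation -/

/-- The mean value of a function is not changed by composition with a surjective homomorphism. -/
lemma card_mul_sum_comp {X Z : Type*} [AddGroup X] [AddGroup Z] [Fintype X] [Fintype Z]
    (φ : Z →+ X) (hφ : Function.Surjective φ) (f : X → ℂ) :
    (Fintype.card X : ℂ) * ∑ z, f (φ z) = Fintype.card Z * ∑ x, f x := by
  classical
  have h1 : ∀ x : X, (Finset.univ.filter fun z => φ z = x).card =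
      (Finset.univ.filter fun z => φ z = 0).card := fun x =>
    AddMonoidHom.card_fiber_eq_of_mem_range φ (hφ x) (hφ 0)
  have h2 : ∀ f : X → ℂ, ∑ z, f (φ z) =
      (Finset.univ.filter fun z => φ z = 0).card * ∑ x, f x := fun f => by
    rw [← Finset.sum_fiberwise _ φ, Finset.mul_sum]
    refine Finset.sum_congr rfl fun x _ => ?_
    rw [Finset.sum_congr rfl (g := fun _ => f x), Finset.sum_const, h1, nsmul_eq_mul]
    intro z hz
    rw [(Finset.mem_filter.mp hz).2]
  have h3 := h2 fun _ => 1
  simp only [Finset.sum_const, Finset.card_univ, nsmul_eq_mul, mul_one] at h3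
  rw [h2, h3]
  ring

/-- The mean value of a function on a group that factors through two finite quotients can be
computed on either of them. -/
lemma card_mul_sum_eq_of_comp_eq {G X Y : Type*} [AddGroup G] [AddGroup X] [AddGroup Y] [Fintype X]
    [Fintype Y] {φ : G →+ X} {ψ : G →+ Y} (hφ : Function.Surjective φ)
    (hψ : Function.Surjective ψ) {f : X → ℂ} {h : Y → ℂ} (hfh : ∀ g, f (φ g) = h (ψ g)) :
    (Fintype.card Y : ℂ) * ∑ x, f x = Fintype.card X * ∑ y, h y := by
  classical
  let Z := (φ.prod ψ).range
  have : Fintype Z := Fintype.ofFinite Z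
  have h1 := card_mul_sum_comp ((AddMonoidHom.fst X Y).comp Z.subtype) (fun x => by
    obtain ⟨g, rfl⟩ := hφ x
    exact ⟨⟨_, g, rfl⟩, rfl⟩) f
  have h2 := card_mul_sum_comp ((AddMonoidHom.snd X Y).comp Z.subtype) (fun x => by
    obtain ⟨g, rfl⟩ := hψ x
    exact ⟨⟨_, g, rfl⟩, rfl⟩) h
  have h3 : ∑ z : Z, f (((AddMonoidHom.fst X Y).comp Z.subtype) z) =
      ∑ z : Z, h (((AddMonoidHom.snd X Y).comp Z.subtype) z) := by
    refine Finset.sum_congr rfl fun z _ => ?_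
    obtain ⟨_, g, rfl⟩ := z
    exact hfh g
  rw [h3] at h1
  have hZ : (Fintype.card Z : ℂ) ≠ 0 := by exact_mod_cast Fintype.card_ne_zero
  apply mul_left_cancel₀ hZ
  linear_combination (Fintype.card X : ℂ) * h2 - (Fintype.card Y : ℂ) * h1

/-- The phase `e(d Q(x) / c)` depends only on `x ∈ L'` modulo `cL`. -/
lemma e_Q_div_congr (heven : ∀ x ∈ L, ∃ m : ℤ, Q x = m) {x l : V} (hx : x ∈ dualLattice Q L)
    (hl : l ∈ L) (c : ℕ) [NeZero c] (d : ℤ) :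
    e (d * (Q (x + (c : ℝ) • l) : ℂ) / c) = e (d * (Q x : ℂ) / c) := by
  obtain ⟨m, hm⟩ := heven _ hl
  obtain ⟨k, hk⟩ := mem_dualLattice_iff.mp hx _ hl
  have hc : (c : ℂ) ≠ 0 := NeZero.ne _
  apply e_eq_of_sub_int (d * (c * m + k))
  rw [map_add_eq, bil_smul_right, QuadraticMap.map_smul, hm, hk]
  push_cast
  simp only [smul_eq_mul]
  push_cast
  field_simp
  ring

namespace OrthogonalFrame

variable (F : OrthogonalFrame Q L r)

lemma e_Q_div_red (x : dualLattice Q L) (c : ℕ) [NeZero c] (d : ℤ) :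
    e (∑ i, (F.ε i : ℂ) * d * ((F.red (fun i => F.N i * c) x i).val : ℂ) ^ 2 /
      (2 * (F.N i * c : ℕ))) = e (d * (Q (x : V) : ℂ) / c) := by
  have hc : (c : ℂ) ≠ 0 := NeZero.ne _
  rw [F.Q_eq_coord x.2]
  push_cast
  rw [Finset.mul_sum, Finset.sum_div, e_sum, e_sum]
  refine Finset.prod_congr rfl fun i _ => ?_
  have h1 := e_val_sq (N := F.N i * c) ((F.N_even i).mul_right c) (F.ε i * d) (F.coord (x : V) i)
  push_cast at h1
  rw [red_apply, h1]
  congr 1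
  have : (F.N i : ℂ) ≠ 0 := NeZero.ne _
  field_simp

open Classical in
/-- The first row of the Weil representation as a sum over the coordinates, modulo `N i * c`, of the
vectors of `γ + L`. -/
lemma weilCoeff_eq_sum (heven : ∀ x ∈ L, ∃ m : ℤ, Q x = m) {g : Mp2Z} {c : ℕ} [NeZero c]
    (hc : g.mat 1 0 = c)
    (hφ : ∀ τ : ℍ, g.phi τ = (c * (τ : ℂ) + g.mat 1 1) ^ (1 / 2 : ℂ)) (γ : dualLattice Q L) :
    weilCoeff Q L 0 (Submodule.Quotient.mk γ) g =
      (∏ i, e (-F.ε i / 8) / (Real.sqrt (F.N i * c : ℕ) : ℂ)) *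
        ∑ l : ∀ i, ZMod (F.N i * c),
          if ∃ x : dualLattice Q L, (x : V) - γ ∈ L ∧ F.red (fun i => F.N i * c) x = l then
            e (∑ i, (F.ε i : ℂ) * g.mat 1 1 * ((l i).val : ℂ) ^ 2 / (2 * (F.N i * c : ℕ)))
          else 0 := by
  obtain ⟨R, hT, hS, hrow⟩ := F.exists_weil
  obtain ⟨ρ, hρ, hJ⟩ := F.exists_isWeilRep heven hT hS
  have := F.finite_discGroup
  rw [weilCoeff, (isWeilRep_weilRep ⟨ρ, hρ⟩).unique hρ]
  have h1 := congrFun (hJ g (basisVec (Submodule.Quotient.mk γ))) (F.red F.N 0)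
  rw [embed_red, map_zero] at h1
  have h0 : (Submodule.Quotient.mk (0 : dualLattice Q L) : DiscGroup Q L) = 0 := rfl
  rw [h0] at h1
  rw [← h1, Matrix.mulVec, dotProduct]
  simp_rw [hrow g c hc hφ, mul_assoc]
  rw [← Finset.mul_sum]
  congr 1
  simp_rw [Finset.sum_mul]
  rw [Finset.sum_comm]
  refine Finset.sum_congr rfl fun l _ => ?_
  simp_rw [ite_mul, zero_mul]
  rw [Finset.sum_ite_eq, if_pos (Finset.mem_univ _), embed_apply]
  have hiff : (∃ x : dualLattice Q L, (x : V) - γ ∈ L ∧ F.red (fun i => F.N i * c) x = l) ↔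
      ((fun i => ((l i).val : ZMod (F.N i))) ∈ F.imDual ∧
        F.proj (fun i => ((l i).val : ZMod (F.N i))) = Submodule.Quotient.mk γ) := by
    have hcast : ∀ (i : Fin r) (k : ℤ), (((k : ZMod (F.N i * c)).val : ℕ) : ZMod (F.N i)) =
        (k : ZMod (F.N i)) := fun i k => by
      rw [ZMod.natCast_val, ZMod.cast_intCast (Dvd.intro c rfl)]
    constructor
    · rintro ⟨x, hx, rfl⟩
      have : (fun i => ((F.red (fun i => F.N i * c) x i).val : ZMod (F.N i))) = F.red F.N x := by
        funext i
        rw [red_apply, hcast, red_apply]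
      rw [this, proj_red]
      exact ⟨F.mem_imDual.mpr ⟨x, rfl⟩, mk_eq_mk_iff.mpr hx⟩
    · rintro ⟨h, h'⟩
      obtain ⟨x, hx⟩ := F.mem_imDual.mp h
      rw [← hx, proj_red, mk_eq_mk_iff] at h'
      -- correct `x` by a vector of the span of the frame
      have hk : ∀ i, ∃ k : ℤ, ((l i).val : ℤ) = F.coord (x : V) i + F.N i * k := fun i => by
        have h2 := congrFun hx i
        rw [red_apply] at h2
        have h3 : ((F.coord (x : V) i : ℤ) : ZMod (F.N i)) = (((l i).val : ℤ) : ZMod (F.N i)) := by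
          rw [h2]; simp
        rw [ZMod.intCast_eq_intCast_iff_dvd_sub] at h3
        obtain ⟨k, hk⟩ := h3
        exact ⟨k, by linarith⟩
      choose k hk using hk
      have hmemL : ∑ i, k i • F.v i ∈ L := sum_mem fun i _ => L.smul_mem _ (F.mem i)
      refine ⟨⟨x + ∑ i, k i • F.v i, add_mem x.2 (le_dualLattice heven hmemL)⟩, ?_, ?_⟩
      · rw [add_sub_right_comm]
        exact add_mem h' hmemL
      · funext i
        rw [red_apply, coord_eq (m := (l i).val)]
        · simp
        · exact add_mem x.2 (le_dualLattice heven hmemL)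
        · rw [bil_add_left, mul_add, ← coord_cast x.2, bil_sum_left, Finset.sum_eq_single i]
          · rw [← Int.cast_smul_eq_zsmul ℝ, bil_smul_left, F.norm]
            have h4 : (((l i).val : ℤ) : ℝ) = F.coord (x : V) i + F.N i * k i := by
              exact_mod_cast hk i
            rw [h4]
            linear_combination (k i * F.N i : ℝ) * F.ε_mul_self i
          · intro j _ hj
            rw [← Int.cast_smul_eq_zsmul ℝ, bil_smul_left, F.orth j i hj, mul_zero]
          · simp
  simp only [hiff, basisVec]
  by_cases h : (fun i => ((l i).val : ZMod (F.N i))) ∈ F.imDual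
  · by_cases h' : F.proj (fun i => ((l i).val : ZMod (F.N i))) = Submodule.Quotient.mk γ
    · simp only [h', and_self, if_true, Pi.single_eq_same, mul_one, h]
    · simp only [if_pos h, h', and_false, if_false, Pi.single_apply, mul_zero]
  · simp only [h, false_and, if_false, mul_zero]

end OrthogonalFrame

/-- The first row of the Weil representation at an element with `c > 0`: a Gauss sum over
`L / cL`. -/
theorem weilCoeff_zero_eq (hQ : (QuadraticMap.polarBilin Q).Nondegenerate)
    (b : Module.Basis (Fin r) ℝ V) (hL : L = Submodule.span ℤ (Set.range b))
    (heven : ∀ x ∈ L, ∃ m : ℤ, Q x = m) {g : Mp2Z} {c : ℕ} [NeZero c] (hc : g.mat 1 0 = c)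
    (hφ : ∀ τ : ℍ, g.phi τ = (c * (τ : ℂ) + g.mat 1 1) ^ (1 / 2 : ℂ)) (γ : dualLattice Q L) :
    weilCoeff Q L 0 (Submodule.Quotient.mk γ) g =
      Complex.exp (π * Complex.I / 4) ^ ((sigNeg Q : ℤ) - (sigPos Q : ℤ)) /
        (Real.sqrt (Nat.card (DiscGroup Q L)) : ℂ) / (Real.sqrt c : ℂ) ^ r *
      ∑ x : Fin r → ZMod c, e (g.mat 1 1 * (Q (∑ i, ((x i).val : ℝ) • b i - γ) : ℂ) / c) := by
  classical
  obtain ⟨F⟩ := exists_orthogonalFrame hQ b hL heven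
  set d := g.mat 1 1
  have hcC : (c : ℂ) ≠ 0 := NeZero.ne _
  let Mc : Fin r → ℕ := fun i => F.N i * c
  have hbL : ∀ z : Fin r → ℤ, ∑ i, z i • b i ∈ L := fun z =>
    sum_mem fun i _ => L.smul_mem _ (hL ▸ Submodule.subset_span ⟨i, rfl⟩)
  let E : (∀ i, ZMod (Mc i)) → ℂ := fun l =>
    e (∑ i, (F.ε i : ℂ) * d * ((l i).val : ℂ) ^ 2 / (2 * (F.N i * c : ℕ)))
  have hE : ∀ x : dualLattice Q L, E (F.red Mc x) = e (d * (Q (x : V) : ℂ) / c) := fun x =>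
    F.e_Q_div_red x c d
  -- the image of `L` modulo `c` times the frame
  let toDual : (Fin r → ℤ) →+ dualLattice Q L :=
    { toFun := fun z => ⟨∑ i, z i • b i, le_dualLattice heven (hbL z)⟩
      map_zero' := by ext; simp
      map_add' := fun z w => by ext; simp [add_smul, Finset.sum_add_distrib] }
  let H : AddSubgroup (∀ i, ZMod (Mc i)) := ((F.red Mc).comp toDual).range
  have htoL : ∀ z, (toDual z : V) ∈ L := hbL
  have hmemL : ∀ x ∈ L, ∃ z, (toDual z : V) = x := fun x hx => by
    rw [hL, Submodule.mem_span_range_iff_exists_fun] at hx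
    obtain ⟨z, hz⟩ := hx
    exact ⟨z, hz⟩
  -- the coordinates of `γ + L` are a coset of `H`
  have hsum : (∑ l : ∀ i, ZMod (Mc i),
      if ∃ x : dualLattice Q L, (x : V) - γ ∈ L ∧ F.red Mc x = l then E l else 0) =
      ∑ h : H, E (F.red Mc γ + h) := by
    rw [← Finset.sum_filter]
    symm
    refine Finset.sum_bij (fun h _ => F.red Mc γ + h) ?_ ?_ ?_ (fun _ _ => rfl)
    · rintro ⟨_, z, rfl⟩ _
      rw [Finset.mem_filter]
      refine ⟨Finset.mem_univ _, γ + toDual z, ?_, by simp⟩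
      simpa using htoL z
    · intro y _ z _ h
      exact Subtype.ext (add_left_cancel h)
    · intro l hl
      obtain ⟨_, x, hx, rfl⟩ := Finset.mem_filter.mp hl
      obtain ⟨z, hz⟩ := hmemL _ hx
      refine ⟨⟨_, z, rfl⟩, Finset.mem_univ _, ?_⟩
      have : x = γ + toDual z := by
        ext
        rw [Submodule.coe_add, hz]
        abel
      rw [this, map_add]
      rfl
  -- comparison with the sum over `L / cL`
  let redc : (Fin r → ℤ) →+ (Fin r → ZMod c) :=
    { toFun := fun z i => ((-z i : ℤ) : ZMod c)
      map_zero' := by ext; simp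
      map_add' := fun z w => by ext; simp; ring }
  have hredc : Function.Surjective redc := fun x =>
    ⟨fun i => -((x i).val : ℤ), by funext i; simp [redc]⟩
  have hmean := card_mul_sum_eq_of_comp_eq (φ := ((F.red Mc).comp toDual).rangeRestrict) (ψ := redc)
    (AddMonoidHom.rangeRestrict_surjective _) hredc
    (f := fun h : H => E (F.red Mc γ + h))
    (h := fun x => e (d * (Q (∑ i, ((x i).val : ℝ) • b i - γ) : ℂ) / c)) (fun z => by
      have h1 : F.red Mc γ + (((F.red Mc).comp toDual).rangeRestrict z : H) =
          F.red Mc (γ + toDual z) := by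
        rw [map_add]; rfl
      rw [h1, hE]
      have h2 : ∀ i, ∃ k : ℤ, ((redc z i).val : ℤ) = -z i + c * k := fun i => by
        have h3 : (((-z i : ℤ)) : ZMod c) = (((redc z i).val : ℤ) : ZMod c) := by
          simp [redc]
        rw [ZMod.intCast_eq_intCast_iff_dvd_sub] at h3
        obtain ⟨k, hk⟩ := h3
        exact ⟨k, by linarith⟩
      choose k hk using h2
      have h4 : ∑ i, ((redc z i).val : ℝ) • b i - (γ : V) =
          -((γ + toDual z : dualLattice Q L) + (c : ℝ) • ((-toDual k : dualLattice Q L) : V)) := by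
        have h5 : ∀ i, ((redc z i).val : ℝ) = -(z i : ℝ) + c * k i := fun i => by
          exact_mod_cast hk i
        simp_rw [h5]
        simp only [toDual, AddMonoidHom.coe_mk, ZeroHom.coe_mk, Submodule.coe_add,
          NegMemClass.coe_neg, add_smul, Finset.sum_add_distrib, neg_smul, mul_smul,
          Finset.sum_neg_distrib, ← Finset.smul_sum, Int.cast_smul_eq_zsmul, smul_neg]
        abel
      rw [h4, QuadraticMap.map_neg,
        e_Q_div_congr heven (γ + toDual z).2 (by simpa using htoL k)])
  -- the order of the image of `L`
  have hH : Fintype.card H = c ^ r * Nat.card F.imL := by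
    let rc : (∀ i, ZMod (Mc i)) →+ F.A :=
      { toFun := fun l i => ZMod.castHom (Dvd.intro c rfl : F.N i ∣ F.N i * c) (ZMod (F.N i)) (l i)
        map_zero' := by funext i; simp
        map_add' := fun l l' => by funext i; simp }
    have hrc : Function.Surjective rc := fun x =>
      ⟨fun i => ((x i).val : ZMod (Mc i)), by funext i; simp [rc, -ZMod.natCast_val]; exact ZMod.natCast_zmod_val _⟩
    have hrcred : ∀ x, rc (F.red Mc x) = F.red F.N x := fun x => by
      funext i
      simp [rc, OrthogonalFrame.red_apply]
    have h1 := card_mul_sum_comp rc hrc fun x => if x ∈ F.imL then 1 else 0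
    have h2 : ∀ l, rc l ∈ F.imL ↔ l ∈ H := fun l => by
      constructor
      · intro h
        obtain ⟨x, hx, hxl⟩ := F.mem_imL.mp h
        have hk : ∀ i, ∃ k : ℤ, ((l i).val : ℤ) = F.coord (x : V) i + F.N i * k := fun i => by
          have h2 := congrFun hxl i
          rw [OrthogonalFrame.red_apply] at h2
          have h3 : ((F.coord (x : V) i : ℤ) : ZMod (F.N i)) =
              (((l i).val : ℤ) : ZMod (F.N i)) := by
            rw [h2]; simp [rc]
          rw [ZMod.intCast_eq_intCast_iff_dvd_sub] at h3
          obtain ⟨k, hk⟩ := h3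
          exact ⟨k, by linarith⟩
        choose k hk using hk
        have hmem : (x : V) + ∑ i, k i • F.v i ∈ L :=
          add_mem hx (sum_mem fun i _ => L.smul_mem _ (F.mem i))
        obtain ⟨z, hz⟩ := hmemL _ hmem
        refine ⟨z, ?_⟩
        funext i
        change (F.coord (toDual z : V) i : ZMod (Mc i)) = l i
        rw [hz, OrthogonalFrame.coord_eq (m := (l i).val)]
        · simp
        · exact le_dualLattice heven hmem
        · rw [bil_add_left, mul_add, ← OrthogonalFrame.coord_cast x.2, bil_sum_left,
            Finset.sum_eq_single i]
          · rw [← Int.cast_smul_eq_zsmul ℝ, bil_smul_left, F.norm]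
            have h4 : (((l i).val : ℤ) : ℝ) = F.coord (x : V) i + F.N i * k i := by
              exact_mod_cast hk i
            rw [h4]
            linear_combination (k i * F.N i : ℝ) * F.ε_mul_self i
          · intro j _ hj
            rw [← Int.cast_smul_eq_zsmul ℝ, bil_smul_left, F.orth j i hj, mul_zero]
          · simp
      · rintro ⟨z, rfl⟩
        exact F.mem_imL.mpr ⟨toDual z, hbL z, (hrcred _).symm⟩
    simp only [h2] at h1
    rw [← Finset.sum_filter, ← Finset.sum_filter, Finset.sum_const, Finset.sum_const] at h1
    have h3 : (Finset.univ.filter fun x => x ∈ F.imL).card = Nat.card F.imL := by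
      rw [Nat.card_eq_fintype_card, Fintype.card_subtype]
    have h4 : (Finset.univ.filter fun x => x ∈ H).card = Fintype.card H := by
      rw [Fintype.card_subtype]
    have h5 : Fintype.card (∀ i, ZMod (Mc i)) = c ^ r * Fintype.card F.A := by
      simp only [Fintype.card_pi, ZMod.card, Mc, Finset.prod_mul_distrib, Finset.prod_const,
        Finset.card_univ, Fintype.card_fin]
      ring
    rw [h3, h4, h5] at h1
    simp only [nsmul_eq_mul, mul_one] at h1
    have h6 : Fintype.card F.A * Fintype.card H = c ^ r * Fintype.card F.A * Nat.card F.imL := by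
      exact_mod_cast h1
    have h7 : 0 < Fintype.card F.A := Fintype.card_pos
    apply Nat.eq_of_mul_eq_mul_left h7
    rw [h6]
    ring
  rw [hH, Fintype.card_pi] at hmean
  simp only [ZMod.card, Finset.prod_const, Finset.card_univ, Fintype.card_fin] at hmean
  push_cast at hmean
  have hmean' : ∑ h : H, E (F.red Mc γ + h) = Nat.card F.imL *
      ∑ x : Fin r → ZMod c, e (d * (Q (∑ i, ((x i).val : ℝ) • b i - γ) : ℂ) / c) := by
    apply mul_left_cancel₀ (pow_ne_zero r hcC)
    rw [hmean]
    ring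
  rw [F.weilCoeff_eq_sum heven hc hφ γ]
  have hsum' := hsum.trans hmean'
  rw [show (∑ l : ∀ i, ZMod (F.N i * c),
      if ∃ x : dualLattice Q L, (x : V) - γ ∈ L ∧ F.red (fun i => F.N i * c) x = l then
        e (∑ i, (F.ε i : ℂ) * g.mat 1 1 * ((l i).val : ℂ) ^ 2 / (2 * (F.N i * c : ℕ)))
      else 0) = _ from hsum', ← F.prod_e_mul_card heven]
  have hprod : (∏ i, e (-F.ε i / 8) / (Real.sqrt (F.N i * c : ℕ) : ℂ)) =
      (∏ i, e (-F.ε i / 8) / (Real.sqrt (F.N i) : ℂ)) / (Real.sqrt c : ℂ) ^ r := by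
    have h1 : ∀ i, e (-F.ε i / 8) / (Real.sqrt (F.N i * c : ℕ) : ℂ) =
        e (-F.ε i / 8) / (Real.sqrt (F.N i) : ℂ) / (Real.sqrt c : ℂ) := fun i => by
      rw [Nat.cast_mul, Real.sqrt_mul (Nat.cast_nonneg _), Complex.ofReal_mul, div_div]
    simp_rw [h1]
    rw [Finset.prod_div_distrib, Finset.prod_const, Finset.card_univ, Fintype.card_fin]
  rw [hprod]
  ring

end WeilRow

/-! ### Quadratic Gauss sums and real characters -/

/-- The principal square root maps the upper half plane to the open first quadrant. -/
lemma cpow_half_re_im_pos {z : ℂ} (hz : 0 < z.im) :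
    0 < (z ^ (1 / 2 : ℂ)).re ∧ 0 < (z ^ (1 / 2 : ℂ)).im := by
  have h0 : z ≠ 0 := fun h => by simp [h] at hz
  have h2 : 0 < Complex.arg z := by
    rcases (Complex.arg_nonneg_iff.mpr hz.le).lt_or_eq with h | h
    · exact h
    · exact absurd (Complex.arg_eq_zero_iff.mp h.symm).2 hz.ne'
  have h3 := Complex.arg_le_pi z
  have h4 : (1 / 2 : ℂ) = ((1 / 2 : ℝ) : ℂ) := by push_cast; rfl
  have hn : 0 < ‖z‖ ^ (1 / 2 : ℝ) := Real.rpow_pos_of_pos (norm_pos_iff.mpr h0) _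
  have h5 : Complex.arg z < π := Complex.arg_lt_pi_iff.mpr (Or.inr hz.ne')
  rw [h4, Complex.cpow_ofReal_re, Complex.cpow_ofReal_im]
  constructor
  · refine mul_pos hn (Real.cos_pos_of_mem_Ioo ⟨?_, ?_⟩) <;> linarith
  · refine mul_pos hn (Real.sin_pos_of_pos_of_lt_pi ?_ ?_) <;> linarith

/-- The element `S T^n S` has lower row `(n, -1)` and the principal square root of `nτ - 1`. -/
lemma S_T_pow_S_phi (n : ℕ) [NeZero n] (τ : ℍ) :
    (Mp2Z.S * Mp2Z.T ^ n * Mp2Z.S).mat 1 0 = n ∧ (Mp2Z.S * Mp2Z.T ^ n * Mp2Z.S).mat 1 1 = -1 ∧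
    (Mp2Z.S * Mp2Z.T ^ n * Mp2Z.S).phi τ = ((n : ℂ) * τ - 1) ^ (1 / 2 : ℂ) := by
  have hm : (Mp2Z.T ^ n).mat = !![1, (n : ℤ); 0, 1] := by
    induction n with
    | zero => ext i j; fin_cases i <;> fin_cases j <;> simp [Mp2Z.one_mat]
    | succ m ih =>
      rcases Nat.eq_zero_or_pos m with rfl | h
      · ext i j; fin_cases i <;> fin_cases j <;> simp [Mp2Z.T_mat, ModularGroup.T]
      · have : NeZero m := ⟨h.ne'⟩
        rw [pow_succ, Mp2Z.mul_mat, Matrix.SpecialLinearGroup.coe_mul, ih, Mp2Z.T_mat]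
        ext i j; fin_cases i <;> fin_cases j <;> simp [ModularGroup.T, Matrix.mul_apply, add_comm]
  have hphi : ∀ (m : ℕ) (τ : ℍ), (Mp2Z.T ^ m).phi τ = 1 := by
    intro m
    induction m with
    | zero => intro τ; simp
    | succ m ih => intro τ; rw [pow_succ, Mp2Z.mul_phi, ih]; simp
  have e10 : (Mp2Z.S * Mp2Z.T ^ n * Mp2Z.S).mat 1 0 = n := by
    simp only [Mp2Z.mul_mat, Matrix.SpecialLinearGroup.coe_mul, hm, Mp2Z.S_mat]
    simp [ModularGroup.S, Matrix.mul_apply, Fin.sum_univ_two]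
  have e11 : (Mp2Z.S * Mp2Z.T ^ n * Mp2Z.S).mat 1 1 = -1 := by
    simp only [Mp2Z.mul_mat, Matrix.SpecialLinearGroup.coe_mul, hm, Mp2Z.S_mat]
    simp [ModularGroup.S, Matrix.mul_apply, Fin.sum_univ_two]
  refine ⟨e10, e11, ?_⟩
  have hn : (0 : ℝ) < n := Nat.cast_pos.mpr (NeZero.pos n)
  have hA : 0 < ((Mp2Z.S * Mp2Z.T ^ n * Mp2Z.S).phi τ).im := by
    rw [Mp2Z.mul_phi, Mp2Z.mul_phi, hphi, mul_one]
    have h1 := cpow_half_re_im_pos (((Mp2Z.T ^ n).mat • (Mp2Z.S.mat • τ) : ℍ)).im_pos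
    have h2 := cpow_half_re_im_pos τ.im_pos
    rw [Mp2Z.S_phi, Mp2Z.S_phi, Complex.mul_im]
    exact add_pos (mul_pos h1.1 h2.2) (mul_pos h1.2 h2.1)
  have hB : 0 < (((n : ℂ) * τ - 1) ^ (1 / 2 : ℂ)).im := by
    refine (cpow_half_re_im_pos ?_).2
    simpa using mul_pos hn τ.im_pos
  have hsq : (Mp2Z.S * Mp2Z.T ^ n * Mp2Z.S).phi τ ^ 2 = (((n : ℂ) * τ - 1) ^ (1 / 2 : ℂ)) ^ 2 := by
    rw [Mp2Z.sq, e10, e11, ← Complex.cpow_nat_mul]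
    push_cast
    norm_num
    ring
  rcases sq_eq_sq_iff_eq_or_eq_neg.mp hsq with h | h
  · exact h
  · rw [h, Complex.neg_im] at hA
    linarith

/-- The quadratic Gauss sum, read off from the Weil representation of rank one at `S T^n S`. -/
theorem sum_e_neg_sq_div (n : ℕ) [NeZero n] :
    ∑ j ∈ Finset.range n, e (-((j : ℂ) ^ 2 / n))
      = √(n : ℝ) * (e (-1 / 8) * (1 + e (n / 4)) / √(2 : ℝ)) := by
  obtain ⟨R, hT, hS, hrow⟩ := exists_rankOne_weil (N := 2) even_two (ε := 1) (Or.inl rfl)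
  have h1 := hrow (Mp2Z.S * Mp2Z.T ^ n * Mp2Z.S) n (S_T_pow_S_phi n UpperHalfPlane.I).1
    (fun τ => by
      rw [(S_T_pow_S_phi n τ).2.2, (S_T_pow_S_phi n τ).2.1]; push_cast; rw [sub_eq_add_neg]) 0
  rw [(S_T_pow_S_phi n UpperHalfPlane.I).2.1] at h1
  -- for `N = 2` the matrix product `ρ(S) ρ(T)^n ρ(S)` has a sum over two elements as an entry, and
  -- the formula for the first row evaluates the same entry as a sum of length `n`
  have hTd : R Mp2Z.T = Matrix.diagonal (fun μ : ZMod 2 => e ((μ.val : ℂ) ^ 2 / 4)) := by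
    ext μ ν
    rw [hT, Matrix.diagonal_apply]
    congr 2
    push_cast; ring
  have h2 : R (Mp2Z.S * Mp2Z.T ^ n * Mp2Z.S) 0 0
      = e (-1 / 8) ^ 2 / 2 * (1 + e (n / 4)) := by
    rw [map_mul, map_mul, map_pow, hTd, Matrix.diagonal_pow, Matrix.mul_apply]
    simp only [Matrix.mul_diagonal, hS]
    rw [show (Finset.univ : Finset (ZMod 2)) = {0, 1} from rfl]
    rw [Finset.sum_pair (by decide)]
    have h3 : ((0 : ZMod 2).val : ℂ) = 0 := by simp
    have h4 : ((1 : ZMod 2).val : ℂ) = 1 := by rw [ZMod.val_one]; simp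
    have h5 : (√((2 : ℕ) : ℝ) : ℂ) ^ 2 = 2 := by
      rw [← Complex.ofReal_pow, Real.sq_sqrt (by positivity)]; simp
    have h6 : (√((2 : ℕ) : ℝ) : ℂ) ≠ 0 := fun h => by rw [h] at h5; norm_num at h5
    have h7 : e (1 / 4) ^ n = e (n / 4) := by
      rw [e, e, ← Complex.exp_nat_mul]; congr 1; ring
    simp only [Pi.pow_apply, h3, h4]
    simp only [one_pow, h7, mul_zero, zero_div, e_zero, mul_one, ne_eq, OfNat.ofNat_ne_zero,
      not_false_eq_true, zero_pow]
    rw [show ((-(1 : ℤ) : ℂ) / 8) = -1 / 8 by push_cast; ring]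
    generalize (√((2 : ℕ) : ℝ) : ℂ) = t at *
    rw [← h5]
    field_simp
  rw [h2] at h1
  -- only the even residues `l = 2j` contribute
  have h8 : (∑ l : ZMod (2 * n), if (l.val : ZMod 2) = 0 then
      e ((1 : ℤ) * ((-1 : ℤ) : ℂ) * (l.val : ℂ) ^ 2 / (2 * ((2 * n : ℕ) : ℂ))) else 0)
      = ∑ j ∈ Finset.range n, e (-((j : ℂ) ^ 2 / n)) := by
    rw [← Finset.sum_filter]
    have hn0 : (n : ℂ) ≠ 0 := Nat.cast_ne_zero.mpr (NeZero.ne n)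
    refine Finset.sum_bij' (fun l _ => l.val / 2) (fun j _ => ((2 * j : ℕ) : ZMod (2 * n)))
      ?_ ?_ ?_ ?_ ?_
    · intro l hl
      have := ZMod.val_lt l
      simp only [Finset.mem_range]
      omega
    · intro j hj
      have := Finset.mem_range.mp hj
      have h9 : ((2 * j : ℕ) : ZMod (2 * n)).val = 2 * j := ZMod.val_cast_of_lt (by omega)
      rw [Finset.mem_filter, h9]
      refine ⟨Finset.mem_univ _, ?_⟩
      rw [ZMod.natCast_eq_zero_iff]
      exact Dvd.intro _ rfl
    · intro l hl
      have h9 := (ZMod.natCast_eq_zero_iff _ _).mp (Finset.mem_filter.mp hl).2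
      rw [Nat.mul_div_cancel' h9, ZMod.natCast_zmod_val]
    · intro j hj
      have := Finset.mem_range.mp hj
      rw [ZMod.val_cast_of_lt (by omega)]
      omega
    · intro l hl
      have h9 := (ZMod.natCast_eq_zero_iff _ _).mp (Finset.mem_filter.mp hl).2
      obtain ⟨m, hm⟩ := h9
      rw [hm, Nat.mul_div_cancel_left _ two_pos]
      congr 1
      push_cast
      field_simp
  rw [h8] at h1
  have hn0 : (√(n : ℝ) : ℂ) ≠ 0 := by
    rw [Complex.ofReal_ne_zero, Real.sqrt_ne_zero']; exact Nat.cast_pos.mpr (NeZero.pos n)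
  have h20 : (√(2 : ℝ) : ℂ) ^ 2 = 2 := by
    rw [← Complex.ofReal_pow, Real.sq_sqrt (by positivity)]; simp
  have h21 : (√(2 : ℝ) : ℂ) ≠ 0 := fun h => by rw [h] at h20; norm_num at h20
  have he := e_ne_zero (-1 / 8)
  rw [show ((-(1 : ℤ) : ℂ) / 8) = -1 / 8 by push_cast; ring] at h1
  have h22 : (√((2 * n : ℕ) : ℝ) : ℂ) = √(2 : ℝ) * √(n : ℝ) := by
    rw [← Complex.ofReal_mul, ← Real.sqrt_mul (by positivity)]; push_cast; rfl
  rw [h22] at h1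
  generalize (√(2 : ℝ) : ℂ) = t at *
  generalize (√(n : ℝ) : ℂ) = u at *
  generalize e (-1 / 8) = E at *
  field_simp at h1 ⊢
  rw [← h20] at h1
  have : E * t * (E * (1 + e (n / 4)) * u) = E * t * (t * ∑ j ∈ Finset.range n, e (-((j : ℂ) ^ 2 / n))) := by
    linear_combination E * h1
  have := mul_left_cancel₀ (mul_ne_zero he h21) this
  linear_combination -this

lemma e_eight : e (-1 / 8) = (1 - Complex.I) / √(2 : ℝ) := by
  have h20 : (√(2 : ℝ) : ℂ) ^ 2 = 2 := by
    rw [← Complex.ofReal_pow, Real.sq_sqrt (by positivity)]; simp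
  have h21 : (√(2 : ℝ) : ℂ) ≠ 0 := fun h => by rw [h] at h20; norm_num at h20
  rw [e, show 2 * (π : ℂ) * Complex.I * (-1 / 8) = ((-(π / 4) : ℝ) : ℂ) * Complex.I by
    push_cast; ring, Complex.exp_mul_I, ← Complex.ofReal_cos, ← Complex.ofReal_sin, Real.cos_neg,
    Real.sin_neg, Real.cos_pi_div_four, Real.sin_pi_div_four]
  push_cast
  field_simp
  rw [h20]
  ring

lemma e_quarter : e (1 / 4) = Complex.I := by
  rw [e, show 2 * (π : ℂ) * Complex.I * (1 / 4) = π / 2 * Complex.I by ring,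
    Complex.exp_pi_div_two_mul_I]

/-- `1` for `n ≡ 1`, and `-i` for `n ≡ 3 mod 4`. -/
def gaussSign (n : ℕ) : ℂ := if n % 4 = 1 then 1 else -Complex.I

/-- The value of `sum_e_neg_sq_div`, divided by `√n`, for odd `n`. -/
lemma gauss_odd (n : ℕ) (hn : Odd n) :
    e (-1 / 8) * (1 + e (n / 4)) / √(2 : ℝ) = gaussSign n := by
  have h20 : (√(2 : ℝ) : ℂ) ^ 2 = 2 := by
    rw [← Complex.ofReal_pow, Real.sq_sqrt (by positivity)]; simp
  have h21 : (√(2 : ℝ) : ℂ) ≠ 0 := fun h => by rw [h] at h20; norm_num at h20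
  have hI := Complex.I_sq
  have hmod : n % 4 = 1 ∨ n % 4 = 3 := by have := Nat.odd_iff.mp hn; omega
  have key : ∀ r : ℕ, n % 4 = r → e (n / 4) = Complex.I ^ r := by
    intro r hr
    have h1 : e (n / 4) = e (r / 4) := by
      refine e_eq_of_sub_int ((n / 4 : ℕ) : ℤ) ?_
      have : (n : ℂ) = 4 * (n / 4 : ℕ) + r := by
        rw [← hr]; exact_mod_cast (Nat.div_add_mod n 4).symm
      generalize n / 4 = q at *
      rw [this]; push_cast; ring
    rw [h1, ← e_quarter, e, e, ← Complex.exp_nat_mul]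
    congr 1; ring
  rw [e_eight, gaussSign]
  rcases hmod with h | h
  · rw [if_pos h, key 1 h, pow_one]
    field_simp
    rw [h20]; linear_combination -hI
  · rw [if_neg (by omega), key 3 h]
    field_simp
    rw [h20]; linear_combination (Complex.I - Complex.I ^ 2 + 1 ) * hI

/-- A real Dirichlet character modulo `N`, given as an integer-valued function on `ℤ`, whose
Gauss sums are `w √N χ(k)` for all `k`. -/
structure IsRealGaussChar (N : ℕ) [NeZero N] (χ : ℤ → ℤ) (w : ℂ) : Prop where
  periodic : ∀ a b : ℤ, (a : ZMod N) = b → χ a = χ b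
  mul : ∀ a b : ℤ, χ (a * b) = χ a * χ b
  one : χ 1 = 1
  gauss : ∀ k : ℤ, ∑ x : ZMod N, (χ x.val : ℂ) * e (-((x.val : ℂ) * k / N)) = w * √(N : ℝ) * χ k

/-- The Chinese remainder theorem in the form `x = N₂ y + N₁ z`. -/
lemma sum_zmod_mul {N₁ N₂ : ℕ} [NeZero N₁] [NeZero N₂] (h : N₁.Coprime N₂) (F : ℤ → ℂ)
    (hF : ∀ a b : ℤ, (a : ZMod (N₁ * N₂)) = b → F a = F b) :
    ∑ x : ZMod (N₁ * N₂), F x.val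
      = ∑ y : ZMod N₁, ∑ z : ZMod N₂, F (N₂ * (y.val : ℤ) + N₁ * (z.val : ℤ)) := by
  rw [← Fintype.sum_prod_type']
  symm
  refine Fintype.sum_bijective
    (fun p : ZMod N₁ × ZMod N₂ => ((N₂ * p.1.val + N₁ * p.2.val : ℕ) : ZMod (N₁ * N₂))) ?_ _ _ ?_
  · rw [Fintype.bijective_iff_injective_and_card]
    refine ⟨?_, by simp [ZMod.card]⟩
    rintro ⟨y, z⟩ ⟨y', z'⟩ hyz
    have h0 := (ZMod.natCast_eq_natCast_iff _ _ _).mp hyz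
    have h1 : N₂ * y.val ≡ N₂ * y'.val [MOD N₁] := by
      have := Nat.ModEq.of_mul_right _ h0
      simpa [Nat.ModEq] using this
    have h2 : N₁ * z.val ≡ N₁ * z'.val [MOD N₂] := by
      have := Nat.ModEq.of_mul_left _ h0
      simpa [Nat.ModEq] using this
    have h3 := (ZMod.natCast_eq_natCast_iff _ _ _).mpr (Nat.ModEq.cancel_left_of_coprime h h1)
    have h4 := (ZMod.natCast_eq_natCast_iff _ _ _).mpr (Nat.ModEq.cancel_left_of_coprime h.symm h2)
    simpa only [ZMod.natCast_zmod_val, Prod.mk.injEq] using And.intro h3 h4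
  · rintro ⟨y, z⟩
    refine hF _ _ ?_
    simp only [Int.cast_natCast, ZMod.natCast_zmod_val]
    push_cast
    rfl

lemma IsRealGaussChar.product {N₁ N₂ : ℕ} [NeZero N₁] [NeZero N₂] (h : N₁.Coprime N₂)
    {χ₁ χ₂ : ℤ → ℤ} {w₁ w₂ : ℂ} (h₁ : IsRealGaussChar N₁ χ₁ w₁) (h₂ : IsRealGaussChar N₂ χ₂ w₂) :
    IsRealGaussChar (N₁ * N₂) (fun a => χ₁ a * χ₂ a) (χ₁ N₂ * χ₂ N₁ * w₁ * w₂) := by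
  have hper : ∀ a b : ℤ, (a : ZMod (N₁ * N₂)) = b → χ₁ a * χ₂ a = χ₁ b * χ₂ b := by
    intro a b hab
    rw [ZMod.intCast_eq_intCast_iff] at hab
    push_cast at hab
    rw [h₁.periodic a b ((ZMod.intCast_eq_intCast_iff _ _ _).mpr hab.of_mul_right),
      h₂.periodic a b ((ZMod.intCast_eq_intCast_iff _ _ _).mpr hab.of_mul_left)]
  refine ⟨hper, fun a b => ?_, ?_, fun k => ?_⟩
  · simp only [h₁.mul, h₂.mul]; ring
  · simp only [h₁.one, h₂.one, mul_one]
  · have hN1 : (N₁ : ℂ) ≠ 0 := Nat.cast_ne_zero.mpr (NeZero.ne N₁)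
    have hN2 : (N₂ : ℂ) ≠ 0 := Nat.cast_ne_zero.mpr (NeZero.ne N₂)
    have hs := sum_zmod_mul h
      (fun x : ℤ => ((χ₁ x * χ₂ x : ℤ) : ℂ) * e (-((x : ℂ) * k / ((N₁ * N₂ : ℕ) : ℂ))))
      (fun a b hab => by
        rw [hper a b hab]
        congr 1
        obtain ⟨m, hm⟩ := (ZMod.intCast_eq_intCast_iff_dvd_sub _ _ _).mp hab
        refine e_eq_of_sub_int (m * k) ?_
        have : (b : ℂ) = a + (N₁ * N₂ : ℕ) * m := by
          rw [sub_eq_iff_eq_add'] at hm; rw [hm]; push_cast; ring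
        rw [this]; push_cast; field_simp; ring)
    simp only [Int.cast_natCast] at hs
    rw [hs]
    have hterm : ∀ (y : ZMod N₁) (z : ZMod N₂),
        ((χ₁ (N₂ * (y.val : ℤ) + N₁ * (z.val : ℤ)) * χ₂ (N₂ * (y.val : ℤ) + N₁ * (z.val : ℤ)) : ℤ) : ℂ)
          * e (-(((N₂ * (y.val : ℤ) + N₁ * (z.val : ℤ) : ℤ) : ℂ) * k / ((N₁ * N₂ : ℕ) : ℂ)))
        = (χ₁ N₂ * χ₂ N₁ : ℂ) * (((χ₁ y.val : ℂ) * e (-((y.val : ℂ) * k / N₁))) *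
            ((χ₂ z.val : ℂ) * e (-((z.val : ℂ) * k / N₂)))) := by
      intro y z
      have e1 : χ₁ (N₂ * (y.val : ℤ) + N₁ * (z.val : ℤ)) = χ₁ N₂ * χ₁ y.val := by
        rw [← h₁.mul]; refine h₁.periodic _ _ ?_; push_cast; simp
      have e2 : χ₂ (N₂ * (y.val : ℤ) + N₁ * (z.val : ℤ)) = χ₂ N₁ * χ₂ z.val := by
        rw [← h₂.mul]; refine h₂.periodic _ _ ?_; push_cast; simp
      rw [e1, e2]
      have e3 : -(((N₂ * (y.val : ℤ) + N₁ * (z.val : ℤ) : ℤ) : ℂ) * k / ((N₁ * N₂ : ℕ) : ℂ))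
          = -((y.val : ℂ) * k / N₁) + -((z.val : ℂ) * k / N₂) := by
        push_cast; field_simp; ring
      rw [e3, e_add]
      push_cast; ring
    simp only [hterm]
    simp only [← Finset.mul_sum, ← Finset.sum_mul]
    rw [h₁.gauss, h₂.gauss]
    have : (√((N₁ * N₂ : ℕ) : ℝ) : ℂ) = √(N₁ : ℝ) * √(N₂ : ℝ) := by
      rw [← Complex.ofReal_mul, ← Real.sqrt_mul (by positivity)]; push_cast; rfl
    rw [this]
    push_cast; ring

/-- The Legendre symbol. The value of its Gauss sum, with the sign, is that of
`sum_e_neg_sq_div`. -/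
lemma isRealGaussChar_prime {p : ℕ} [hp : Fact p.Prime] (hp2 : p ≠ 2) :
    IsRealGaussChar p (fun a => jacobiSym a p) (gaussSign p) := by
  have hodd : Odd p := hp.out.odd_of_ne_two hp2
  have hp0 : (p : ℂ) ≠ 0 := Nat.cast_ne_zero.mpr (NeZero.ne p)
  have hJ : ∀ a : ℤ, jacobiSym a p = quadraticChar (ZMod p) (a : ZMod p) := fun a => by
    rw [← jacobiSym.legendreSym.to_jacobiSym]; rfl
  refine ⟨fun a b hab => ?_, fun a b => jacobiSym.mul_left a b p, jacobiSym.one_left p, fun k => ?_⟩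
  · simp only [hJ, hab]
  have hring : ringChar (ZMod p) ≠ 2 := by rwa [ZMod.ringChar_zmod_n]
  -- the character `x ↦ e(-x/p)`
  have hψ : ∀ x : ZMod p, ∀ k : ℤ, e (-((x.val : ℂ) * k / p)) = (ZMod.stdAddChar⁻¹ : AddChar (ZMod p) ℂ) (x * k) := by
    intro x k
    rw [AddChar.inv_apply, show -(x * (k : ZMod p)) = ((-(x.val * k : ℤ) : ℤ) : ZMod p) by
      push_cast; simp, stdAddChar_eq_e]
    congr 1; push_cast; ring
  simp only [hψ, hJ]
  simp only [Int.cast_natCast, ZMod.natCast_zmod_val]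
  have hsum0 : ∑ x : ZMod p, ((quadraticChar (ZMod p) x : ℤ) : ℂ) = 0 := by
    rw [← Int.cast_sum, quadraticChar_sum_zero hring]; simp
  -- the value at `k = 1`
  have hone : ∑ x : ZMod p, ((quadraticChar (ZMod p) x : ℤ) : ℂ) *
      (ZMod.stdAddChar⁻¹ : AddChar (ZMod p) ℂ) x = gaussSign p * √(p : ℝ) := by
    have h1 : ∑ j ∈ Finset.range p, e (-((j : ℂ) ^ 2 / p))
        = ∑ x : ZMod p, (ZMod.stdAddChar⁻¹ : AddChar (ZMod p) ℂ) (x ^ 2) := by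
      symm
      refine Finset.sum_bij' (fun x _ => x.val) (fun j _ => (j : ZMod p)) ?_ ?_ ?_ ?_ ?_
      · intro x _; exact Finset.mem_range.mpr (ZMod.val_lt x)
      · intro j _; exact Finset.mem_univ _
      · intro x _; exact ZMod.natCast_zmod_val x
      · intro j hj; exact ZMod.val_cast_of_lt (Finset.mem_range.mp hj)
      · intro x _
        rw [show x ^ 2 = x * ((x.val : ℤ) : ZMod p) by simp [sq], ← hψ]
        congr 1; push_cast; ring
    have h2 : ∑ x : ZMod p, (ZMod.stdAddChar⁻¹ : AddChar (ZMod p) ℂ) (x ^ 2)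
        = ∑ y : ZMod p, (((quadraticChar (ZMod p) y : ℤ) : ℂ) + 1) *
          (ZMod.stdAddChar⁻¹ : AddChar (ZMod p) ℂ) y := by
      rw [← Finset.sum_fiberwise (s := Finset.univ) (g := fun x : ZMod p => x ^ 2)]
      refine Finset.sum_congr rfl fun y _ => ?_
      have h3 := quadraticChar_card_sqrts hring y
      have h4 : ∑ x : ZMod p with x ^ 2 = y, (ZMod.stdAddChar⁻¹ : AddChar (ZMod p) ℂ) (x ^ 2)
          = ∑ x : ZMod p with x ^ 2 = y, (ZMod.stdAddChar⁻¹ : AddChar (ZMod p) ℂ) y :=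
        Finset.sum_congr rfl fun x hx => by rw [(Finset.mem_filter.mp hx).2]
      rw [h4, Finset.sum_const, nsmul_eq_mul]
      congr 1
      have h5 : ((quadraticChar (ZMod p) y + 1 : ℤ) : ℂ)
          = (((↑{x : ZMod p | x ^ 2 = y}.toFinset.card : ℤ)) : ℂ) := by rw [h3]
      push_cast at h5
      rw [h5]
      congr 2
      ext; simp
    have h6 : ∑ y : ZMod p, (ZMod.stdAddChar⁻¹ : AddChar (ZMod p) ℂ) y = 0 := by
      refine AddChar.sum_eq_zero_of_ne_one ?_
      intro h
      have := ZMod.isPrimitive_stdAddChar p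
      have h7 := inv_eq_one.mp h
      have h8 := this (a := 1) one_ne_zero
      rw [AddChar.mulShift_one] at h8
      exact h8 h7
    have h9 := sum_e_neg_sq_div p
    rw [gauss_odd p hodd, h1, h2] at h9
    simp only [add_mul, one_mul, Finset.sum_add_distrib, h6, add_zero] at h9
    rw [h9]; ring
  -- the value at general `k` by the substitution `x ↦ x / k`
  by_cases hk : (k : ZMod p) = 0
  · rw [hk, MulChar.map_zero]
    simp only [mul_zero, AddChar.map_zero_eq_one, mul_one, hsum0, Int.cast_zero]
  · have := Fintype.sum_equiv (Equiv.mulRight₀ (k : ZMod p) hk)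
      (fun x => ((quadraticChar (ZMod p) x : ℤ) : ℂ) *
        (ZMod.stdAddChar⁻¹ : AddChar (ZMod p) ℂ) (x * k))
      (fun x => ((quadraticChar (ZMod p) (x * (k : ZMod p)⁻¹) : ℤ) : ℂ) *
        (ZMod.stdAddChar⁻¹ : AddChar (ZMod p) ℂ) x) (fun x => by
          simp [mul_assoc, mul_inv_cancel₀ hk])
    rw [this]
    have hinv : quadraticChar (ZMod p) (k : ZMod p)⁻¹ = quadraticChar (ZMod p) (k : ZMod p) := by
      have h1 := quadraticChar_sq_one (F := ZMod p) hk
      have h2 : quadraticChar (ZMod p) (k : ZMod p) * quadraticChar (ZMod p) (k : ZMod p)⁻¹ = 1 := by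
        rw [← map_mul, mul_inv_cancel₀ hk, map_one]
      have h3 : quadraticChar (ZMod p) (k : ZMod p) ≠ 0 := fun h => by simp [h] at h1
      refine mul_left_cancel₀ h3 ?_
      rw [h2, ← sq, h1]
    simp only [map_mul, hinv, Int.cast_mul]
    rw [← hone, Finset.sum_mul]
    exact Finset.sum_congr rfl fun x _ => by ring

lemma IsRealGaussChar.congr {N N' : ℕ} [NeZero N] [NeZero N'] {χ χ' : ℤ → ℤ} {w w' : ℂ}
    (h : IsRealGaussChar N χ w) (hN : N = N') (hχ : ∀ a, χ a = χ' a) (hw : w = w') :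
    IsRealGaussChar N' χ' w' := by
  obtain rfl := funext hχ
  subst hN hw
  exact h

lemma isRealGaussChar_one : IsRealGaussChar 1 (fun a => jacobiSym a 1) (gaussSign 1) := by
  refine ⟨fun a b _ => by simp, fun a b => by simp, by simp, fun k => ?_⟩
  have : (Finset.univ : Finset (ZMod 1)) = {0} := rfl
  rw [this]
  simp [gaussSign, e_zero]

/-- The multiplicativity of the signs of Gauss sums is quadratic reciprocity. -/
lemma gaussSign_mul {m n : ℕ} (hm : Odd m) (hn : Odd n) (h : m.Coprime n) :
    (jacobiSym n m : ℂ) * jacobiSym m n * gaussSign m * gaussSign n = gaussSign (m * n) := by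
  have hJ : (jacobiSym n m : ℂ) * jacobiSym n m = 1 := by
    have : jacobiSym n m ^ 2 = 1 := jacobiSym.sq_one (by
      rw [Int.gcd_natCast_natCast]; exact h.symm)
    rw [← Int.cast_mul, ← sq, this, Int.cast_one]
  have hm' : m % 4 = 1 ∨ m % 4 = 3 := by have := Nat.odd_iff.mp hm; omega
  have hn' : n % 4 = 1 ∨ n % 4 = 3 := by have := Nat.odd_iff.mp hn; omega
  have hI := Complex.I_mul_I
  have hmn := Nat.mul_mod m n 4
  rcases hm' with h1 | h1
  · rw [jacobiSym.quadratic_reciprocity_one_mod_four h1 hn, hJ]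
    rcases hn' with h2 | h2 <;> simp [gaussSign, hmn, h1, h2]
  · rcases hn' with h2 | h2
    · rw [← jacobiSym.quadratic_reciprocity_one_mod_four h2 hm, hJ]
      simp [gaussSign, hmn, h1, h2]
    · rw [jacobiSym.quadratic_reciprocity_three_mod_four h1 h2]
      simp [gaussSign, hmn, h1, h2]
      linear_combination -Complex.I * Complex.I * hJ - hI

lemma isRealGaussChar_odd (n : ℕ) [NeZero n] (hn : Odd n) (hs : Squarefree n) :
    IsRealGaussChar n (fun a => jacobiSym a n) (gaussSign n) := by
  have key : ∀ n : ℕ, ∀ _ : NeZero n, Odd n → Squarefree n →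
      IsRealGaussChar n (fun a => jacobiSym a n) (gaussSign n) := by
    intro n
    induction n using induction_on_primes with
    | zero => exact fun h => absurd rfl h.out
    | one => exact fun _ _ _ => isRealGaussChar_one.congr rfl (fun _ => rfl) rfl
    | prime_mul p m hp ih =>
      intro _ hodd hsq
      have h1 := Nat.squarefree_mul_iff.mp hsq
      have h2 := Nat.odd_mul.mp hodd
      have h3 : NeZero m := ⟨fun h => by simp [h] at hodd⟩
      have : Fact p.Prime := ⟨hp⟩
      have hp2 : p ≠ 2 := by rintro rfl; exact absurd h2.1 (by decide)
      refine ((isRealGaussChar_prime hp2).product h1.1 (ih h3 h2.2 h1.2.2)).congr rfl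
        (fun a => (jacobiSym.mul_right a p m).symm) (gaussSign_mul h2.1 h2.2 h1.1)
  exact key n _ hn hs

lemma e_intCast_div (k : ℤ) (n : ℕ) : e (-((k : ℂ) / n)) = e (-(1 / n)) ^ k := by
  rw [e, e, ← Complex.exp_int_mul]; congr 1; ring

lemma sum_zmod_four (F : ℕ → ℂ) : ∑ x : ZMod 4, F x.val = F 0 + F 1 + F 2 + F 3 :=
  Fin.sum_univ_four (fun x : Fin 4 => F x.val)

lemma sum_zmod_eight (F : ℕ → ℂ) :
    ∑ x : ZMod 8, F x.val = F 0 + F 1 + F 2 + F 3 + F 4 + F 5 + F 6 + F 7 :=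
  Fin.sum_univ_eight (fun x : Fin 8 => F x.val)

lemma isRealGaussChar_four : IsRealGaussChar 4 (fun a => ZMod.χ₄ a) (-Complex.I) := by
  refine ⟨fun a b h => by simp only [h], fun a b => by rw [Int.cast_mul, map_mul],
    by rw [Int.cast_one, map_one], fun k => ?_⟩
  have h1 : e (-(1 / 4)) = -Complex.I := by
    rw [e_neg, e_quarter, Complex.inv_I]
  rw [sum_zmod_four (fun x => (ZMod.χ₄ ((x : ℤ) : ZMod 4) : ℂ) * e (-((x : ℂ) * k / (4 : ℕ))))]
  have h2 : ∀ j : ℕ, e (-((j : ℂ) * k / (4 : ℕ))) = ((-Complex.I) ^ k) ^ j := by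
    intro j
    have := e_intCast_div (j * k) 4
    rw [Int.cast_mul] at this
    rw [← h1, ← zpow_natCast, ← zpow_mul, mul_comm k]
    simpa using this
  simp only [h2]
  have h3 : (√((4 : ℕ) : ℝ) : ℂ) = 2 := by
    rw [show ((4 : ℕ) : ℝ) = 2 ^ 2 by norm_num, Real.sqrt_sq (by norm_num)]; simp
  rw [h3]
  have c0 : ZMod.χ₄ (((0 : ℕ) : ℤ) : ZMod 4) = 0 := rfl
  have c1 : ZMod.χ₄ (((1 : ℕ) : ℤ) : ZMod 4) = 1 := rfl
  have c2 : ZMod.χ₄ (((2 : ℕ) : ℤ) : ZMod 4) = 0 := rfl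
  have c3 : ZMod.χ₄ (((3 : ℕ) : ℤ) : ZMod 4) = -1 := rfl
  simp only [c0, c1, c2, c3]
  have hI := Complex.I_sq
  have h4 : (-Complex.I) ^ (4 : ℤ) = 1 := by
    rw [show (4 : ℤ) = ((4 : ℕ) : ℤ) from rfl, zpow_natCast]
    linear_combination (Complex.I ^ 2 - 1) * hI
  obtain ⟨q, ρ, hρ0, hρ4, rfl⟩ : ∃ q ρ : ℤ, 0 ≤ ρ ∧ ρ < 4 ∧ k = 4 * q + ρ :=
    ⟨k / 4, k % 4, by omega, by omega, by omega⟩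
  have h5 : (-Complex.I) ^ (4 * q + ρ) = (-Complex.I) ^ ρ := by
    rw [zpow_add₀ (by simp), zpow_mul, h4, one_zpow, one_mul]
  have h6 : ((4 * q + ρ : ℤ) : ZMod 4) = ρ := by
    push_cast; rw [show (4 : ZMod 4) = 0 from rfl, zero_mul, zero_add]
  rw [h5, h6]
  lift ρ to ℕ using hρ0
  rw [zpow_natCast]
  have : ρ < 4 := by exact_mod_cast hρ4
  generalize Complex.I = i at *
  clear h1 h2 h5
  interval_cases ρ <;> simp only [c0, c1, c2, c3] <;> push_cast <;> grind

/-- The two primitive characters modulo `8`: the even one and the odd one. -/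
lemma isRealGaussChar_eight_aux (χ : MulChar (ZMod 8) ℤ) (w : ℂ) (h2 : χ 2 = 0) (h4 : χ 4 = 0)
    (h6 : χ 6 = 0) (h0 : χ 0 = 0) (hχ : χ 3 = -1 ∧ χ 5 = -1 ∧ χ 7 = 1 ∧ w = 1 ∨
      χ 3 = 1 ∧ χ 5 = -1 ∧ χ 7 = -1 ∧ w = -Complex.I) :
    IsRealGaussChar 8 (fun a => χ a) w := by
  refine ⟨fun a b h => by simp only [h], fun a b => by simp, by simp, fun k => ?_⟩
  have h20 : (√(2 : ℝ) : ℂ) ^ 2 = 2 := by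
    rw [← Complex.ofReal_pow, Real.sq_sqrt (by positivity)]; simp
  have h21 : (√(2 : ℝ) : ℂ) ≠ 0 := fun h => by rw [h] at h20; norm_num at h20
  have hI := Complex.I_sq
  set ζ := e (-(1 / 8)) with hζ
  have hζ0 : ζ ≠ 0 := e_ne_zero _
  have h1 : ζ = (1 - Complex.I) / √(2 : ℝ) := by rw [← e_eight, hζ]; congr 1; ring
  have hζt : ζ * √(2 : ℝ) = 1 - Complex.I := by rw [h1]; field_simp
  have hz2 : ζ ^ 2 = -Complex.I := by
    rw [h1, div_pow, h20]; linear_combination hI / 2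
  rw [sum_zmod_eight (fun x => (χ ((x : ℤ) : ZMod 8) : ℂ) * e (-((x : ℂ) * k / (8 : ℕ))))]
  have h2' : ∀ j : ℕ, e (-((j : ℂ) * k / (8 : ℕ))) = (ζ ^ k) ^ j := by
    intro j
    have := e_intCast_div (j * k) 8
    rw [Int.cast_mul] at this
    rw [← zpow_natCast, ← zpow_mul, mul_comm k]
    simpa [hζ] using this
  simp only [h2']
  have h3 : (√((8 : ℕ) : ℝ) : ℂ) = 2 * √(2 : ℝ) := by
    rw [show ((8 : ℕ) : ℝ) = 2 ^ 2 * 2 by norm_num, Real.sqrt_mul (by norm_num),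
      Real.sqrt_sq (by norm_num)]; simp
  rw [h3]
  have c0 : χ (((0 : ℕ) : ℤ) : ZMod 8) = 0 := h0
  have c1 : χ (((1 : ℕ) : ℤ) : ZMod 8) = 1 := map_one χ
  have c2 : χ (((2 : ℕ) : ℤ) : ZMod 8) = 0 := h2
  have c4 : χ (((4 : ℕ) : ℤ) : ZMod 8) = 0 := h4
  have c6 : χ (((6 : ℕ) : ℤ) : ZMod 8) = 0 := h6
  have c3 : χ (((3 : ℕ) : ℤ) : ZMod 8) = χ 3 := rfl
  have c5 : χ (((5 : ℕ) : ℤ) : ZMod 8) = χ 5 := rfl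
  have c7 : χ (((7 : ℕ) : ℤ) : ZMod 8) = χ 7 := rfl
  have hz8 : ζ ^ (8 : ℤ) = 1 := by
    rw [show (8 : ℤ) = ((2 * 4 : ℕ) : ℤ) from rfl, zpow_natCast, pow_mul, hz2]
    linear_combination (Complex.I ^ 2 - 1) * hI
  obtain ⟨q, ρ, hρ0, hρ8, rfl⟩ : ∃ q ρ : ℤ, 0 ≤ ρ ∧ ρ < 8 ∧ k = 8 * q + ρ :=
    ⟨k / 8, k % 8, by omega, by omega, by omega⟩
  have h5 : ζ ^ (8 * q + ρ) = ζ ^ ρ := by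
    rw [zpow_add₀ hζ0, zpow_mul, hz8, one_zpow, one_mul]
  have h6' : ((8 * q + ρ : ℤ) : ZMod 8) = ρ := by
    push_cast; rw [show (8 : ZMod 8) = 0 from rfl, zero_mul, zero_add]
  rw [h5, h6']
  lift ρ to ℕ using hρ0
  rw [zpow_natCast]
  have : ρ < 8 := by exact_mod_cast hρ8
  have hi : Complex.I = -ζ ^ 2 := by rw [hz2, neg_neg]
  have hz4 : ζ ^ 4 = -1 := by
    rw [show ζ ^ 4 = (ζ ^ 2) ^ 2 by ring, hz2]; linear_combination hI
  have ht : (√(2 : ℝ) : ℂ) = ζ - ζ ^ 3 := by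
    refine mul_left_cancel₀ hζ0 ?_
    linear_combination hζt - hi + hz4
  rw [ht]
  rw [hi] at hχ
  clear_value ζ
  simp only [c0, c2, c4, c6, c1, c3, c5, c7]
  clear h2' h5 hz8 hI hi hz2 h1 hζt h20 h21 h3 hζ hζ0 ht
  rcases hχ with ⟨d3, d5, d7, rfl⟩ | ⟨d3, d5, d7, rfl⟩ <;>
  · interval_cases ρ <;> simp only [c0, c1, c2, c3, c4, c5, c6, c7, d3, d5, d7] <;>
      push_cast <;> grind

lemma isRealGaussChar_eight : IsRealGaussChar 8 (fun a => ZMod.χ₈ a) 1 :=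
  isRealGaussChar_eight_aux _ _ rfl rfl rfl rfl (Or.inl ⟨rfl, rfl, rfl, rfl⟩)

lemma isRealGaussChar_eight' : IsRealGaussChar 8 (fun a => ZMod.χ₈' a) (-Complex.I) :=
  isRealGaussChar_eight_aux _ _ rfl rfl rfl rfl (Or.inr ⟨rfl, rfl, rfl, rfl⟩)

/-! ### The `L`-function of a fundamental discriminant -/

/-- Quadratic reciprocity with an odd integer in the numerator. -/
lemma jacobiSym_flip {m : ℤ} (hm : Odd m) {a : ℕ} (ha : Odd a) :
    jacobiSym m a = (if m % 4 = 1 then 1 else ZMod.χ₄ a) * jacobiSym a m.natAbs := by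
  have hn : Odd m.natAbs := Int.natAbs_odd.mpr hm
  have ha4 : a % 4 = 1 ∨ a % 4 = 3 := by have := Nat.odd_iff.mp ha; omega
  have key : jacobiSym m.natAbs a = (if m.natAbs % 4 = 1 then 1 else ZMod.χ₄ a) *
      jacobiSym a m.natAbs := by
    split_ifs with h
    · rw [one_mul, jacobiSym.quadratic_reciprocity_one_mod_four h ha]
    · rcases ha4 with h1 | h1
      · rw [jacobiSym.quadratic_reciprocity_one_mod_four' hn h1,
          ZMod.χ₄_nat_one_mod_four h1, one_mul]
      · rw [jacobiSym.quadratic_reciprocity_three_mod_four (by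
          have := Nat.odd_iff.mp hn; omega) h1, ZMod.χ₄_nat_three_mod_four h1, neg_one_mul]
  have hm2 := Int.odd_iff.mp hm
  rcases Int.natAbs_eq m with h | h
  · rw [h, Int.natAbs_natCast, key]
    congr 1
    have : (m.natAbs % 4 = 1) ↔ ((m.natAbs : ℤ) % 4 = 1) := by omega
    simp only [this]
  · rw [h, jacobiSym.neg _ ha, Int.natAbs_neg, Int.natAbs_natCast, key, ← mul_assoc]
    congr 1
    have : (m.natAbs % 4 = 1) ↔ ¬ ((-(m.natAbs : ℤ)) % 4 = 1) := by omega
    by_cases hc : (-(m.natAbs : ℤ)) % 4 = 1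
    · rw [if_pos hc, if_neg (by rw [this]; exact not_not.mpr hc)]
      rcases ha4 with h1 | h1
      · rw [ZMod.χ₄_nat_one_mod_four h1]; rfl
      · rw [ZMod.χ₄_nat_three_mod_four h1]; rfl
    · rw [if_neg hc, if_pos (this.mpr hc), mul_one]

lemma kroneckerSymbol_of_odd (D : ℤ) {a : ℕ} (ha : Odd a) : kroneckerSymbol D a = jacobiSym D a := by
  have h0 : a ≠ 0 := by rintro rfl; exact absurd ha (by decide)
  have h2 : padicValNat 2 a = 0 := padicValNat.eq_zero_of_not_dvd (by
    rw [← even_iff_two_dvd]; exact Nat.not_even_iff_odd.mpr ha)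
  rw [kroneckerSymbol, if_neg h0, h2, pow_zero, pow_zero, one_mul, Nat.div_one]

lemma kroneckerSymbol_four_mul_of_even (m : ℤ) {a : ℕ} (ha : Even a) :
    kroneckerSymbol (4 * m) a = 0 := by
  rw [kroneckerSymbol]
  split_ifs with h0 h1
  · omega
  · rfl
  · have h2 : padicValNat 2 a ≠ 0 := by
      have := one_le_padicValNat_of_dvd h0 (even_iff_two_dvd.mp ha)
      omega
    have h3 : ZMod.χ₈ ((4 * m : ℤ) : ZMod 8) = 0 := by
      push_cast
      generalize (m : ZMod 8) = x
      revert x; decide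
    rw [h3, zero_pow h2, zero_mul]

/-- For `D ≡ 1 mod 4` the Kronecker symbol is the Jacobi symbol with modulus `|D|`. -/
lemma kroneckerSymbol_of_odd_left {D : ℤ} (hD : D % 4 = 1) (a : ℕ) :
    kroneckerSymbol D a = jacobiSym a D.natAbs := by
  have hodd : Odd D := Int.odd_iff.mpr (by omega)
  rw [kroneckerSymbol]
  split_ifs with h0 h1
  · rw [h1, jacobiSym.one_right]
  · rw [h0, Nat.cast_zero, jacobiSym.zero_left]
    have : D.natAbs ≠ 0 := by rw [Int.natAbs_ne_zero]; rintro rfl; omega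
    omega
  · obtain ⟨v, a', ha', rfl⟩ : ∃ v a', Odd a' ∧ a = 2 ^ v * a' := by
      obtain ⟨v, a', h, h'⟩ := Nat.exists_eq_two_pow_mul_odd h0
      exact ⟨v, a', h, h'⟩
    have hv : padicValNat 2 (2 ^ v * a') = v := by
      have : Fact (Nat.Prime 2) := ⟨Nat.prime_two⟩
      rw [padicValNat.mul (by positivity) (by rintro rfl; exact absurd ha' (by decide)),
        padicValNat.prime_pow, padicValNat.eq_zero_of_not_dvd (by
          rw [← even_iff_two_dvd]; exact Nat.not_even_iff_odd.mpr ha'), add_zero]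
    rw [hv, Nat.mul_div_cancel_left _ (by positivity), jacobiSym_flip hodd ha', if_pos hD, one_mul]
    push_cast
    rw [jacobiSym.mul_left, jacobiSym.pow_left, jacobiSym.at_two (Int.natAbs_odd.mpr hodd)]
    congr 2
    rcases Int.natAbs_eq D with h | h
    · conv_lhs => rw [h]
      simp
    · conv_lhs => rw [h]
      rw [Int.cast_neg, Int.cast_natCast]
      exact (by decide : ∀ x : ZMod 8, ZMod.χ₈ (-x) = ZMod.χ₈ x) _

/-- The Kronecker symbol of a fundamental discriminant is a real character whose Gauss sums have
the classical sign. -/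
theorem exists_isRealGaussChar {D : ℤ} (hD : IsFundamentalDiscriminant D) [NeZero D.natAbs] :
    ∃ χ : ℤ → ℤ, IsRealGaussChar D.natAbs χ (if 0 < D then 1 else -Complex.I) ∧
      ∀ a : ℕ, kroneckerSymbol D a = χ a := by
  have hI := Complex.I_sq
  -- `D` is a product of an odd part and of `1`, `4` or `8`; the Gauss sums multiply, and so do the
  -- symbols, by quadratic reciprocity
  -- the factor of a discriminant that is prime to `2`
  have hsign : ∀ m : ℤ, m % 2 = 1 → gaussSign m.natAbs =
      if m % 4 = 1 then (if 0 < m then 1 else -Complex.I) else (if 0 < m then -Complex.I else 1) := by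
    intro m hm
    rw [gaussSign]
    split_ifs <;> first | rfl | omega
  have hcop : ∀ (m : ℤ) (j : ℕ), m % 2 = 1 → (2 ^ j).Coprime m.natAbs := by
    intro m j hm
    refine Nat.Coprime.pow_left _ ?_
    rw [Nat.coprime_two_left]
    exact Int.natAbs_odd.mpr (Int.odd_iff.mpr hm)
  rcases hD with ⟨h1, h2⟩ | ⟨m, rfl, h1, h2⟩
  · refine ⟨fun a => jacobiSym a D.natAbs, ?_, fun a => kroneckerSymbol_of_odd_left h1 a⟩
    refine (isRealGaussChar_odd D.natAbs (Int.natAbs_odd.mpr (Int.odd_iff.mpr (by omega)))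
      (Int.squarefree_natAbs.mpr h2)).congr rfl (fun _ => rfl) ?_
    rw [hsign D (by omega), if_pos h1]
  · have hpos : ∀ m : ℤ, 0 < 4 * m ↔ 0 < m := fun m => by omega
    simp only [hpos]
    rcases h1 with h1 | h1
    · obtain ⟨m₁, rfl⟩ : ∃ m₁, m = 2 * m₁ := ⟨m / 2, by omega⟩
      have hm1 : m₁ % 2 = 1 := by omega
      have hodd : Odd m₁ := Int.odd_iff.mpr hm1
      have hsq : Squarefree m₁.natAbs :=
        Int.squarefree_natAbs.mpr (h2.squarefree_of_dvd (Dvd.intro_left 2 rfl))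
      have : NeZero m₁.natAbs := ⟨by rw [Int.natAbs_ne_zero]; rintro rfl; omega⟩
      have hJ := isRealGaussChar_odd m₁.natAbs (Int.natAbs_odd.mpr hodd) hsq
      have hN : 8 * m₁.natAbs = (4 * (2 * m₁)).natAbs := by omega
      have hn := Int.natAbs_odd.mpr hodd
      have h8 : jacobiSym 8 m₁.natAbs = ZMod.χ₈ m₁.natAbs := by
        rw [← jacobiSym.at_two hn, show (8 : ℤ) = 2 ^ 3 by norm_num, jacobiSym.pow_left]
        rcases jacobiSym.trichotomy 2 m₁.natAbs with h | h | h <;> rw [h] <;> norm_num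
      have hodd8 : ∀ a : ℕ, Odd a → jacobiSym (4 * (2 * m₁)) a = ZMod.χ₈ a * jacobiSym m₁ a := by
        intro a ha
        rw [show (4 * (2 * m₁)) = 2 ^ 2 * (2 * m₁) by ring, jacobiSym.mul_left,
          jacobiSym.mul_left 2, jacobiSym.sq_one', one_mul, jacobiSym.at_two ha]
        exact_mod_cast (Nat.coprime_two_left.mpr ha)
      have hchi : ∀ x : ZMod 8, ∀ a : ℕ, (a : ZMod 8) = x → Odd a →
          ZMod.χ₄ a * ZMod.χ₈ a = ZMod.χ₈' a := by
        intro x a hx ha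
        rw [ZMod.χ₈'_eq_χ₄_mul_χ₈]
        congr 2
        simp
      have hval : ∀ a : ℕ, Odd a → (ZMod.χ₈ (a : ZMod 8)) ^ 2 = 1 ∧
          ZMod.χ₈ (a : ZMod 8) * ZMod.χ₈' (a : ZMod 8) = if a % 4 = 1 then 1 else -1 := by
        intro a ha
        have : a % 8 = 1 ∨ a % 8 = 3 ∨ a % 8 = 5 ∨ a % 8 = 7 := by
          have := Nat.odd_iff.mp ha; omega
        rw [← ZMod.natCast_mod a 8]
        rcases this with h | h | h | h <;> rw [h] <;> refine ⟨rfl, ?_⟩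
        · rw [if_pos (by omega)]; rfl
        · rw [if_neg (by omega)]; rfl
        · rw [if_pos (by omega)]; rfl
        · rw [if_neg (by omega)]; rfl
      have heven : ∀ (χ : MulChar (ZMod 8) ℤ) (a : ℕ), Even a → χ 0 = 0 → χ 2 = 0 → χ 4 = 0 →
          χ 6 = 0 → χ a = 0 := by
        intro χ a ha h0 h2 h4 h6
        rw [← ZMod.natCast_mod a 8]
        have : a % 8 = 0 ∨ a % 8 = 2 ∨ a % 8 = 4 ∨ a % 8 = 6 := by
          have := Nat.even_iff.mp ha; omega
        rcases this with h | h | h | h <;> rw [h] <;> assumption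
      by_cases hm4 : m₁ % 4 = 1
      · refine ⟨fun a => ZMod.χ₈ a * jacobiSym a m₁.natAbs, ?_, fun a => ?_⟩
        · refine (isRealGaussChar_eight.product (hcop m₁ 3 hm1) hJ).congr hN (fun _ => rfl) ?_
          simp only [Int.cast_natCast]
          rw [show (((2 ^ 3 : ℕ) : ℤ)) = 8 from rfl, h8, hsign m₁ hm1, if_pos hm4]
          have := (hval _ hn).1
          have h' : (ZMod.χ₈ (m₁.natAbs : ZMod 8) : ℂ) ^ 2 = 1 := by exact_mod_cast this
          simp only [show (0 < 2 * m₁) ↔ 0 < m₁ by omega]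
          linear_combination (if 0 < m₁ then 1 else -Complex.I) * h'
        · beta_reduce
          rcases Nat.even_or_odd a with ha | ha
          · rw [kroneckerSymbol_four_mul_of_even _ ha, Int.cast_natCast,
              heven _ a ha rfl rfl rfl rfl, zero_mul]
          · rw [kroneckerSymbol_of_odd _ ha, hodd8 a ha, jacobiSym_flip hodd ha, if_pos hm4, one_mul,
              Int.cast_natCast]
      · refine ⟨fun a => ZMod.χ₈' a * jacobiSym a m₁.natAbs, ?_, fun a => ?_⟩
        · refine (isRealGaussChar_eight'.product (hcop m₁ 3 hm1) hJ).congr hN (fun _ => rfl) ?_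
          simp only [Int.cast_natCast]
          rw [show (((2 ^ 3 : ℕ) : ℤ)) = 8 from rfl, h8, hsign m₁ hm1, if_neg hm4]
          have := (hval _ hn).2
          have h' : (ZMod.χ₈ (m₁.natAbs : ZMod 8) : ℂ) * ZMod.χ₈' (m₁.natAbs : ZMod 8)
              = if m₁.natAbs % 4 = 1 then 1 else -1 := by exact_mod_cast congrArg (Int.cast (R := ℂ)) this
          simp only [show (0 < 2 * m₁) ↔ 0 < m₁ by omega]
          rw [show (ZMod.χ₈' (m₁.natAbs : ZMod 8) : ℂ) * (ZMod.χ₈ (m₁.natAbs : ZMod 8) : ℂ) =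
            (ZMod.χ₈ (m₁.natAbs : ZMod 8) : ℂ) * ZMod.χ₈' (m₁.natAbs : ZMod 8) by ring, h']
          by_cases hp : 0 < m₁
          · rw [if_pos hp, if_pos hp, if_neg (by omega)]; linear_combination -hI
          · rw [if_neg hp, if_neg hp, if_pos (by omega)]; ring
        · beta_reduce
          rcases Nat.even_or_odd a with ha | ha
          · rw [kroneckerSymbol_four_mul_of_even _ ha, Int.cast_natCast,
              heven _ a ha rfl rfl rfl rfl, zero_mul]
          · rw [kroneckerSymbol_of_odd _ ha, hodd8 a ha, jacobiSym_flip hodd ha, if_neg hm4,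
              ← mul_assoc, mul_comm (ZMod.χ₈ _), hchi _ a rfl ha, Int.cast_natCast]
    · have hm1 : m % 2 = 1 := by omega
      have hm4 : ¬ m % 4 = 1 := by omega
      have hodd : Odd m := Int.odd_iff.mpr hm1
      have : NeZero m.natAbs := ⟨by rw [Int.natAbs_ne_zero]; rintro rfl; omega⟩
      have hn := Int.natAbs_odd.mpr hodd
      have hJ := isRealGaussChar_odd m.natAbs hn (Int.squarefree_natAbs.mpr h2)
      have hN : 4 * m.natAbs = (4 * m).natAbs := by omega
      have h4 : ∀ a : ℕ, Odd a → jacobiSym 4 a = 1 := by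
        intro a ha
        rw [show (4 : ℤ) = 2 ^ 2 by norm_num, jacobiSym.sq_one']
        exact_mod_cast (Nat.coprime_two_left.mpr ha)
      refine ⟨fun a => ZMod.χ₄ a * jacobiSym a m.natAbs, ?_, fun a => ?_⟩
      · refine (isRealGaussChar_four.product (hcop m 2 hm1) hJ).congr hN (fun _ => rfl) ?_
        simp only [Int.cast_natCast]
        rw [show (((2 ^ 2 : ℕ) : ℤ)) = 4 from rfl, h4 _ hn, hsign m hm1, if_neg hm4]
        by_cases hp : 0 < m
        · rw [if_pos hp, if_pos hp, ZMod.χ₄_nat_three_mod_four (by omega)]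
          push_cast; linear_combination -hI
        · rw [if_neg hp, if_neg hp, ZMod.χ₄_nat_one_mod_four (by omega)]
          push_cast; ring
      · beta_reduce
        rcases Nat.even_or_odd a with ha | ha
        · rw [kroneckerSymbol_four_mul_of_even _ ha, Int.cast_natCast]
          have : ZMod.χ₄ (a : ZMod 4) = 0 := by
            rw [← ZMod.natCast_mod a 4]
            have : a % 4 = 0 ∨ a % 4 = 2 := by have := Nat.even_iff.mp ha; omega
            rcases this with h | h <;> rw [h] <;> rfl
          rw [this, zero_mul]
        · rw [kroneckerSymbol_of_odd _ ha, jacobiSym.mul_left, h4 a ha, one_mul,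
            jacobiSym_flip hodd ha, if_neg hm4, Int.cast_natCast]

/-- Complex conjugation of the Gauss sum determines the parity of the character. -/
lemma IsRealGaussChar.conj_eq {N : ℕ} [NeZero N] {χ : ℤ → ℤ} {w : ℂ} (h : IsRealGaussChar N χ w) :
    (starRingEnd ℂ) w = w * χ (-1) := by
  have hN : (√(N : ℝ) : ℂ) ≠ 0 := by
    rw [Complex.ofReal_ne_zero, Real.sqrt_ne_zero']; exact Nat.cast_pos.mpr (NeZero.pos N)
  have h1 := congrArg (starRingEnd ℂ) (h.gauss 1)
  have h2 := h.gauss (-1)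
  have hconj : ∀ x : ℝ, (starRingEnd ℂ) (e x) = e (-x) := by
    intro x
    rw [e, e, ← Complex.exp_conj]
    congr 1
    simp only [map_mul, Complex.conj_ofReal, Complex.conj_I, map_ofNat]
    ring
  rw [map_sum] at h1
  have h3 : ∀ x : ZMod N, (starRingEnd ℂ) ((χ x.val : ℂ) * e (-((x.val : ℂ) * (1 : ℤ) / N)))
      = (χ x.val : ℂ) * e (-((x.val : ℂ) * (-1 : ℤ) / N)) := by
    intro x
    rw [map_mul, map_intCast]
    have := hconj (-((x.val : ℝ) * (1 : ℤ) / N))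
    push_cast at this ⊢
    rw [this]
    congr 2
    ring
  simp only [h3] at h1
  rw [h2] at h1
  simp only [map_mul, Complex.conj_ofReal, h.one, Int.cast_one, mul_one] at h1
  refine mul_right_cancel₀ hN ?_
  rw [← h1]; ring

lemma ne_zero_of_isFundamentalDiscriminant {D : ℤ} (hD : IsFundamentalDiscriminant D) :
    D ≠ 0 := by
  rcases hD with ⟨h, -⟩ | ⟨m, rfl, h, -⟩
  · rintro rfl; omega
  · omega

/-- The functional equation of `L(χ_D, s)`. -/
theorem kroneckerL_one_sub {D : ℤ} (hD : IsFundamentalDiscriminant D) {S : ℂ} (hS : 1 < S.re) :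
    kroneckerL D (1 - S) = 2 * (D.natAbs : ℂ) ^ (S - 1 / 2) * (2 * π) ^ (-S) * Complex.Gamma S *
      Complex.cos (π * (S - signDelta D) / 2) * kroneckerL D S := by
  have hD0 := ne_zero_of_isFundamentalDiscriminant hD
  have : NeZero D.natAbs := ⟨Int.natAbs_ne_zero.mpr hD0⟩
  obtain ⟨χ, hχ, hK⟩ := exists_isRealGaussChar hD
  simp only [kroneckerL, dif_neg hD0]
  rw [ZMod.LFunction_one_sub]
  rotate_left
  · intro n h
    rw [h] at hS
    simp at hS
    have : (0 : ℝ) ≤ n := Nat.cast_nonneg n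
    linarith
  · right; rintro rfl; simp at hS
  set N := D.natAbs with hN
  set w : ℂ := if 0 < D then 1 else -Complex.I with hw
  have hN0 : (N : ℂ) ≠ 0 := Nat.cast_ne_zero.mpr (NeZero.ne N)
  have hdft : ∀ k : ℤ, ZMod.dft (fun a : ZMod N => (kroneckerSymbol D a.val : ℂ)) (k : ZMod N)
      = w * √(N : ℝ) * χ k := by
    intro k
    rw [ZMod.dft_apply, ← hχ.gauss k]
    refine Finset.sum_congr rfl fun x _ => ?_
    rw [show -(x * (k : ZMod N)) = ((-(x.val * k : ℤ) : ℤ) : ZMod N) by push_cast; simp,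
      stdAddChar_eq_e, smul_eq_mul, mul_comm, hK]
    congr 2; push_cast; ring
  have h1 : ZMod.dft (fun a : ZMod N => (kroneckerSymbol D a.val : ℂ))
      = fun a => (w * √(N : ℝ)) * (kroneckerSymbol D a.val : ℂ) := by
    funext a
    rw [hK, ← hdft, Int.cast_natCast, ZMod.natCast_zmod_val]
  have h2 : ZMod.dft (fun x : ZMod N => (fun a : ZMod N => (kroneckerSymbol D a.val : ℂ)) (-x))
      = fun a => (χ (-1) * (w * √(N : ℝ))) * (kroneckerSymbol D a.val : ℂ) := by
    have := ZMod.dft_comp_neg (fun a : ZMod N => (kroneckerSymbol D a.val : ℂ))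
    rw [this]
    funext a
    have h3 := hdft (-(a.val : ℤ))
    push_cast at h3
    rw [ZMod.natCast_zmod_val] at h3
    rw [h3, hK, show -(a.val : ℤ) = (-1) * a.val by ring, hχ.mul]
    push_cast; ring
  have hL : ∀ (c : ℂ) (Φ : ZMod N → ℂ), ZMod.LFunction (fun a => c * Φ a) S = c * ZMod.LFunction Φ S := by
    intro c Φ
    simp only [ZMod.LFunction, Finset.mul_sum]
    refine Finset.sum_congr rfl fun x _ => by ring
  rw [h2, h1, hL, hL]
  have hc := hχ.conj_eq
  have hpow : (N : ℂ) ^ (S - 1) * √(N : ℝ) = (N : ℂ) ^ (S - 1 / 2) := by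
    rw [Real.sqrt_eq_rpow, Complex.ofReal_cpow (Nat.cast_nonneg _), Complex.ofReal_natCast,
      ← Complex.cpow_add _ _ hN0]
    congr 1; push_cast; ring
  rw [← hpow]
  -- the two exponentials of the functional equation combine by the parity of `χ`
  have hcos : (w * Complex.exp (π * Complex.I * S / 2) +
      (χ (-1) * w) * Complex.exp (-π * Complex.I * S / 2)) =
      2 * Complex.cos (π * (S - signDelta D) / 2) := by
    rw [mul_comm _ w, ← hc, hw, signDelta]
    split_ifs with hp
    · rw [map_one, Complex.two_cos]
      ring_nf
    · rw [map_neg, Complex.conj_I, show (π : ℂ) * (S - 1) / 2 = π * S / 2 - π / 2 by ring,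
        Complex.cos_sub_pi_div_two, Complex.two_sin]
      ring_nf
  linear_combination (N : ℂ) ^ (S - 1) * √(N : ℝ) * (2 * π) ^ (-S) * Complex.Gamma S *
    ZMod.LFunction (fun a : ZMod N => (kroneckerSymbol D a.val : ℂ)) S * hcos

/-- The summand of the Dirichlet series of `χ_D`, as a completely multiplicative function. -/
lemma exists_kroneckerHom {D : ℤ} (hD : IsFundamentalDiscriminant D) {S : ℂ} (hS : 1 < S.re) :
    ∃ F : ℕ →*₀ ℂ, (∀ n, F n = kroneckerSymbol D n * (n : ℂ) ^ (-S)) ∧ Summable (‖F ·‖) ∧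
      ∑' n, F n = kroneckerL D S := by
  have hD0 := ne_zero_of_isFundamentalDiscriminant hD
  have : NeZero D.natAbs := ⟨Int.natAbs_ne_zero.mpr hD0⟩
  obtain ⟨χ, hχ, hK⟩ := exists_isRealGaussChar hD
  have hS0 : -S ≠ 0 := fun h => by rw [neg_eq_zero] at h; simp [h] at hS; linarith
  let F : ℕ →*₀ ℂ :=
    { toFun := fun n => kroneckerSymbol D n * (n : ℂ) ^ (-S)
      map_zero' := by simp [Complex.zero_cpow hS0]
      map_one' := by rw [hK]; simp [hχ.one]
      map_mul' := fun m n => by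
        rw [hK, hK, hK]; push_cast
        rw [hχ.mul, Complex.natCast_mul_natCast_cpow]; push_cast; ring }
  have hterm : ∀ n, F n = LSeries.term
      (fun n : ℕ => (fun a : ZMod D.natAbs => (kroneckerSymbol D a.val : ℂ)) n) S n := by
    intro n
    rcases eq_or_ne n 0 with rfl | hn
    · simp
    · rw [LSeries.term_of_ne_zero hn]
      change (kroneckerSymbol D n : ℂ) * (n : ℂ) ^ (-S) = _
      simp only [hK]
      rw [hχ.periodic n (((n : ZMod D.natAbs).val : ℕ) : ℤ) (by
          rw [Int.cast_natCast, Int.cast_natCast, ZMod.natCast_zmod_val]),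
        Complex.cpow_neg, div_eq_mul_inv]
  have hsum := ZMod.LSeriesSummable_of_one_lt_re
    (fun a : ZMod D.natAbs => (kroneckerSymbol D a.val : ℂ)) hS
  refine ⟨F, fun _ => rfl, ?_, ?_⟩
  · refine Summable.norm ?_
    exact hsum.congr fun n => (hterm n).symm
  · rw [kroneckerL, dif_neg hD0, ZMod.LFunction_eq_LSeries _ hS, LSeries]
    exact tsum_congr hterm

theorem hasProd_kroneckerL {D : ℤ} (hD : IsFundamentalDiscriminant D) {S : ℂ} (hS : 1 < S.re) :
    HasProd (fun p : Nat.Primes => (1 - kroneckerSymbol D p * (p : ℂ) ^ (-S))⁻¹) (kroneckerL D S) := by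
  obtain ⟨F, hF, hs, ht⟩ := exists_kroneckerHom hD hS
  have := EulerProduct.eulerProduct_completely_multiplicative_hasProd hs
  rw [ht] at this
  simpa only [hF] using this

theorem kroneckerL_ne_zero {D : ℤ} (hD : IsFundamentalDiscriminant D) {S : ℂ} (hS : 1 < S.re) :
    kroneckerL D S ≠ 0 := by
  obtain ⟨F, hF, hs, ht⟩ := exists_kroneckerHom hD hS
  rw [← ht, ← EulerProduct.exp_tsum_primes_log_eq_tsum hs]
  exact Complex.exp_ne_zero _

lemma one_sub_kroneckerSymbol_mul_ne_zero {D : ℤ} (hD : IsFundamentalDiscriminant D) {S : ℂ}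
    (hS : 1 < S.re) {p : ℕ} (hp : p.Prime) : 1 - kroneckerSymbol D p * (p : ℂ) ^ (-S) ≠ 0 := by
  obtain ⟨F, hF, hs, ht⟩ := exists_kroneckerHom hD hS
  have := hs.of_norm.norm_lt_one (f := F.toMonoidHom) hp.one_lt
  change ‖F p‖ < 1 at this
  rw [hF] at this
  intro h
  rw [sub_eq_zero] at h
  rw [← h, norm_one] at this
  exact lt_irrefl _ this

lemma differentiableAt_kroneckerL (D : ℤ) {S : ℂ} (hS : S ≠ 1) :
    DifferentiableAt ℂ (kroneckerL D) S := by
  by_cases hD0 : D = 0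
  · have : kroneckerL D = fun _ => 0 := by funext s; rw [kroneckerL, dif_pos hD0]
    rw [this]; exact differentiableAt_const _
  · have : NeZero D.natAbs := ⟨Int.natAbs_ne_zero.mpr hD0⟩
    have : kroneckerL D = ZMod.LFunction (fun a : ZMod D.natAbs => (kroneckerSymbol D a.val : ℂ)) := by
      funext s; rw [kroneckerL, dif_neg hD0]
    rw [this]
    exact ZMod.differentiableAt_LFunction _ _ (Or.inl hS)

lemma analyticAt_kroneckerL (D : ℤ) {S : ℂ} (hS : S ≠ 1) : AnalyticAt ℂ (kroneckerL D) S := by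
  rw [Complex.analyticAt_iff_eventually_differentiableAt]
  filter_upwards [isOpen_ne.mem_nhds hS] with s hs using differentiableAt_kroneckerL D hs

/-- A function with at most a simple pole at `a` is meromorphic there: `(s - a) F(s)` has a removable
singularity. -/
lemma meromorphicAt_of_tendsto_sub_mul {F : ℂ → ℂ} {a l : ℂ}
    (hF : ∀ s, s ≠ a → DifferentiableAt ℂ F s)
    (hl : Filter.Tendsto (fun s => (s - a) * F s) (𝓝[≠] a) (𝓝 l)) : MeromorphicAt F a := by
  have h1 : AnalyticAt ℂ (Function.update (fun s => (s - a) * F s) a l) a := by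
    refine Complex.analyticAt_of_differentiable_on_punctured_nhds_of_continuousAt ?_ ?_
    · filter_upwards [self_mem_nhdsWithin] with s hs
      have hs' : s ≠ a := hs
      have h2 : DifferentiableAt ℂ (fun s => (s - a) * F s) s :=
        (differentiableAt_id.sub_const a).mul (hF s hs')
      refine h2.congr_of_eventuallyEq ?_
      filter_upwards [isOpen_ne.mem_nhds hs'] with z hz
      exact Function.update_of_ne hz _ _
    · exact continuousAt_update_same.mpr hl
  have h2 : MeromorphicAt (fun s => (s - a)⁻¹ * Function.update (fun s => (s - a) * F s) a l s) a :=
    (MeromorphicAt.inv (by fun_prop)).mul h1.meromorphicAt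
  refine h2.congr ?_
  filter_upwards [self_mem_nhdsWithin] with s hs
  have hs' : s - a ≠ 0 := sub_ne_zero.mpr hs
  rw [Function.update_of_ne hs, inv_mul_cancel_left₀ hs']

lemma meromorphic_kroneckerL (D : ℤ) (S : ℂ) : MeromorphicAt (kroneckerL D) S := by
  by_cases hS : S = 1
  · subst hS
    by_cases hD0 : D = 0
    · have : kroneckerL D = fun _ => 0 := by funext s; rw [kroneckerL, dif_pos hD0]
      rw [this]; exact MeromorphicAt.const _ _
    · have : NeZero D.natAbs := ⟨Int.natAbs_ne_zero.mpr hD0⟩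
      have h : kroneckerL D = ZMod.LFunction (fun a : ZMod D.natAbs => (kroneckerSymbol D a.val : ℂ)) := by
        funext s; rw [kroneckerL, dif_neg hD0]
      have h1 := ZMod.LFunction_residue_one
        (fun a : ZMod D.natAbs => (kroneckerSymbol D a.val : ℂ))
      rw [← h] at h1
      exact meromorphicAt_of_tendsto_sub_mul (fun s hs => differentiableAt_kroneckerL D hs) h1
  · exact (analyticAt_kroneckerL D hS).meromorphicAt

/-! ### Exponential sums of integral quadratic polynomials -/

open Matrix in
/-- An integral quadratic polynomial `x ↦ xᵀ a x + lᵀ x + m` on `ℤ^r`, together with an integral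
form of completing the square: with the Gram matrix `A = a + aᵀ`, the vector `g / d` is the centre
of symmetry, and the value there is `ν` with `d² ν = N` and `2 d ν = μ`. -/
structure IntQuadPoly (r : ℕ) where
  a : Matrix (Fin r) (Fin r) ℤ
  l : Fin r → ℤ
  m : ℤ
  d : ℕ
  d_pos : 0 < d
  g : Fin r → ℤ
  N : ℤ
  μ : ℤ
  smul_l : (d : ℤ) • l = -((a + aᵀ) *ᵥ g)
  sq_mul_m : (d : ℤ) ^ 2 * m = g ⬝ᵥ (a *ᵥ g) + N
  mul_μ : (d : ℤ) * μ = 2 * N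

lemma addChar_sum {A ι : Type*} [AddCommMonoid A] (ψ : AddChar A ℂ) (s : Finset ι) (f : ι → A) :
    ψ (∑ i ∈ s, f i) = ∏ i ∈ s, ψ (f i) := by
  classical
  induction s using Finset.induction_on with
  | empty => simp
  | insert a s h ih => rw [Finset.sum_insert h, Finset.prod_insert h, AddChar.map_add_eq_mul, ih]

namespace IntQuadPoly

open Matrix

variable {r : ℕ} (P : IntQuadPoly r)

/-- The Gram matrix. -/
def gram : Matrix (Fin r) (Fin r) ℤ := P.a + P.aᵀ

/-- The homogeneous part of degree two, over an arbitrary ring. -/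
def quad {R : Type*} [CommRing R] (x : Fin r → R) : R := x ⬝ᵥ (P.a.map (Int.cast : ℤ → R) *ᵥ x)

/-- The values of the polynomial in an arbitrary ring. -/
def eval {R : Type*} [CommRing R] (x : Fin r → R) : R :=
  P.quad x + (fun i => (P.l i : R)) ⬝ᵥ x + P.m

lemma quad_map {R S : Type*} [CommRing R] [CommRing S] (φ : R →+* S) (x : Fin r → R) :
    φ (P.quad x) = P.quad (fun i => φ (x i)) := by
  simp [quad, dotProduct, mulVec, map_sum]

lemma eval_map {R S : Type*} [CommRing R] [CommRing S] (φ : R →+* S) (x : Fin r → R) :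
    φ (P.eval x) = P.eval (fun i => φ (x i)) := by
  rw [eval, eval, ← quad_map]
  simp [dotProduct, map_sum]

lemma eval_intCast {R : Type*} [CommRing R] (x : Fin r → ℤ) :
    ((P.eval x : ℤ) : R) = P.eval (fun i => (x i : R)) := P.eval_map (Int.castRingHom R) x

lemma quad_intCast {R : Type*} [CommRing R] (x : Fin r → ℤ) :
    ((P.quad x : ℤ) : R) = P.quad (fun i => (x i : R)) := P.quad_map (Int.castRingHom R) x

lemma quad_add {R : Type*} [CommRing R] (x h : Fin r → R) :
    P.quad (x + h) = P.quad x + (P.gram.map (Int.cast : ℤ → R) *ᵥ x) ⬝ᵥ h + P.quad h := by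
  have h1 : P.gram.map (Int.cast : ℤ → R)
      = P.a.map (Int.cast : ℤ → R) + (P.a.map (Int.cast : ℤ → R))ᵀ := by
    ext i j; simp [gram]
  have h2 : ((P.a.map (Int.cast : ℤ → R))ᵀ *ᵥ x) ⬝ᵥ h = x ⬝ᵥ (P.a.map (Int.cast : ℤ → R) *ᵥ h) := by
    rw [mulVec_transpose, dotProduct_mulVec]
  rw [h1, quad, quad, quad, mulVec_add, add_dotProduct, dotProduct_add, dotProduct_add, add_mulVec,
    add_dotProduct, h2, dotProduct_comm h (_ *ᵥ x)]
  ring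

lemma quad_smul {R : Type*} [CommRing R] (t : R) (x : Fin r → R) :
    P.quad (t • x) = t ^ 2 * P.quad x := by
  rw [quad, quad, mulVec_smul, smul_dotProduct, dotProduct_smul, smul_eq_mul, smul_eq_mul]; ring

lemma eval_add {R : Type*} [CommRing R] (x h : Fin r → R) :
    P.eval (x + h) = P.eval x +
      (P.gram.map (Int.cast : ℤ → R) *ᵥ x + fun i => (P.l i : R)) ⬝ᵥ h + P.quad h := by
  rw [eval, eval, quad_add, dotProduct_add, add_dotProduct]; ring

lemma two_quad {R : Type*} [CommRing R] (x : Fin r → R) :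
    2 * P.quad x = (P.gram.map (Int.cast : ℤ → R) *ᵥ x) ⬝ᵥ x := by
  have h1 := P.quad_add x x
  rw [show x + x = (2 : R) • x by rw [two_smul], quad_smul] at h1
  linear_combination h1

lemma map_int_id (M : Matrix (Fin r) (Fin r) ℤ) : M.map (Int.cast : ℤ → ℤ) = M := by
  ext i j; simp

/-- Completing the square. -/
lemma sq_mul_eval (x : Fin r → ℤ) :
    P.quad ((P.d : ℤ) • x - P.g) = (P.d : ℤ) ^ 2 * P.eval x - P.N := by
  have h1 := P.quad_add ((P.d : ℤ) • x) (-P.g)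
  rw [← sub_eq_add_neg] at h1
  have h2 : P.quad (-P.g) = P.quad P.g := by
    have := P.quad_smul (-1 : ℤ) P.g
    rw [neg_one_smul] at this
    rw [this]; ring
  have h3 : P.quad P.g = P.g ⬝ᵥ (P.a *ᵥ P.g) := by rw [quad, map_int_id]
  have h4 : P.gram *ᵥ P.g = -((P.d : ℤ) • P.l) := by rw [P.smul_l, neg_neg, gram]
  have h5 : (P.gram *ᵥ x) ⬝ᵥ P.g = x ⬝ᵥ (P.gram *ᵥ P.g) := by
    have : P.gramᵀ = P.gram := by rw [gram, transpose_add, transpose_transpose, add_comm]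
    rw [dotProduct_mulVec, ← mulVec_transpose, this]
  rw [h1, h2, h3, quad_smul, map_int_id, mulVec_smul, smul_dotProduct, dotProduct_neg, h5, h4,
    dotProduct_neg, dotProduct_smul, eval]
  simp only [smul_eq_mul, Int.cast_id]
  rw [dotProduct_comm x]
  linear_combination P.sq_mul_m * (-1)

/-- The derivative of the polynomial in the direction of `x - g / d`, times `d`. It is a multiple of
the value up to the constant `μ`, which the Hensel argument at high prime powers exploits. -/
lemma gradient_dotProduct (x : Fin r → ℤ) :
    (P.gram *ᵥ x + P.l) ⬝ᵥ ((P.d : ℤ) • x - P.g) = 2 * P.d * P.eval x - P.μ := by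
  have hd : (P.d : ℤ) ≠ 0 := by exact_mod_cast P.d_pos.ne'
  refine mul_left_cancel₀ hd ?_
  have h1 : (P.d : ℤ) • (P.gram *ᵥ x + P.l) = P.gram *ᵥ ((P.d : ℤ) • x - P.g) := by
    rw [smul_add, P.smul_l, mulVec_sub, mulVec_smul, gram, sub_eq_add_neg]
  have h2 := P.two_quad ((P.d : ℤ) • x - P.g)
  rw [map_int_id, ← h1, smul_dotProduct, smul_eq_mul, sq_mul_eval] at h2
  rw [← h2]
  linear_combination P.mul_μ

/-- The dilation by `1 + td` around the centre of symmetry. -/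
lemma eval_dilate {R : Type*} [CommRing R] (hR : Function.Surjective (Int.cast : ℤ → R))
    (t : R) (x : Fin r → R) :
    P.eval ((1 + t * P.d) • x - t • fun i => (P.g i : R))
      = P.eval x + t * (2 * P.d * P.eval x - P.μ) + t ^ 2 * ((P.d : R) ^ 2 * P.eval x - P.N) := by
  obtain ⟨t, rfl⟩ := hR t
  choose z hz using fun i => hR (x i)
  obtain rfl : (fun i => ((z i : ℤ) : R)) = x := funext hz
  have key : P.eval (z + t • ((P.d : ℤ) • z - P.g)) = P.eval z +
      t * (2 * P.d * P.eval z - P.μ) + t ^ 2 * ((P.d : ℤ) ^ 2 * P.eval z - P.N) := by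
    rw [eval_add, quad_smul, sq_mul_eval, dotProduct_smul, map_int_id]
    simp only [Int.cast_id]
    rw [gradient_dotProduct, smul_eq_mul]
  have := congrArg (Int.cast : ℤ → R) key
  push_cast at this
  rw [eval_intCast, eval_intCast] at this
  rw [← this]
  congr 1
  funext i
  simp
  ring

section Sums

variable {c : ℕ} [NeZero c]

/-- The exponential sum `∑ e(δ P(x) / c)` over `x` modulo `c`. -/
def gaussSum (δ : ZMod c) : ℂ := ∑ x : Fin r → ZMod c, ZMod.stdAddChar (δ * P.eval x)

open Classical in
/-- The sum of `P.gaussSum δ` over all units `δ` modulo `c`. -/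
def unitSum (c : ℕ) [NeZero c] : ℂ := ∑ δ : ZMod c, if IsUnit δ then P.gaussSum δ else 0

/-- The number of zeros modulo `c`. -/
def count (c : ℕ) : ℕ := Nat.card {x : Fin r → ZMod c // P.eval x = 0}

/-- Weyl's bound `|G(δ)| ≤ √(c |det|)^r`, by squaring the sum and counting the kernel of the Gram
matrix modulo `c`. -/
lemma norm_gaussSum_sq_le (hdet : P.gram.det ≠ 0) {δ : ZMod c} (hδ : IsUnit δ) :
    ‖P.gaussSum δ‖ ^ 2 ≤ (c : ℝ) ^ r * (P.gram.det.natAbs : ℝ) ^ r := by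
  set ψ : AddChar (ZMod c) ℂ := ZMod.stdAddChar
  have hconj : ∀ z : ZMod c, (starRingEnd ℂ) (ψ z) = ψ (-z) := fun z => by
    rw [AddChar.map_neg_eq_conj]
  set S := {h : Fin r → ZMod c | P.gram.map (Int.cast : ℤ → ZMod c) *ᵥ h = 0} with hS
  -- with the difference `h` of the two variables, the inner sum is over additive characters
  have h1 : (‖P.gaussSum δ‖ ^ 2 : ℂ) = ∑ h : Fin r → ZMod c, ψ (δ * (P.eval h - P.m)) *
      ∑ y : Fin r → ZMod c, ψ (δ * ((P.gram.map (Int.cast : ℤ → ZMod c) *ᵥ h) ⬝ᵥ y)) := by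
    rw [← Complex.mul_conj', gaussSum, map_sum, Finset.sum_mul_sum, Finset.sum_comm]
    simp only [Finset.mul_sum]
    conv_rhs => rw [Finset.sum_comm]
    refine Finset.sum_congr rfl fun y _ => ?_
    rw [← Equiv.sum_comp (Equiv.addRight y)]
    refine Finset.sum_congr rfl fun h _ => ?_
    rw [hconj, ← AddChar.map_add_eq_mul, ← AddChar.map_add_eq_mul]
    congr 1
    rw [show (Equiv.addRight y) h = y + h from add_comm h y, eval_add, add_dotProduct]
    have h2 : (P.gram.map (Int.cast : ℤ → ZMod c) *ᵥ y) ⬝ᵥ h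
        = (P.gram.map (Int.cast : ℤ → ZMod c) *ᵥ h) ⬝ᵥ y := by
      have : (P.gram.map (Int.cast : ℤ → ZMod c))ᵀ = P.gram.map (Int.cast : ℤ → ZMod c) := by
        rw [← transpose_map, gram, transpose_add, transpose_transpose, add_comm]
      rw [dotProduct_comm, dotProduct_mulVec, ← mulVec_transpose, this]
    rw [h2, eval, eval]
    ring
  have h3 : ∀ h : Fin r → ZMod c,
      ∑ y : Fin r → ZMod c, ψ (δ * ((P.gram.map (Int.cast : ℤ → ZMod c) *ᵥ h) ⬝ᵥ y))
        = if h ∈ S then (c : ℂ) ^ r else 0 := by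
    intro h
    set w := P.gram.map (Int.cast : ℤ → ZMod c) *ᵥ h with hw
    have h4 : ∑ y : Fin r → ZMod c, ψ (δ * (w ⬝ᵥ y)) = ∏ i, ∑ z : ZMod c, ψ (z * (δ * w i)) := by
      rw [Finset.prod_univ_sum, Fintype.piFinset_univ]
      refine Finset.sum_congr rfl fun y _ => ?_
      rw [dotProduct, Finset.mul_sum, addChar_sum]
      refine Finset.prod_congr rfl fun i _ => by ring_nf
    rw [h4]
    simp only [AddChar.sum_mulShift _ (ZMod.isPrimitive_stdAddChar c), ψ, ZMod.card]
    split_ifs with hh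
    · have h5 : w = 0 := hh
      simp [h5]
    · have : ∃ i, w i ≠ 0 := by
        by_contra hcon
        push Not at hcon
        exact hh (funext hcon)
      obtain ⟨i, hi⟩ := this
      refine Finset.prod_eq_zero (Finset.mem_univ i) ?_
      rw [if_neg, Nat.cast_zero]
      rwa [hδ.mul_right_eq_zero]
  -- multiplication by the adjugate shows that the kernel of the Gram matrix is killed by `det`
  have hcard : (Nat.card S : ℝ) ≤ (P.gram.det.natAbs : ℝ) ^ r := by
    have hsub : S ⊆ Set.pi Set.univ (fun _ : Fin r => {z : ZMod c | (P.gram.det : ZMod c) * z = 0}) := by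
      intro h hh i _
      have h5 := congrArg (fun v => ((P.gram.map (Int.cast : ℤ → ZMod c)).adjugate *ᵥ v) i) hh
      simp only [mulVec_mulVec, adjugate_mul, smul_mulVec, one_mulVec, mulVec_zero] at h5
      have h6 : (P.gram.map (Int.cast : ℤ → ZMod c)).det = (P.gram.det : ZMod c) :=
        ((Int.castRingHom (ZMod c)).map_det P.gram).symm
      rw [h6] at h5
      simpa using h5
    have hz : Nat.card {z : ZMod c | (P.gram.det : ZMod c) * z = 0} ≤ P.gram.det.natAbs := by
      have hpos : 0 < P.gram.det.natAbs := Int.natAbs_pos.mpr hdet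
      have : NeZero P.gram.det.natAbs := ⟨hpos.ne'⟩
      have hdvd : ∀ z : {z : ZMod c | (P.gram.det : ZMod c) * z = 0},
          c ∣ P.gram.det.natAbs * z.1.val := by
        rintro ⟨z, hz⟩
        have hz' : (P.gram.det : ZMod c) * z = 0 := hz
        have h7 : ((P.gram.det * (z.val : ℤ) : ℤ) : ZMod c) = 0 := by
          rw [Int.cast_mul, Int.cast_natCast, ZMod.natCast_zmod_val]; exact hz'
        have h8 := (ZMod.intCast_zmod_eq_zero_iff_dvd _ c).mp h7
        have h9 := Int.natAbs_dvd_natAbs.mpr h8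
        rwa [Int.natAbs_mul, Int.natAbs_natCast, Int.natAbs_natCast] at h9
      have hlt : ∀ z : {z : ZMod c | (P.gram.det : ZMod c) * z = 0},
          P.gram.det.natAbs * z.1.val / c < P.gram.det.natAbs := by
        intro z
        rw [Nat.div_lt_iff_lt_mul (NeZero.pos c)]
        exact (Nat.mul_lt_mul_left hpos).mpr (ZMod.val_lt _)
      have hinj : Function.Injective
          (fun z : {z : ZMod c | (P.gram.det : ZMod c) * z = 0} =>
            (⟨P.gram.det.natAbs * z.1.val / c, hlt z⟩ : Fin P.gram.det.natAbs)) := by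
        intro z z' hzz
        have h10 := congrArg Fin.val hzz
        simp only at h10
        have h11 : P.gram.det.natAbs * z.1.val = P.gram.det.natAbs * z'.1.val := by
          rw [← Nat.div_mul_cancel (hdvd z), ← Nat.div_mul_cancel (hdvd z'), h10]
        exact Subtype.ext (ZMod.val_injective c (Nat.eq_of_mul_eq_mul_left hpos h11))
      simpa using Nat.card_le_card_of_injective _ hinj
    have h12 := Set.ncard_le_ncard hsub (Set.toFinite _)
    have h13 : (Set.pi Set.univ (fun _ : Fin r => {z : ZMod c | (P.gram.det : ZMod c) * z = 0})).ncard
        = (Nat.card {z : ZMod c | (P.gram.det : ZMod c) * z = 0}) ^ r := by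
      rw [← Nat.card_coe_set_eq, Nat.card_congr (Equiv.Set.univPi _), Nat.card_pi]
      simp
    rw [h13] at h12
    exact_mod_cast h12.trans (Nat.pow_le_pow_left hz r)
  classical
  have h4 : (‖P.gaussSum δ‖ ^ 2 : ℂ)
      = ∑ h : Fin r → ZMod c, if h ∈ S then ψ (δ * (P.eval h - P.m)) * (c : ℂ) ^ r else 0 := by
    rw [h1]
    refine Finset.sum_congr rfl fun h _ => ?_
    rw [h3]
    split_ifs <;> simp
  have h5 : ‖P.gaussSum δ‖ ^ 2 = ‖(‖P.gaussSum δ‖ ^ 2 : ℂ)‖ := by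
    rw [norm_pow, Complex.norm_real, norm_norm]
  rw [h5, h4]
  refine (norm_sum_le _ _).trans ?_
  have h6 : ∀ h : Fin r → ZMod c,
      ‖if h ∈ S then ψ (δ * (P.eval h - P.m)) * (c : ℂ) ^ r else 0‖ = if h ∈ S then (c : ℝ) ^ r else 0 := by
    intro h
    split_ifs
    · rw [norm_mul, AddChar.norm_apply, one_mul, norm_pow, Complex.norm_natCast]
    · exact norm_zero
  simp only [h6]
  rw [← Finset.sum_filter, Finset.sum_const, nsmul_eq_mul, mul_comm]
  refine mul_le_mul_of_nonneg_left ?_ (by positivity)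
  rw [Nat.card_eq_fintype_card, Fintype.card_subtype] at hcard
  exact hcard

lemma unitSum_mul_unit (u : (ZMod c)ˣ) :
    ∑ δ : ZMod c, (open Classical in if IsUnit δ then P.gaussSum ((u : ZMod c) * δ) else 0) = P.unitSum c := by
  classical
  rw [unitSum, ← Equiv.sum_comp (Units.mulLeft u) (fun δ => if IsUnit δ then P.gaussSum δ else 0)]
  refine Finset.sum_congr rfl fun δ _ => ?_
  rw [Units.mulLeft_apply]
  have : IsUnit ((u : ZMod c) * δ) ↔ IsUnit δ := by simp
  simp only [this]

/-- Multiplicativity in the modulus. -/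
lemma unitSum_mul {m n : ℕ} [NeZero m] [NeZero n] (h : m.Coprime n) :
    P.unitSum (m * n) = P.unitSum m * P.unitSum n := by
  classical
  have hm0 : (m : ℂ) ≠ 0 := Nat.cast_ne_zero.mpr (NeZero.ne m)
  have hn0 : (n : ℂ) ≠ 0 := Nat.cast_ne_zero.mpr (NeZero.ne n)
  set φ := ZMod.chineseRemainder h
  have hb : (1 : ℤ) = m * Nat.gcdA m n + n * Nat.gcdB m n := by
    rw [← Nat.gcd_eq_gcd_ab, h]; rfl
  -- `1/(mn) = u/m + v/n` modulo `1`, with Bézout coefficients `u`, `v` that are units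
  have hu : IsUnit ((Nat.gcdB m n : ℤ) : ZMod m) := by
    refine IsUnit.of_mul_eq_one ((n : ℤ) : ZMod m) ?_
    have := congrArg (Int.cast : ℤ → ZMod m) hb
    push_cast at this ⊢
    rw [ZMod.natCast_self, zero_mul, zero_add] at this
    rw [this]; ring
  have hv : IsUnit ((Nat.gcdA m n : ℤ) : ZMod n) := by
    refine IsUnit.of_mul_eq_one ((m : ℤ) : ZMod n) ?_
    have := congrArg (Int.cast : ℤ → ZMod n) hb
    push_cast at this ⊢
    rw [ZMod.natCast_self, zero_mul, add_zero] at this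
    rw [this]; ring
  obtain ⟨u, hu⟩ := hu
  obtain ⟨v, hv⟩ := hv
  have hψ : ∀ z : ZMod (m * n), (ZMod.stdAddChar z : ℂ)
      = ZMod.stdAddChar ((u : ZMod m) * (φ z).1) * ZMod.stdAddChar ((v : ZMod n) * (φ z).2) := by
    intro z
    obtain ⟨z, rfl⟩ := ZMod.intCast_surjective z
    rw [map_intCast φ z, Prod.fst_intCast, Prod.snd_intCast, hu, hv, ← Int.cast_mul, ← Int.cast_mul,
      stdAddChar_eq_e, stdAddChar_eq_e, stdAddChar_eq_e, ← e_add]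
    congr 1
    push_cast
    have := congrArg (Int.cast : ℤ → ℂ) hb
    push_cast at this
    field_simp
    linear_combination (z : ℂ) * this
  have hG : ∀ δ : ZMod (m * n), P.gaussSum δ
      = P.gaussSum ((u : ZMod m) * (φ δ).1) * P.gaussSum ((v : ZMod n) * (φ δ).2) := by
    intro δ
    rw [gaussSum, gaussSum, gaussSum, Finset.sum_mul_sum, ← Fintype.sum_prod_type']
    refine Fintype.sum_equiv ((Equiv.arrowCongr (Equiv.refl _) φ.toEquiv).trans
      (Equiv.arrowProdEquivProdArrow _ _ _)) _ _ fun x => ?_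
    rw [hψ]
    have h1 : (φ (P.eval x)).1 = P.eval (fun i => (φ (x i)).1) :=
      P.eval_map ((RingHom.fst _ _).comp φ.toRingHom) x
    have h2 : (φ (P.eval x)).2 = P.eval (fun i => (φ (x i)).2) :=
      P.eval_map ((RingHom.snd _ _).comp φ.toRingHom) x
    rw [map_mul φ, Prod.fst_mul, Prod.snd_mul, h1, h2, ← mul_assoc, ← mul_assoc]
    rfl
  -- the factors `u`, `v` disappear because one sums over all units
  rw [← P.unitSum_mul_unit u, ← P.unitSum_mul_unit v, Finset.sum_mul_sum, ← Fintype.sum_prod_type',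
    unitSum]
  refine Fintype.sum_equiv φ.toEquiv _ _ fun δ => ?_
  have hiso : IsUnit δ ↔ IsUnit (φ δ).1 ∧ IsUnit (φ δ).2 := by
    rw [← Prod.isUnit_iff]
    exact (MulEquiv.isUnit_map φ).symm
  rw [hG δ]
  change _ = (if IsUnit (φ δ).1 then _ else 0) * (if IsUnit (φ δ).2 then _ else 0)
  by_cases h1 : IsUnit (φ δ).1 <;> by_cases h2 : IsUnit (φ δ).2 <;> simp [hiso, h1, h2]

lemma unitSum_one : P.unitSum 1 = 1 := by
  classical
  rw [unitSum]
  have : (Finset.univ : Finset (ZMod 1)) = {0} := rfl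
  rw [this, Finset.sum_singleton, if_pos (isUnit_of_subsingleton _), gaussSum]
  simp

end Sums

end IntQuadPoly

namespace IntQuadPoly

open Matrix

variable {r : ℕ} (P : IntQuadPoly r)

lemma sum_gaussSum (c : ℕ) [NeZero c] : ∑ δ : ZMod c, P.gaussSum δ = c * P.count c := by
  classical
  simp only [gaussSum]
  rw [Finset.sum_comm]
  simp only [AddChar.sum_mulShift _ (ZMod.isPrimitive_stdAddChar c), ZMod.card]
  rw [count, Nat.card_eq_fintype_card, Fintype.card_subtype]
  push_cast
  rw [← Finset.sum_filter, Finset.sum_const, nsmul_eq_mul, mul_comm]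

/-- The exponential sums at a prime power in terms of the numbers of zeros. -/
lemma unitSum_prime_pow {p : ℕ} (hp : p.Prime) (k : ℕ) [NeZero (p ^ (k + 1))] [NeZero (p ^ k)] :
    P.unitSum (p ^ (k + 1)) = (p : ℂ) ^ (k + 1) * P.count (p ^ (k + 1)) -
      (p : ℂ) ^ (r + k) * P.count (p ^ k) := by
  classical
  have hp0 : (p : ℂ) ≠ 0 := Nat.cast_ne_zero.mpr hp.ne_zero
  have h1 : P.unitSum (p ^ (k + 1)) = ∑ δ : ZMod (p ^ (k + 1)), P.gaussSum δ -
      ∑ δ : ZMod (p ^ (k + 1)), if IsUnit δ then 0 else P.gaussSum δ := by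
    rw [unitSum, ← Finset.sum_sub_distrib]
    refine Finset.sum_congr rfl fun δ _ => ?_
    split_ifs <;> ring
  -- the non-units are `p δ'` with `δ'` modulo `p^k`
  have h2 : (∑ δ : ZMod (p ^ (k + 1)), if IsUnit δ then 0 else P.gaussSum δ)
      = ∑ δ' : ZMod (p ^ k), (p : ℂ) ^ r * P.gaussSum δ' := by
    have hfil : (∑ δ : ZMod (p ^ (k + 1)), if IsUnit δ then 0 else P.gaussSum δ)
        = ∑ δ : ZMod (p ^ (k + 1)) with ¬ IsUnit δ, P.gaussSum δ := by
      rw [Finset.sum_filter]; simp only [ite_not]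
    rw [hfil]
    have hlt : ∀ δ' : ZMod (p ^ k), p * δ'.val < p ^ (k + 1) := by
      intro δ'
      rw [pow_succ, mul_comm (p ^ k)]
      exact (Nat.mul_lt_mul_left hp.pos).mpr (ZMod.val_lt δ')
    have hunit : ∀ δ : ZMod (p ^ (k + 1)), IsUnit δ ↔ ¬ p ∣ δ.val := by
      intro δ
      conv_lhs => rw [← ZMod.natCast_zmod_val δ]
      exact ZMod.isUnit_natCast_iff_not_dvd_pow hp (Nat.succ_pos k)
    symm
    refine Finset.sum_bij' (fun δ' _ => ((p * δ'.val : ℕ) : ZMod (p ^ (k + 1))))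
      (fun δ _ => ((δ.val / p : ℕ) : ZMod (p ^ k))) ?_ ?_ ?_ ?_ ?_
    · intro δ' _
      rw [Finset.mem_filter]
      refine ⟨Finset.mem_univ _, ?_⟩
      rw [hunit, not_not, ZMod.val_cast_of_lt (hlt δ')]
      exact Dvd.intro _ rfl
    · intro δ _; exact Finset.mem_univ _
    · intro δ' _
      rw [ZMod.val_cast_of_lt (hlt δ'), Nat.mul_div_cancel_left _ hp.pos, ZMod.natCast_zmod_val]
    · intro δ hδ
      have h3 := (Finset.mem_filter.mp hδ).2
      rw [hunit, not_not] at h3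
      rw [ZMod.val_cast_of_lt, Nat.mul_div_cancel' h3, ZMod.natCast_zmod_val]
      rw [Nat.div_lt_iff_lt_mul hp.pos, ← pow_succ]
      exact ZMod.val_lt δ
    · intro δ' _
      have hdvd : p ^ k ∣ p ^ (k + 1) := pow_dvd_pow p (Nat.le_succ k)
      let φ : (Fin r → ZMod (p ^ (k + 1))) →+ (Fin r → ZMod (p ^ k)) :=
        { toFun := fun x i => ZMod.castHom hdvd (ZMod (p ^ k)) (x i)
          map_zero' := by ext i; simp
          map_add' := fun x y => by
            ext i; exact map_add (ZMod.castHom hdvd (ZMod (p ^ k))) (x i) (y i) }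
      have hφ : Function.Surjective φ := by
        intro y
        choose x hx using fun i => ZMod.castHom_surjective hdvd (y i)
        exact ⟨x, funext hx⟩
      have h4 := card_mul_sum_comp φ hφ (fun x => ZMod.stdAddChar (δ' * P.eval x))
      have h5 : ∀ x, (ZMod.stdAddChar (δ' * P.eval (φ x)) : ℂ)
          = ZMod.stdAddChar (((p * δ'.val : ℕ) : ZMod (p ^ (k + 1))) * P.eval x) := by
        intro x
        have h6 : P.eval (φ x) = ZMod.castHom hdvd (ZMod (p ^ k)) (P.eval x) :=
          (P.eval_map (ZMod.castHom hdvd (ZMod (p ^ k))) x).symm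
        rw [h6]
        obtain ⟨z, hz⟩ := ZMod.intCast_surjective (P.eval x)
        rw [← hz, map_intCast]
        have e1 : δ' * (z : ZMod (p ^ k)) = ((δ'.val * z : ℤ) : ZMod (p ^ k)) := by
          rw [Int.cast_mul, Int.cast_natCast, ZMod.natCast_zmod_val]
        have e2 : ((p * δ'.val : ℕ) : ZMod (p ^ (k + 1))) * (z : ZMod (p ^ (k + 1)))
            = ((p * δ'.val * z : ℤ) : ZMod (p ^ (k + 1))) := by push_cast; ring
        rw [e1, e2, stdAddChar_eq_e, stdAddChar_eq_e]
        congr 1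
        push_cast
        field_simp
        ring
      simp only [h5] at h4
      rw [← gaussSum, ← gaussSum] at h4
      simp only [Fintype.card_pi, ZMod.card, Finset.prod_const, Finset.card_univ, Fintype.card_fin,
        Nat.cast_pow] at h4
      have h7 : (((p : ℂ) ^ k) ^ r) ≠ 0 := pow_ne_zero _ (pow_ne_zero _ hp0)
      refine mul_left_cancel₀ h7 ?_
      rw [h4]
      ring
  rw [h1, h2, ← Finset.mul_sum, sum_gaussSum, sum_gaussSum]
  push_cast
  ring

/-- The exponential sums at high prime powers vanish; this is a form of Hensel's lemma. -/
lemma unitSum_prime_pow_eq_zero {p : ℕ} (hp : p.Prime) {v k : ℕ} {u : ℤ} (hμ : P.μ = p ^ v * u)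
    (hu : ¬ (p : ℤ) ∣ u) (hk : 2 * v + 2 ≤ k) [NeZero (p ^ k)] : P.unitSum (p ^ k) = 0 := by
  classical
  set c := p ^ k with hc
  have hpk : (p : ZMod c) ^ k = 0 := by
    rw [← Nat.cast_pow, ← hc, ZMod.natCast_self]
  have hpow : ∀ j, k ≤ j → (p : ZMod c) ^ j = 0 := fun j hj => by
    rw [← Nat.sub_add_cancel hj, pow_add, hpk, mul_zero]
  -- the dilation with `t = p^(k-1-v) j`, where `t² = 0`, multiplies the value of `P` by the unit
  -- `1 + 2td` and shifts it by `p^(k-1) u j`; the unit is absorbed by the sum over `δ`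
  have key : ∀ j : ℕ, P.unitSum c = ∑ δ : ZMod c, if IsUnit δ then
      P.gaussSum δ * ZMod.stdAddChar (-(δ * ((p : ZMod c) ^ (k - 1) * (u : ZMod c)))) ^ j else 0 := by
    intro j
    set t : ZMod c := p ^ (k - 1 - v) * j with ht
    have ht2 : t ^ 2 = 0 := by
      rw [ht, mul_pow, ← pow_mul, hpow _ (by omega), zero_mul]
    have htμ : t * (P.μ : ZMod c) = (p : ZMod c) ^ (k - 1) * (u : ZMod c) * j := by
      rw [ht, hμ]; push_cast
      have : (p : ZMod c) ^ (k - 1) = (p : ZMod c) ^ (k - 1 - v) * (p : ZMod c) ^ v := by rw [← pow_add]; congr 1; omega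
      rw [this]; ring
    have hinv : (1 + t * P.d) * (1 - t * P.d) = 1 := by linear_combination (-(P.d : ZMod c) ^ 2) * ht2
    have hinv2 : (1 + 2 * t * P.d) * (1 - 2 * t * P.d) = 1 := by
      linear_combination (-4 * (P.d : ZMod c) ^ 2) * ht2
    let α : (ZMod c)ˣ := ⟨1 + t * P.d, 1 - t * P.d, hinv, by rw [mul_comm]; exact hinv⟩
    let β : (ZMod c)ˣ := ⟨1 + 2 * t * P.d, 1 - 2 * t * P.d, hinv2, by rw [mul_comm]; exact hinv2⟩
    have h1 : ∀ δ : ZMod c, P.gaussSum δ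
        = P.gaussSum ((β : ZMod c) * δ) * ZMod.stdAddChar (-(δ * ((p : ZMod c) ^ (k - 1) * (u : ZMod c)))) ^ j := by
      intro δ
      rw [gaussSum, gaussSum, Finset.sum_mul]
      let σ : (Fin r → ZMod c) ≃ (Fin r → ZMod c) :=
        (MulAction.toPerm α).trans (Equiv.subRight (t • fun i => (P.g i : ZMod c)))
      rw [← Equiv.sum_comp σ]
      refine Finset.sum_congr rfl fun x _ => ?_
      have h2 : σ x = (1 + t * P.d) • x - t • fun i => (P.g i : ZMod c) := rfl
      have h3 : P.eval (σ x) = (1 + 2 * t * P.d) * P.eval x - (p : ZMod c) ^ (k - 1) * (u : ZMod c) * j := by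
        rw [h2, P.eval_dilate ZMod.intCast_surjective, ht2, ← htμ]; ring
      rw [h3, ← AddChar.map_nsmul_eq_pow, ← AddChar.map_add_eq_mul]
      congr 1
      rw [nsmul_eq_mul]
      change _ = (1 + 2 * t * P.d) * δ * P.eval x + _
      ring
    rw [unitSum]
    rw [← Equiv.sum_comp (Units.mulLeft β)
      (fun δ => if IsUnit δ then P.gaussSum δ * ZMod.stdAddChar (-(δ * ((p : ZMod c) ^ (k - 1) * (u : ZMod c)))) ^ j else 0)]
    refine Finset.sum_congr rfl fun δ _ => ?_
    rw [Units.mulLeft_apply]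
    have h4 : IsUnit ((β : ZMod c) * δ) ↔ IsUnit δ := by simp
    simp only [h4]
    rw [h1 δ, ← AddChar.map_nsmul_eq_pow, ← AddChar.map_nsmul_eq_pow]
    congr 3
    rw [nsmul_eq_mul, nsmul_eq_mul]
    change _ = (j : ZMod c) * -((1 + 2 * t * P.d) * δ * _)
    linear_combination -2 * P.d * δ * t * htμ + 2 * P.d * δ * P.μ * ht2
  -- the average over `j` modulo `p` is a sum over a nontrivial character
  have hsum : (p : ℂ) * P.unitSum c = 0 := by
    have h1 : ∑ j ∈ Finset.range p, P.unitSum c = (p : ℂ) * P.unitSum c := by simp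
    rw [← h1, Finset.sum_congr rfl fun j _ => key j, Finset.sum_comm]
    refine Finset.sum_eq_zero fun δ _ => ?_
    split_ifs with hδ
    · rw [← Finset.mul_sum]
      have hp1 : (p : ZMod c) ^ (k - 1) * p = 0 := by rw [← pow_succ]; exact hpow _ (by omega)
      have h2 : ZMod.stdAddChar (-(δ * ((p : ZMod c) ^ (k - 1) * (u : ZMod c)))) ≠ (1 : ℂ) := by
        intro h
        rw [← AddChar.map_zero_eq_one (ZMod.stdAddChar : AddChar (ZMod c) ℂ)] at h
        have h3 := ZMod.injective_stdAddChar h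
        rw [neg_eq_zero, hδ.mul_right_eq_zero] at h3
        have h4 : (((p : ℤ) ^ (k - 1) * u : ℤ) : ZMod c) = 0 := by push_cast; exact h3
        rw [ZMod.intCast_zmod_eq_zero_iff_dvd, hc] at h4
        refine hu ?_
        have hk1 : (p : ℤ) ^ k = (p : ℤ) ^ (k - 1) * p := by rw [← pow_succ]; congr 1; omega
        push_cast at h4
        rw [hk1] at h4
        exact (mul_dvd_mul_iff_left (pow_ne_zero _ (by exact_mod_cast hp.ne_zero))).mp h4
      have h5 : ZMod.stdAddChar (-(δ * ((p : ZMod c) ^ (k - 1) * (u : ZMod c)))) ^ p = (1 : ℂ) := by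
        rw [← AddChar.map_nsmul_eq_pow, nsmul_eq_mul,
          show (p : ZMod c) * -(δ * ((p : ZMod c) ^ (k - 1) * (u : ZMod c)))
            = -(δ * (u : ZMod c)) * ((p : ZMod c) ^ (k - 1) * p) by ring, hp1,
          mul_zero, AddChar.map_zero_eq_one]
      rw [geom_sum_eq h2, h5, sub_self, zero_div, mul_zero]
    · simp
  exact (mul_eq_zero.mp hsum).resolve_left (Nat.cast_ne_zero.mpr hp.ne_zero)

section Prime

variable {p : ℕ} [hp : Fact p.Prime]

/-- The quadratic Gauss sum over a prime field, as a sum over the quadratic character. -/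
lemma sum_addChar_mul_sq (hp2 : p ≠ 2) {a : ZMod p} (ha : a ≠ 0) :
    ∑ y : ZMod p, (ZMod.stdAddChar (a * y ^ 2) : ℂ) = (quadraticChar (ZMod p) a : ℂ) *
      ∑ z : ZMod p, (quadraticChar (ZMod p) z : ℂ) * ZMod.stdAddChar z := by
  have hring : ringChar (ZMod p) ≠ 2 := by rwa [ZMod.ringChar_zmod_n]
  have h1 : ∑ y : ZMod p, (ZMod.stdAddChar (a * y ^ 2) : ℂ)
      = ∑ z : ZMod p, ((quadraticChar (ZMod p) z : ℂ) + 1) * ZMod.stdAddChar (a * z) := by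
    rw [← Finset.sum_fiberwise (s := Finset.univ) (g := fun x : ZMod p => x ^ 2)]
    refine Finset.sum_congr rfl fun y _ => ?_
    have h3 := quadraticChar_card_sqrts hring y
    have h4 : ∑ x : ZMod p with x ^ 2 = y, (ZMod.stdAddChar (a * x ^ 2) : ℂ)
        = ∑ x : ZMod p with x ^ 2 = y, (ZMod.stdAddChar (a * y) : ℂ) :=
      Finset.sum_congr rfl fun x hx => by rw [(Finset.mem_filter.mp hx).2]
    rw [h4, Finset.sum_const, nsmul_eq_mul]
    congr 1
    have h5 : ((quadraticChar (ZMod p) y + 1 : ℤ) : ℂ)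
        = (((↑{x : ZMod p | x ^ 2 = y}.toFinset.card : ℤ)) : ℂ) := by rw [h3]
    push_cast at h5
    rw [h5]
    congr 2
    ext; simp
  have h2 : ∑ z : ZMod p, (ZMod.stdAddChar (a * z) : ℂ) = 0 := by
    have := AddChar.sum_mulShift a (ZMod.isPrimitive_stdAddChar p)
    rw [if_neg ha] at this
    simpa [mul_comm] using this
  rw [h1]
  simp only [add_mul, one_mul, Finset.sum_add_distrib, h2, add_zero]
  rw [Finset.mul_sum, ← Equiv.sum_comp (Equiv.mulLeft₀ a ha)
    (fun z => (quadraticChar (ZMod p) a : ℂ) * ((quadraticChar (ZMod p) z : ℂ) * ZMod.stdAddChar z))]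
  refine Finset.sum_congr rfl fun z _ => ?_
  rw [Equiv.mulLeft₀_apply, map_mul (quadraticChar (ZMod p))]
  have := quadraticChar_sq_one (F := ZMod p) ha
  have h' : (quadraticChar (ZMod p) a : ℂ) ^ 2 = 1 := by exact_mod_cast this
  push_cast
  linear_combination -(quadraticChar (ZMod p) z : ℂ) * ZMod.stdAddChar (a * z) * h'

lemma sq_sum_quadraticChar (hp2 : p ≠ 2) :
    (∑ z : ZMod p, (quadraticChar (ZMod p) z : ℂ) * ZMod.stdAddChar z) ^ 2
      = quadraticChar (ZMod p) (-1) * p := by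
  have hring : ringChar (ZMod p) ≠ 2 := by rwa [ZMod.ringChar_zmod_n]
  have := gaussSum_sq (χ := (quadraticChar (ZMod p)).ringHomComp (Int.castRingHom ℂ))
    ((MulChar.ringHomComp_ne_one_iff Int.cast_injective).mpr (quadraticChar_ne_one hring))
    ((quadraticChar_isQuadratic (ZMod p)).comp _) (ZMod.isPrimitive_stdAddChar p)
  rw [ZMod.card] at this
  exact this

/-- The quadratic Gauss sum in several variables over a prime field, by diagonalization. -/
lemma sum_addChar_quad (hp2 : p ≠ 2) (hdet : (P.gram.det : ZMod p) ≠ 0) {t : ZMod p} (ht : t ≠ 0) :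
    ∑ z : Fin r → ZMod p, (ZMod.stdAddChar (t * P.quad z) : ℂ)
      = (quadraticChar (ZMod p) (2 * t) : ℂ) ^ r * quadraticChar (ZMod p) (P.gram.det : ZMod p) *
        (∑ z : ZMod p, (quadraticChar (ZMod p) z : ℂ) * ZMod.stdAddChar z) ^ r := by
  have h20 : (2 : ZMod p) ≠ 0 := by
    intro h
    have : ((2 : ℕ) : ZMod p) = 0 := by exact_mod_cast h
    rw [ZMod.natCast_eq_zero_iff] at this
    exact hp2 ((Nat.prime_dvd_prime_iff_eq hp.out Nat.prime_two).mp this)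
  have : Invertible (2 : ZMod p) := invertibleOfNonzero h20
  set A := P.gram.map (Int.cast : ℤ → ZMod p) with hA
  have hAsymm : Aᵀ = A := by
    rw [hA, ← transpose_map, gram, transpose_add, transpose_transpose, add_comm]
  set B := Matrix.toBilin' A with hB
  have hBsymm : LinearMap.IsSymm B := by
    refine ⟨fun x y => ?_⟩
    rw [RingHom.id_apply]
    rw [hB, Matrix.toBilin'_apply', Matrix.toBilin'_apply', dotProduct_mulVec, ← mulVec_transpose, hAsymm,
      dotProduct_comm]
  obtain ⟨w₀, hw₀⟩ := LinearMap.BilinForm.exists_orthogonal_basis hBsymm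
  have hfr : Module.finrank (ZMod p) (Fin r → ZMod p) = r := by simp
  set w := w₀.reindex (finCongr hfr) with hw
  have horth : ∀ i j, i ≠ j → B (w i) (w j) = 0 := by
    intro i j hij
    rw [hw, Module.Basis.reindex_apply, Module.Basis.reindex_apply]
    exact hw₀ (fun h => hij (by simpa using h))
  -- the determinant
  set M : Matrix (Fin r) (Fin r) (ZMod p) := Matrix.of (fun i j => w j i) with hM
  have hMA : Mᵀ * A * M = Matrix.diagonal (fun i => B (w i) (w i)) := by
    ext i j
    have h1 : (Mᵀ * A * M) i j = B (w i) (w j) := by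
      rw [hB, Matrix.toBilin'_apply', Matrix.mul_assoc]
      rfl
    rw [h1, Matrix.diagonal_apply]
    split_ifs with h
    · rw [h]
    · exact horth i j h
  have hMdet : M.det ≠ 0 := by
    have h1 : M = (Pi.basisFun (ZMod p) (Fin r)).toMatrix w := by
      ext i j; simp [hM, Module.Basis.toMatrix_apply]
    have h2 := (Pi.basisFun (ZMod p) (Fin r)).invertibleToMatrix w
    rw [← h1] at h2
    exact (Matrix.isUnit_det_of_invertible M).ne_zero
  have hAdet : A.det = (P.gram.det : ZMod p) := ((Int.castRingHom (ZMod p)).map_det P.gram).symm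
  have hprod : ∏ i, B (w i) (w i) = M.det ^ 2 * (P.gram.det : ZMod p) := by
    rw [← Matrix.det_diagonal, ← hMA, Matrix.det_mul, Matrix.det_mul, Matrix.det_transpose, hAdet]; ring
  have hne : ∀ i, B (w i) (w i) ≠ 0 := by
    have : ∏ i, B (w i) (w i) ≠ 0 := by
      rw [hprod]; exact mul_ne_zero (pow_ne_zero _ hMdet) hdet
    intro i
    exact Finset.prod_ne_zero_iff.mp this i (Finset.mem_univ i)
  have hquad : ∀ y : Fin r → ZMod p, t * P.quad (w.equivFun.symm y)
      = ∑ i, (t / 2 * B (w i) (w i)) * y i ^ 2 := by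
    intro y
    have h1 := P.two_quad (w.equivFun.symm y)
    rw [dotProduct_comm, ← Matrix.toBilin'_apply', ← hA, ← hB, Module.Basis.equivFun_symm_apply] at h1
    simp only [map_sum, LinearMap.sum_apply, map_smul, LinearMap.smul_apply, smul_eq_mul] at h1
    have h2 : ∀ i, ∑ j, y i * (y j * B (w j) (w i)) = B (w i) (w i) * y i ^ 2 := by
      intro i
      rw [Finset.sum_eq_single i]
      · ring
      · intro j _ hj; rw [horth j i hj]; ring
      · intro h; exact absurd (Finset.mem_univ i) h
    rw [Module.Basis.equivFun_symm_apply]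
    have h3 : 2 * P.quad (∑ i, y i • w i) = ∑ i, B (w i) (w i) * y i ^ 2 := by
      rw [h1, ← Finset.sum_congr rfl fun i _ => h2 i]
      simp only [Finset.mul_sum]
    have h4 : P.quad (∑ i, y i • w i) = (∑ i, B (w i) (w i) * y i ^ 2) / 2 := by
      rw [← h3]; field_simp
    rw [h4, ← mul_div_assoc, mul_div_right_comm, Finset.mul_sum]
    exact Finset.sum_congr rfl fun i _ => by ring
  have h5 : ∑ z : Fin r → ZMod p, (ZMod.stdAddChar (t * P.quad z) : ℂ)
      = ∏ i : Fin r, ∑ y : ZMod p, (ZMod.stdAddChar ((t / 2 * B (w i) (w i)) * y ^ 2) : ℂ) := by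
    rw [Finset.prod_univ_sum, Fintype.piFinset_univ, ← Equiv.sum_comp w.equivFun.symm.toEquiv]
    refine Finset.sum_congr rfl fun y _ => ?_
    change ZMod.stdAddChar (t * P.quad (w.equivFun.symm y)) = _
    rw [hquad, addChar_sum]
  have ht2 : t / 2 ≠ 0 := div_ne_zero ht h20
  rw [h5, Finset.prod_congr rfl fun i _ => sum_addChar_mul_sq hp2 (mul_ne_zero ht2 (hne i)),
    Finset.prod_mul_distrib, Finset.prod_const, Finset.card_univ, Fintype.card_fin]
  congr 1
  have h6 : quadraticChar (ZMod p) (t / 2) = quadraticChar (ZMod p) (2 * t) := by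
    have : 2 * t = (t / 2) * 2 ^ 2 := by field_simp
    rw [this, map_mul (quadraticChar (ZMod p)), quadraticChar_sq_one' h20, mul_one]
  rw [← Int.cast_prod, ← map_prod, Finset.prod_mul_distrib, hprod, map_mul (quadraticChar (ZMod p)),
    map_mul (quadraticChar (ZMod p)) (M.det ^ 2), quadraticChar_sq_one' hMdet, one_mul,
    Finset.prod_const, Finset.card_univ, Fintype.card_fin, map_pow, h6]
  push_cast
  rfl

/-- The exponential sum at a prime that does not divide `2 d det N`. -/
lemma unitSum_prime (hp2 : p ≠ 2) (hdet : (P.gram.det : ZMod p) ≠ 0) (hd : (P.d : ZMod p) ≠ 0)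
    (hN : (P.N : ZMod p) ≠ 0) :
    P.unitSum p = if Even r then
        -(quadraticChar (ZMod p) ((-1) ^ (r / 2) * (P.gram.det : ZMod p)) : ℂ) * p ^ (r / 2)
      else (quadraticChar (ZMod p) (2 * (-1) ^ ((r + 1) / 2) * (P.N : ZMod p) * (P.gram.det : ZMod p)) : ℂ) *
        p ^ ((r + 1) / 2) := by
  classical
  have h20 : (2 : ZMod p) ≠ 0 := by
    intro h
    have : ((2 : ℕ) : ZMod p) = 0 := by exact_mod_cast h
    rw [ZMod.natCast_eq_zero_iff] at this
    exact hp2 ((Nat.prime_dvd_prime_iff_eq hp.out Nat.prime_two).mp this)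
  set η := quadraticChar (ZMod p)
  set G := ∑ z : ZMod p, (η z : ℂ) * ZMod.stdAddChar z with hG
  have hG2 : G ^ 2 = η (-1) * p := sq_sum_quadraticChar hp2
  -- the unit `d²` in front completes the square: `d² P(x) = q(dx - g) + N`
  have hgauss : ∀ t : ZMod p, t ≠ 0 → P.gaussSum ((P.d : ZMod p) ^ 2 * t)
      = ZMod.stdAddChar (t * (P.N : ZMod p)) * ((η (2 * t) : ℂ) ^ r * η (P.gram.det : ZMod p) * G ^ r) := by
    intro t ht
    rw [← P.sum_addChar_quad hp2 hdet ht, gaussSum, Finset.mul_sum]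
    let σ : (Fin r → ZMod p) ≃ (Fin r → ZMod p) :=
      (MulAction.toPerm (Units.mk0 (P.d : ZMod p) hd)).trans (Equiv.subRight (fun i => (P.g i : ZMod p)))
    rw [← Equiv.sum_comp σ (fun z => ZMod.stdAddChar (t * (P.N : ZMod p)) * (ZMod.stdAddChar (t * P.quad z) : ℂ))]
    refine Finset.sum_congr rfl fun x _ => ?_
    have hσ : σ x = (P.d : ZMod p) • x - fun i => (P.g i : ZMod p) := rfl
    choose z hz using fun i => ZMod.intCast_surjective (x i)
    obtain rfl : (fun i => ((z i : ℤ) : ZMod p)) = x := funext hz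
    have h1 := congrArg (Int.cast : ℤ → ZMod p) (P.sq_mul_eval z)
    rw [quad_intCast] at h1
    push_cast at h1
    rw [eval_intCast] at h1
    have h2 : P.quad (σ fun i => ((z i : ℤ) : ZMod p))
        = (P.d : ZMod p) ^ 2 * P.eval (fun i => ((z i : ℤ) : ZMod p)) - (P.N : ZMod p) := by
      rw [← h1, hσ]
      congr 1
      funext i
      simp
    rw [← AddChar.map_add_eq_mul, h2]
    congr 1
    ring
  have hd2 : IsUnit ((P.d : ZMod p) ^ 2) := (isUnit_iff_ne_zero.mpr hd).pow 2
  obtain ⟨u, hu⟩ := hd2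
  have hsum : P.unitSum p = ∑ t : ZMod p, if t = 0 then 0 else
      ZMod.stdAddChar (t * (P.N : ZMod p)) * ((η (2 * t) : ℂ) ^ r * η (P.gram.det : ZMod p) * G ^ r) := by
    rw [← P.unitSum_mul_unit u]
    refine Finset.sum_congr rfl fun t _ => ?_
    rw [hu]
    by_cases ht : t = 0
    · simp [ht]
    · rw [if_pos (isUnit_iff_ne_zero.mpr ht), if_neg ht, hgauss t ht]
  have hη2 : ∀ a : ZMod p, a ≠ 0 → (η a : ℂ) ^ 2 = 1 := fun a ha => by
    exact_mod_cast quadraticChar_sq_one (F := ZMod p) ha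
  have hψN : ∑ t : ZMod p, (ZMod.stdAddChar (t * (P.N : ZMod p)) : ℂ) = 0 := by
    rw [AddChar.sum_mulShift _ (ZMod.isPrimitive_stdAddChar p), if_neg hN, Nat.cast_zero]
  rw [hsum]
  clear hsum hgauss hdet
  generalize (P.gram.det : ZMod p) = Δ at *
  generalize (P.N : ZMod p) = ν at *
  split_ifs with hr
  · obtain ⟨k, rfl⟩ := hr
    have hk : (k + k) / 2 = k := by omega
    rw [hk]
    have h1 : ∀ t : ZMod p, (if t = 0 then (0 : ℂ) else
        ZMod.stdAddChar (t * ν) * ((η (2 * t) : ℂ) ^ (k + k) * η Δ * G ^ (k + k)))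
        = (η Δ * G ^ (k + k)) *
          (ZMod.stdAddChar (t * ν) - if t = 0 then 1 else 0) := by
      intro t
      split_ifs with ht
      · simp [ht]
      · rw [← two_mul, pow_mul, hη2 _ (mul_ne_zero h20 ht)]; ring
    simp only [h1]
    rw [← Finset.mul_sum, Finset.sum_sub_distrib, hψN, Finset.sum_ite_eq' , if_pos (Finset.mem_univ _),
      ← two_mul, pow_mul, hG2, map_mul, map_pow]
    push_cast
    ring
  · obtain ⟨k, rfl⟩ := Nat.not_even_iff_odd.mp hr
    have hk : (2 * k + 1 + 1) / 2 = k + 1 := by omega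
    rw [hk]
    have h1 : ∀ t : ZMod p, (if t = 0 then (0 : ℂ) else
        ZMod.stdAddChar (t * ν) * ((η (2 * t) : ℂ) ^ (2 * k + 1) * η Δ * G ^ (2 * k + 1)))
        = (η (2 * Δ * ν) * G ^ (2 * k + 1)) *
          (η (ν * t) * ZMod.stdAddChar (ν * t)) := by
      intro t
      split_ifs with ht
      · rw [ht, mul_zero, MulChar.map_zero]; simp
      · rw [pow_succ, pow_mul, hη2 _ (mul_ne_zero h20 ht), mul_comm t]
        simp only [map_mul]
        push_cast
        linear_combination (-(ZMod.stdAddChar (ν * t) : ℂ) * η 2 * η t * η Δ *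
          G ^ (2 * k + 1)) * hη2 _ hN
    simp only [h1]
    have h2 : ∑ t : ZMod p, (η (ν * t) : ℂ) * ZMod.stdAddChar (ν * t) = G :=
      Equiv.sum_comp (Equiv.mulLeft₀ ν hN) (fun t => (η t : ℂ) * ZMod.stdAddChar t)
    rw [← Finset.mul_sum, h2, mul_assoc, ← pow_succ,
      show 2 * k + 1 + 1 = 2 * (k + 1) by ring, pow_mul, hG2]
    simp only [map_mul, map_pow]
    push_cast
    ring

end Prime

end IntQuadPoly

/-! ### The quadratic polynomial of a coset of the lattice -/
section LatticePoly

variable {V : Type*} [AddCommGroup V] [Module ℝ V] {r : ℕ} {Q : QuadraticForm ℝ V}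
  {b : Module.Basis (Fin r) ℝ V} {L : Submodule ℤ V}

lemma mem_lattice_iff (hL : L = Submodule.span ℤ (Set.range b)) {x : V} :
    x ∈ L ↔ ∃ z : Fin r → ℤ, x = ∑ i, (z i : ℝ) • b i := by
  rw [hL, Submodule.mem_span_range_iff_exists_fun]
  constructor
  · rintro ⟨z, rfl⟩
    exact ⟨z, Finset.sum_congr rfl fun i _ => by rw [Int.cast_smul_eq_zsmul]⟩
  · rintro ⟨z, rfl⟩
    exact ⟨z, Finset.sum_congr rfl fun i _ => by rw [Int.cast_smul_eq_zsmul]⟩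

lemma basis_mem (hL : L = Submodule.span ℤ (Set.range b)) (i : Fin r) : b i ∈ L := by
  rw [hL]; exact Submodule.subset_span ⟨i, rfl⟩

lemma sum_smul_injective {z z' : Fin r → ℤ}
    (h : ∑ i, (z i : ℝ) • b i = ∑ i, (z' i : ℝ) • b i) : z = z' := by
  funext i
  have := congrArg (fun x => b.repr x i) h
  simpa [Finsupp.single_apply] using this

lemma level_pos_and_mem (hQ : (QuadraticMap.polarBilin Q).Nondegenerate)
    (hL : L = Submodule.span ℤ (Set.range b)) (heven : ∀ x ∈ L, ∃ m : ℤ, Q x = m)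
    (γ : dualLattice Q L) : 0 < level L (γ : V) ∧ level L (γ : V) • (γ : V) ∈ L := by
  obtain ⟨F⟩ := exists_orthogonalFrame hQ b hL heven
  have hfin := F.finite_discGroup
  have h1 : ({m : ℕ | 0 < m ∧ m • (γ : V) ∈ L}).Nonempty := by
    refine ⟨Nat.card (DiscGroup Q L), Nat.card_pos, ?_⟩
    have h2 : Nat.card (DiscGroup Q L) • (Submodule.Quotient.mk γ : DiscGroup Q L) = 0 :=
      card_nsmul_eq_zero'
    rw [← Submodule.Quotient.mk_smul, Submodule.Quotient.mk_eq_zero] at h2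
    exact h2
  exact Nat.sInf_mem h1

/-- The integral quadratic polynomial `x ↦ Q(∑ xᵢ bᵢ - γ) + n`. -/
theorem exists_intQuadPoly (hQ : (QuadraticMap.polarBilin Q).Nondegenerate)
    (hL : L = Submodule.span ℤ (Set.range b)) (heven : ∀ x ∈ L, ∃ m : ℤ, Q x = m)
    (γ : dualLattice Q L) {n : ℚ} (hnγ : ∃ m : ℤ, (n : ℝ) = m - Q (γ : V)) :
    ∃ P : IntQuadPoly r,
      (∀ x : Fin r → ℤ, ((P.eval x : ℤ) : ℝ) = Q (∑ i, (x i : ℝ) • b i - γ) + n) ∧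
      P.d = level L (γ : V) ∧ (P.N : ℚ) = (level L (γ : V)) ^ 2 * n ∧
      (P.μ : ℚ) = 2 * n * level L (γ : V) ∧ (P.gram.det : ℝ) = gramDet Q b ∧
      ∀ p : ℕ, p.Prime → p ∣ P.d → ∃ i, ¬ (p : ℤ) ∣ P.g i := by
  classical
  obtain ⟨hd, hdγ⟩ := level_pos_and_mem hQ hL heven γ
  set d := level L (γ : V) with hdef
  obtain ⟨g, hg⟩ := (mem_lattice_iff hL).mp hdγ
  obtain ⟨m, hm⟩ := hnγ
  choose q hq using fun i => heven (b i) (basis_mem hL i)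
  have hA : ∀ i j, ∃ z : ℤ, bil Q (b i) (b j) = z := fun i j =>
    bil_int_of_mem heven (basis_mem hL i) (basis_mem hL j)
  choose A hA using hA
  have hl : ∀ i, ∃ z : ℤ, bil Q (γ : V) (b i) = z := fun i =>
    mem_dualLattice_iff.mp γ.2 (b i) (basis_mem hL i)
  choose l hl using hl
  obtain ⟨e₁, he₁⟩ := mem_dualLattice_iff.mp γ.2 _ hdγ
  obtain ⟨e₂, he₂⟩ := heven _ hdγ
  have hdγ' : d • (γ : V) = (d : ℝ) • (γ : V) := (Nat.cast_smul_eq_nsmul ℝ d (γ : V)).symm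
  rw [hdγ', bil_smul_right, bil_self] at he₁
  have he₂' : (d : ℝ) ^ 2 * Q (γ : V) = e₂ := by
    rw [← he₂, hdγ', QuadraticMap.map_smul, smul_eq_mul]; ring
  -- upper triangular with the integers `Q (b i)` on the diagonal, since the Gram matrix is even
  let a : Matrix (Fin r) (Fin r) ℤ := Matrix.of fun i j => if i = j then q i else if i < j then A i j else 0
  have hgram : ∀ i j, (a + a.transpose) i j = A i j := by
    intro i j
    have hsymm : A i j = A j i := by
      have : (A i j : ℝ) = A j i := by rw [← hA, ← hA, bil_comm]
      exact_mod_cast this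
    have hdiag : A i i = 2 * q i := by
      have : (A i i : ℝ) = 2 * q i := by rw [← hA, bil_self, hq]
      exact_mod_cast this
    simp only [Matrix.add_apply, Matrix.transpose_apply, Matrix.of_apply, a]
    rcases lt_trichotomy i j with h | h | h
    · simp [h, h.ne, h.ne', h.not_gt]
    · subst h; simp [hdiag]; ring
    · simp [h, h.ne, h.ne', h.not_gt, hsymm]
  -- the quadratic form in the coordinates
  have hquad : ∀ z : Fin r → ℤ, ((z ⬝ᵥ (a.mulVec z) : ℤ) : ℝ) = Q (∑ i, (z i : ℝ) • b i) := by
    intro z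
    have h1 : bil Q (∑ i, (z i : ℝ) • b i) (∑ i, (z i : ℝ) • b i)
        = (((z ⬝ᵥ ((a + a.transpose).mulVec z) : ℤ)) : ℝ) := by
      rw [bil_sum_left]
      simp only [bil_sum_right, bil_smul_left, bil_smul_right, hA, dotProduct, Matrix.mulVec, hgram]
      push_cast
      refine Finset.sum_congr rfl fun i _ => ?_
      rw [Finset.mul_sum]
      refine Finset.sum_congr rfl fun j _ => by ring
    have h2 : z ⬝ᵥ ((a + a.transpose).mulVec z) = 2 * (z ⬝ᵥ (a.mulVec z)) := by
      rw [Matrix.add_mulVec, dotProduct_add, Matrix.mulVec_transpose, dotProduct_comm z (Matrix.vecMul z a),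
        ← Matrix.dotProduct_mulVec]
      ring
    rw [bil_self, h2] at h1
    push_cast at h1
    linarith
  let P : IntQuadPoly r :=
    { a := a
      l := fun i => -l i
      m := m
      d := d
      d_pos := hd
      g := g
      N := d ^ 2 * m - e₂
      μ := 2 * d * m - e₁
      smul_l := by
        funext i
        have h1 : ((∑ j, A i j * g j : ℤ) : ℝ) = d * l i := by
          have h2 : bil Q (b i) (d • (γ : V)) = d * l i := by
            rw [hdγ', bil_smul_right, bil_comm, hl]
          rw [← h2, hg, bil_sum_right]
          push_cast
          refine Finset.sum_congr rfl fun j _ => ?_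
          rw [bil_smul_right, hA]; ring
        have h2 : (∑ j, A i j * g j : ℤ) = d * l i := by exact_mod_cast h1
        simp only [Pi.smul_apply, Pi.neg_apply, smul_eq_mul, Matrix.mulVec, dotProduct, hgram, h2]
        ring
      sq_mul_m := by
        have h1 := hquad g
        rw [← hg, he₂] at h1
        have h2 : g ⬝ᵥ (a.mulVec g) = e₂ := by exact_mod_cast h1
        rw [h2]; ring
      mul_μ := by
        have h1 : (d : ℝ) * e₁ = 2 * e₂ := by rw [← he₁, ← he₂']; ring
        have h2 : (d : ℤ) * e₁ = 2 * e₂ := by exact_mod_cast h1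
        linear_combination -h2 }
  refine ⟨P, ?_, rfl, ?_, ?_, ?_, ?_⟩
  · intro x
    have h1 : P.eval x = x ⬝ᵥ (a.mulVec x) + (fun i => -l i) ⬝ᵥ x + m := by
      rw [IntQuadPoly.eval, IntQuadPoly.quad, IntQuadPoly.map_int_id]; rfl
    rw [h1]
    push_cast
    rw [hquad, sub_eq_add_neg, map_add_eq, QuadraticMap.map_neg, ← neg_one_smul ℝ (γ : V), bil_smul_right,
      hm, bil_comm, bil_sum_right]
    simp only [bil_smul_right, hl, dotProduct]
    push_cast
    have : ∑ i, -(l i : ℝ) * (x i : ℝ) = -1 * ∑ i, (x i : ℝ) * (l i : ℝ) := by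
      rw [Finset.mul_sum]; exact Finset.sum_congr rfl fun i _ => by ring
    rw [this]; ring
  · have : ((P.N : ℚ) : ℝ) = ((d ^ 2 * n : ℚ) : ℝ) := by
      push_cast
      rw [hm, mul_sub, he₂']
      change (((d ^ 2 * m - e₂ : ℤ)) : ℝ) = _
      push_cast; ring
    exact_mod_cast this
  · have : ((P.μ : ℚ) : ℝ) = ((2 * n * d : ℚ) : ℝ) := by
      push_cast
      rw [hm]
      change (((2 * d * m - e₁ : ℤ)) : ℝ) = _
      push_cast
      rw [← he₁]; ring
    exact_mod_cast this
  · have h1 : P.gram = Matrix.of A := by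
      ext i j
      exact hgram i j
    have h2 := (Int.castRingHom ℝ).map_det (Matrix.of A)
    rw [eq_intCast] at h2
    rw [h1, gramDet, h2]
    congr 1
    ext i j
    simp [hA]
  -- if `p` divides `d` and all coordinates of `dγ`, then `(d/p) γ` is already in the lattice
  · intro p hp hpd
    by_contra hcon
    push Not at hcon
    choose g' hg' using hcon
    obtain ⟨d', hd'⟩ := hpd
    have hd'' : d = p * d' := hd'
    have hmem : d' • (γ : V) ∈ L := by
      rw [mem_lattice_iff hL]
      refine ⟨g', ?_⟩
      have h1 : (p : ℝ) • (d' • (γ : V)) = (p : ℝ) • ∑ i, (g' i : ℝ) • b i := by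
        rw [Nat.cast_smul_eq_nsmul, smul_smul, ← hd'', hg, Finset.smul_sum]
        refine Finset.sum_congr rfl fun i _ => ?_
        have : g i = p * g' i := hg' i
        rw [this, smul_smul]; push_cast; rfl
      exact smul_right_injective V (Nat.cast_ne_zero.mpr hp.ne_zero : (p : ℝ) ≠ 0) h1
    have hd0 : 0 < d' := by
      rcases Nat.eq_zero_or_pos d' with h | h
      · rw [h, mul_zero] at hd''; omega
      · exact h
    have hle : d ≤ d' := Nat.sInf_le ⟨hd0, hmem⟩
    have := hp.two_le
    nlinarith

lemma ncard_image_eq_of_iff {α β δ : Type*} {f : α → β} {g : α → δ} (h : ∀ x y, f x = f y ↔ g x = g y)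
    (s : Set α) : (f '' s).ncard = (g '' s).ncard := by
  classical
  rcases isEmpty_or_nonempty α with hα | hα
  · simp [Set.eq_empty_of_isEmpty s]
  have h1 : g '' s = (fun y => g (Function.invFun f y)) '' (f '' s) := by
    rw [← Set.image_comp]
    refine Set.image_congr fun x _ => ?_
    exact ((h _ _).mp (Function.invFun_eq ⟨x, rfl⟩)).symm
  rw [h1]
  symm
  apply Set.InjOn.ncard_image
  rintro _ ⟨x, _, rfl⟩ _ ⟨y, _, rfl⟩ hxy
  have hx : f (Function.invFun f (f x)) = f x := Function.invFun_eq ⟨x, rfl⟩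
  have hy : f (Function.invFun f (f y)) = f y := Function.invFun_eq ⟨y, rfl⟩
  rw [← hx, ← hy]
  exact (h _ _).mpr hxy

/-- The classes in `L/cL` counted by `repCount` are the zeros modulo `c` of the polynomial. -/
lemma repCount_eq_count (hL : L = Submodule.span ℤ (Set.range b)) {γ : V} {n : ℚ}
    {P : IntQuadPoly r} (hP : ∀ x : Fin r → ℤ, ((P.eval x : ℤ) : ℝ) = Q (∑ i, (x i : ℝ) • b i - γ) + n)
    (c : ℕ) [NeZero c] : repCount Q L γ n c = P.count c := by
  have hc0 : (c : ℝ) ≠ 0 := Nat.cast_ne_zero.mpr (NeZero.ne c)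
  choose z hz using fun x : L => (mem_lattice_iff hL).mp x.2
  have hz' : ∀ w : Fin r → ℤ, ∃ x : L, z x = w := fun w => by
    refine ⟨⟨∑ i, (w i : ℝ) • b i, (mem_lattice_iff hL).mpr ⟨w, rfl⟩⟩, ?_⟩
    exact (sum_smul_injective (b := b) (hz ⟨_, _⟩)).symm
  rw [repCount, IntQuadPoly.count, ncard_image_eq_of_iff (g := fun x : L => fun i => (z x i : ZMod c))]
  · change _ = Nat.card ({x : Fin r → ZMod c | P.eval x = 0} : Set _)
    rw [Nat.card_coe_set_eq]
    congr 1
    ext w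
    simp only [Set.mem_image, Set.mem_ofPred_eq]
    have key : ∀ x : L, (∃ m : ℤ, Q ((x : V) - γ) + n = (c : ℕ) * m) ↔
        P.eval (fun i => (z x i : ZMod c)) = 0 := by
      intro x
      rw [← IntQuadPoly.eval_intCast, ZMod.intCast_zmod_eq_zero_iff_dvd, hz x, ← hP]
      constructor
      · rintro ⟨m, hm⟩; exact ⟨m, by exact_mod_cast hm⟩
      · rintro ⟨m, hm⟩; exact ⟨m, by rw [hm]; push_cast; rfl⟩
    constructor
    · rintro ⟨x, hx, rfl⟩; exact (key x).mp hx
    · intro hw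
      choose y hy using fun i => ZMod.intCast_surjective (w i)
      obtain ⟨x, hx⟩ := hz' y
      have : (fun i => (z x i : ZMod c)) = w := by rw [hx]; exact funext hy
      exact ⟨x, (key x).mpr (this ▸ hw), this⟩
  · intro x y
    rw [Submodule.Quotient.eq, Submodule.mem_smul_pointwise_iff_exists]
    constructor
    · rintro ⟨w, -, hw⟩
      have h1 : z x = fun i => z y i + c * z w i := by
        refine sum_smul_injective (b := b) ?_
        have h2 := congrArg (Subtype.val) hw
        have h3 : (x : V) = y + (c : ℤ) • (w : V) := by
          rw [← sub_eq_iff_eq_add']; exact h2.symm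
        rw [← hz x, h3]
        conv_lhs => rw [hz y, hz w]
        rw [Finset.smul_sum, ← Finset.sum_add_distrib]
        refine Finset.sum_congr rfl fun i _ => ?_
        push_cast
        rw [add_smul, ← Int.cast_smul_eq_zsmul ℝ, smul_smul]
        push_cast; rfl
      funext i
      rw [h1]; simp
    · intro h
      have h1 : ∀ i, ∃ k : ℤ, z x i = z y i + c * k := by
        intro i
        obtain ⟨k, hk⟩ := (ZMod.intCast_eq_intCast_iff_dvd_sub _ _ _).mp (congrFun h i).symm
        exact ⟨k, by rw [← hk]; ring⟩
      choose k hk using h1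
      obtain ⟨w, hw⟩ := hz' k
      refine ⟨w, Submodule.mem_top, Subtype.ext ?_⟩
      change (c : ℤ) • (w : V) = (x : V) - y
      rw [hz x, hz y, hz w, ← Finset.sum_sub_distrib, Finset.smul_sum]
      refine Finset.sum_congr rfl fun i _ => ?_
      rw [hk i, hw, ← sub_smul, ← Int.cast_smul_eq_zsmul ℝ, smul_smul]
      congr 1
      push_cast; ring

end LatticePoly

/-! ### The Dirichlet series of the exponential sums and its Euler product -/
namespace IntQuadPoly

open Matrix

variable {r : ℕ} (P : IntQuadPoly r)

/-- Weyl's bound, with the factor `c^{r/2}` isolated. -/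
lemma norm_gaussSum_le (hdet : P.gram.det ≠ 0) {c : ℕ} [NeZero c] {δ : ZMod c} (hδ : IsUnit δ) :
    ‖P.gaussSum δ‖ ≤ (c : ℝ) ^ ((r : ℝ) / 2) * √((P.gram.det.natAbs : ℝ) ^ r) := by
  have h1 := Real.sqrt_le_sqrt (P.norm_gaussSum_sq_le hdet hδ)
  rw [Real.sqrt_sq (norm_nonneg _), Real.sqrt_mul (by positivity)] at h1
  have h2 : √((c : ℝ) ^ r) = (c : ℝ) ^ ((r : ℝ) / 2) := by
    rw [Real.sqrt_eq_rpow, ← Real.rpow_natCast, ← Real.rpow_mul (Nat.cast_nonneg _)]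
    congr 1; ring
  rwa [h2] at h1

/-- `P.unitSum`, extended by `0` to the modulus `0`. -/
def expSum (n : ℕ) : ℂ :=
  if h : n = 0 then 0 else
    have : NeZero n := ⟨h⟩
    P.unitSum n

lemma expSum_eq (n : ℕ) [NeZero n] : P.expSum n = P.unitSum n := by
  rw [expSum, dif_neg (NeZero.ne n)]

/-- The terms of the Dirichlet series `∑ H(n) n^{-r/2-S}`. -/
def term (S : ℂ) (n : ℕ) : ℂ := P.expSum n * (n : ℂ) ^ (-(r / 2 + S))

lemma norm_expSum_le (hdet : P.gram.det ≠ 0) (n : ℕ) [NeZero n] :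
    ‖P.expSum n‖ ≤ n * ((n : ℝ) ^ ((r : ℝ) / 2) * √((P.gram.det.natAbs : ℝ) ^ r)) := by
  classical
  rw [expSum_eq, unitSum]
  refine (norm_sum_le _ _).trans ?_
  have h1 : ∀ δ ∈ (Finset.univ : Finset (ZMod n)), ‖if IsUnit δ then P.gaussSum δ else 0‖
      ≤ (n : ℝ) ^ ((r : ℝ) / 2) * √((P.gram.det.natAbs : ℝ) ^ r) := by
    intro δ _
    split_ifs with h
    · exact P.norm_gaussSum_le hdet h
    · rw [norm_zero]; positivity
  refine (Finset.sum_le_sum h1).trans ?_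
  rw [Finset.sum_const, Finset.card_univ, ZMod.card, nsmul_eq_mul]

lemma norm_term_le (hdet : P.gram.det ≠ 0) (S : ℂ) (n : ℕ) :
    ‖P.term S n‖ ≤ √((P.gram.det.natAbs : ℝ) ^ r) * (n : ℝ) ^ (1 - S.re) := by
  rcases Nat.eq_zero_or_pos n with rfl | hn
  · rw [term, expSum, dif_pos rfl, zero_mul, norm_zero]; positivity
  · have : NeZero n := ⟨hn.ne'⟩
    have hn' : (0 : ℝ) < n := Nat.cast_pos.mpr hn
    rw [term, norm_mul, Complex.norm_natCast_cpow_of_pos hn]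
    have h1 : (-((r : ℂ) / 2 + S)).re = -((r : ℝ) / 2 + S.re) := by simp
    rw [h1]
    refine (mul_le_mul_of_nonneg_right (P.norm_expSum_le hdet n) (by positivity)).trans (le_of_eq ?_)
    have h2 : (n : ℝ) ^ (1 - S.re) = n * ((n : ℝ) ^ ((r : ℝ) / 2) * (n : ℝ) ^ (-((r : ℝ) / 2 + S.re))) := by
      rw [← Real.rpow_add hn']
      nth_rw 2 [← Real.rpow_one (n : ℝ)]
      rw [← Real.rpow_add hn']
      congr 1; ring
    rw [h2]; ring

lemma summable_term (hdet : P.gram.det ≠ 0) {S : ℂ} (hS : 2 < S.re) : Summable fun n => ‖P.term S n‖ := by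
  refine Summable.of_nonneg_of_le (fun _ => norm_nonneg _) (P.norm_term_le hdet S) ?_
  exact (Real.summable_nat_rpow.mpr (by linarith)).mul_left _

/-- The Euler product, from the multiplicativity of the exponential sums. -/
lemma hasProd_term (hdet : P.gram.det ≠ 0) {S : ℂ} (hS : 2 < S.re) :
    HasProd (fun p : Nat.Primes => ∑' e, P.term S (p ^ e)) (∑' n, P.term S n) := by
  refine EulerProduct.eulerProduct_hasProd (f := P.term S) ?_ ?_ (P.summable_term hdet hS) ?_
  · rw [term, expSum_eq, unitSum_one]; simp
  · intro m n hmn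
    rcases Nat.eq_zero_or_pos m with rfl | hm
    · simp [term, expSum]
    rcases Nat.eq_zero_or_pos n with rfl | hn
    · simp [term, expSum]
    have : NeZero m := ⟨hm.ne'⟩
    have : NeZero n := ⟨hn.ne'⟩
    rw [term, term, term, expSum_eq, expSum_eq, expSum_eq, P.unitSum_mul hmn, Nat.cast_mul,
      Complex.natCast_mul_natCast_cpow]
    ring
  · rw [term, expSum, dif_pos rfl, zero_mul]

lemma natCast_pow_cpow (p e : ℕ) (z : ℂ) : ((p ^ e : ℕ) : ℂ) ^ z = ((p : ℂ) ^ z) ^ e := by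
  induction e with
  | zero => simp
  | succ e ih => rw [pow_succ, Nat.cast_mul, Complex.natCast_mul_natCast_cpow, ih, pow_succ]

/-- Local factors are finite sums, since the exponential sums to high prime powers vanish. -/
lemma tsum_prime_pow {p : ℕ} (hp : p.Prime) {v : ℕ} {u : ℤ} (hμ : P.μ = p ^ v * u)
    (hu : ¬ (p : ℤ) ∣ u) (S : ℂ) :
    ∑' e, P.term S (p ^ e)
      = ∑ e ∈ Finset.range (2 * v + 2), P.expSum (p ^ e) * ((p : ℂ) ^ (-(r / 2 + S))) ^ e := by
  have : NeZero p := ⟨hp.ne_zero⟩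
  rw [tsum_eq_sum (s := Finset.range (2 * v + 2))]
  · refine Finset.sum_congr rfl fun e _ => ?_
    rw [term, natCast_pow_cpow]
  · intro e he
    rw [Finset.mem_range, not_lt] at he
    rw [term, expSum_eq, P.unitSum_prime_pow_eq_zero hp hμ hu he, zero_mul]

lemma count_one : P.count 1 = 1 := by
  rw [count]
  have : Unique {x : Fin r → ZMod 1 // P.eval x = 0} :=
    ⟨⟨⟨0, Subsingleton.elim _ _⟩⟩, fun x => Subsingleton.elim _ _⟩
  exact Nat.card_unique

/-- The local Euler factor as a polynomial in the numbers of zeros. -/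
lemma sum_expSum_prime_pow {p : ℕ} (hp : p.Prime) (Y : ℂ) (w : ℕ) :
    ∑ e ∈ Finset.range (w + 1), P.expSum (p ^ e) * Y ^ e
      = P.count (p ^ w) * (p * Y) ^ w + (1 - (p : ℂ) ^ ((r : ℤ) - 1) * (p * Y)) *
        ∑ ν ∈ Finset.range w, (P.count (p ^ ν) : ℂ) * (p * Y) ^ ν := by
  have : NeZero p := ⟨hp.ne_zero⟩
  have hp0 : (p : ℂ) ≠ 0 := Nat.cast_ne_zero.mpr hp.ne_zero
  induction w with
  | zero =>
    have h1 : P.expSum (p ^ 0) = 1 := by rw [pow_zero, expSum_eq, unitSum_one]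
    rw [zero_add, Finset.sum_range_one, h1, pow_zero p, count_one]; simp
  | succ w ih =>
    rw [Finset.sum_range_succ, ih, expSum_eq, P.unitSum_prime_pow hp, Finset.sum_range_succ _ w,
      zpow_sub_one₀ hp0, zpow_natCast, pow_add (p : ℂ) r w]
    field_simp
    ring

end IntQuadPoly

section Series

variable {V : Type*} [AddCommGroup V] [Module ℝ V] {r : ℕ} {Q : QuadraticForm ℝ V}
  {b : Module.Basis (Fin r) ℝ V} {L : Submodule ℤ V}

lemma wExp_eq {γ : V} {n : ℚ} {P : IntQuadPoly r} (hμ : (P.μ : ℚ) = 2 * n * level L γ) (p : ℕ)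
    [Fact p.Prime] : wExp L γ n p = 2 * padicValInt p P.μ + 1 := by
  rw [wExp, ← hμ, padicValRat.of_int, Int.toNat_natCast, add_comm]

/-- The local Euler factor is the polynomial `L^{(p)}_{γ,n}` at `p^{1-r/2-S}`. -/
lemma localPoly_eq (hL : L = Submodule.span ℤ (Set.range b)) {γ : V} {n : ℚ} {P : IntQuadPoly r}
    (hP : ∀ x : Fin r → ℤ, ((P.eval x : ℤ) : ℝ) = Q (∑ i, (x i : ℝ) • b i - γ) + n)
    (hμ : (P.μ : ℚ) = 2 * n * level L γ) (hμ0 : P.μ ≠ 0) {p : ℕ} (hp : p.Prime) (S : ℂ) :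
    localPoly Q L r γ n p ((p : ℂ) ^ (1 - r / 2 - S)) = ∑' e, P.term S (p ^ e) := by
  have : Fact p.Prime := ⟨hp⟩
  have hp0 : (p : ℂ) ≠ 0 := Nat.cast_ne_zero.mpr hp.ne_zero
  have : NeZero p := ⟨hp.ne_zero⟩
  obtain ⟨u, hu⟩ : (p : ℤ) ^ padicValInt p P.μ ∣ P.μ := by
    exact padicValInt_dvd P.μ
  have hu' : ¬ (p : ℤ) ∣ u := by
    rintro ⟨w, rfl⟩
    have h1 : (p : ℤ) ^ (padicValInt p P.μ + 1) ∣ P.μ := ⟨w, by rw [pow_succ, mul_assoc]; exact hu⟩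
    have := (padicValInt_dvd_iff _ P.μ).mp h1
    omega
  rw [P.tsum_prime_pow hp hu hu', show 2 * padicValInt p P.μ + 2 = (2 * padicValInt p P.μ + 1) + 1 by rfl,
    P.sum_expSum_prime_pow hp, localPoly, wExp_eq hμ]
  have hX : (p : ℂ) * (p : ℂ) ^ (-(r / 2 + S)) = (p : ℂ) ^ (1 - r / 2 - S) := by
    nth_rw 1 [← Complex.cpow_one (p : ℂ)]
    rw [← Complex.cpow_add _ _ hp0]; congr 1; ring
  rw [hX, repCount_eq_count hL hP]
  congr 2
  refine Finset.sum_congr rfl fun ν _ => ?_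
  rw [repCount_eq_count hL hP]

variable {γ : dualLattice Q L} {n : ℚ}

lemma badPrimes_eq {P : IntQuadPoly r} (hN : (P.N : ℚ) = (level L (γ : V)) ^ 2 * n)
    (hdet : (P.gram.det : ℝ) = gramDet Q b) :
    badPrimes Q L b (γ : V) n = (2 * P.N * P.gram.det).natAbs.primeFactors := by
  have h1 : |2 * (level L (γ : V) : ℝ) ^ 2 * n * gramDet Q b| = ((2 * P.N * P.gram.det).natAbs : ℝ) := by
    have h2 : ((P.N : ℚ) : ℝ) = (level L (γ : V) : ℝ) ^ 2 * n := by rw [hN]; push_cast; rfl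
    rw [Nat.cast_natAbs, Int.cast_abs]
    push_cast [-Int.cast_det]
    push_cast at h2
    rw [h2, hdet]; ring_nf
  rw [badPrimes, h1, Nat.floor_natCast]

/-- At a prime outside the bad set all the invariants are units. -/
lemma good_prime {P : IntQuadPoly r} (h0 : 2 * P.N * P.gram.det ≠ 0)
    (hprim : ∀ p : ℕ, p.Prime → p ∣ P.d → ∃ i, ¬ (p : ℤ) ∣ P.g i) {p : ℕ} [hp : Fact p.Prime]
    (hbad : p ∉ (2 * P.N * P.gram.det).natAbs.primeFactors) :
    p ≠ 2 ∧ (P.N : ZMod p) ≠ 0 ∧ (P.gram.det : ZMod p) ≠ 0 ∧ (P.d : ZMod p) ≠ 0 ∧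
      ¬ (p : ℤ) ∣ P.μ := by
  have h1 : ¬ (p : ℤ) ∣ 2 * P.N * P.gram.det := fun h => hbad (by
    rw [Nat.mem_primeFactors]
    exact ⟨hp.out, Int.natCast_dvd.mp h, Int.natAbs_ne_zero.mpr h0⟩)
  have h2 : (P.N : ZMod p) ≠ 0 := fun h => h1 (by
    rw [ZMod.intCast_zmod_eq_zero_iff_dvd] at h
    exact dvd_mul_of_dvd_left (dvd_mul_of_dvd_right h _) _)
  have h3 : (P.gram.det : ZMod p) ≠ 0 := fun h => h1 (by
    rw [ZMod.intCast_zmod_eq_zero_iff_dvd] at h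
    exact dvd_mul_of_dvd_right h _)
  refine ⟨?_, h2, h3, ?_, ?_⟩
  · rintro rfl
    exact h1 (dvd_mul_of_dvd_left (dvd_mul_right _ _) _)
  · intro hd
    rw [ZMod.natCast_eq_zero_iff] at hd
    -- if `p ∣ d`, then `A g ≡ 0` with `A` invertible modulo `p`, so `p ∣ g`
    obtain ⟨i, hi⟩ := hprim p hp.out hd
    have h4 := congrArg (fun v : Fin r → ℤ => fun i => ((v i : ℤ) : ZMod p)) P.smul_l
    have hd0 : (P.d : ZMod p) = 0 := (ZMod.natCast_eq_zero_iff _ _).mpr hd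
    have h5 : (P.gram.map (Int.cast : ℤ → ZMod p)).mulVec (fun i => (P.g i : ZMod p)) = 0 := by
      funext j
      have h6 := congrFun h4 j
      simp only [Pi.smul_apply, Pi.neg_apply, smul_eq_mul] at h6
      push_cast at h6
      rw [hd0, zero_mul] at h6
      have h7 : (P.gram.map (Int.cast : ℤ → ZMod p)).mulVec (fun i => (P.g i : ZMod p)) j
          = ((P.gram.mulVec P.g j : ℤ) : ZMod p) := by
        simp [Matrix.mulVec, dotProduct]
      rw [h7]
      rw [Pi.zero_apply]
      exact (neg_eq_zero.mp h6.symm)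
    have h8 := congrArg (fun v => ((P.gram.map (Int.cast : ℤ → ZMod p)).adjugate.mulVec v) i) h5
    simp only [Matrix.mulVec_mulVec, Matrix.adjugate_mul, Matrix.smul_mulVec, Matrix.one_mulVec,
      Matrix.mulVec_zero] at h8
    have h9 : (P.gram.map (Int.cast : ℤ → ZMod p)).det = (P.gram.det : ZMod p) :=
      ((Int.castRingHom (ZMod p)).map_det P.gram).symm
    rw [h9] at h8
    have h10 : (P.g i : ZMod p) = 0 := by
      have : (P.gram.det : ZMod p) * (P.g i : ZMod p) = 0 := h8
      exact (mul_eq_zero.mp this).resolve_left h3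
    exact hi ((ZMod.intCast_zmod_eq_zero_iff_dvd _ _).mp h10)
  · intro h
    refine h1 ?_
    rw [← P.mul_μ]
    exact dvd_mul_of_dvd_left (dvd_mul_of_dvd_right h _) _

/-- The character of `D₀` at a prime where the discriminant `D₀ f²` is a unit. -/
lemma quadraticChar_eq_kroneckerSymbol {D₀ D : ℤ} {f : ℕ} (hD : D = D₀ * f ^ 2) {p : ℕ}
    [hp : Fact p.Prime] (hp2 : p ≠ 2) (hDp : (D : ZMod p) ≠ 0) :
    quadraticChar (ZMod p) (D : ZMod p) = kroneckerSymbol D₀ p ∧ (kroneckerSymbol D₀ p) ^ 2 = 1 := by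
  have h1 : kroneckerSymbol D₀ p = quadraticChar (ZMod p) (D₀ : ZMod p) := by
    rw [kroneckerSymbol_of_odd _ (hp.out.odd_of_ne_two hp2), ← jacobiSym.legendreSym.to_jacobiSym]
    rfl
  have h2 : (D : ZMod p) = D₀ * (f : ZMod p) ^ 2 := by rw [hD]; push_cast; rfl
  have h3 : (f : ZMod p) ≠ 0 := fun h => hDp (by rw [h2, h]; simp)
  have h4 : (D₀ : ZMod p) ≠ 0 := fun h => hDp (by rw [h2, h]; simp)
  rw [h1, h2, map_mul, quadraticChar_sq_one' h3, mul_one]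
  exact ⟨rfl, quadraticChar_sq_one h4⟩

lemma cpow_half_mul_pow {p : ℕ} (hp : p.Prime) (S : ℂ) (k : ℕ) (hr : r = 2 * k) :
    (p : ℂ) ^ k * (p : ℂ) ^ (-((r : ℂ) / 2 + S)) = (p : ℂ) ^ (-S) := by
  have hp0 : (p : ℂ) ≠ 0 := Nat.cast_ne_zero.mpr hp.ne_zero
  rw [← Complex.cpow_natCast, ← Complex.cpow_add _ _ hp0]
  congr 1
  rw [hr]; push_cast; ring

/-- If `p ∤ μ`, only the first two terms of the local factor survive. -/
lemma tsum_good_prime {P : IntQuadPoly r} (S : ℂ) {p : ℕ} [hp : Fact p.Prime] (hμ : ¬ (p : ℤ) ∣ P.μ) :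
    ∑' e, P.term S (p ^ e) = 1 + P.unitSum p * (p : ℂ) ^ (-(r / 2 + S)) := by
  rw [P.tsum_prime_pow hp.out (v := 0) (u := P.μ) (by simp) hμ, mul_zero, zero_add,
    Finset.sum_range_succ, Finset.sum_range_one]
  have h1 : P.expSum (p ^ 0) = 1 := by
    rw [pow_zero, IntQuadPoly.expSum_eq, IntQuadPoly.unitSum_one]
  have h2 : P.expSum (p ^ 1) = P.unitSum p := by rw [pow_one, IntQuadPoly.expSum_eq]
  rw [h1, h2, pow_zero, pow_one, mul_one]

/-- An Euler product with trivial factors outside a finite set is a finite product. -/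
lemma hasProd_finset {F : ℕ → ℂ} {A : ℂ} (s : Finset ℕ) (hs : ∀ p ∈ s, p.Prime)
    (hF : ∀ p : ℕ, p.Prime → p ∉ s → F p = 1) (h : HasProd (fun p : Nat.Primes => F p) A) :
    A = ∏ p ∈ s, F p := by
  have h1 : HasProd (fun p : Nat.Primes => F p) (∏ p ∈ s.subtype Nat.Prime, F p) := by
    refine hasProd_prod_of_ne_finset_one fun p hp => hF p p.2 fun hps => hp ?_
    exact Finset.mem_subtype.mpr hps
  rw [h.unique h1, Finset.prod_subtype_of_mem F hs]

/-- The Dirichlet series in even rank is `σ(S) / L(χ, S)`: the product of the two has trivial Euler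
factors at the good primes. -/
theorem tsum_term_even (hL : L = Submodule.span ℤ (Set.range b)) {P : IntQuadPoly r}
    (hP : ∀ x : Fin r → ℤ, ((P.eval x : ℤ) : ℝ) = Q (∑ i, (x i : ℝ) • b i - γ) + n)
    (hN : (P.N : ℚ) = (level L (γ : V)) ^ 2 * n) (hμ : (P.μ : ℚ) = 2 * n * level L (γ : V))
    (hdet : (P.gram.det : ℝ) = gramDet Q b)
    (hprim : ∀ p : ℕ, p.Prime → p ∣ P.d → ∃ i, ¬ (p : ℤ) ∣ P.g i)
    (hN0 : P.N ≠ 0) (hdet0 : P.gram.det ≠ 0)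
    {D₀ : ℤ} {f : ℕ} (hD₀ : IsFundamentalDiscriminant D₀)
    (hD : latticeDiscriminant Q L b (γ : V) n = D₀ * f ^ 2) (hr : Even r) {S : ℂ} (hS : 2 < S.re) :
    (∑' n, P.term S n) * kroneckerL D₀ S = sigma Q L b (γ : V) n D₀ S := by
  have h0 : 2 * P.N * P.gram.det ≠ 0 := mul_ne_zero (mul_ne_zero two_ne_zero hN0) hdet0
  have hμ0 : P.μ ≠ 0 := fun h => hN0 (by
    have := P.mul_μ; rw [h, mul_zero] at this; omega)
  have hDint : (-1) ^ (r / 2) * P.gram.det = D₀ * f ^ 2 := by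
    rw [latticeDiscriminant, if_pos hr, ← hdet] at hD
    exact_mod_cast hD
  have h1 := (P.hasProd_term hdet0 hS).mul (hasProd_kroneckerL hD₀ (S := S) (by linarith))
  rw [sigma, if_pos hr, badPrimes_eq hN hdet]
  rw [hasProd_finset (F := fun p => (∑' e, P.term S (p ^ e)) *
    (1 - kroneckerSymbol D₀ p * (p : ℂ) ^ (-S))⁻¹) _ (fun p hp => Nat.prime_of_mem_primeFactors hp)
    ?_ h1]
  · refine Finset.prod_congr rfl fun p hp => ?_
    rw [localPoly_eq hL hP hμ hμ0 (Nat.prime_of_mem_primeFactors hp), div_eq_mul_inv]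
  · intro p hp hbad
    have : Fact p.Prime := ⟨hp⟩
    obtain ⟨hp2, hN', hdet', hd', hμ'⟩ := good_prime h0 hprim hbad
    have hDp : (((-1) ^ (r / 2) * P.gram.det : ℤ) : ZMod p) ≠ 0 := by
      push_cast [-Int.cast_det]
      exact mul_ne_zero (pow_ne_zero _ (neg_ne_zero.mpr one_ne_zero)) hdet'
    have h2 := (quadraticChar_eq_kroneckerSymbol hDint hp2 hDp).1
    push_cast [-Int.cast_det] at h2
    have h3 : ∑' e, P.term S (p ^ e) = 1 - kroneckerSymbol D₀ p * (p : ℂ) ^ (-S) := by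
      rw [tsum_good_prime S hμ', P.unitSum_prime hp2 hdet' hd' hN', if_pos hr, h2, mul_assoc,
        cpow_half_mul_pow hp S (r / 2) (by have := Nat.even_iff.mp hr; omega)]
      ring
    rw [h3]
    exact mul_inv_cancel₀ (one_sub_kroneckerSymbol_mul_ne_zero hD₀ (by linarith) hp)

/-- The Dirichlet series in odd rank is `L(χ, S - 1/2) σ(S) / ζ(2S - 1)`: at a good prime its Euler
factor is `1 + χ(p) p^{1/2-S}`, and `χ(p)² = 1`. -/
theorem tsum_term_odd (hL : L = Submodule.span ℤ (Set.range b)) {P : IntQuadPoly r}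
    (hP : ∀ x : Fin r → ℤ, ((P.eval x : ℤ) : ℝ) = Q (∑ i, (x i : ℝ) • b i - γ) + n)
    (hN : (P.N : ℚ) = (level L (γ : V)) ^ 2 * n) (hμ : (P.μ : ℚ) = 2 * n * level L (γ : V))
    (hdet : (P.gram.det : ℝ) = gramDet Q b)
    (hprim : ∀ p : ℕ, p.Prime → p ∣ P.d → ∃ i, ¬ (p : ℤ) ∣ P.g i)
    (hN0 : P.N ≠ 0) (hdet0 : P.gram.det ≠ 0)
    {D₀ : ℤ} {f : ℕ} (hD₀ : IsFundamentalDiscriminant D₀)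
    (hD : latticeDiscriminant Q L b (γ : V) n = D₀ * f ^ 2) (hr : ¬ Even r) {S : ℂ} (hS : 2 < S.re) :
    (∑' n, P.term S n) * riemannZeta (2 * S - 1)
      = kroneckerL D₀ (S - 1 / 2) * sigma Q L b (γ : V) n D₀ S := by
  have h0 : 2 * P.N * P.gram.det ≠ 0 := mul_ne_zero (mul_ne_zero two_ne_zero hN0) hdet0
  have hμ0 : P.μ ≠ 0 := fun h => hN0 (by
    have := P.mul_μ; rw [h, mul_zero] at this; omega)
  have hDint : 2 * (-1) ^ ((r + 1) / 2) * P.N * P.gram.det = D₀ * f ^ 2 := by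
    have h2 : ((P.N : ℚ) : ℝ) = (level L (γ : V) : ℝ) ^ 2 * n := by rw [hN]; push_cast; rfl
    push_cast at h2
    rw [latticeDiscriminant, if_neg hr, ← hdet, mul_assoc (2 * _) _ (n : ℝ), ← h2] at hD
    exact_mod_cast hD
  have hS1 : 1 < (S - 1 / 2).re := by
    rw [Complex.sub_re]; norm_num; linarith
  have hS2 : 1 < (2 * S - 1).re := by
    rw [Complex.sub_re, Complex.mul_re]; norm_num; linarith
  have hL0 := kroneckerL_ne_zero hD₀ hS1
  have h1 := (((P.hasProd_term hdet0 hS).mul (riemannZeta_eulerProduct_hasProd hS2)).div₀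
    (hasProd_kroneckerL hD₀ hS1) hL0)
  have hne : ∀ p : ℕ, p.Prime → 1 - (p : ℂ) ^ (-(2 * S - 1)) ≠ 0 := by
    intro p hp h
    have h2 : ‖(p : ℂ) ^ (-(2 * S - 1))‖ = 1 := by rw [← sub_eq_zero.mp h, norm_one]
    rw [Complex.norm_natCast_cpow_of_pos hp.pos, Complex.neg_re] at h2
    have := Real.rpow_lt_one_of_one_lt_of_neg (Nat.one_lt_cast.mpr hp.one_lt : (1 : ℝ) < p)
      (show -(2 * S - 1).re < 0 by linarith)
    linarith
  have hexp : ∀ p : ℕ, p.Prime → (1 - kroneckerSymbol D₀ p * (p : ℂ) ^ (-(S - 1 / 2))) ≠ 0 := fun p hp =>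
    one_sub_kroneckerSymbol_mul_ne_zero hD₀ hS1 hp
  rw [eq_comm, mul_comm, ← eq_div_iff hL0, sigma, if_neg hr, badPrimes_eq hN hdet]
  rw [hasProd_finset (F := fun p => (∑' e, P.term S (p ^ e)) * (1 - (p : ℂ) ^ (-(2 * S - 1)))⁻¹ /
    (1 - kroneckerSymbol D₀ p * (p : ℂ) ^ (-(S - 1 / 2)))⁻¹) _
    (fun p hp => Nat.prime_of_mem_primeFactors hp) ?_ h1]
  · refine Finset.prod_congr rfl fun p hp => ?_
    rw [localPoly_eq hL hP hμ hμ0 (Nat.prime_of_mem_primeFactors hp)]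
    rw [show -(S - 1 / 2) = 1 / 2 - S by ring, show -(2 * S - 1) = 1 - 2 * S by ring]
    rw [div_inv_eq_mul, div_eq_mul_inv]
    ring
  · intro p hp hbad
    have : Fact p.Prime := ⟨hp⟩
    have hp0 : (p : ℂ) ≠ 0 := Nat.cast_ne_zero.mpr hp.ne_zero
    obtain ⟨hp2, hN', hdet', hd', hμ'⟩ := good_prime h0 hprim hbad
    have h20 : (2 : ZMod p) ≠ 0 := by
      intro h
      have : ((2 : ℕ) : ZMod p) = 0 := by exact_mod_cast h
      rw [ZMod.natCast_eq_zero_iff] at this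
      exact hp2 ((Nat.prime_dvd_prime_iff_eq hp Nat.prime_two).mp this)
    have hDp : ((2 * (-1) ^ ((r + 1) / 2) * P.N * P.gram.det : ℤ) : ZMod p) ≠ 0 := by
      push_cast [-Int.cast_det]
      exact mul_ne_zero (mul_ne_zero (mul_ne_zero h20
        (pow_ne_zero _ (neg_ne_zero.mpr one_ne_zero))) hN') hdet'
    obtain ⟨h2, h2'⟩ := quadraticChar_eq_kroneckerSymbol hDint hp2 hDp
    push_cast [-Int.cast_det] at h2
    have h4 : (p : ℂ) ^ ((r + 1) / 2) * (p : ℂ) ^ (-((r : ℂ) / 2 + S)) = (p : ℂ) ^ (-(S - 1 / 2)) := by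
      rw [← Complex.cpow_natCast, ← Complex.cpow_add _ _ hp0]
      congr 1
      obtain ⟨k, hk⟩ := Nat.not_even_iff_odd.mp hr
      rw [show (r + 1) / 2 = k + 1 by omega, hk]; push_cast; ring
    have h3 : ∑' e, P.term S (p ^ e) = 1 + kroneckerSymbol D₀ p * (p : ℂ) ^ (-(S - 1 / 2)) := by
      rw [tsum_good_prime S hμ', P.unitSum_prime hp2 hdet' hd' hN', if_neg hr, h2, mul_assoc, h4]
    have h5 : (p : ℂ) ^ (-(2 * S - 1)) = ((p : ℂ) ^ (-(S - 1 / 2))) ^ 2 := by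
      rw [← Complex.cpow_nat_mul]; congr 1; push_cast; ring
    have h6 : (kroneckerSymbol D₀ p : ℂ) ^ 2 = 1 := by exact_mod_cast h2'
    have h7 := hne p hp
    rw [h3, div_inv_eq_mul, mul_assoc, mul_comm (_)⁻¹, ← mul_assoc, ← div_eq_mul_inv, div_eq_one_iff_eq h7,
      h5]
    linear_combination (-((p : ℂ) ^ (-(S - 1 / 2))) ^ 2) * h6

end Series

/-! ### The archimedean integral -/
section Archimedean

open MeasureTheory Set Filter

lemma norm_cpow_le_exp (z w : ℂ) : ‖z ^ w‖ ≤ Real.exp (π * |w.im|) * ‖z‖ ^ w.re := by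
  refine (Complex.norm_cpow_le z w).trans ?_
  rw [div_eq_mul_inv, ← Real.exp_neg, mul_comm]
  refine mul_le_mul_of_nonneg_right (Real.exp_le_exp.mpr ?_) (by positivity)
  calc -(z.arg * w.im) ≤ |z.arg * w.im| := neg_le_abs _
    _ = |z.arg| * |w.im| := abs_mul _ _
    _ ≤ π * |w.im| := mul_le_mul_of_nonneg_right (Complex.abs_arg_le_pi z) (abs_nonneg _)

lemma normSq_sub_mul_I (y x : ℝ) : ‖(y - x * Complex.I : ℂ)‖ ^ 2 = y ^ 2 + x ^ 2 := by
  rw [Complex.sq_norm, Complex.normSq_apply]; simp; ring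

lemma norm_add_mul_I (y x : ℝ) : ‖(y + x * Complex.I : ℂ)‖ = ‖(y - x * Complex.I : ℂ)‖ := by
  rw [← sq_eq_sq₀ (norm_nonneg _) (norm_nonneg _), normSq_sub_mul_I, Complex.sq_norm,
    Complex.normSq_apply]; simp; ring

lemma sub_mul_I_ne_zero {y : ℝ} (hy : 0 < y) (x : ℝ) : (y - x * Complex.I : ℂ) ≠ 0 := fun h => by
  have := congrArg Complex.re h; simp at this; exact hy.ne' this

lemma add_mul_I_ne_zero {y : ℝ} (hy : 0 < y) (x : ℝ) : (y + x * Complex.I : ℂ) ≠ 0 := fun h => by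
  have := congrArg Complex.re h; simp at this; exact hy.ne' this

lemma integrable_norm_rpow {y : ℝ} (hy : 0 < y) {p : ℝ} (hp : 1 < p) :
    Integrable fun x : ℝ => ‖(y - x * Complex.I : ℂ)‖ ^ (-p) := by
  have h1 : Integrable fun x : ℝ => ((1 : ℝ) + ‖x‖ ^ 2) ^ (-p / 2) :=
    integrable_rpow_neg_one_add_norm_sq (by simpa using hp)
  refine (h1.const_mul ((min 1 (y ^ 2)) ^ (-p / 2))).mono' ?_ (ae_of_all _ fun x => ?_)
  · refine Measurable.aestronglyMeasurable ?_
    fun_prop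
  · have h2 : ‖(y - x * Complex.I : ℂ)‖ ^ (-p) = (y ^ 2 + x ^ 2) ^ (-p / 2) := by
      rw [← normSq_sub_mul_I, ← Real.rpow_natCast, ← Real.rpow_mul (norm_nonneg _)]
      congr 1; push_cast; ring
    have hm : 0 < min 1 (y ^ 2) := lt_min one_pos (by positivity)
    rw [Real.norm_of_nonneg (by positivity), h2, ← Real.mul_rpow hm.le (by positivity)]
    refine Real.rpow_le_rpow_of_nonpos (by positivity) ?_ (by linarith)
    rw [Real.norm_eq_abs, sq_abs, mul_add, mul_one]
    refine add_le_add (min_le_right _ _) ?_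
    calc min 1 (y ^ 2) * x ^ 2 ≤ 1 * x ^ 2 := mul_le_mul_of_nonneg_right (min_le_left _ _) (sq_nonneg _)
      _ = x ^ 2 := one_mul _

/-- The integrand `(y - ix)^{-α} (y + ix)^j e^{-iωx} e^{-u(y + ix)}`. -/
def archKernel (α : ℂ) (y ω : ℝ) (j : ℕ) (u x : ℝ) : ℂ :=
  (y - x * Complex.I) ^ (-α) * (y + x * Complex.I) ^ j * Complex.exp (-(ω * x * Complex.I)) *
    Complex.exp (-(u * (y + x * Complex.I)))

/-- The function `u ↦ ∫ (y - ix)^{-α} (y + ix)^j e^{-iωx} e^{-u(y + ix)} dx`. -/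
def archF (α : ℂ) (y ω : ℝ) (j : ℕ) (u : ℝ) : ℂ := ∫ x : ℝ, archKernel α y ω j u x

variable {α : ℂ} {y ω : ℝ}

lemma measurable_archKernel (α : ℂ) (y ω : ℝ) (j : ℕ) :
    Measurable fun p : ℝ × ℝ => archKernel α y ω j p.1 p.2 := by
  unfold archKernel
  fun_prop

lemma norm_archKernel_le (hy : 0 < y) (j : ℕ) (u x : ℝ) :
    ‖archKernel α y ω j u x‖ ≤ Real.exp (π * |α.im|) * Real.exp (-(u * y)) *
      ‖(y - x * Complex.I : ℂ)‖ ^ (-(α.re - j)) := by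
  have h0 : 0 < ‖(y - x * Complex.I : ℂ)‖ := norm_pos_iff.mpr (sub_mul_I_ne_zero hy x)
  have h1 : ‖Complex.exp (-(ω * x * Complex.I))‖ = 1 := by
    rw [Complex.norm_exp]; simp
  have h2 : ‖Complex.exp (-(u * (y + x * Complex.I)))‖ = Real.exp (-(u * y)) := by
    rw [Complex.norm_exp]; simp
  have h3 := norm_cpow_le_exp (y - x * Complex.I) (-α)
  rw [Complex.neg_im, abs_neg, Complex.neg_re] at h3
  rw [archKernel, norm_mul, norm_mul, norm_mul, h1, h2, mul_one, norm_pow, norm_add_mul_I]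
  have h4 : ‖(y - x * Complex.I : ℂ)‖ ^ (-(α.re - j))
      = ‖(y - x * Complex.I : ℂ)‖ ^ (-α.re) * ‖(y - x * Complex.I : ℂ)‖ ^ j := by
    rw [← Real.rpow_natCast, ← Real.rpow_add h0]; congr 1; ring
  rw [h4]
  calc _ ≤ (Real.exp (π * |α.im|) * ‖(y - x * Complex.I : ℂ)‖ ^ (-α.re)) * ‖(y - x * Complex.I : ℂ)‖ ^ j
        * Real.exp (-(u * y)) := by gcongr
    _ = _ := by ring

lemma integrable_archKernel (hy : 0 < y) {j : ℕ} (hj : j + 1 < α.re) (u : ℝ) :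
    Integrable (archKernel α y ω j u) := by
  refine ((integrable_norm_rpow hy (p := α.re - j) (by linarith)).const_mul
    (Real.exp (π * |α.im|) * Real.exp (-(u * y)))).mono' ?_ (ae_of_all _ fun x => norm_archKernel_le hy j u x)
  exact ((measurable_archKernel α y ω j).comp measurable_prodMk_left).aestronglyMeasurable

lemma norm_archF_le (hy : 0 < y) {j : ℕ} (hj : j + 1 < α.re) (ω : ℝ) :
    ∃ C : ℝ, 0 ≤ C ∧ ∀ u, ‖archF α y ω j u‖ ≤ C * Real.exp (-(u * y)) := by
  refine ⟨Real.exp (π * |α.im|) * ∫ x : ℝ, ‖(y - x * Complex.I : ℂ)‖ ^ (-(α.re - j)),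
    mul_nonneg (by positivity) (integral_nonneg fun x => by positivity), fun u => ?_⟩
  refine (norm_integral_le_of_norm_le ((integrable_norm_rpow hy (p := α.re - j) (by linarith)).const_mul
    (Real.exp (π * |α.im|) * Real.exp (-(u * y)))) (ae_of_all _ fun x => norm_archKernel_le hy j u x)).trans ?_
  rw [integral_const_mul]
  exact le_of_eq (by ring)

/-- The dominating function on a unit neighbourhood. -/
lemma norm_archKernel_le_of_mem (hy : 0 < y) (j : ℕ) {u₀ u : ℝ} (hu : u ∈ Metric.ball u₀ 1) (x : ℝ) :
    ‖archKernel α y ω j u x‖ ≤ Real.exp (π * |α.im|) * Real.exp ((1 - u₀) * y) *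
      ‖(y - x * Complex.I : ℂ)‖ ^ (-(α.re - j)) := by
  refine (norm_archKernel_le hy j u x).trans ?_
  have h1 : u₀ - 1 < u := by
    rw [Metric.mem_ball, Real.dist_eq, abs_lt] at hu; linarith [hu.1]
  have h2 : -(u * y) ≤ (1 - u₀) * y := by nlinarith
  gcongr

lemma continuous_archF (hy : 0 < y) {j : ℕ} (hj : j + 1 < α.re) : Continuous (archF α y ω j) := by
  rw [continuous_iff_continuousAt]
  intro u₀
  refine continuousAt_of_dominated (bound := fun x => Real.exp (π * |α.im|) * Real.exp ((1 - u₀) * y) *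
      ‖(y - x * Complex.I : ℂ)‖ ^ (-(α.re - j))) ?_ ?_ ?_ ?_
  · exact Eventually.of_forall fun u => (integrable_archKernel hy hj u).aestronglyMeasurable
  · filter_upwards [Metric.ball_mem_nhds u₀ one_pos] with u hu
    exact ae_of_all _ fun x => norm_archKernel_le_of_mem hy j hu x
  · exact (integrable_norm_rpow hy (by linarith)).const_mul _
  · refine ae_of_all _ fun x => Continuous.continuousAt ?_
    unfold archKernel
    fun_prop

/-- Differentiation in `u` raises the exponent `j`. -/
lemma hasDerivAt_archF (hy : 0 < y) {j : ℕ} (hj : j + 2 < α.re) (u₀ : ℝ) :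
    HasDerivAt (archF α y ω j) (-archF α y ω (j + 1) u₀) u₀ := by
  have h := hasDerivAt_integral_of_dominated_loc_of_deriv_le (μ := volume) (𝕜 := ℝ) (x₀ := u₀)
    (F := archKernel α y ω j) (F' := fun u x => -archKernel α y ω (j + 1) u x)
    (bound := fun x : ℝ => Real.exp (π * |α.im|) * Real.exp ((1 - u₀) * y) *
      ‖(y - x * Complex.I : ℂ)‖ ^ (-(α.re - (j + 1 : ℕ)))) (Metric.ball_mem_nhds u₀ one_pos)
    (Eventually.of_forall fun u => (integrable_archKernel hy (by linarith) u).aestronglyMeasurable)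
    (integrable_archKernel hy (by linarith) u₀)
    ((measurable_archKernel α y ω (j + 1)).comp measurable_prodMk_left).neg.aestronglyMeasurable
    (ae_of_all _ fun (x : ℝ) (u : ℝ) hu => by
      rw [norm_neg]; exact norm_archKernel_le_of_mem hy (j + 1) hu x)
    ((integrable_norm_rpow hy (by push_cast; linarith)).const_mul _)
    (ae_of_all _ fun (x : ℝ) (u : ℝ) _ => by
      have h1 : HasDerivAt (fun u : ℝ => -((u : ℂ) * (y + x * Complex.I))) (-(1 * ((y : ℂ) + x * Complex.I))) u :=
        ((Complex.ofRealCLM.hasDerivAt (x := u)).mul_const _).neg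
      have h2 := (h1.cexp).const_mul ((y - x * Complex.I) ^ (-α) * (y + x * Complex.I) ^ j *
        Complex.exp (-(ω * x * Complex.I)))
      refine h2.congr_deriv ?_
      rw [archKernel, pow_succ]; ring)
  have h2 := h.2
  rw [integral_neg] at h2
  exact h2

lemma integrableOn_cpow_mul_exp {a : ℂ} (ha : 0 < a.re) {z : ℂ} (hz : 0 < z.re) :
    IntegrableOn (fun t : ℝ => (t : ℂ) ^ (a - 1) * Complex.exp (-(z * t))) (Ioi 0) := by
  have h1 := integrableOn_rpow_mul_exp_neg_mul_rpow (s := a.re - 1) (p := 1) (b := z.re) (by linarith)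
    one_pos hz
  refine Integrable.mono' h1 (Measurable.aestronglyMeasurable (by fun_prop)) ?_
  refine (ae_restrict_mem measurableSet_Ioi).mono fun t ht => le_of_eq ?_
  rw [norm_mul, Complex.norm_cpow_eq_rpow_re_of_pos ht, Complex.norm_exp]
  simp

/-- The Gamma integral with a complex parameter. -/
lemma integral_cpow_mul_exp_neg_mul {a : ℂ} (ha : 0 < a.re) {z : ℂ} (hz : 0 < z.re) :
    ∫ t in Ioi (0 : ℝ), (t : ℂ) ^ (a - 1) * Complex.exp (-(z * t)) = z ^ (-a) * Complex.Gamma a := by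
  set U : Set ℂ := {z | 0 < z.re} with hU
  have hUo : IsOpen U := isOpen_lt continuous_const Complex.continuous_re
  have hf : DifferentiableOn ℂ (fun z : ℂ => ∫ t in Ioi (0 : ℝ), (t : ℂ) ^ (a - 1) * Complex.exp (-(z * t))) U := by
    intro z₀ hz₀
    have hz₀' : 0 < z₀.re := hz₀
    refine DifferentiableAt.differentiableWithinAt ?_
    have hs : {z : ℂ | z₀.re / 2 < z.re} ∈ 𝓝 z₀ :=
      (isOpen_lt continuous_const Complex.continuous_re).mem_nhds (by simpa using hz₀')
    have hd := integrableOn_rpow_mul_exp_neg_mul_rpow (s := a.re) (p := 1) (b := z₀.re / 2) (by linarith)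
      one_pos (by linarith)
    exact (hasDerivAt_integral_of_dominated_loc_of_deriv_le (μ := volume.restrict (Ioi (0 : ℝ)))
      (F := fun z t => (t : ℂ) ^ (a - 1) * Complex.exp (-(z * t)))
      (F' := fun z t => (t : ℂ) ^ (a - 1) * (Complex.exp (-(z * t)) * -(1 * t)))
      (bound := fun t => t ^ a.re * Real.exp (-(z₀.re / 2) * t ^ (1 : ℝ))) hs
      (Eventually.of_forall fun z => Measurable.aestronglyMeasurable (by fun_prop))
      (integrableOn_cpow_mul_exp ha hz₀') (Measurable.aestronglyMeasurable (by fun_prop))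
      ((ae_restrict_mem measurableSet_Ioi).mono fun t ht z hz => by
        have ht' : (0 : ℝ) < t := ht
        have hz' : z₀.re / 2 < z.re := hz
        have e1 : ‖(-(1 * t) : ℂ)‖ = t := by simp [abs_of_pos ht']
        rw [norm_mul, norm_mul, e1, Complex.norm_cpow_eq_rpow_re_of_pos ht', Complex.norm_exp,
          mul_comm (Real.exp _), ← mul_assoc]
        have e2 : t ^ (a - 1).re * t = t ^ a.re := by
          nth_rw 2 [← Real.rpow_one t]
          rw [← Real.rpow_add ht']; congr 1; simp
        rw [e2]
        refine mul_le_mul_of_nonneg_left (Real.exp_le_exp.mpr ?_) (by positivity)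
        simp only [Complex.neg_re, Complex.mul_re, Complex.ofReal_re, Complex.ofReal_im, mul_zero,
          sub_zero, Real.rpow_one]
        nlinarith) hd
      (ae_of_all _ fun t z _ => by
        exact (((hasDerivAt_id z).mul_const (t : ℂ)).neg.cexp).const_mul _)).2.differentiableAt
  have hg : DifferentiableOn ℂ (fun z : ℂ => z ^ (-a) * Complex.Gamma a) U := fun z₀ hz₀ =>
    ((differentiableAt_id.cpow_const (Or.inl hz₀)).mul_const _).differentiableWithinAt
  have hpre : IsPreconnected U := (convex_halfSpace_re_gt 0).isPreconnected
  have h1 : (1 : ℂ) ∈ U := by simp [hU]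
  refine (hf.analyticOnNhd hUo).eqOn_of_preconnected_of_frequently_eq (hg.analyticOnNhd hUo) hpre h1 ?_ hz
  have htend : Tendsto (fun t : ℝ => (t : ℂ)) (𝓝[≠] 1) (𝓝[≠] (1 : ℂ)) := by
    refine tendsto_nhdsWithin_iff.mpr ⟨?_, ?_⟩
    · exact (Complex.continuous_ofReal.tendsto' 1 1 (by simp)).mono_left nhdsWithin_le_nhds
    · filter_upwards [self_mem_nhdsWithin] with t ht
      simpa using ht
  refine htend.frequently (Eventually.frequently ?_)
  filter_upwards [nhdsWithin_le_nhds (Ioi_mem_nhds (one_pos : (0 : ℝ) < 1))] with t ht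
  rw [Complex.integral_cpow_mul_exp_neg_mul_Ioi ha ht, one_div, Complex.inv_cpow, ← Complex.cpow_neg]
  rw [Complex.arg_ofReal_of_nonneg (le_of_lt ht)]
  exact Real.pi_pos.ne

/-- The Fourier transform of the density of the Gamma distribution, inverted. -/
lemma integral_cpow_mul_exp (hy : 0 < y) (hα : 1 < α.re) {l : ℝ} (hl : l ≠ 0) :
    ∫ x : ℝ, (y - x * Complex.I : ℂ) ^ (-α) * Complex.exp (-(l * x * Complex.I))
      = if 0 < l then 2 * π / Complex.Gamma α * (l : ℂ) ^ (α - 1) * Complex.exp (-(l * y)) else 0 := by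
  set h : ℝ → ℂ := (Ioi (0 : ℝ)).indicator fun t => (t : ℂ) ^ (α - 1) * Complex.exp (-(y * t)) with hh
  have hα0 : 0 < α.re := by linarith
  have hint : Integrable h := by
    rw [hh, integrable_indicator_iff measurableSet_Ioi]
    exact integrableOn_cpow_mul_exp hα0 (by simpa using hy)
  have hF : ∀ w : ℝ, FourierTransform.fourier h w = Complex.Gamma α * (y - (-(2 * π) * w : ℝ) * Complex.I) ^ (-α) := by
    intro w
    rw [Real.fourier_real_eq_integral_exp_smul]
    have h1 : (fun v : ℝ => Complex.exp (↑(-2 * π * v * w) * Complex.I) • h v)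
        = (Ioi (0 : ℝ)).indicator fun t => (t : ℂ) ^ (α - 1) *
          Complex.exp (-((y - (-(2 * π) * w : ℝ) * Complex.I) * t)) := by
      funext v
      by_cases hv : v ∈ Ioi (0 : ℝ)
      · rw [hh, indicator_of_mem hv, indicator_of_mem hv, smul_eq_mul, mul_left_comm, ← Complex.exp_add]
        congr 2; push_cast; ring
      · rw [hh, indicator_of_notMem hv, indicator_of_notMem hv, smul_zero]
    rw [h1, integral_indicator measurableSet_Ioi,
      integral_cpow_mul_exp_neg_mul hα0 (by simp [hy]), mul_comm]
  have hFint : Integrable (FourierTransform.fourier h) := by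
    have h1 : Integrable fun x : ℝ => Complex.Gamma α * (y - x * Complex.I : ℂ) ^ (-α) := by
      have := (integrable_archKernel (ω := 0) hy (j := 0) (α := α) (by simpa using hα) 0)
      simpa [archKernel] using this.const_mul (Complex.Gamma α)
    have h2 := h1.comp_mul_left' (R := -(2 * π)) (by simp [Real.pi_ne_zero])
    refine h2.congr (ae_of_all _ fun w => ?_)
    exact (hF w).symm
  have hcont : ContinuousAt h l := by
    rcases lt_or_gt_of_ne hl with hl' | hl'
    · have : h =ᶠ[𝓝 l] fun _ => 0 := by
        filter_upwards [Iio_mem_nhds hl'] with t ht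
        rw [hh, indicator_of_notMem (by simpa using (le_of_lt ht))]
      exact continuousAt_const.congr this.symm
    · have : h =ᶠ[𝓝 l] fun t => (t : ℂ) ^ (α - 1) * Complex.exp (-(y * t)) := by
        filter_upwards [Ioi_mem_nhds hl'] with t ht
        rw [hh, indicator_of_mem ht]
      refine ContinuousAt.congr ?_ this.symm
      refine ContinuousAt.mul ?_ (by fun_prop)
      exact ContinuousAt.cpow (by fun_prop) continuousAt_const (Or.inl (by simpa using hl'))
  have hinv := hint.fourierInv_fourier_eq hFint hcont
  rw [Real.fourierInv_eq'] at hinv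
  have h3 : (∫ v : ℝ, Complex.exp (↑(2 * π * inner ℝ v l) * Complex.I) • FourierTransform.fourier h v)
      = Complex.Gamma α * ((2 * π)⁻¹ * ∫ x : ℝ, (y - x * Complex.I : ℂ) ^ (-α) * Complex.exp (-(l * x * Complex.I))) := by
    have h4 := Measure.integral_comp_mul_left (fun x : ℝ => (y - x * Complex.I : ℂ) ^ (-α) * Complex.exp (-(l * x * Complex.I)))
      (-(2 * π))
    have h5 : |(-(2 * π))⁻¹| = (2 * π)⁻¹ := by
      rw [inv_neg, abs_neg, abs_of_pos (by positivity)]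
    rw [h5] at h4
    have h6 : (((2 * π)⁻¹ : ℝ) • ∫ x : ℝ, (y - x * Complex.I : ℂ) ^ (-α) * Complex.exp (-(l * x * Complex.I)))
      = (2 * π)⁻¹ * ∫ x : ℝ, (y - x * Complex.I : ℂ) ^ (-α) * Complex.exp (-(l * x * Complex.I)) := by
      rw [Complex.real_smul]
    rw [← h6, ← h4, ← integral_const_mul]
    refine integral_congr_ae (ae_of_all _ fun w => ?_)
    dsimp only
    rw [hF w, smul_eq_mul, mul_comm, mul_assoc]
    congr 3
    simp [mul_comm, mul_left_comm, mul_assoc]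
  rw [h3] at hinv
  have hG : Complex.Gamma α ≠ 0 := Complex.Gamma_ne_zero_of_re_pos hα0
  have hpi : (π : ℂ) ≠ 0 := by exact_mod_cast Real.pi_ne_zero
  have h7 : (∫ x : ℝ, (y - x * Complex.I : ℂ) ^ (-α) * Complex.exp (-(l * x * Complex.I)))
      = 2 * π / Complex.Gamma α * h l := by
    rw [← hinv]
    generalize (∫ x : ℝ, (y - x * Complex.I : ℂ) ^ (-α) * Complex.exp (-(l * x * Complex.I))) = J
    push_cast; field_simp
  rw [h7, hh]
  split_ifs with hl0
  · rw [indicator_of_mem (show l ∈ Ioi (0 : ℝ) from hl0), mul_assoc, mul_comm (y : ℂ)]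
  · rw [indicator_of_notMem (by simpa using hl0), mul_zero]

/-- The Fourier inversion above, for `j = 0`: the function is supported on `u > -ω`. -/
lemma archF_zero (hy : 0 < y) (hα : 1 < α.re) {u : ℝ} (hu : ω + u ≠ 0) :
    archF α y ω 0 u = if 0 < ω + u then
      2 * π / Complex.Gamma α * ((ω + u : ℝ) : ℂ) ^ (α - 1) * Complex.exp (-((ω + 2 * u) * y)) else 0 := by
  have h1 : archF α y ω 0 u = (∫ x : ℝ, (y - x * Complex.I : ℂ) ^ (-α) *
      Complex.exp (-((ω + u : ℝ) * x * Complex.I))) * Complex.exp (-(u * y)) := by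
    rw [archF, ← integral_mul_const]
    refine integral_congr_ae (ae_of_all _ fun x => ?_)
    dsimp only
    rw [archKernel, pow_zero, mul_one, mul_assoc, mul_assoc ((y - x * Complex.I : ℂ) ^ (-α)), ← Complex.exp_add,
      ← Complex.exp_add]
    congr 2; push_cast; ring
  rw [h1, integral_cpow_mul_exp hy hα hu]
  split_ifs
  · rw [mul_assoc, ← Complex.exp_add]; congr 2; push_cast; ring
  · rw [zero_mul]

/-- Interchange of the integration with the Gamma integral for `(y + ix)^{-β-m}`; the shift by `m`
makes the latter converge when `Re β ≤ 0`. -/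
lemma integral_mul_Gamma (hy : 0 < y) {β : ℂ} {m : ℕ} (hm : m + 1 < α.re) (hβ : 0 < β.re + m) :
    (∫ x : ℝ, (y - x * Complex.I : ℂ) ^ (-α) * (y + x * Complex.I : ℂ) ^ (-β) *
        Complex.exp (-(ω * x * Complex.I))) * Complex.Gamma (β + m)
      = ∫ u in Ioi (0 : ℝ), (u : ℂ) ^ (β + m - 1) * archF α y ω m u := by
  have hre : (β + m).re = β.re + m := by simp
  have hint : Integrable (Function.uncurry fun (u : ℝ) (x : ℝ) => (u : ℂ) ^ (β + m - 1) * archKernel α y ω m u x)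
      ((volume.restrict (Ioi (0 : ℝ))).prod volume) := by
    have h1 : IntegrableOn (fun u : ℝ => u ^ (β.re + m - 1) * Real.exp (-(u * y))) (Ioi 0) := by
      have := integrableOn_rpow_mul_exp_neg_mul_rpow (s := β.re + m - 1) (p := 1) (b := y) (by linarith)
        one_pos hy
      refine this.congr_fun (fun u _ => ?_) measurableSet_Ioi
      simp [mul_comm]
    have h2 := (Integrable.mul_prod (h1.integrable) (integrable_norm_rpow hy (p := α.re - m) (by linarith))).const_mul
      (Real.exp (π * |α.im|))
    refine h2.mono' ?_ ?_
    · refine Measurable.aestronglyMeasurable ?_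
      refine Measurable.mul ?_ (measurable_archKernel α y ω m)
      fun_prop
    · have h3 : ∀ᵐ p : ℝ × ℝ ∂((volume.restrict (Ioi (0 : ℝ))).prod volume), p.1 ∈ Ioi (0 : ℝ) := by
        have := Measure.quasiMeasurePreserving_fst (μ := volume.restrict (Ioi (0 : ℝ))) (ν := (volume : Measure ℝ))
        exact this.ae (ae_restrict_mem measurableSet_Ioi)
      filter_upwards [h3] with p hp
      have h4 : ‖((p.1 : ℂ)) ^ (β + m - 1)‖ = p.1 ^ (β.re + m - 1) := by
        rw [Complex.norm_cpow_eq_rpow_re_of_pos hp]; simp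
      simp only [Function.uncurry]
      rw [norm_mul, h4]
      refine (mul_le_mul_of_nonneg_left (norm_archKernel_le hy m p.1 p.2)
        (Real.rpow_nonneg (le_of_lt hp) _)).trans (le_of_eq (by ring))
  have hswap := integral_integral_swap hint
  have h1 : ∀ u : ℝ, ∫ x : ℝ, (u : ℂ) ^ (β + m - 1) * archKernel α y ω m u x
      = (u : ℂ) ^ (β + m - 1) * archF α y ω m u := fun u => by rw [integral_const_mul]; rfl
  simp only [h1] at hswap
  rw [hswap, ← integral_mul_const]
  refine integral_congr_ae (ae_of_all _ fun x => ?_)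
  dsimp only
  have h2 : ∀ u : ℝ, (u : ℂ) ^ (β + m - 1) * archKernel α y ω m u x
      = ((y - x * Complex.I) ^ (-α) * (y + x * Complex.I) ^ m * Complex.exp (-(ω * x * Complex.I))) *
        ((u : ℂ) ^ (β + m - 1) * Complex.exp (-((y + x * Complex.I) * u))) := fun u => by
    rw [archKernel, mul_comm (u : ℂ) (y + x * Complex.I)]; ring
  simp only [h2]
  rw [integral_const_mul, integral_cpow_mul_exp_neg_mul (by rw [hre]; exact hβ) (by simp [hy])]
  · have h3 : (y + x * Complex.I : ℂ) ^ (-β)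
        = (y + x * Complex.I : ℂ) ^ m * (y + x * Complex.I : ℂ) ^ (-(β + m)) := by
      rw [← Complex.cpow_natCast, ← Complex.cpow_add _ _ (add_mul_I_ne_zero hy x)]
      congr 1; ring
    rw [h3]; ring

end Archimedean

section Archimedean

open MeasureTheory Set Filter

variable {α β : ℂ} {y w ω : ℝ}

lemma iteratedDeriv_archF (hy : 0 < y) (K : ℂ) (w : ℝ) {j : ℕ} (hj : j + 1 < α.re) :
    iteratedDeriv j (fun t : ℝ => K * archF α y ω 0 (w * t))
      = fun t : ℝ => K * (-w) ^ j * archF α y ω j (w * t) := by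
  induction j with
  | zero => funext t; rw [iteratedDeriv_zero, pow_zero, mul_one]
  | succ j ih =>
    push_cast at hj
    rw [iteratedDeriv_succ, ih (by linarith)]
    funext t
    have h1 : HasDerivAt (fun t : ℝ => archF α y ω j (w * t)) _ t := (hasDerivAt_archF (ω := ω) hy (by linarith : (j : ℝ) + 2 < α.re) (w * t)).scomp t
      ((hasDerivAt_id t).const_mul w)
    rw [(h1.const_mul (K * (-w) ^ j)).deriv, Complex.real_smul, pow_succ]
    push_cast; ring

/-- The archimedean integral for positive frequency. -/
lemma integral_eq_kummerU_of_pos (hy : 0 < y) (hw : 0 < w) (hα : 1 < α.re) (hαβ : 2 < α.re + β.re) :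
    (∫ x : ℝ, (y - x * Complex.I : ℂ) ^ (-α) * (y + x * Complex.I : ℂ) ^ (-β) *
        Complex.exp (-(w * x * Complex.I)))
      = 2 * π / Complex.Gamma α * (w : ℂ) ^ (α + β - 1) * Complex.exp (-(w * y)) *
        kummerU β (α + β) (2 * w * y) := by
  -- the shift that occurs in the definition of `kummerU`
  set m : ℕ := ⌊1 - β.re⌋₊ with hm
  have hm1 : 1 - β.re < m + 1 := Nat.lt_floor_add_one _
  have hm2 : m + 1 < α.re := by
    rcases le_or_gt 0 (1 - β.re) with h | h
    · have := Nat.floor_le h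
      rw [← hm] at this; linarith
    · have : m = 0 := Nat.floor_of_nonpos h.le
      rw [this]; simpa using hα
  have hβm : 0 < β.re + m := by linarith
  have hΓ : Complex.Gamma (β + m) ≠ 0 := Complex.Gamma_ne_zero_of_re_pos (by simpa using hβm)
  have hΓα : Complex.Gamma α ≠ 0 := Complex.Gamma_ne_zero_of_re_pos (by linarith)
  have hwc : (w : ℂ) ≠ 0 := by exact_mod_cast hw.ne'
  have hpi : (π : ℂ) ≠ 0 := by exact_mod_cast Real.pi_ne_zero
  have hJ := integral_mul_Gamma (α := α) (ω := w) hy hm2 hβm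
  set J := (∫ x : ℝ, (y - x * Complex.I : ℂ) ^ (-α) * (y + x * Complex.I : ℂ) ^ (-β) *
        Complex.exp (-(w * x * Complex.I)))
  set K : ℂ := 2 * π / Complex.Gamma α * (w : ℂ) ^ (α - 1) * Complex.exp (-(w * y)) with hK
  have hwα : (w : ℂ) ^ (α - 1) ≠ 0 := by simp [Complex.cpow_eq_zero_iff, hwc]
  have hK0 : K ≠ 0 := by
    rw [hK]
    exact mul_ne_zero (mul_ne_zero (div_ne_zero (mul_ne_zero two_ne_zero hpi) hΓα) hwα) (Complex.exp_ne_zero _)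
  -- the integrand of `kummerU` is a multiple of the inverted Fourier transform
  have hder : ∀ t ∈ Ioi (0 : ℝ), iteratedDeriv m (fun u : ℝ => Complex.exp (-((2 * w * y : ℝ) * u)) *
      (1 + (u : ℂ)) ^ (α + β - β - 1)) t = K⁻¹ * (-w) ^ m * archF α y w m (w * t) := by
    intro t ht
    rw [← congrFun (iteratedDeriv_archF hy K⁻¹ w hm2) t]
    refine Filter.EventuallyEq.iteratedDeriv_eq m ?_
    filter_upwards [Ioi_mem_nhds (show (0 : ℝ) < t from ht)] with u hu
    have hu0 : (0 : ℝ) < u := hu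
    have h1 : 0 < w + w * u := by positivity
    rw [archF_zero hy hα h1.ne', if_pos h1, show w + w * u = w * (1 + u) by ring, Complex.ofReal_mul w (1 + u),
      Complex.mul_cpow_ofReal_nonneg hw.le (by positivity)]
    rw [eq_inv_mul_iff_mul_eq₀ hK0, hK, add_sub_cancel_right]
    have h2 : Complex.exp (-((w + 2 * ((w * u : ℝ) : ℂ)) * y))
        = Complex.exp (-(w * y)) * Complex.exp (-((2 * w * y : ℝ) * u)) := by
      rw [← Complex.exp_add]; congr 1; push_cast; ring
    rw [h2]; push_cast; ring
  have hU : kummerU β (α + β) (2 * w * y) = (-1) ^ m / Complex.Gamma (β + m) *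
      (K⁻¹ * (-w) ^ m * ((w : ℂ) ^ (β + m - 1))⁻¹ * ((w : ℂ)⁻¹ * (J * Complex.Gamma (β + m)))) := by
    rw [hJ]
    have h1 := integral_comp_mul_left_Ioi (fun u : ℝ => (u : ℂ) ^ (β + m - 1) * archF α y w m u) 0 hw
    rw [mul_zero, Complex.real_smul] at h1
    push_cast at h1
    rw [← h1, ← integral_const_mul, kummerU]
    rw [← hm]
    congr 1
    refine setIntegral_congr_fun measurableSet_Ioi fun t ht => ?_
    rw [hder t ht]
    have h2 : ((w : ℂ) * t) ^ (β + m - 1) = (w : ℂ) ^ (β + m - 1) * (t : ℂ) ^ (β + m - 1) :=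
      Complex.mul_cpow_ofReal_nonneg hw.le (le_of_lt ht) _
    have h3 : (w : ℂ) ^ (β + m - 1) ≠ 0 := by simp [Complex.cpow_eq_zero_iff, hwc]
    rw [h2]
    field_simp
  have h4 : (w : ℂ) ^ (α + β - 1) = (w : ℂ) ^ (α - 1) * (w : ℂ) ^ β := by
    rw [← Complex.cpow_add _ _ hwc]; congr 1; ring
  have h5 : (w : ℂ) ^ (β + m - 1) = (w : ℂ) ^ β * (w : ℂ) ^ m * (w : ℂ)⁻¹ := by
    rw [Complex.cpow_sub _ _ hwc, Complex.cpow_add _ _ hwc, Complex.cpow_natCast, Complex.cpow_one, div_eq_mul_inv]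
  have h6 : (w : ℂ) ^ β ≠ 0 := by simp [Complex.cpow_eq_zero_iff, hwc]
  have h7 : ((-1 : ℂ)) ^ m * (-w) ^ m = (w : ℂ) ^ m := by rw [← mul_pow]; congr 1; ring
  have h8 : 2 * π / Complex.Gamma α * (w : ℂ) ^ (α + β - 1) * Complex.exp (-(w * y)) = K * (w : ℂ) ^ β := by
    rw [h4, hK]; ring
  rw [h8, hU, h5]
  calc J = ((w : ℂ) ^ m) * ((w : ℂ) ^ m)⁻¹ * J := by field_simp
    _ = ((-1 : ℂ)) ^ m * (-w) ^ m * ((w : ℂ) ^ m)⁻¹ * J := by rw [h7]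
    _ = _ := by field_simp

/-- For negative frequency `-w` the function vanishes below `w`; for `j > 0` as a derivative. -/
lemma archF_eq_zero (hy : 0 < y) {j : ℕ} (hj : j + 1 < α.re) {u : ℝ} (hu : u < w) :
    archF α y (-w) j u = 0 := by
  have h1 := congrFun (iteratedDeriv_archF (α := α) (ω := -w) hy 1 1 hj) u
  have h2 : (fun t : ℝ => (1 : ℂ) * archF α y (-w) 0 (1 * t)) =ᶠ[𝓝 u] fun _ => (0 : ℂ) := by
    filter_upwards [Iio_mem_nhds hu] with t ht
    have ht' : t < w := ht
    rw [one_mul, one_mul, archF_zero hy (by linarith [(Nat.cast_nonneg j : (0 : ℝ) ≤ j)]) (by linarith),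
      if_neg (by linarith)]
  rw [h2.iteratedDeriv_eq j, iteratedDeriv_const] at h1
  simp only [one_mul] at h1
  have h3 : ((-(1 : ℝ) : ℂ)) ^ j ≠ 0 := pow_ne_zero _ (by simp)
  have h4 := h1.symm
  rw [ite_self] at h4
  exact (mul_eq_zero.mp h4).resolve_left h3

lemma integrableOn_cpow_mul_archF (hy : 0 < y) (hw : 0 < w) {j : ℕ} (hj : j + 1 < α.re) (p : ℂ) :
    IntegrableOn (fun u : ℝ => (u : ℂ) ^ p * archF α y (-w) j u) (Ioi (w / 2)) := by
  obtain ⟨C, hC0, hC⟩ := norm_archF_le hy hj (-w)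
  have h1 : IntegrableOn (fun u : ℝ => u ^ p.re * Real.exp (-(u * y))) (Ioi (w / 2)) := by
    refine integrable_of_isBigO_exp_neg (b := y / 2) (by linarith) ?_ ?_
    · refine ContinuousOn.mul (fun u hu => ?_) (by fun_prop)
      have : 0 < u := lt_of_lt_of_le (by linarith) (show w / 2 ≤ u from hu)
      exact (Real.continuousAt_rpow_const _ _ (Or.inl this.ne')).continuousWithinAt
    · have h2 := (isLittleO_rpow_exp_pos_mul_atTop p.re (show 0 < y / 2 by linarith)).isBigO
      have h3 := h2.mul (Asymptotics.isBigO_refl (fun u : ℝ => Real.exp (-(u * y))) atTop)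
      refine h3.congr_right fun u => ?_
      rw [← Real.exp_add]; congr 1; ring
  refine Integrable.mono' (h1.const_mul C) ?_ ?_
  · exact (Measurable.aestronglyMeasurable (by fun_prop)).mul
      (continuous_archF hy hj).aestronglyMeasurable
  · refine (ae_restrict_mem measurableSet_Ioi).mono fun u hu => ?_
    have : 0 < u := lt_trans (by linarith) (show w / 2 < u from hu)
    rw [norm_mul, Complex.norm_cpow_eq_rpow_re_of_pos this]
    calc _ ≤ u ^ p.re * (C * Real.exp (-(u * y))) := by
          have := hC u; gcongr
      _ = _ := by ring

lemma tendsto_cpow_mul_archF (hy : 0 < y) {j : ℕ} (hj : j + 1 < α.re) (p : ℂ) :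
    Tendsto (fun u : ℝ => (u : ℂ) ^ p * archF α y (-w) j u) atTop (𝓝 0) := by
  obtain ⟨C, hC0, hC⟩ := norm_archF_le hy hj (-w)
  have h1 : Tendsto (fun u : ℝ => C * (u ^ p.re * Real.exp (-y * u))) atTop (𝓝 0) := by
    have := tendsto_rpow_mul_exp_neg_mul_atTop_nhds_zero p.re y hy
    simpa using this.const_mul C
  refine squeeze_zero_norm' ?_ h1
  filter_upwards [eventually_gt_atTop 0] with u hu
  rw [norm_mul, Complex.norm_cpow_eq_rpow_re_of_pos hu]
  calc _ ≤ u ^ p.re * (C * Real.exp (-(u * y))) := by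
        have := hC u; gcongr
    _ = _ := by rw [show -y * u = -(u * y) by ring]; ring

lemma setIntegral_archF (hy : 0 < y) {j : ℕ} (hj : j + 1 < α.re) (p : ℂ) {a : ℝ}
    (ha0 : 0 ≤ a) (ha : a < w) :
    ∫ u in Ioi (0 : ℝ), (u : ℂ) ^ p * archF α y (-w) j u
      = ∫ u in Ioi a, (u : ℂ) ^ p * archF α y (-w) j u := by
  refine setIntegral_eq_of_subset_of_forall_sdiff_eq_zero measurableSet_Ioi (Ioi_subset_Ioi ha0) fun u hu => ?_
  rw [archF_eq_zero hy hj (lt_of_le_of_lt (not_lt.mp hu.2) ha), mul_zero]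

/-- Partial integration. -/
lemma integral_cpow_mul_archF_succ (hy : 0 < y) (hw : 0 < w) {j : ℕ} (hj : j + 2 < α.re) (p : ℂ) :
    ∫ u in Ioi (0 : ℝ), (u : ℂ) ^ p * archF α y (-w) (j + 1) u
      = p * ∫ u in Ioi (0 : ℝ), (u : ℂ) ^ (p - 1) * archF α y (-w) j u := by
  have hj1 : (j : ℝ) + 1 < α.re := by linarith
  have hj2 : ((j + 1 : ℕ) : ℝ) + 1 < α.re := by push_cast; linarith
  rw [setIntegral_archF hy hj2 p (a := w / 2) (by linarith) (by linarith),
    setIntegral_archF hy hj1 (p - 1) (a := w / 2) (by linarith) (by linarith)]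
  have hpos : ∀ u ∈ Ioi (w / 2), 0 < u := fun u hu => lt_trans (by linarith) (show w / 2 < u from hu)
  have h := integral_Ioi_mul_deriv_eq_deriv_mul (a := w / 2) (a' := (0 : ℂ)) (b' := (0 : ℂ))
    (u := fun u : ℝ => (u : ℂ) ^ p) (u' := fun u : ℝ => p * (u : ℂ) ^ (p - 1))
    (v := archF α y (-w) j) (v' := fun u => -archF α y (-w) (j + 1) u)
    (fun u hu => by
      have h1 := (hasDerivAt_id (u : ℂ)).cpow_const (c := p) (Or.inl (by simpa using hpos u hu))
      have h2 := h1.comp_ofReal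
      simpa using h2)
    (fun u _ => hasDerivAt_archF hy hj u)
    (by
      have := (integrableOn_cpow_mul_archF hy hw hj2 p).neg
      refine this.congr_fun (fun u _ => ?_) measurableSet_Ioi
      simp)
    (by
      have := (integrableOn_cpow_mul_archF hy hw hj1 (p - 1)).const_mul p
      refine IntegrableOn.congr_fun this (fun u _ => ?_) measurableSet_Ioi
      simp [mul_assoc])
    (by
      have h0 : (fun _ : ℝ => (0 : ℂ)) =ᶠ[𝓝[>] (w / 2)]
          ((fun u : ℝ => (u : ℂ) ^ p) * archF α y (-w) j) := by
        filter_upwards [nhdsWithin_le_nhds (Iio_mem_nhds (show w / 2 < w by linarith))] with u hu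
        rw [Pi.mul_apply, archF_eq_zero hy hj1 hu, mul_zero]
      exact tendsto_const_nhds.congr' h0)
    (tendsto_cpow_mul_archF hy hj1 p)
  simp only [mul_neg, integral_neg, sub_zero, zero_sub, neg_inj, mul_assoc] at h
  rw [h, integral_const_mul]

/-- The shift `j` in `∫ u^{β+j-1} F_j(u) du / Γ(β + j)` can be removed by partial integration; no
boundary term arises at `0`, since the functions vanish there, so `β` is arbitrary. -/
lemma integral_cpow_mul_archF_mul_inv_Gamma (hy : 0 < y) (hw : 0 < w) {j : ℕ} (hj : j + 1 < α.re) (β : ℂ) :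
    (∫ u in Ioi (0 : ℝ), (u : ℂ) ^ (β + j - 1) * archF α y (-w) j u) * (Complex.Gamma (β + j))⁻¹
      = (∫ u in Ioi (0 : ℝ), (u : ℂ) ^ (β - 1) * archF α y (-w) 0 u) * (Complex.Gamma β)⁻¹ := by
  induction j with
  | zero => simp
  | succ j ih =>
    push_cast at hj
    rw [← ih (by linarith), integral_cpow_mul_archF_succ hy hw (by linarith),
      Complex.one_div_Gamma_eq_self_mul_one_div_Gamma_add_one (β + j)]
    push_cast
    rw [show β + (j + 1) - 1 = β + j by ring, show β + j + 1 = β + (j + 1) by ring]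
    ring

/-- The archimedean integral for negative frequency. -/
lemma integral_eq_kummerU_of_neg (hy : 0 < y) (hw : 0 < w) (hα : 1 < α.re) (hαβ : 2 < α.re + β.re) :
    (∫ x : ℝ, (y - x * Complex.I : ℂ) ^ (-α) * (y + x * Complex.I : ℂ) ^ (-β) *
        Complex.exp (-((-w : ℝ) * x * Complex.I)))
      = 2 * π / Complex.Gamma β * (w : ℂ) ^ (α + β - 1) * Complex.exp (-(w * y)) *
        kummerU α (α + β) (2 * w * y) := by
  set m : ℕ := ⌊1 - β.re⌋₊ with hm
  have hm1 : 1 - β.re < m + 1 := Nat.lt_floor_add_one _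
  have hm2 : m + 1 < α.re := by
    rcases le_or_gt 0 (1 - β.re) with h | h
    · have := Nat.floor_le h
      rw [← hm] at this; linarith
    · have : m = 0 := Nat.floor_of_nonpos h.le
      rw [this]; simpa using hα
  have hβm : 0 < β.re + m := by linarith
  have hΓ : Complex.Gamma (β + m) ≠ 0 := Complex.Gamma_ne_zero_of_re_pos (by simpa using hβm)
  have hΓα : Complex.Gamma α ≠ 0 := Complex.Gamma_ne_zero_of_re_pos (by linarith)
  have hwc : (w : ℂ) ≠ 0 := by exact_mod_cast hw.ne'
  have hJ := integral_mul_Gamma (α := α) (ω := -w) hy hm2 hβm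
  rw [← eq_mul_inv_iff_mul_eq₀ hΓ, integral_cpow_mul_archF_mul_inv_Gamma hy hw hm2] at hJ
  rw [hJ]
  -- `Re α > 1`, so that the integral for `kummerU` needs no shift
  have hU : kummerU α (α + β) (2 * w * y) = 1 / Complex.Gamma α * ∫ t in Ioi (0 : ℝ), (t : ℂ) ^ (α - 1) *
      (Complex.exp (-((2 * w * y : ℝ) * t)) * (1 + (t : ℂ)) ^ (β - 1)) := by
    have h0 : ⌊1 - α.re⌋₊ = 0 := Nat.floor_of_nonpos (by linarith)
    rw [kummerU]
    simp only [h0, Nat.cast_zero, add_zero, pow_zero, iteratedDeriv_zero, add_sub_cancel_left]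
  have h1 : ∫ u in Ioi (0 : ℝ), (u : ℂ) ^ (β - 1) * archF α y (-w) 0 u
      = ∫ u in Ioi (0 : ℝ), 2 * π / Complex.Gamma α * (w : ℂ) ^ (α + β - 1) * Complex.exp (-(w * y)) *
        ((u : ℂ) ^ (α - 1) * (Complex.exp (-((2 * w * y : ℝ) * u)) * (1 + (u : ℂ)) ^ (β - 1))) := by
    have h2 : ∫ u in Ioi (0 : ℝ), (u : ℂ) ^ (β - 1) * archF α y (-w) 0 u
        = ∫ u in Ioi w, (u : ℂ) ^ (β - 1) * archF α y (-w) 0 u := by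
      refine setIntegral_eq_of_subset_of_ae_sdiff_eq_zero measurableSet_Ioi.nullMeasurableSet
        (Ioi_subset_Ioi hw.le) ?_
      have h3 : ∀ᵐ u : ℝ, u ≠ w := by simp [ae_iff]
      filter_upwards [h3] with u hu hu'
      have h4 : u < w := lt_of_le_of_ne (not_lt.mp hu'.2) hu
      rw [archF_eq_zero hy (by simpa using hα) h4, mul_zero]
    -- the substitution `u = w (t + 1)`
    have h5 := integral_comp_mul_left_Ioi' (fun u : ℝ => (u : ℂ) ^ (β - 1) * archF α y (-w) 0 u) 1 hw
    rw [mul_one] at h5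
    have h6 : ∫ t in Ioi (1 : ℝ), (((w * t : ℝ) : ℂ)) ^ (β - 1) * archF α y (-w) 0 (w * t)
        = ∫ t in Ioi (0 : ℝ), (((w * (t + 1) : ℝ) : ℂ)) ^ (β - 1) * archF α y (-w) 0 (w * (t + 1)) := by
      have hmp := (measurePreserving_add_right (volume : Measure ℝ) 1).setIntegral_preimage_emb
        (MeasurableEquiv.addRight (1 : ℝ)).measurableEmbedding
        (fun t : ℝ => (((w * t : ℝ) : ℂ)) ^ (β - 1) * archF α y (-w) 0 (w * t)) (Ioi 1)
      rw [← hmp]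
      congr 2
      ext t; simp
    rw [h2, ← h5, h6, Complex.real_smul, ← integral_const_mul]
    refine setIntegral_congr_fun measurableSet_Ioi fun t ht => ?_
    have ht' : (0 : ℝ) < t := ht
    have h7 : -w + w * (t + 1) = w * t := by ring
    rw [archF_zero hy hα (by rw [h7]; positivity), h7, if_pos (by positivity), Complex.ofReal_mul,
      Complex.ofReal_mul, Complex.mul_cpow_ofReal_nonneg hw.le (by positivity),
      Complex.mul_cpow_ofReal_nonneg hw.le ht'.le]
    have h8 : Complex.exp (-((((-w : ℝ) : ℂ) + 2 * ((w * ((t + 1 : ℝ) : ℂ)))) * y))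
        = Complex.exp (-(w * y)) * Complex.exp (-((2 * w * y : ℝ) * t)) := by
      rw [← Complex.exp_add]; congr 1; push_cast; ring
    have h9 : (w : ℂ) ^ (α + β - 1) = w * (w : ℂ) ^ (α - 1) * (w : ℂ) ^ (β - 1) := by
      nth_rw 2 [← Complex.cpow_one (w : ℂ)]
      rw [← Complex.cpow_add _ _ hwc, ← Complex.cpow_add _ _ hwc]; congr 1; ring
    rw [h8, h9, show ((t + 1 : ℝ) : ℂ) = 1 + t by push_cast; ring]
    ring
  rw [h1, integral_const_mul, hU]
  field_simp

lemma cpow_half_zpow {z : ℂ} (k : ℤ) : (z ^ (1 / 2 : ℂ)) ^ (-k) = z ^ (-(k / 2 : ℂ)) := by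
  rw [← Complex.cpow_mul_int]; congr 1; push_cast; ring

/-- `τ = i (y - ix)`, with all arguments in the principal range. -/
lemma cpow_mul_I_rotate (hy : 0 < y) (x : ℝ) (c : ℂ) :
    (x + y * Complex.I : ℂ) ^ c = Complex.exp (π * Complex.I / 2 * c) * (y - x * Complex.I : ℂ) ^ c := by
  have h0 := sub_mul_I_ne_zero hy x
  have h1 : (x + y * Complex.I : ℂ) = Complex.I * (y - x * Complex.I) := by
    linear_combination (x : ℂ) * Complex.I_sq
  have h2 : |(y - x * Complex.I : ℂ).arg| < π / 2 := by
    rw [Complex.abs_arg_lt_pi_div_two_iff]; left; simpa using hy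
  rw [abs_lt] at h2
  rw [Complex.cpow_def_of_ne_zero (by rw [h1]; exact mul_ne_zero Complex.I_ne_zero h0),
    Complex.cpow_def_of_ne_zero h0, h1, Complex.log_mul Complex.I_ne_zero h0, Complex.log_I, ← Complex.exp_add]
  · congr 1; ring
  · rw [Complex.arg_I]; constructor <;> linarith [Real.pi_pos]

lemma ofReal_cpow_normSq (hy : 0 < y) (x : ℝ) (s : ℂ) :
    ((y / (x ^ 2 + y ^ 2) : ℝ) : ℂ) ^ s
      = (y : ℂ) ^ s * ((y - x * Complex.I : ℂ) ^ (-s) * (y + x * Complex.I : ℂ) ^ (-s)) := by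
  have h2 : |(y - x * Complex.I : ℂ).arg| < π / 2 := by
    rw [Complex.abs_arg_lt_pi_div_two_iff]; left; simpa using hy
  have h3 : |(y + x * Complex.I : ℂ).arg| < π / 2 := by
    rw [Complex.abs_arg_lt_pi_div_two_iff]; left; simpa using hy
  rw [abs_lt] at h2 h3
  rw [div_eq_mul_inv, Complex.ofReal_mul, Complex.mul_cpow_ofReal_nonneg hy.le (by positivity),
    Complex.ofReal_inv, Complex.inv_cpow _ _ (by
      rw [Complex.arg_ofReal_of_nonneg (by positivity)]; exact Real.pi_pos.ne), ← Complex.cpow_neg]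
  congr 1
  have h4 : ((x ^ 2 + y ^ 2 : ℝ) : ℂ) = (y - x * Complex.I) * (y + x * Complex.I) := by
    push_cast
    linear_combination (x ^ 2 : ℂ) * Complex.I_sq
  have h5 := sub_mul_I_ne_zero hy x
  have h6 := add_mul_I_ne_zero hy x
  rw [h4, Complex.cpow_def_of_ne_zero (mul_ne_zero h5 h6), Complex.cpow_def_of_ne_zero h5,
    Complex.cpow_def_of_ne_zero h6, Complex.log_mul h5 h6, ← Complex.exp_add]
  · congr 1; ring
  · constructor <;> linarith

/-- The archimedean integral, in terms of the Whittaker function. -/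
theorem integral_archimedean {κ : ℝ} (hκ : 2 ≤ κ) {k : ℤ} (hk : 2 * κ = k) {s : ℂ} (hs : 1 - κ / 2 < s.re)
    (hy : 0 < y) {n : ℚ} (hn : n ≠ 0) :
    ∫ x : ℝ, ((x + y * Complex.I : ℂ) ^ (1 / 2 : ℂ)) ^ (-k) * ((y / (x ^ 2 + y ^ 2) : ℝ) : ℂ) ^ s *
        e (-(n * x))
      = Complex.exp (π * Complex.I / 4) ^ (-k) * ((2 : ℂ) ^ (κ : ℂ) * (π : ℂ) ^ (κ + s) *
        ((|n| : ℚ) : ℂ) ^ (κ + s - 1) / gammaFactor κ n s) * calW κ s (4 * π * n * y) := by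
  have hα : 1 < ((κ : ℂ) + s).re := by simp; linarith
  have hαβ : 2 < ((κ : ℂ) + s).re + s.re := by simp; linarith
  have hk2 : (k / 2 : ℂ) = κ := by
    have : (k : ℂ) = 2 * κ := by exact_mod_cast hk.symm
    rw [this]; ring
  have hpi : (π : ℂ) ≠ 0 := by exact_mod_cast Real.pi_ne_zero
  -- with `τ = i (y - ix)` the integrand becomes `(y - ix)^{-κ-s} (y + ix)^{-s} e^{-2πinx}`
  have h1 : ∀ x : ℝ, ((x + y * Complex.I : ℂ) ^ (1 / 2 : ℂ)) ^ (-k) * ((y / (x ^ 2 + y ^ 2) : ℝ) : ℂ) ^ s *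
        e (-(n * x)) = Complex.exp (π * Complex.I / 4) ^ (-k) * (y : ℂ) ^ s *
        ((y - x * Complex.I : ℂ) ^ (-(κ + s)) * (y + x * Complex.I : ℂ) ^ (-s) *
        Complex.exp (-((2 * π * n : ℝ) * x * Complex.I))) := by
    intro x
    have e1 : e (-(n * x)) = Complex.exp (-((2 * π * n : ℝ) * x * Complex.I)) := by
      rw [e]; congr 1; push_cast; ring
    have e2 : Complex.exp (π * Complex.I / 2 * -κ) = Complex.exp (π * Complex.I / 4) ^ (-k) := by
      rw [← Complex.exp_int_mul]; congr 1
      rw [← hk2]; push_cast; ring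
    rw [cpow_half_zpow, hk2, cpow_mul_I_rotate hy, ofReal_cpow_normSq hy, e1, e2, neg_add,
      Complex.cpow_add _ _ (sub_mul_I_ne_zero hy x)]
    ring
  simp only [h1]
  rw [integral_const_mul, mul_assoc (Complex.exp _ ^ (-k)), mul_assoc (Complex.exp _ ^ (-k))]
  congr 1
  have hexp1 : (1 / 2 - ((1 - κ : ℂ) / 2 - s)) = κ / 2 + s := by ring
  have hexp2 : (1 - 2 * ((1 - κ : ℂ) / 2 - s)) = κ + s + s := by ring
  -- the powers of `n` and `y`
  have hpow : ∀ v : ℝ, 0 < v → (y : ℂ) ^ s * (2 * π * ((2 * π * v : ℝ) : ℂ) ^ ((κ : ℂ) + s + s - 1))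
      = (2 : ℂ) ^ (κ : ℂ) * (π : ℂ) ^ (κ + s) * (v : ℂ) ^ (κ + s - 1) *
        ((((4 * π * v * y : ℝ)) ^ (-κ / 2) : ℝ) : ℂ) * ((4 * π * v * y : ℝ) : ℂ) ^ (κ / 2 + s) := by
    intro v hv
    have hvc : (v : ℂ) ≠ 0 := by exact_mod_cast hv.ne'
    have hz : (0 : ℝ) < 4 * π * v * y := by positivity
    have hzc : ((4 * π * v * y : ℝ) : ℂ) ≠ 0 := by exact_mod_cast hz.ne'
    have e1 : ((((4 * π * v * y : ℝ)) ^ (-κ / 2) : ℝ) : ℂ) * ((4 * π * v * y : ℝ) : ℂ) ^ (κ / 2 + s)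
        = ((4 * π * v * y : ℝ) : ℂ) ^ s := by
      rw [Complex.ofReal_cpow hz.le, ← Complex.cpow_add _ _ hzc]; congr 1; push_cast; ring
    rw [mul_assoc ((2 : ℂ) ^ (κ : ℂ) * (π : ℂ) ^ (κ + s) * (v : ℂ) ^ (κ + s - 1)), e1]
    have e2 : ((4 * π * v * y : ℝ) : ℂ) ^ s = (2 : ℂ) ^ (s + s) * (π : ℂ) ^ s * (v : ℂ) ^ s * (y : ℂ) ^ s := by
      rw [show (4 * π * v * y : ℝ) = (2 * (2 * (π * (v * y))) : ℝ) by ring, Complex.ofReal_mul,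
        Complex.mul_cpow_ofReal_nonneg (by norm_num) (by positivity), Complex.ofReal_mul 2 (π * _),
        Complex.mul_cpow_ofReal_nonneg (by norm_num) (by positivity), Complex.ofReal_mul π,
        Complex.mul_cpow_ofReal_nonneg (by positivity) (by positivity), Complex.ofReal_mul v,
        Complex.mul_cpow_ofReal_nonneg hv.le hy.le, Complex.cpow_add _ _ two_ne_zero]
      push_cast; ring
    have e3 : ((2 * π * v : ℝ) : ℂ) ^ ((κ : ℂ) + s + s - 1)
        = (2 : ℂ) ^ ((κ : ℂ) + s + s - 1) * (π : ℂ) ^ ((κ : ℂ) + s + s - 1) * (v : ℂ) ^ ((κ : ℂ) + s + s - 1) := by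
      rw [mul_assoc, Complex.ofReal_mul, Complex.mul_cpow_ofReal_nonneg (by norm_num) (by positivity),
        Complex.ofReal_mul, Complex.mul_cpow_ofReal_nonneg (by positivity) hv.le]
      push_cast; ring
    have e4 : 2 * (2 : ℂ) ^ ((κ : ℂ) + s + s - 1) = (2 : ℂ) ^ (κ : ℂ) * (2 : ℂ) ^ (s + s) := by
      nth_rw 1 [← Complex.cpow_one (2 : ℂ)]
      rw [← Complex.cpow_add _ _ two_ne_zero, ← Complex.cpow_add _ _ two_ne_zero]; congr 1; ring
    have e5 : (π : ℂ) * (π : ℂ) ^ ((κ : ℂ) + s + s - 1) = (π : ℂ) ^ ((κ : ℂ) + s) * (π : ℂ) ^ s := by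
      nth_rw 1 [← Complex.cpow_one (π : ℂ)]
      rw [← Complex.cpow_add _ _ hpi, ← Complex.cpow_add _ _ hpi]; congr 1; ring
    have e6 : (v : ℂ) ^ ((κ : ℂ) + s + s - 1) = (v : ℂ) ^ ((κ : ℂ) + s - 1) * (v : ℂ) ^ s := by
      rw [← Complex.cpow_add _ _ hvc]; congr 1; ring
    rw [e2, e3, e6]
    linear_combination ((y : ℂ) ^ s * π * (π : ℂ) ^ ((κ : ℂ) + s + s - 1) * ((v : ℂ) ^ ((κ : ℂ) + s - 1) * (v : ℂ) ^ s)) * e4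
      + ((y : ℂ) ^ s * (2 : ℂ) ^ (κ : ℂ) * (2 : ℂ) ^ (s + s) * ((v : ℂ) ^ ((κ : ℂ) + s - 1) * (v : ℂ) ^ s)) * e5
  rcases lt_or_gt_of_ne hn with hneg | hpos
  · have hv : (0 : ℝ) < ((-n : ℚ) : ℝ) := by exact_mod_cast neg_pos.mpr hneg
    have hp := hpow _ hv
    set v : ℝ := ((-n : ℚ) : ℝ) with hvdef
    have hnv : ((n : ℚ) : ℝ) = -v := by rw [hvdef]; push_cast; ring
    have habs : ((|n| : ℚ) : ℂ) = (v : ℂ) := by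
      rw [abs_of_neg hneg, hvdef]; push_cast; rfl
    have hz : (4 * π * (n : ℝ) * y) = -(4 * π * v * y) := by rw [hnv]; ring
    have hz0 : (0 : ℝ) < 4 * π * v * y := by positivity
    rw [show (2 * π * (n : ℝ)) = -(2 * π * v) by rw [hnv]; ring,
      integral_eq_kummerU_of_neg hy (by positivity) hα hαβ, habs, gammaFactor, if_neg (by linarith), hz, calW,
      whittakerW, abs_neg, abs_of_pos hz0, sign_neg (neg_lt_zero.mpr hz0)]
    have hexp3 : (1 / 2 - ((1 - κ : ℂ) / 2 - s) - ((-1 : SignType) : ℂ) * κ / 2) = κ + s := by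
      simp; ring
    rw [hexp3, hexp1, hexp2, show 2 * (2 * π * v) * y = 4 * π * v * y by ring,
      show -((4 * π * v * y : ℝ) : ℂ) / 2 = -((2 * π * v : ℝ) * y) by push_cast; ring]
    linear_combination ((Complex.Gamma s)⁻¹ * Complex.exp (-((2 * π * v : ℝ) * y)) *
      kummerU (κ + s) (κ + s + s) (4 * π * v * y)) * hp
  · have hv : (0 : ℝ) < (n : ℝ) := by exact_mod_cast hpos
    have hp := hpow _ hv
    set v : ℝ := (n : ℝ) with hvdef
    have habs : ((|n| : ℚ) : ℂ) = (v : ℂ) := by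
      rw [abs_of_pos hpos, hvdef]; push_cast; rfl
    have hz0 : (0 : ℝ) < 4 * π * v * y := by positivity
    rw [integral_eq_kummerU_of_pos hy (by positivity) hα hαβ, habs, gammaFactor, if_pos hpos, calW,
      whittakerW, abs_of_pos hz0, sign_pos hz0]
    have hexp3 : (1 / 2 - ((1 - κ : ℂ) / 2 - s) - ((1 : SignType) : ℂ) * κ / 2) = s := by
      simp; ring
    rw [hexp3, hexp1, hexp2, show 2 * (2 * π * v) * y = 4 * π * v * y by ring,
      show -((4 * π * v * y : ℝ) : ℂ) / 2 = -((2 * π * v : ℝ) * y) by push_cast; ring, add_comm s (κ : ℂ)]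
    linear_combination ((Complex.Gamma (κ + s))⁻¹ * Complex.exp (-((2 * π * v : ℝ) * y)) *
      kummerU s (κ + s + s) (4 * π * v * y)) * hp

end Archimedean

/-! ### Cosets of the metaplectic group and coprime rows -/
namespace Mp2Z

/-- The element with bottom row `v` and with the principal branch of the square root, up to the
choice of the upper row. -/
def ofRow (v : Fin 2 → ℤ) (hv : IsCoprime (v 0) (v 1)) (ε : ℤˣ) : Mp2Z where
  mat := (IsCoprime.exists_SL2_row hv 1).choose
  phi := fun τ => (ε : ℤ) * ((v 0 : ℂ) * τ + v 1) ^ (1 / 2 : ℂ)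
  holo := by
    rcases eq_or_ne (v 0) 0 with h0 | h0
    · simp only [h0, Int.cast_zero, zero_mul]
      exact mdifferentiable_const
    · intro τ
      have him : ((v 0 : ℂ) * τ + v 1).im ≠ 0 := by
        simp [h0, τ.im_ne_zero]
      have hd0 : DifferentiableAt ℂ (fun z : ℂ => (v 0 : ℂ) * z + v 1) (τ : ℂ) := by fun_prop
      have hd : DifferentiableAt ℂ (fun z : ℂ => ((ε : ℤ) : ℂ) * ((v 0 : ℂ) * z + v 1) ^ (1 / 2 : ℂ)) (τ : ℂ) := by
        exact (hd0.cpow_const (Or.inr him)).const_mul _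
      exact hd.mdifferentiableAt.comp τ (UpperHalfPlane.mdifferentiable_coe τ)
  sq := fun τ => by
    obtain ⟨h1, h2⟩ := (IsCoprime.exists_SL2_row hv 1).choose_spec
    rw [mul_pow, ← Complex.cpow_nat_mul, h1, h2]
    have : (((ε : ℤ) : ℂ)) ^ 2 = 1 := by
      rcases Int.units_eq_one_or ε with rfl | rfl <;> simp
    rw [this]; simp

variable {v : Fin 2 → ℤ} {hv : IsCoprime (v 0) (v 1)} {ε : ℤˣ}

@[simp] lemma ofRow_mat_zero : (ofRow v hv ε).mat 1 0 = v 0 := (IsCoprime.exists_SL2_row hv 1).choose_spec.1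
@[simp] lemma ofRow_mat_one : (ofRow v hv ε).mat 1 1 = v 1 := (IsCoprime.exists_SL2_row hv 1).choose_spec.2
lemma ofRow_phi (τ : ℍ) : (ofRow v hv ε).phi τ = (ε : ℤ) * ((v 0 : ℂ) * τ + v 1) ^ (1 / 2 : ℂ) := rfl

lemma negOne_mul_ofRow : negOne * ofRow v hv ε = ofRow v hv (-ε) := by
  apply Mp2Z.ext
  · change 1 * (ofRow v hv ε).mat = (ofRow v hv ε).mat
    exact one_mul _
  · funext τ
    rw [negOne_mul_phi, ofRow_phi, ofRow_phi]; push_cast; ring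

lemma isCoprime_row (g : Mp2Z) : IsCoprime (g.mat 1 0) (g.mat 1 1) := by
  have h := Matrix.SpecialLinearGroup.det_coe g.mat
  rw [Matrix.det_fin_two] at h
  exact ⟨-g.mat 0 1, g.mat 0 0, by linarith⟩

lemma T_zpow_mul_mat_zero (g : Mp2Z) (m : ℤ) : (T ^ m * g).mat 1 0 = g.mat 1 0 := by
  rw [mul_mat, zpow_mat, T_mat, Matrix.SpecialLinearGroup.coe_mul, ModularGroup.coe_T_zpow]
  simp [Matrix.mul_apply, Fin.sum_univ_two]

lemma T_zpow_mul_mat_one (g : Mp2Z) (m : ℤ) : (T ^ m * g).mat 1 1 = g.mat 1 1 := by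
  rw [mul_mat, zpow_mat, T_mat, Matrix.SpecialLinearGroup.coe_mul, ModularGroup.coe_T_zpow]
  simp [Matrix.mul_apply, Fin.sum_univ_two]

lemma T_zpow_phi (m : ℤ) (τ : ℍ) : (T ^ m).phi τ = 1 := by
  induction m generalizing τ with
  | zero => rw [zpow_zero, one_phi]
  | succ m ih => rw [zpow_add_one, mul_phi, ih, T_phi, mul_one]
  | pred m ih => rw [zpow_sub_one, mul_phi, ih, inv_phi, T_phi, inv_one, mul_one]

/-- Elements with the same bottom row differ by `⟨T, (1, -1)⟩`. -/
lemma exists_T_zpow {g h : Mp2Z} (h0 : g.mat 1 0 = h.mat 1 0) (h1 : g.mat 1 1 = h.mat 1 1) :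
    ∃ m : ℤ, h = T ^ m * g ∨ h = negOne * (T ^ m * g) := by
  have hg := Matrix.SpecialLinearGroup.det_coe g.mat
  have hh := Matrix.SpecialLinearGroup.det_coe h.mat
  rw [Matrix.det_fin_two] at hg hh
  set m : ℤ := h.mat 0 1 * g.mat 0 0 - h.mat 0 0 * g.mat 0 1 with hm
  have hmat : h.mat = (T ^ m * g).mat := by
    rw [mul_mat, zpow_mat, T_mat]
    ext i j
    rw [Matrix.SpecialLinearGroup.coe_mul, ModularGroup.coe_T_zpow]
    fin_cases i <;> fin_cases j <;> simp [Matrix.mul_apply, Fin.sum_univ_two]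
    · rw [← h0, ← h1] at hh
      rw [hm]
      linear_combination (-h.mat 0 0) * hg + g.mat 0 0 * hh
    · rw [← h0, ← h1] at hh
      rw [hm]
      linear_combination (-h.mat 0 1) * hg + g.mat 0 1 * hh
    · exact h0.symm
    · exact h1.symm
  refine ⟨m, ?_⟩
  rcases phi_eq_or_eq_neg hmat with hp | hp
  · exact Or.inl (Mp2Z.ext hmat (funext hp))
  · refine Or.inr (Mp2Z.ext ?_ (funext fun τ => ?_))
    · rw [hmat]
      exact (one_mul _).symm
    · rw [negOne_mul_phi, hp]

end Mp2Z

open Mp2Z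

/-- The cosets of `⟨T⟩` in `Mp₂(ℤ)` are the coprime pairs together with a sign. -/
def cuspEquiv : {v : Fin 2 → ℤ // IsCoprime (v 0) (v 1)} × ℤˣ ≃ CuspCosets :=
  Equiv.ofBijective (fun p => Quotient.mk _ (ofRow p.1.1 p.1.2 p.2)) <| by
    constructor
    · rintro ⟨⟨v, hv⟩, ε⟩ ⟨⟨v', hv'⟩, ε'⟩ h
      have h1 := Quotient.exact h
      rw [← Quotient.eq_iff_equiv, Quotient.eq, QuotientGroup.rightRel_apply] at h1
      obtain ⟨m, hm⟩ := h1
      have h2 : ofRow v' hv' ε' = T ^ m * ofRow v hv ε := by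
        rw [← mul_inv_eq_iff_eq_mul]; exact hm.symm
      have h3 := congrArg (fun g : Mp2Z => g.mat 1 0) h2
      have h4 := congrArg (fun g : Mp2Z => g.mat 1 1) h2
      simp only [T_zpow_mul_mat_zero, T_zpow_mul_mat_one, ofRow_mat_zero, ofRow_mat_one] at h3 h4
      have hvv : v' = v := by
        funext i; fin_cases i <;> assumption
      subst hvv
      have h5 := congrArg (fun g : Mp2Z => g.phi UpperHalfPlane.I) h2
      simp only [mul_phi, T_zpow_phi, one_mul, ofRow_phi] at h5
      have h6 := phi_ne_zero (ofRow v' hv 1) UpperHalfPlane.I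
      rw [ofRow_phi] at h6
      have h7 : ε' = ε := by
        have := mul_right_cancel₀ (right_ne_zero_of_mul h6) h5
        exact Units.ext (by exact_mod_cast this)
      rw [h7]
    · intro q
      induction q using Quotient.inductionOn with
      | h g =>
        have hmem : ∀ (x : Mp2Z) (m : ℤ), g = T ^ m * x →
            (Quotient.mk (QuotientGroup.rightRel (Subgroup.zpowers T)) x) = Quotient.mk _ g := by
          intro x m hx
          refine Quotient.sound ?_
          rw [← Quotient.eq_iff_equiv, Quotient.eq, QuotientGroup.rightRel_apply]
          exact ⟨m, by rw [hx]; group⟩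
        set x := ofRow (fun i => g.mat 1 i) g.isCoprime_row 1 with hx
        obtain ⟨m, hm | hm⟩ := exists_T_zpow (g := x) (h := g) ofRow_mat_zero ofRow_mat_one
        · exact ⟨⟨⟨_, g.isCoprime_row⟩, 1⟩, hmem _ m hm⟩
        · refine ⟨⟨⟨_, g.isCoprime_row⟩, -1⟩, hmem _ m ?_⟩
          change g = T ^ m * ofRow (fun i => g.mat 1 i) g.isCoprime_row (-1)
          rw [← negOne_mul_ofRow, ← hx, hm]
          apply ext_of_apply _ UpperHalfPlane.I
          · rw [negOne_mul_phi, mul_phi, mul_phi, T_zpow_phi, T_zpow_phi, negOne_mul_phi]; ring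
          · change 1 * ((T ^ m).mat * _) = (T ^ m).mat * (1 * _)
            rw [one_mul, one_mul]

section Weil

variable {V : Type*} [AddCommGroup V] [Module ℝ V] {Q : QuadraticForm ℝ V} {L : Submodule ℤ V}

open Classical in
/-- A linear map on `ℂ[L'/L]` through its matrix entries. -/
lemma map_eq_sum [Fintype (DiscGroup Q L)] (A : (DiscGroup Q L → ℂ) →ₗ[ℂ] (DiscGroup Q L → ℂ))
    (f : DiscGroup Q L → ℂ) (δ : DiscGroup Q L) : A f δ = ∑ β, f β * A (basisVec β) δ := by
  have h : f = ∑ β, f β • (basisVec β : DiscGroup Q L → ℂ) := by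
    conv_lhs => rw [pi_eq_sum_univ' f]
    refine Finset.sum_congr rfl fun β _ => ?_
    congr 1
  conv_lhs => rw [h, map_sum]
  simp [Finset.sum_apply]

/-- `ρ(T)` acts trivially on the component of `𝔢₀`, as `q(0) = 0`. -/
lemma IsWeilRep.apply_T_zero [Finite (DiscGroup Q L)] {ρ : Representation ℂ Mp2Z (DiscGroup Q L → ℂ)}
    (h : IsWeilRep Q L ρ) (f : DiscGroup Q L → ℂ) : ρ T f 0 = f 0 := by
  classical
  have : Fintype (DiscGroup Q L) := Fintype.ofFinite _
  rw [map_eq_sum, Finset.sum_eq_single 0]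
  · have h1 := h.1 0
    rw [Submodule.Quotient.mk_zero] at h1
    rw [h1]
    simp [basisVec, e]
  · intro β _ hβ
    obtain ⟨γ, rfl⟩ := Submodule.Quotient.mk_surjective _ β
    rw [h.1]
    simp [basisVec, hβ.symm]
  · simp

/-- `ρ(S²)` is the scalar `√i^{2(b⁻ - b⁺)}` on the component of `𝔢₀`, by orthogonality of the
characters `e(-(γ, ·))`. -/
lemma IsWeilRep.apply_S_sq_zero [Finite (DiscGroup Q L)] {ρ : Representation ℂ Mp2Z (DiscGroup Q L → ℂ)}
    (h : IsWeilRep Q L ρ) (f : DiscGroup Q L → ℂ) :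
    ρ (S * S) f 0 = (Complex.exp (π * Complex.I / 4) ^ ((sigNeg Q : ℤ) - (sigPos Q : ℤ))) ^ 2 * f 0 := by
  classical
  have : Fintype (DiscGroup Q L) := Fintype.ofFinite _
  set Z : ℂ := Complex.exp (π * Complex.I / 4) ^ ((sigNeg Q : ℤ) - (sigPos Q : ℤ)) with hZ
  set D : ℂ := (Real.sqrt (Nat.card (DiscGroup Q L)) : ℂ) with hD
  have hD2 : D * D = Fintype.card (DiscGroup Q L) := by
    rw [hD, ← Complex.ofReal_mul, Real.mul_self_sqrt (Nat.cast_nonneg _), Nat.card_eq_fintype_card]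
    simp
  have hDne : D ≠ 0 := fun h0 => by
    rw [h0, mul_zero] at hD2
    exact Fintype.card_ne_zero (α := DiscGroup Q L) (by exact_mod_cast hD2.symm)
  have hZne : Z ≠ 0 := zpow_ne_zero _ (Complex.exp_ne_zero _)
  have hS0 : ∀ β : DiscGroup Q L, ρ S (basisVec β) 0 = Z / D := fun β => by
    obtain ⟨γ, rfl⟩ := Submodule.Quotient.mk_surjective _ β
    have h1 := h.2 γ 0
    rw [Submodule.Quotient.mk_zero] at h1
    rw [h1]; simp [bil, QuadraticMap.polar, e, hZ, hD]
  have h0S : ∀ β : DiscGroup Q L, ρ S (basisVec 0) β = Z / D := fun β => by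
    obtain ⟨γ, rfl⟩ := Submodule.Quotient.mk_surjective _ β
    have h1 := h.2 0 γ
    rw [Submodule.Quotient.mk_zero] at h1
    rw [h1]; simp [bil, QuadraticMap.polar, e, hZ, hD]
  -- the character sums
  have hsum : ∀ β : DiscGroup Q L, ∑ δ, ρ S (basisVec β) δ = if β = 0 then Z * D else 0 := by
    intro β
    split_ifs with hβ
    · rw [hβ]
      simp only [h0S, Finset.sum_const, Finset.card_univ, nsmul_eq_mul, ← hD2]
      field_simp
    · obtain ⟨γ, rfl⟩ := Submodule.Quotient.mk_surjective _ β
      -- otherwise the columns of `𝔢_γ` and of `𝔢₀` in the invertible matrix `ρ(S)` coincide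
      obtain ⟨δ₀, hδ₀⟩ : ∃ δ₀ : dualLattice Q L, e (-(bil Q (γ : V) (δ₀ : V) : ℂ)) ≠ 1 := by
        by_contra! hcon
        refine hβ ?_
        have h1 : ρ S (basisVec (Submodule.Quotient.mk γ)) = ρ S (basisVec 0) := by
          funext δ
          obtain ⟨δ, rfl⟩ := Submodule.Quotient.mk_surjective _ δ
          rw [h.2, hcon, h0S, mul_one]
        have h2 := congrArg (ρ S⁻¹) h1
        rw [← Module.End.mul_apply, ← Module.End.mul_apply, ← map_mul, inv_mul_cancel, map_one] at h2
        have h3 := congrFun h2 0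
        by_contra hne
        simp [basisVec, Ne.symm hne] at h3
      have h1 : ∀ δ : DiscGroup Q L, ρ S (basisVec (Submodule.Quotient.mk γ)) (δ + Submodule.Quotient.mk δ₀)
          = e (-(bil Q (γ : V) (δ₀ : V) : ℂ)) * ρ S (basisVec (Submodule.Quotient.mk γ)) δ := by
        intro δ
        obtain ⟨δ, rfl⟩ := Submodule.Quotient.mk_surjective _ δ
        rw [← Submodule.Quotient.mk_add, h.2, h.2, Submodule.coe_add, bil_add_right, Complex.ofReal_add,
          neg_add, e_add]
        ring
      -- translating the index by `δ₀` multiplies the sum by a number different from `1`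
      have h2 := (Equiv.sum_comp (Equiv.addRight (Submodule.Quotient.mk δ₀ : DiscGroup Q L))
        (ρ S (basisVec (Submodule.Quotient.mk γ))))
      simp only [Equiv.coe_addRight, h1, ← Finset.mul_sum] at h2
      have h3 : (e (-(bil Q (γ : V) (δ₀ : V) : ℂ)) - 1) *
          ∑ δ, ρ S (basisVec (Submodule.Quotient.mk γ)) δ = 0 := by rw [sub_mul, one_mul, h2, sub_self]
      exact (mul_eq_zero.mp h3).resolve_left (sub_ne_zero.mpr hδ₀)
  rw [map_eq_sum, Finset.sum_eq_single 0]
  · rw [map_mul, Module.End.mul_apply, map_eq_sum]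
    simp only [hS0, ← Finset.sum_mul, hsum, if_true]
    field_simp
  · intro β _ hβ
    rw [map_mul, Module.End.mul_apply, map_eq_sum]
    simp only [hS0, ← Finset.sum_mul, hsum, if_neg hβ]
    simp
  · simp

end Weil

/-! ### The Eisenstein series as a sum over rows -/
open Mp2Z

section

variable {V : Type*} [AddCommGroup V] [Module ℝ V] (Q : QuadraticForm ℝ V) (L : Submodule ℤ V)

/-- The `γ`-component of `(𝔢₀ y^s) ∣ (M, φ)` at `τ`, divided by `Im(τ)^s`. -/
def cuspTerm (k : ℤ) (s : ℂ) (γ : DiscGroup Q L) (g : Mp2Z) (τ : ℍ) : ℂ :=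
  g.phi τ ^ (-k) * (((‖g.phi τ‖ ^ 4)⁻¹ : ℝ) : ℂ) ^ s * weilCoeff Q L 0 γ g

variable {Q L} {k : ℤ} {s : ℂ} {γ : DiscGroup Q L}

lemma slash_eq_cuspTerm (g : Mp2Z) (τ : ℍ) :
    slash Q L k (fun τ => ((τ.im : ℂ) ^ s) • basisVec 0) g τ γ
      = (τ.im : ℂ) ^ s * cuspTerm Q L k s γ g τ := by
  classical
  have h1 : (g.mat • τ).im = τ.im * (‖g.phi τ‖ ^ 4)⁻¹ := by
    rw [ModularGroup.im_smul_eq_div_normSq, div_eq_mul_inv, ← g.sq_denom, map_pow,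
      Complex.normSq_eq_norm_sq, ← pow_mul]
  have h2 : weilDual Q L g⁻¹ ((((g.mat • τ).im : ℂ) ^ s) • basisVec 0) γ
      = ((g.mat • τ).im : ℂ) ^ s * weilCoeff Q L 0 γ g := by
    rw [weilDual, finsum_eq_single _ (0 : DiscGroup Q L), inv_inv]
    · simp [basisVec, mul_comm]
    · intro β hβ
      simp [basisVec, hβ]
  rw [slash, Pi.smul_apply, h2, h1, Complex.ofReal_mul,
    Complex.mul_cpow_ofReal_nonneg τ.im_pos.le (by positivity), smul_eq_mul, cuspTerm]
  ring

variable (hW : IsWeilRep Q L (weilRep Q L)) [Finite (DiscGroup Q L)]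
  (hsig : (4 : ℤ) ∣ k - (sigNeg Q : ℤ) + (sigPos Q : ℤ))

variable (Q L k s γ) in
/-- The elements that leave the terms of the Eisenstein series invariant. -/
def cuspStabilizer : Subgroup Mp2Z where
  carrier := {x | ∀ g τ, cuspTerm Q L k s γ (x * g) τ = cuspTerm Q L k s γ g τ}
  one_mem' := fun g τ => by rw [one_mul]
  mul_mem' := fun {x y} hx hy g τ => by rw [mul_assoc, hx, hy]
  inv_mem' := fun {x} hx g τ => by rw [← hx, mul_inv_cancel_left]

include hW in
lemma T_mem_cuspStabilizer : T ∈ cuspStabilizer Q L k s γ := fun g τ => by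
  rw [cuspTerm, cuspTerm, mul_phi, T_phi, one_mul, weilCoeff, map_mul, Module.End.mul_apply, hW.apply_T_zero]
  rfl

include hW hsig in
/-- This is where `2κ - b⁻ + b⁺ ≡ 0 (mod 4)` enters: `φ(S²)^{-2κ} = i^{-2κ}` cancels the scalar
`ρ(S²)`. -/
lemma S_sq_mem_cuspStabilizer : S * S ∈ cuspStabilizer Q L k s γ := fun g τ => by
  have h1 : Complex.I ^ (-k) *
      (Complex.exp (π * Complex.I / 4) ^ ((sigNeg Q : ℤ) - (sigPos Q : ℤ))) ^ 2 = 1 := by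
    have h2 : (Complex.exp (π * Complex.I / 4)) ^ 2 = Complex.I := by
      rw [← Complex.exp_nat_mul, show ((2 : ℕ) : ℂ) * (π * Complex.I / 4) = π / 2 * Complex.I by push_cast; ring,
        Complex.exp_pi_div_two_mul_I]
    obtain ⟨j, hj⟩ := hsig
    rw [← zpow_natCast, ← zpow_mul, mul_comm _ ((2 : ℕ) : ℤ), zpow_mul, zpow_natCast, h2,
      ← zpow_add₀ Complex.I_ne_zero, show -k + ((sigNeg Q : ℤ) - (sigPos Q : ℤ)) = 4 * -j by linarith,
      zpow_mul]
    rw [show Complex.I ^ (4 : ℤ) = 1 by exact_mod_cast Complex.I_pow_four, one_zpow]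
  rw [cuspTerm, cuspTerm, mul_phi, S_pow_two_phi, norm_mul, Complex.norm_I, one_mul, weilCoeff, map_mul,
    Module.End.mul_apply, hW.apply_S_sq_zero, mul_zpow]
  change _ * (_ * weilCoeff Q L 0 γ g) = _
  linear_combination (g.phi τ ^ (-k) * (((‖g.phi τ‖ ^ 4)⁻¹ : ℝ) : ℂ) ^ s * weilCoeff Q L 0 γ g) * h1

include hW hsig in
lemma negOne_mem_cuspStabilizer : negOne ∈ cuspStabilizer Q L k s γ := by
  rw [← S_pow_four]
  exact mul_mem (S_sq_mem_cuspStabilizer hW hsig) (S_sq_mem_cuspStabilizer hW hsig)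

include hW hsig in
/-- The terms depend only on the bottom row. -/
lemma cuspTerm_congr {g h : Mp2Z} (h0 : g.mat 1 0 = h.mat 1 0) (h1 : g.mat 1 1 = h.mat 1 1) (τ : ℍ) :
    cuspTerm Q L k s γ g τ = cuspTerm Q L k s γ h τ := by
  have hT : ∀ m : ℤ, T ^ m ∈ cuspStabilizer Q L k s γ := fun m => zpow_mem (T_mem_cuspStabilizer hW) m
  obtain ⟨m, rfl | rfl⟩ := exists_T_zpow h0 h1
  · rw [hT m]
  · rw [negOne_mem_cuspStabilizer hW hsig, hT m]

include hW hsig in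
lemma cuspTerm_congr_neg {g h : Mp2Z} (h0 : g.mat 1 0 = -h.mat 1 0) (h1 : g.mat 1 1 = -h.mat 1 1) (τ : ℍ) :
    cuspTerm Q L k s γ g τ = cuspTerm Q L k s γ h τ := by
  rw [← S_sq_mem_cuspStabilizer hW hsig h τ]
  have h2 : (S * S).mat = -1 := by
    change ModularGroup.S * ModularGroup.S = -1
    decide
  refine cuspTerm_congr hW hsig ?_ ?_ τ <;> rw [mul_mat, h2, neg_mul, one_mul] <;> assumption

variable (Q L k s γ) in
open Classical in
/-- The term of the Eisenstein series that belongs to the bottom row `v`. -/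
def rowTerm (v : Fin 2 → ℤ) (τ : ℍ) : ℂ :=
  if hv : IsCoprime (v 0) (v 1) then cuspTerm Q L k s γ (ofRow v hv 1) τ else 0

include hW hsig in
lemma rowTerm_neg (v : Fin 2 → ℤ) (τ : ℍ) : rowTerm Q L k s γ (-v) τ = rowTerm Q L k s γ v τ := by
  rw [rowTerm, rowTerm]
  have h : IsCoprime ((-v) 0) ((-v) 1) ↔ IsCoprime (v 0) (v 1) := by
    rw [Pi.neg_apply, Pi.neg_apply, IsCoprime.neg_neg_iff]
  by_cases hv : IsCoprime (v 0) (v 1)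
  · rw [dif_pos hv, dif_pos (h.mpr hv)]
    exact cuspTerm_congr_neg hW hsig (by simp) (by simp) τ
  · rw [dif_neg hv, dif_neg (mt h.mp hv)]

include hW hsig in
lemma eisensteinTerm_cuspEquiv (p : {v : Fin 2 → ℤ // IsCoprime (v 0) (v 1)} × ℤˣ) (τ : ℍ) :
    eisensteinTerm Q L k 0 s (cuspEquiv p) τ γ = (τ.im : ℂ) ^ s * rowTerm Q L k s γ p.1 τ := by
  rw [eisensteinTerm, slash_eq_cuspTerm, rowTerm, dif_pos p.1.2]
  congr 1
  have h1 : (QuotientGroup.rightRel (Subgroup.zpowers T)) (cuspEquiv p).out (ofRow p.1.1 p.1.2 p.2) := by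
    have := Quotient.exact (Quotient.out_eq (cuspEquiv p))
    exact this
  rw [QuotientGroup.rightRel_apply] at h1
  obtain ⟨m, hm⟩ := h1
  have h2 : ofRow p.1.1 p.1.2 p.2 = T ^ m * (cuspEquiv p).out := by
    rw [← mul_inv_eq_iff_eq_mul]; exact hm.symm
  refine cuspTerm_congr hW hsig ?_ ?_ τ
  · rw [ofRow_mat_zero, ← T_zpow_mul_mat_zero _ m, ← h2, ofRow_mat_zero]
  · rw [ofRow_mat_one, ← T_zpow_mul_mat_one _ m, ← h2, ofRow_mat_one]

include hW hsig in
lemma summable_eisensteinTerm {τ : ℍ} (h : ∀ γ, Summable fun v => rowTerm Q L k s γ v τ) :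
    Summable fun c : CuspCosets => eisensteinTerm Q L k 0 s c τ := by
  rw [Pi.summable]
  intro γ
  rw [← cuspEquiv.summable_iff]
  have h1 : ((fun c : CuspCosets => eisensteinTerm Q L k 0 s c τ γ) ∘ cuspEquiv)
      = fun p => (τ.im : ℂ) ^ s * rowTerm Q L k s γ p.1 τ :=
    funext fun p => eisensteinTerm_cuspEquiv hW hsig p τ
  rw [h1]
  refine Summable.mul_left _ ?_
  have h2 : Summable fun v : {v : Fin 2 → ℤ // IsCoprime (v 0) (v 1)} => rowTerm Q L k s γ v τ :=
    (h γ).comp_injective Subtype.val_injective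
  have h3 := summable_mul_of_summable_norm h2.norm (Summable.of_finite (f := fun _ : ℤˣ => ‖(1 : ℂ)‖))
  simpa using h3

include hW hsig in
/-- The factor `1/2` of the definition is absorbed by the two branches of the square root over each
row. -/
lemma eisenstein_eq {τ : ℍ} (h : ∀ γ, Summable fun v => rowTerm Q L k s γ v τ) :
    eisenstein Q L k 0 s τ γ = (τ.im : ℂ) ^ s * ∑' v, rowTerm Q L k s γ v τ := by
  have hs := summable_eisensteinTerm hW hsig h
  rw [eisenstein, Pi.smul_apply, tsum_apply hs, ← cuspEquiv.tsum_eq]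
  simp only [eisensteinTerm_cuspEquiv hW hsig]
  have h2 : Summable fun v : {v : Fin 2 → ℤ // IsCoprime (v 0) (v 1)} => rowTerm Q L k s γ v τ :=
    (h γ).comp_injective Subtype.val_injective
  have hs' : Summable fun p : {v : Fin 2 → ℤ // IsCoprime (v 0) (v 1)} × ℤˣ =>
      (τ.im : ℂ) ^ s * rowTerm Q L k s γ p.1 τ := by
    have := cuspEquiv.summable_iff.mpr (Pi.summable.mp hs γ)
    exact this.congr fun p => eisensteinTerm_cuspEquiv hW hsig p τ
  rw [hs'.tsum_prod]
  have h3 : ∑' v : {v : Fin 2 → ℤ // IsCoprime (v 0) (v 1)}, rowTerm Q L k s γ v τ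
      = ∑' v, rowTerm Q L k s γ v τ := by
    refine tsum_subtype_eq_of_support_subset (f := fun v => rowTerm Q L k s γ v τ) (s := {v : Fin 2 → ℤ | IsCoprime (v 0) (v 1)}) fun v hv => ?_
    by_contra hcon
    exact hv (dif_neg hcon)
  simp only [tsum_fintype, Finset.sum_const, Finset.card_univ, Fintype.card_units_int]
  simp only [nsmul_eq_mul, tsum_mul_left, h3, smul_eq_mul]
  push_cast; ring

end

open Mp2Z Filter

/-! ### Convergence and continuity -/

section

variable {V : Type*} [AddCommGroup V] [Module ℝ V] {Q : QuadraticForm ℝ V} {L : Submodule ℤ V}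
  {r : ℕ} {b : Module.Basis (Fin r) ℝ V}

lemma gramDet_ne_zero (hQ : (QuadraticMap.polarBilin Q).Nondegenerate) (b : Module.Basis (Fin r) ℝ V) :
    gramDet Q b ≠ 0 := by
  have h := (LinearMap.BilinForm.nondegenerate_iff_det_ne_zero (B := QuadraticMap.polarBilin Q) b).mp hQ
  have h2 : LinearMap.BilinForm.toMatrix b (QuadraticMap.polarBilin Q) = Matrix.of fun i j => bil Q (b i) (b j) := by
    ext i j; rw [LinearMap.BilinForm.toMatrix_apply]; rfl
  rwa [h2] at h

variable (Q L) in
/-- The constant `√i ^ (b⁻ - b⁺) / √|L'/L|`. -/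
def weilConst : ℂ := Complex.exp (π * Complex.I / 4) ^ ((sigNeg Q : ℤ) - (sigPos Q : ℤ)) /
  (Real.sqrt (Nat.card (DiscGroup Q L)) : ℂ)

/-- The entry of `ρ(M, φ)` at `(0, γ)` is a Gauss sum of the polynomial `q(x - γ) + n`; the
choice of `n` only shifts the phase. -/
lemma weilCoeff_ofRow (hQ : (QuadraticMap.polarBilin Q).Nondegenerate)
    (hL : L = Submodule.span ℤ (Set.range b)) (heven : ∀ x ∈ L, ∃ m : ℤ, Q x = m)
    {γ : dualLattice Q L} {n : ℚ} {P : IntQuadPoly r}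
    (hP : ∀ x : Fin r → ℤ, ((P.eval x : ℤ) : ℝ) = Q (∑ i, (x i : ℝ) • b i - γ) + n)
    {v : Fin 2 → ℤ} (hv : IsCoprime (v 0) (v 1)) {c : ℕ} [NeZero c] (hc : v 0 = c) :
    weilCoeff Q L 0 (Submodule.Quotient.mk γ) (ofRow v hv 1)
      = weilConst Q L / (Real.sqrt c : ℂ) ^ r * (e (-(n * (v 1 / c))) * P.gaussSum (v 1 : ZMod c)) := by
  have hcC : (c : ℂ) ≠ 0 := NeZero.ne _
  rw [weilCoeff_zero_eq hQ b hL heven (c := c) (by rw [ofRow_mat_zero, hc])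
    (fun τ => by rw [ofRow_phi, ofRow_mat_one, hc]; simp), ofRow_mat_one, weilConst, IntQuadPoly.gaussSum]
  congr 1
  rw [Finset.mul_sum]
  refine Finset.sum_congr rfl fun x _ => ?_
  have h1 : ((v 1 : ℤ) : ZMod c) * P.eval x
      = ((v 1 * P.eval (fun i => ((x i).val : ℤ)) : ℤ) : ZMod c) := by
    rw [Int.cast_mul, P.eval_intCast]
    congr 2
    funext i
    simp
  rw [h1, stdAddChar_eq_e, ← e_add]
  congr 1
  have h2 := congrArg (fun t : ℝ => (t : ℂ)) (hP (fun i => ((x i).val : ℤ)))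
  push_cast at h2 ⊢
  rw [h2]
  field_simp
  ring

/-- Weyl's bound makes the entries of `ρ` bounded, uniformly in the row. -/
lemma norm_weilCoeff_ofRow_le (hQ : (QuadraticMap.polarBilin Q).Nondegenerate)
    (hL : L = Submodule.span ℤ (Set.range b)) (heven : ∀ x ∈ L, ∃ m : ℤ, Q x = m)
    {γ : dualLattice Q L} {n : ℚ} {P : IntQuadPoly r}
    (hP : ∀ x : Fin r → ℤ, ((P.eval x : ℤ) : ℝ) = Q (∑ i, (x i : ℝ) • b i - γ) + n)
    (hdet : P.gram.det ≠ 0)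
    {v : Fin 2 → ℤ} (hv : IsCoprime (v 0) (v 1)) (hv0 : 0 < v 0) :
    ‖weilCoeff Q L 0 (Submodule.Quotient.mk γ) (ofRow v hv 1)‖
      ≤ ‖weilConst Q L‖ * √((P.gram.det.natAbs : ℝ) ^ r) := by
  obtain ⟨c, hc⟩ := Int.eq_ofNat_of_zero_le hv0.le
  have hc0 : c ≠ 0 := by rintro rfl; simp at hc; omega
  have : NeZero c := ⟨hc0⟩
  have hcpos : (0 : ℝ) < c := by exact_mod_cast Nat.pos_of_ne_zero hc0
  rw [weilCoeff_ofRow hQ hL heven hP hv hc]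
  have hu : IsUnit ((v 1 : ℤ) : ZMod c) := by
    rw [hc] at hv
    rw [ZMod.coe_int_isUnit_iff_isCoprime]
    exact hv
  have h1 := P.norm_gaussSum_le hdet hu
  have h2 : ‖e (-(n * (v 1 / c)))‖ = 1 := by
    have := norm_e_ofReal (-(n * (v 1 / c)))
    push_cast at this
    exact this
  have h3 : ‖(Real.sqrt c : ℂ) ^ r‖ = (c : ℝ) ^ ((r : ℝ) / 2) := by
    rw [norm_pow, Complex.norm_real, Real.norm_of_nonneg (Real.sqrt_nonneg _), Real.sqrt_eq_rpow,
      ← Real.rpow_natCast, ← Real.rpow_mul hcpos.le]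
    congr 1; ring
  rw [norm_mul, norm_mul, h2, one_mul, norm_div, h3, div_mul_eq_mul_div, div_le_iff₀ (by positivity), mul_assoc]
  refine mul_le_mul_of_nonneg_left ?_ (norm_nonneg _)
  exact h1.trans (le_of_eq (mul_comm _ _))

lemma norm_cuspTerm {κ : ℝ} {k : ℤ} (hk : 2 * κ = k) (s : ℂ) (γ : DiscGroup Q L) (g : Mp2Z) (τ : ℍ) :
    ‖cuspTerm Q L k s γ g τ‖
      = ‖(g.mat 1 0 : ℂ) * τ + g.mat 1 1‖ ^ (-(κ + 2 * s.re)) * ‖weilCoeff Q L 0 γ g‖ := by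
  have hD : 0 < ‖g.phi τ‖ := norm_pos_iff.mpr (g.phi_ne_zero τ)
  rw [cuspTerm, norm_mul, norm_mul, norm_zpow, Complex.norm_cpow_eq_rpow_re_of_pos (by positivity), ← g.sq,
    norm_pow]
  congr 1
  rw [← Real.rpow_intCast, ← Real.rpow_natCast, ← Real.rpow_natCast, ← Real.rpow_neg hD.le,
    ← Real.rpow_mul hD.le, ← Real.rpow_mul hD.le, ← Real.rpow_add hD]
  congr 1
  push_cast
  rw [← hk]; ring

variable {k : ℤ} {s : ℂ}

lemma weilCoeff_one [Finite (DiscGroup Q L)] (γ : DiscGroup Q L) : weilCoeff Q L 0 γ 1 = basisVec γ 0 := by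
  rw [weilCoeff, map_one]; rfl

/-- The rows `(0, ±1)` contribute the constant term `𝔢₀`. -/
lemma rowTerm_of_eq_zero (hW : IsWeilRep Q L (weilRep Q L)) [Finite (DiscGroup Q L)]
    (hsig : (4 : ℤ) ∣ k - (sigNeg Q : ℤ) + (sigPos Q : ℤ)) (γ : DiscGroup Q L) {v : Fin 2 → ℤ}
    (hv : IsCoprime (v 0) (v 1)) (hv0 : v 0 = 0) (τ : ℍ) :
    rowTerm Q L k s γ v τ = basisVec γ 0 := by
  have h1 : cuspTerm Q L k s γ 1 τ = basisVec γ 0 := by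
    rw [cuspTerm, weilCoeff_one, one_phi]; simp
  rw [rowTerm, dif_pos hv, ← h1]
  rw [hv0, isCoprime_zero_left, Int.isUnit_iff] at hv
  rcases hv with h | h
  · exact cuspTerm_congr hW hsig (by simp [hv0]) (by simp [h]) τ
  · exact cuspTerm_congr_neg hW hsig (by simp [hv0]) (by simp [h]) τ

/-- The Eisenstein series is dominated, up to a constant, by `∑ |cτ + d|^{-κ - 2 Re s}`. -/
lemma exists_norm_rowTerm_le (hQ : (QuadraticMap.polarBilin Q).Nondegenerate)
    (hL : L = Submodule.span ℤ (Set.range b)) (heven : ∀ x ∈ L, ∃ m : ℤ, Q x = m)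
    (hW : IsWeilRep Q L (weilRep Q L)) [Finite (DiscGroup Q L)]
    (hsig : (4 : ℤ) ∣ k - (sigNeg Q : ℤ) + (sigPos Q : ℤ)) {κ : ℝ} (hk : 2 * κ = k) (s : ℂ) (γ : DiscGroup Q L) :
    ∃ B : ℝ, 0 ≤ B ∧ ∀ (v : Fin 2 → ℤ) (τ : ℍ),
      ‖rowTerm Q L k s γ v τ‖ ≤ B * ‖(v 0 : ℂ) * τ + v 1‖ ^ (-(κ + 2 * s.re)) := by
  classical
  obtain ⟨γ, rfl⟩ := Submodule.Quotient.mk_surjective _ γ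
  obtain ⟨hd, hdγ⟩ := level_pos_and_mem hQ hL heven γ
  obtain ⟨m, hm⟩ := heven _ hdγ
  have hd0 : (level L (γ : V) : ℝ) ≠ 0 := by exact_mod_cast hd.ne'
  have hQγ : Q (γ : V) = m / (level L (γ : V) : ℝ) ^ 2 := by
    have h1 : Q (level L (γ : V) • (γ : V)) = (level L (γ : V) : ℝ) ^ 2 * Q (γ : V) := by
      rw [← Nat.cast_smul_eq_nsmul ℝ, QuadraticMap.map_smul, smul_eq_mul, pow_two (level L (γ : V) : ℝ)]
    rw [eq_div_iff (by positivity), mul_comm, ← h1, hm]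
  -- any `n ∈ ℤ - q(γ)` serves for the bound; here `n = -q(γ)`
  obtain ⟨P, hP, -, -, -, hdet, -⟩ := exists_intQuadPoly hQ hL heven γ
    (n := -(m / (level L (γ : V) : ℚ) ^ 2)) ⟨0, by rw [hQγ]; push_cast; ring⟩
  have hdet0 : P.gram.det ≠ 0 := fun h => gramDet_ne_zero hQ b (by rw [← hdet, h]; simp)
  set B := max 1 (‖weilConst Q L‖ * √((P.gram.det.natAbs : ℝ) ^ r)) with hB
  have hpos : ∀ (v : Fin 2 → ℤ) (τ : ℍ), 0 < v 0 → ‖rowTerm Q L k s (Submodule.Quotient.mk γ) v τ‖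
      ≤ B * ‖(v 0 : ℂ) * τ + v 1‖ ^ (-(κ + 2 * s.re)) := by
    intro v τ hv0
    rw [rowTerm]
    split_ifs with hv
    · rw [norm_cuspTerm hk, ofRow_mat_zero, ofRow_mat_one, mul_comm]
      refine mul_le_mul_of_nonneg_right ?_ (by positivity)
      exact (norm_weilCoeff_ofRow_le hQ hL heven hP hdet0 hv hv0).trans (le_max_right _ _)
    · rw [norm_zero]; positivity
  refine ⟨B, by positivity, fun v τ => ?_⟩
  rcases lt_trichotomy (v 0) 0 with h | h | h
  · have := hpos (-v) τ (by simpa using h)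
    rw [rowTerm_neg hW hsig] at this
    refine this.trans (le_of_eq ?_)
    congr 2
    rw [← norm_neg]; congr 1
    simp; ring
  · by_cases hv : IsCoprime (v 0) (v 1)
    · rw [rowTerm_of_eq_zero hW hsig _ hv h]
      have h1 : ‖(v 0 : ℂ) * τ + v 1‖ = 1 := by
        rw [h, isCoprime_zero_left, Int.isUnit_iff] at hv
        rw [h]
        rcases hv with h | h <;> simp [h]
      rw [h1, Real.one_rpow, mul_one]
      refine le_trans ?_ (le_max_left _ _)
      rw [basisVec, Pi.single_apply]
      split_ifs <;> simp
    · rw [rowTerm, dif_neg hv, norm_zero]; positivity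
  · exact hpos v τ h

lemma continuous_rowTerm (γ : DiscGroup Q L) (v : Fin 2 → ℤ) : Continuous (rowTerm Q L k s γ v) := by
  by_cases hv : IsCoprime (v 0) (v 1)
  · have h : rowTerm Q L k s γ v = cuspTerm Q L k s γ (ofRow v hv 1) := by
      funext τ; rw [rowTerm, dif_pos hv]
    rw [h]
    unfold cuspTerm
    set g := ofRow v hv 1
    have hc : Continuous g.phi := g.holo.continuous
    refine Continuous.mul (Continuous.mul (hc.zpow₀ _ fun τ => Or.inl (g.phi_ne_zero τ)) ?_) continuous_const
    refine Continuous.cpow (Complex.continuous_ofReal.comp (Continuous.inv₀ (hc.norm.pow 4) fun τ => ?_))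
      continuous_const fun τ => Or.inl ?_
    · exact pow_ne_zero _ (norm_ne_zero_iff.mpr (g.phi_ne_zero τ))
    · have := norm_pos_iff.mpr (g.phi_ne_zero τ)
      simp only [Complex.ofReal_re]
      positivity
  · have h : rowTerm Q L k s γ v = fun _ => 0 := by
      funext τ; rw [rowTerm, dif_neg hv]
    rw [h]; exact continuous_const

/-- Uniform convergence in vertical strips. -/
lemma exists_summable_bound (hQ : (QuadraticMap.polarBilin Q).Nondegenerate)
    (hL : L = Submodule.span ℤ (Set.range b)) (heven : ∀ x ∈ L, ∃ m : ℤ, Q x = m)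
    (hW : IsWeilRep Q L (weilRep Q L)) [Finite (DiscGroup Q L)]
    (hsig : (4 : ℤ) ∣ k - (sigNeg Q : ℤ) + (sigPos Q : ℤ)) {κ : ℝ} (hk : 2 * κ = k)
    (hs : 1 - κ / 2 < s.re) (γ : DiscGroup Q L) (A : ℝ) {Y : ℝ} (hY : 0 < Y) :
    ∃ u : (Fin 2 → ℤ) → ℝ, Summable u ∧ (∀ v, 0 ≤ u v) ∧
      ∀ v, ∀ τ ∈ UpperHalfPlane.verticalStrip A Y, ‖rowTerm Q L k s γ v τ‖ ≤ u v := by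
  obtain ⟨B, hB0, hB⟩ := exists_norm_rowTerm_le hQ hL heven hW hsig hk s γ
  have hp : 2 < κ + 2 * s.re := by linarith
  refine ⟨fun v => B * (EisensteinSeries.r ⟨⟨A, Y⟩, hY⟩ ^ (-(κ + 2 * s.re)) * ‖v‖ ^ (-(κ + 2 * s.re))),
    ((EisensteinSeries.summable_one_div_norm_rpow hp).mul_left _).mul_left _, fun v => ?_, fun v τ hτ => ?_⟩
  · have := EisensteinSeries.r_pos ⟨⟨A, Y⟩, hY⟩
    positivity
  · exact (hB v τ).trans (mul_le_mul_of_nonneg_left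
      (EisensteinSeries.summand_bound_of_mem_verticalStrip (by linarith) v hY hτ) hB0)

lemma summable_rowTerm (hQ : (QuadraticMap.polarBilin Q).Nondegenerate)
    (hL : L = Submodule.span ℤ (Set.range b)) (heven : ∀ x ∈ L, ∃ m : ℤ, Q x = m)
    (hW : IsWeilRep Q L (weilRep Q L)) [Finite (DiscGroup Q L)]
    (hsig : (4 : ℤ) ∣ k - (sigNeg Q : ℤ) + (sigPos Q : ℤ)) {κ : ℝ} (hk : 2 * κ = k)
    (hs : 1 - κ / 2 < s.re) (τ : ℍ) (γ : DiscGroup Q L) : Summable fun v => rowTerm Q L k s γ v τ := by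
  obtain ⟨u, hu, -, hb⟩ := exists_summable_bound hQ hL heven hW hsig hk hs γ |τ.re| τ.im_pos
  exact Summable.of_norm_bounded hu fun v => hb v τ ⟨le_rfl, le_rfl⟩

/-- Continuity, by uniform convergence on neighbourhoods that are vertical strips. -/
lemma continuous_eisenstein (hQ : (QuadraticMap.polarBilin Q).Nondegenerate)
    (hL : L = Submodule.span ℤ (Set.range b)) (heven : ∀ x ∈ L, ∃ m : ℤ, Q x = m)
    (hW : IsWeilRep Q L (weilRep Q L)) [Finite (DiscGroup Q L)]
    (hsig : (4 : ℤ) ∣ k - (sigNeg Q : ℤ) + (sigPos Q : ℤ)) {κ : ℝ} (hk : 2 * κ = k)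
    (hs : 1 - κ / 2 < s.re) : Continuous (eisenstein Q L k 0 s) := by
  refine continuous_pi fun γ => ?_
  have h1 : (fun τ => eisenstein Q L k 0 s τ γ)
      = fun τ : ℍ => (τ.im : ℂ) ^ s * ∑' v, rowTerm Q L k s γ v τ :=
    funext fun τ => eisenstein_eq hW hsig fun γ => summable_rowTerm hQ hL heven hW hsig hk hs τ γ
  rw [h1]
  refine Continuous.mul (Continuous.cpow (Complex.continuous_ofReal.comp UpperHalfPlane.continuous_im)
    continuous_const fun τ => Or.inl (by simpa using τ.im_pos)) ?_
  rw [continuous_iff_continuousAt]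
  intro τ
  obtain ⟨u, hu, -, hb⟩ := exists_summable_bound hQ hL heven hW hsig hk hs γ (|τ.re| + 1)
    (half_pos τ.im_pos)
  have h2 : ContinuousOn (fun τ => ∑' v, rowTerm Q L k s γ v τ)
      (UpperHalfPlane.verticalStrip (|τ.re| + 1) (τ.im / 2)) :=
    continuousOn_tsum (fun v => (continuous_rowTerm γ v).continuousOn) hu hb
  refine h2.continuousAt ?_
  have h3 : ∀ᶠ z : ℍ in 𝓝 τ, |z.re| < |τ.re| + 1 :=
    (UpperHalfPlane.continuous_re.abs.tendsto τ).eventually (gt_mem_nhds (by linarith))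
  have h4 : ∀ᶠ z : ℍ in 𝓝 τ, τ.im / 2 < z.im :=
    (UpperHalfPlane.continuous_im.tendsto τ).eventually (lt_mem_nhds (half_lt_self τ.im_pos))
  filter_upwards [h3, h4] with z hz1 hz2
  exact ⟨hz1.le, hz2.le⟩

end

open Mp2Z Filter MeasureTheory

/-! ### Unfolding the Fourier integral -/

section

/-- The function `τ^{-κ} |τ|^{-2s} e(-nx)` on the line `Im τ = y`. -/
def lineFun (k : ℤ) (s : ℂ) (n : ℚ) (y x : ℝ) : ℂ :=
  ((x + y * Complex.I : ℂ) ^ (1 / 2 : ℂ)) ^ (-k) * (((x ^ 2 + y ^ 2)⁻¹ : ℝ) : ℂ) ^ s * e (-(n * x))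

variable {k : ℤ} {s : ℂ} {n : ℚ} {y : ℝ}

lemma integrable_lineFun (hy : 0 < y) {κ : ℝ} (hk : 2 * κ = k) (hs : 1 - κ / 2 < s.re) :
    Integrable (lineFun k s n y) := by
  have hmeas : Measurable (lineFun k s n y) := by
    unfold lineFun e
    simp only [cpow_half_zpow]
    fun_prop
  refine (integrable_norm_rpow hy (p := κ + 2 * s.re) (by linarith)).mono' hmeas.aestronglyMeasurable
    (ae_of_all _ fun x => le_of_eq ?_)
  have h0 : 0 < ‖(y - x * Complex.I : ℂ)‖ := norm_pos_iff.mpr (sub_mul_I_ne_zero hy x)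
  have h1 : ‖(x + y * Complex.I : ℂ)‖ = ‖(y - x * Complex.I : ℂ)‖ := by
    rw [show (x + y * Complex.I : ℂ) = Complex.I * (y - x * Complex.I) by
      linear_combination (x : ℂ) * Complex.I_sq, norm_mul, Complex.norm_I, one_mul]
  have h2 : ‖e (-(n * x))‖ = 1 := by
    have := norm_e_ofReal (-(n * x))
    push_cast at this
    exact this
  have h3 : ‖(x + y * Complex.I : ℂ) ^ (1 / 2 : ℂ)‖ = ‖(y - x * Complex.I : ℂ)‖ ^ (1 / 2 : ℝ) := by
    have h4 : ‖(x + y * Complex.I : ℂ) ^ (1 / 2 : ℂ)‖ ^ 2 = ‖(y - x * Complex.I : ℂ)‖ := by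
      rw [← norm_pow, ← Complex.cpow_nat_mul, ← h1]; simp
    rw [← h4, ← Real.sqrt_eq_rpow, Real.sqrt_sq (norm_nonneg _)]
  rw [lineFun, norm_mul, norm_mul, h2, mul_one, norm_zpow, h3,
    Complex.norm_cpow_eq_rpow_re_of_pos (by positivity), add_comm (x ^ 2), ← normSq_sub_mul_I,
    ← Real.rpow_intCast, ← Real.rpow_natCast, ← Real.rpow_neg h0.le,
    ← Real.rpow_mul h0.le, ← Real.rpow_mul h0.le, ← Real.rpow_add h0]
  congr 1
  push_cast
  rw [← hk]; ring

lemma integral_lineFun (hy : 0 < y) :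
    (y : ℂ) ^ s * ∫ x : ℝ, lineFun k s n y x
      = ∫ x : ℝ, ((x + y * Complex.I : ℂ) ^ (1 / 2 : ℂ)) ^ (-k) * ((y / (x ^ 2 + y ^ 2) : ℝ) : ℂ) ^ s *
        e (-(n * x)) := by
  rw [← integral_const_mul]
  refine integral_congr_ae (ae_of_all _ fun x => ?_)
  dsimp only
  rw [div_eq_mul_inv y, Complex.ofReal_mul, Complex.mul_cpow_ofReal_nonneg hy.le (by positivity), lineFun]
  ring

lemma natCast_mul_cpow {c : ℕ} (hc : 0 < c) {z : ℂ} (hz : z ≠ 0) (a : ℂ) :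
    ((c : ℂ) * z) ^ a = (c : ℂ) ^ a * z ^ a := by
  have hcr : (0 : ℝ) < c := Nat.cast_pos.mpr hc
  have hc0 : (c : ℂ) ≠ 0 := Nat.cast_ne_zero.mpr hc.ne'
  have h := Complex.log_ofReal_mul hcr hz
  rw [Complex.ofReal_natCast, Complex.ofReal_log hcr.le, Complex.ofReal_natCast] at h
  rw [Complex.cpow_def_of_ne_zero (mul_ne_zero hc0 hz), Complex.cpow_def_of_ne_zero hc0,
    Complex.cpow_def_of_ne_zero hz, h, add_mul, Complex.exp_add]

variable {V : Type*} [AddCommGroup V] [Module ℝ V] {Q : QuadraticForm ℝ V} {L : Submodule ℤ V}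
  {r : ℕ} {b : Module.Basis (Fin r) ℝ V}

open Classical in
/-- The term of the row `(c, d)`, `c > 0`, times `e(-nx)`: since `cτ + d = c (τ + d/c)`, it is a Gauss
sum modulo `c` times the translate by `d/c` of one fixed function on the line. -/
lemma rowTerm_mul_e (hQ : (QuadraticMap.polarBilin Q).Nondegenerate)
    (hL : L = Submodule.span ℤ (Set.range b)) (heven : ∀ x ∈ L, ∃ m : ℤ, Q x = m) {κ : ℝ} (hk : 2 * κ = k)
    {γ : dualLattice Q L} {P : IntQuadPoly r}
    (hP : ∀ x : Fin r → ℤ, ((P.eval x : ℤ) : ℝ) = Q (∑ i, (x i : ℝ) • b i - γ) + n)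
    (hy : 0 < y) {c : ℕ} [NeZero c] (d : ℤ) (x : ℝ) :
    rowTerm Q L k s (Submodule.Quotient.mk γ) ![c, d] ⟨⟨x, y⟩, hy⟩ * e (-(n * x))
      = weilConst Q L * (c : ℂ) ^ (-(r / 2 + (2 * s + κ))) *
        (if IsUnit (d : ZMod c) then P.gaussSum (d : ZMod c) else 0) * lineFun k s n y (x + d / c) := by
  have hc : 0 < c := Nat.pos_of_ne_zero (NeZero.ne c)
  have hcr : (0 : ℝ) < c := Nat.cast_pos.mpr hc
  have hcC : (c : ℂ) ≠ 0 := NeZero.ne _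
  rw [rowTerm]
  by_cases hv : IsCoprime ((![(c : ℤ), d] : Fin 2 → ℤ) 0) ((![(c : ℤ), d] : Fin 2 → ℤ) 1)
  · have hu : IsUnit (d : ZMod c) := by
      rw [ZMod.coe_int_isUnit_iff_isCoprime]; exact hv
    rw [dif_pos hv, if_pos hu, cuspTerm, weilCoeff_ofRow hQ hL heven hP hv (c := c) rfl]
    set τ : ℍ := ⟨⟨x, y⟩, hy⟩ with hτ
    have hphi : (ofRow ![(c : ℤ), d] hv 1).phi τ = ((c : ℂ) * ((x + d / c : ℝ) + y * Complex.I)) ^ (1 / 2 : ℂ) := by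
      rw [ofRow_phi]
      have h1 : (τ : ℂ) = x + y * Complex.I := by
        apply Complex.ext <;> simp [hτ]
      rw [h1]
      have h2 : (((![(c : ℤ), d] : Fin 2 → ℤ) 0 : ℤ) : ℂ) = c := by simp
      have h3 : (((![(c : ℤ), d] : Fin 2 → ℤ) 1 : ℤ) : ℂ) = d := by simp
      rw [h2, h3]
      simp only [Units.val_one, Int.cast_one, one_mul]
      congr 1
      push_cast
      field_simp
      ring
    have hz0 : (((x + d / c : ℝ) : ℂ) + y * Complex.I) ≠ 0 := fun h => by
      have := congrArg Complex.im h; simp at this; exact hy.ne' this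
    have hn4 : ‖(ofRow ![(c : ℤ), d] hv 1).phi τ‖ ^ 4 = (c : ℝ) ^ 2 * ((x + d / c) ^ 2 + y ^ 2) := by
      rw [hphi, ← norm_pow, show 4 = 2 * 2 by norm_num, pow_mul, ← Complex.cpow_nat_mul, norm_pow]
      simp only [Nat.cast_ofNat, one_div, ne_eq, OfNat.ofNat_ne_zero, not_false_eq_true, mul_inv_cancel₀,
        Complex.cpow_one]
      rw [norm_mul, mul_pow, Complex.norm_natCast, Complex.sq_norm, Complex.normSq_add_mul_I]
    have hA : (ofRow ![(c : ℤ), d] hv 1).phi τ ^ (-k)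
        = (c : ℂ) ^ (-(κ : ℂ)) * ((((x + d / c : ℝ) : ℂ) + y * Complex.I) ^ (1 / 2 : ℂ)) ^ (-k) := by
      have hk2 : (k / 2 : ℂ) = κ := by
        have : (k : ℂ) = 2 * κ := by exact_mod_cast hk.symm
        rw [this]; ring
      rw [hphi, cpow_half_zpow, cpow_half_zpow, natCast_mul_cpow hc hz0, hk2]
    have hB : (((‖(ofRow ![(c : ℤ), d] hv 1).phi τ‖ ^ 4)⁻¹ : ℝ) : ℂ) ^ s
        = (c : ℂ) ^ (-(2 * s)) * ((((x + d / c) ^ 2 + y ^ 2)⁻¹ : ℝ) : ℂ) ^ s := by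
      rw [hn4, mul_inv, Complex.ofReal_mul, Complex.mul_cpow_ofReal_nonneg (by positivity) (by positivity)]
      congr 1
      have h1 : (((c : ℝ) ^ 2)⁻¹ : ℝ) = (c : ℝ) ^ (-2 : ℝ) := by
        rw [Real.rpow_neg hcr.le]; norm_cast
      rw [h1, ← Complex.ofReal_natCast, show (-(2 * s)) = ((-2 : ℝ) : ℂ) * s by push_cast; ring,
        Complex.cpow_mul_ofReal_nonneg hcr.le]
    have hC : e (-(n * (x + d / c : ℝ))) = e (-(n * (d / c))) * e (-(n * x)) := by
      rw [← e_add]; congr 1; push_cast; ring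
    have hD : (c : ℂ) ^ (-(r / 2 + (2 * s + κ))) = (c : ℂ) ^ (-(κ : ℂ)) * (c : ℂ) ^ (-(2 * s)) / (Real.sqrt c : ℂ) ^ r := by
      have h1 : (Real.sqrt c : ℂ) ^ r = (c : ℂ) ^ ((r : ℂ) / 2) := by
        rw [Real.sqrt_eq_rpow, Complex.ofReal_cpow hcr.le, ← Complex.cpow_nat_mul]
        push_cast
        congr 1; ring
      rw [h1, div_eq_mul_inv (_ * _), ← Complex.cpow_neg, ← Complex.cpow_add _ _ hcC, ← Complex.cpow_add _ _ hcC]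
      congr 1; ring
    have h3 : (((![(c : ℤ), d] : Fin 2 → ℤ) 1 : ℤ) : ℂ) = d := by simp
    have h4 : (((![(c : ℤ), d] : Fin 2 → ℤ) 1 : ℤ) : ZMod c) = d := by simp
    rw [hA, hB, h3, h4, lineFun, hC, hD]
    ring
  · have hu : ¬ IsUnit (d : ZMod c) := by
      rw [ZMod.coe_int_isUnit_iff_isCoprime]; exact hv
    rw [dif_neg hv, if_neg hu]; ring

/-- A sum over `ℤ` by residue classes modulo `c`. -/
lemma tsum_int_eq_sum_zmod {c : ℕ} [NeZero c] {t : ℤ → ℂ} (ht : Summable t) :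
    ∑' d : ℤ, t d = ∑ δ : ZMod c, ∑' m : ℤ, t (m * c + δ.val) := by
  have h1 : Summable fun p : ℤ × Fin c => t (p.1 * c + p.2) :=
    ((Int.divModEquiv c).symm.summable_iff (f := t)).mpr ht
  have h2 : Summable fun p : Fin c × ℤ => t (p.2 * c + p.1) :=
    ((Equiv.prodComm (Fin c) ℤ).summable_iff (f := fun p : ℤ × Fin c => t (p.1 * c + p.2))).mpr h1
  have h3 : ∑' d : ℤ, t d = ∑' p : ℤ × Fin c, t (p.1 * c + p.2) :=
    ((Int.divModEquiv c).symm.tsum_eq t).symm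
  have h4 : ∑' p : ℤ × Fin c, t (p.1 * c + p.2) = ∑' p : Fin c × ℤ, t (p.2 * c + p.1) :=
    ((Equiv.prodComm (Fin c) ℤ).tsum_eq (fun p : ℤ × Fin c => t (p.1 * c + p.2))).symm
  rw [h3, h4, h2.tsum_prod, tsum_fintype]
  have h5 : Function.Bijective (fun j : Fin c => ((j : ℕ) : ZMod c)) := by
    rw [Fintype.bijective_iff_injective_and_card]
    refine ⟨fun i j hij => ?_, by simp [ZMod.card]⟩
    have := congrArg ZMod.val hij
    simp only [ZMod.val_cast_of_lt i.2, ZMod.val_cast_of_lt j.2] at this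
    exact Fin.ext this
  refine Fintype.sum_bijective _ h5 _ _ fun j => ?_
  simp only [ZMod.val_cast_of_lt j.2]

/-- Unfolding: a sum over all `d` of integrals over a period, weighted with a function modulo `c`. -/
lemma tsum_int_unfold {c : ℕ} [NeZero c] (h : ZMod c → ℂ) {φ : ℝ → ℂ} (hφ : Integrable φ)
    (hsum : Summable fun d : ℤ => h d * ∫ x in (0 : ℝ)..1, φ (x + d / c)) :
    ∑' d : ℤ, h d * ∫ x in (0 : ℝ)..1, φ (x + d / c) = (∑ δ, h δ) * ∫ x, φ x := by
  have hc : (c : ℝ) ≠ 0 := NeZero.ne _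
  rw [tsum_int_eq_sum_zmod (c := c) hsum, Finset.sum_mul]
  refine Finset.sum_congr rfl fun δ _ => ?_
  have h2 : ∀ m : ℤ, h ((m * c + δ.val : ℤ) : ZMod c) * ∫ x in (0 : ℝ)..1, φ (x + (m * c + δ.val : ℤ) / c)
      = h δ * ∫ x in (0 : ℝ)..1, φ ((x + m) + (δ.val : ℝ) / c) := by
    intro m
    have e1 : ((m * c + δ.val : ℤ) : ZMod c) = δ := by simp
    have e2 : ∀ x : ℝ, x + ((m * c + δ.val : ℤ) : ℝ) / c = (x + m) + (δ.val : ℝ) / c := fun x => by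
      rw [Int.cast_add, Int.cast_mul, Int.cast_natCast, Int.cast_natCast]
      field_simp; ring
    rw [e1]
    simp only [e2]
  simp only [h2]
  have h3 := (hφ.comp_add_right ((δ.val : ℝ) / (c : ℝ))).hasSum_intervalIntegral_comp_add_int
  rw [(h3.mul_left _).tsum_eq, integral_add_right_eq_self φ]

/-- An absolutely convergent sum over the rows `(c, d)` that is invariant under `-1` and has no
contribution from `c = 0` is twice the sum over `c > 0`. -/
lemma tsum_rows {a : (Fin 2 → ℤ) → ℂ} (ha : Summable a) (hneg : ∀ v, a (-v) = a v)
    (hzero : ∀ d : ℤ, a ![0, d] = 0) :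
    (∀ c : ℤ, Summable fun d : ℤ => a ![c, d]) ∧ ∑' v, a v = 2 * ∑' c : ℕ, ∑' d : ℤ, a ![(c : ℤ), d] := by
  have hasum2 : Summable fun p : ℤ × ℤ => a ![p.1, p.2] :=
    ((finTwoArrowEquiv ℤ).symm.summable_iff (f := a)).mpr ha
  have htsum : ∑' v, a v = ∑' c : ℤ, ∑' d : ℤ, a ![c, d] := by
    rw [← hasum2.tsum_prod]
    exact ((finTwoArrowEquiv ℤ).symm.tsum_eq a).symm
  set B : ℤ → ℂ := fun c => ∑' d : ℤ, a ![c, d] with hB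
  have hcs : Summable B := hasum2.prod
  have hev : ∀ c : ℤ, B (-c) = B c := by
    intro c
    rw [hB]
    dsimp only
    rw [← (Equiv.neg ℤ).tsum_eq]
    refine tsum_congr fun d => ?_
    rw [← hneg ![c, d]]
    congr 1
    funext i; fin_cases i <;> simp
  have hs1 : Summable fun c : ℕ => B c := hcs.comp_injective Nat.cast_injective
  have hs2 : Summable fun c : ℕ => B (-(c : ℤ)) := by simpa only [hev] using hs1
  have hB0 : B 0 = 0 := by rw [hB]; simp [hzero]
  refine ⟨fun c => hasum2.prod_factor c, ?_⟩
  rw [htsum, (HasSum.of_nat_of_neg hs1.hasSum hs2.hasSum).tsum_eq, hB0, sub_zero]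
  simp only [hev]
  ring

/-- The Fourier coefficient as a Dirichlet series times the archimedean integral. -/
theorem fourierCoefficient_eisenstein (hQ : (QuadraticMap.polarBilin Q).Nondegenerate)
    (hL : L = Submodule.span ℤ (Set.range b)) (heven : ∀ x ∈ L, ∃ m : ℤ, Q x = m)
    (hW : IsWeilRep Q L (weilRep Q L)) [Finite (DiscGroup Q L)]
    (hsig : (4 : ℤ) ∣ k - (sigNeg Q : ℤ) + (sigPos Q : ℤ)) {κ : ℝ} (hk : 2 * κ = k)
    (hs : 1 - κ / 2 < s.re) {γ : dualLattice Q L} (hn : n ≠ 0) (hnγ : ∃ m : ℤ, (n : ℝ) = m - Q (γ : V))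
    {P : IntQuadPoly r}
    (hP : ∀ x : Fin r → ℤ, ((P.eval x : ℤ) : ℝ) = Q (∑ i, (x i : ℝ) • b i - γ) + n) (hy : 0 < y) :
    fourierCoefficient (eisenstein Q L k 0 s) (Submodule.Quotient.mk γ) n y hy
      = 2 * weilConst Q L * (∑' m, P.term (2 * s + κ) m) * ((y : ℂ) ^ s * ∫ x, lineFun k s n y x) := by
  classical
  set γ' : DiscGroup Q L := Submodule.Quotient.mk γ with hγ'
  have hpt : ∀ x : ℝ, (⟨⟨x, y⟩, hy⟩ : ℍ).im = y := fun x => rfl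
  obtain ⟨u, hu, hu0, hb⟩ := exists_summable_bound hQ hL heven hW hsig hk hs γ' 1 hy
  have hcont : Continuous fun x : ℝ => (⟨⟨x, y⟩, hy⟩ : ℍ) := by
    refine UpperHalfPlane.isEmbedding_coe.continuous_iff.mpr ?_
    have : (UpperHalfPlane.coe ∘ fun x : ℝ => (⟨⟨x, y⟩, hy⟩ : ℍ)) = fun x : ℝ => (x : ℂ) + y * Complex.I := by
      funext x
      apply Complex.ext <;> simp
    rw [this]
    fun_prop
  have hecont : Continuous fun x : ℝ => e (-(n * x)) := by unfold e; fun_prop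
  let F : (Fin 2 → ℤ) → C(ℝ, ℂ) := fun v =>
    ⟨fun x => rowTerm Q L k s γ' v ⟨⟨x, y⟩, hy⟩ * e (-(n * x)),
      ((continuous_rowTerm γ' v).comp hcont).mul hecont⟩
  have he1 : ∀ x : ℝ, ‖e (-(n * x))‖ = 1 := fun x => by
    have := norm_e_ofReal (-(n * x))
    push_cast at this
    exact this
  -- uniform convergence on `[0, 1]` permits integration term by term
  have hsumm : Summable fun v => ‖(F v).restrict (⟨Set.uIcc 0 1, isCompact_uIcc⟩ : TopologicalSpace.Compacts ℝ)‖ := by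
    refine Summable.of_nonneg_of_le (fun _ => norm_nonneg _) (fun v => ?_) hu
    refine (ContinuousMap.norm_le _ (hu0 v)).mpr fun x => ?_
    have hx : (x : ℝ) ∈ Set.Icc (0 : ℝ) 1 := by
      have := x.2
      rwa [← Set.uIcc_of_le (zero_le_one' ℝ)]
    change ‖rowTerm Q L k s γ' v ⟨⟨x, y⟩, hy⟩ * e (-(n * (x : ℝ)))‖ ≤ u v
    rw [norm_mul, he1, mul_one]
    refine hb v _ ⟨?_, le_rfl⟩
    change |(x : ℝ)| ≤ 1
    rw [abs_of_nonneg hx.1]; exact hx.2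
  have hsum := intervalIntegral.hasSum_intervalIntegral_of_summable_norm hsumm
  set a : (Fin 2 → ℤ) → ℂ := fun v => ∫ x in (0 : ℝ)..1, F v x with ha
  have hc0 : fourierCoefficient (eisenstein Q L k 0 s) γ' n y hy = (y : ℂ) ^ s * ∑' v, a v := by
    rw [hsum.tsum_eq, fourierCoefficient, ← intervalIntegral.integral_const_mul]
    refine intervalIntegral.integral_congr fun x _ => ?_
    rw [eisenstein_eq hW hsig fun γ => summable_rowTerm hQ hL heven hW hsig hk hs _ γ, hpt]
    change _ = _ * ∑' v, rowTerm Q L k s γ' v ⟨⟨x, y⟩, hy⟩ * e (-(n * x))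
    rw [tsum_mul_right]; ring
  have hneg : ∀ v, a (-v) = a v := fun v => by
    refine intervalIntegral.integral_congr fun x _ => ?_
    change rowTerm Q L k s γ' (-v) _ * _ = rowTerm Q L k s γ' v _ * _
    rw [rowTerm_neg hW hsig]
  -- the constant term of the expansion does not contribute, as `n ≠ 0`
  have hzero : ∀ d : ℤ, a ![0, d] = 0 := by
    intro d
    by_cases hv : IsCoprime ((![0, d] : Fin 2 → ℤ) 0) ((![0, d] : Fin 2 → ℤ) 1)
    · have h1 : a ![0, d] = ∫ x in (0 : ℝ)..1, basisVec γ' 0 * e (-(n * x)) := by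
        refine intervalIntegral.integral_congr fun x _ => ?_
        change rowTerm Q L k s γ' _ _ * _ = _
        rw [rowTerm_of_eq_zero hW hsig γ' hv rfl]
      rw [h1, intervalIntegral.integral_const_mul]
      by_cases hγ0 : γ' = 0
      · have hmem : (γ : V) ∈ L := by
          rw [hγ', Submodule.Quotient.mk_eq_zero] at hγ0
          exact hγ0
        obtain ⟨q, hq⟩ := heven _ hmem
        obtain ⟨m, hm⟩ := hnγ
        have hnm : (n : ℂ) = ((m - q : ℤ) : ℂ) := by
          have : (n : ℝ) = ((m - q : ℤ) : ℝ) := by rw [hm, hq]; push_cast; ring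
          exact_mod_cast congrArg (fun t : ℝ => (t : ℂ)) this
        have hn0 : (n : ℂ) ≠ 0 := by exact_mod_cast hn
        have h2 : ∀ x : ℝ, e (-(n * x)) = Complex.exp (-(2 * π * Complex.I * n) * x) := fun x => by
          rw [e]; congr 1; ring
        have h3 : (-(2 * π * Complex.I * n) : ℂ) ≠ 0 :=
          neg_ne_zero.mpr (mul_ne_zero Complex.two_pi_I_ne_zero hn0)
        simp only [h2]
        rw [integral_exp_mul_complex h3, hnm]
        have h4 : Complex.exp (-(2 * π * Complex.I * ((m - q : ℤ) : ℂ)) * ((1 : ℝ) : ℂ)) = 1 := by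
          rw [Complex.exp_eq_one_iff]
          exact ⟨-(m - q), by push_cast; ring⟩
        rw [h4]; simp
      · rw [basisVec, Pi.single_apply, if_neg (Ne.symm hγ0), zero_mul]
    · rw [ha]
      have h1 : ∀ x : ℝ, F ![0, d] x = 0 := fun x => by
        change rowTerm Q L k s γ' _ _ * _ = 0
        rw [rowTerm, dif_neg hv, zero_mul]
      simp [h1]
  have hint := integrable_lineFun (n := n) hy hk hs
  have hasum : Summable a := hsum.summable
  obtain ⟨hrow, htsum⟩ := tsum_rows hasum hneg hzero
  -- the terms with a given `c > 0`
  have hpos : ∀ c : ℕ, ∑' d : ℤ, a ![(c : ℤ), d]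
      = weilConst Q L * P.term (2 * s + κ) c * ∫ x, lineFun k s n y x := by
    intro c
    rcases Nat.eq_zero_or_pos c with rfl | hc
    · simp [hzero, IntQuadPoly.term, IntQuadPoly.expSum]
    · have : NeZero c := ⟨hc.ne'⟩
      set h : ZMod c → ℂ := fun δ => weilConst Q L * (c : ℂ) ^ (-(r / 2 + (2 * s + κ))) *
        (if IsUnit δ then P.gaussSum δ else 0) with hh
      have h1 : ∀ d : ℤ, a ![(c : ℤ), d] = h d * ∫ x in (0 : ℝ)..1, lineFun k s n y (x + d / c) := by
        intro d
        rw [← intervalIntegral.integral_const_mul]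
        refine intervalIntegral.integral_congr fun x _ => ?_
        exact rowTerm_mul_e hQ hL heven hk hP hy d x
      have h2 : Summable fun d : ℤ => a ![(c : ℤ), d] := hrow c
      simp only [h1] at h2 ⊢
      rw [tsum_int_unfold h hint h2, hh, ← Finset.mul_sum, IntQuadPoly.term, IntQuadPoly.expSum_eq,
        IntQuadPoly.unitSum]
      ring
  rw [hc0, htsum]
  simp only [hpos]
  rw [tsum_mul_right, tsum_mul_left]
  ring

end

/-! ### The coefficient function and its closed formulas -/

section Closed

open Complex

variable {V : Type*} [AddCommGroup V] [Module ℝ V] (Q : QuadraticForm ℝ V) (L : Submodule ℤ V)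
  {r : ℕ} (b : Module.Basis (Fin r) ℝ V)

/-- The analytic continuation of the Dirichlet series of the finite exponential sums: its value is
`σ(S) / L(χ, S)` in even rank and `L(χ, S - 1/2) σ(S) / ζ(2S - 1)` in odd rank. -/
def dirichletQuotient (γ : dualLattice Q L) (n : ℚ) (D₀ : ℤ) (S : ℂ) : ℂ :=
  if Even r then sigma Q L b γ n D₀ S / kroneckerL D₀ S
  else kroneckerL D₀ (S - 1 / 2) * sigma Q L b γ n D₀ S / riemannZeta (2 * S - 1)

/-- The function `C(γ, n, s)`, as the product of the archimedean factor and the Dirichlet series;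
`j` is the integer with `4j = 2κ - b⁻ + b⁺`. -/
def coeffFun (κ : ℝ) (j : ℤ) (γ : dualLattice Q L) (n : ℚ) (D₀ : ℤ) (s : ℂ) : ℂ :=
  (-1) ^ j * ((2 : ℂ) ^ (κ + 1 : ℂ) * (π : ℂ) ^ (κ + s) * ((|n| : ℚ) : ℂ) ^ (κ + s - 1) /
    ((Real.sqrt (Nat.card (DiscGroup Q L)) : ℂ) * gammaFactor κ n s)) *
    dirichletQuotient Q L b γ n D₀ (2 * s + κ)

variable {Q L b}

lemma cos_add_int_mul_pi (z : ℂ) (j : ℤ) : cos (z + j * π) = (-1) ^ j * cos z := by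
  rw [cos_antiperiodic.add_int_mul_eq, Int.cast_negOnePow]

lemma cos_pi_mul_ne_zero {z : ℂ} (hz : z.im ≠ 0) : cos (π * z) ≠ 0 := by
  intro h
  obtain ⟨m, hm⟩ := cos_eq_zero_iff.mp h
  have h1 : z = (((2 * m + 1) / 2 : ℝ) : ℂ) := by
    have hpi : (π : ℂ) ≠ 0 := ofReal_ne_zero.mpr Real.pi_ne_zero
    apply mul_left_cancel₀ hpi
    rw [hm]; push_cast; ring
  exact hz (by rw [h1, ofReal_im])

lemma sin_pi_mul_ne_zero {z : ℂ} (hz : z.im ≠ 0) : sin (π * z) ≠ 0 := by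
  intro h
  obtain ⟨m, hm⟩ := sin_eq_zero_iff.mp h
  have h1 : z = ((m : ℝ) : ℂ) := by
    have hpi : (π : ℂ) ≠ 0 := ofReal_ne_zero.mpr Real.pi_ne_zero
    apply mul_left_cancel₀ hpi
    rw [hm]; push_cast; ring
  exact hz (by rw [h1, ofReal_im])

lemma two_lt_re {κ : ℝ} {s : ℂ} (hs : 1 - κ / 2 < s.re) : 2 < (2 * s + κ).re := by
  simp; linarith

lemma signDelta_im (D : ℤ) : (signDelta D).im = 0 := by
  unfold signDelta; split_ifs <;> simp

/-- The functional equation of `L(χ_D, ·)` with the cosine of the even rank formula. -/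
lemma kroneckerL_one_sub_even {D : ℤ} (hD : IsFundamentalDiscriminant D) {κ : ℝ} {p q : ℂ} {j : ℤ}
    (hj : 2 * (κ : ℂ) - q + p = 4 * j) {s : ℂ} (hs : 1 - κ / 2 < s.re) :
    kroneckerL D (1 - 2 * s - κ) = 2 * (D.natAbs : ℂ) ^ (2 * s + κ - 1 / 2) *
      (2 * π) ^ (-(2 * s + κ)) * Gamma (2 * s + κ) *
      ((-1) ^ j * cos (π * (s - signDelta D / 2 + (q - p) / 4))) * kroneckerL D (2 * s + κ) := by
  have h := kroneckerL_one_sub hD (S := 2 * s + κ) (by linarith [two_lt_re hs])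
  rw [← cos_add_int_mul_pi, show (1 : ℂ) - 2 * s - κ = 1 - (2 * s + κ) by ring, h,
    show (π : ℂ) * (2 * s + κ - signDelta D) / 2 =
      π * (s - signDelta D / 2 + (q - p) / 4) + j * π by
        have : (κ : ℂ) = 2 * j + (q - p) / 2 := by linear_combination hj / 2
        rw [this]; ring]

/-- The functional equation of `L(χ_D, ·)` with the cosine of the odd rank formula. -/
lemma kroneckerL_one_sub_odd {D : ℤ} (hD : IsFundamentalDiscriminant D) {κ : ℝ} {p q : ℂ} {j : ℤ}
    (hj : 2 * (κ : ℂ) - q + p = 4 * j) {s : ℂ} (hs : 1 - κ / 2 < s.re) :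
    kroneckerL D (3 / 2 - 2 * s - κ) = 2 * (D.natAbs : ℂ) ^ (2 * s + κ - 1) *
      (2 * π) ^ (-(2 * s + κ - 1 / 2)) * Gamma (2 * s + κ - 1 / 2) *
      ((-1) ^ j * cos (π * (s - signDelta D / 2 + (q - p - 1) / 4))) *
        kroneckerL D (2 * s + κ - 1 / 2) := by
  have h := kroneckerL_one_sub hD (S := 2 * s + κ - 1 / 2) (by
    have := two_lt_re hs
    have e : (1 / 2 : ℂ).re = 1 / 2 := by norm_num
    rw [sub_re, e]; linarith)
  rw [← cos_add_int_mul_pi, show (3 / 2 : ℂ) - 2 * s - κ = 1 - (2 * s + κ - 1 / 2) by ring, h,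
    show (π : ℂ) * (2 * s + κ - 1 / 2 - signDelta D) / 2 =
      π * (s - signDelta D / 2 + (q - p - 1) / 4) + j * π by
        have : (κ : ℂ) = 2 * j + (q - p) / 2 := by linear_combination hj / 2
        rw [this]; ring, show (2 * s + κ - 1 / 2 - 1 / 2 : ℂ) = 2 * s + κ - 1 by ring]

/-- The functional equation of `ζ` at `1 - (2(2s + κ) - 1)`, with the sine of the odd rank formula. -/
lemma riemannZeta_one_sub_odd {κ : ℝ} {s : ℂ} (hs : 1 - κ / 2 < s.re) :
    riemannZeta (2 - 4 * s - 2 * κ) = 2 * (2 * π) ^ (-(2 * (2 * s + κ) - 1)) *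
      Gamma (2 * (2 * s + κ) - 1) * sin (π * (2 * s + κ)) *
        riemannZeta (2 * (2 * s + κ) - 1) := by
  have h2 := two_lt_re hs
  have hre : 1 < (2 * (2 * s + κ) - 1 : ℂ).re := by
    rw [sub_re, one_re, show (2 * (2 * s + κ) : ℂ).re = 2 * (2 * s + κ : ℂ).re by simp]
    linarith
  have h := riemannZeta_one_sub (s := 2 * (2 * s + κ) - 1) (fun m hm => by
      rw [hm] at hre
      simp only [neg_re, natCast_re] at hre
      linarith [(Nat.cast_nonneg m : (0 : ℝ) ≤ m)]) (fun hm => by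
      rw [hm, one_re] at hre; exact lt_irrefl _ hre)
  rw [show (2 - 4 * s - 2 * κ : ℂ) = 1 - (2 * (2 * s + κ) - 1) by ring, h,
    show (π : ℂ) * (2 * (2 * s + κ) - 1) / 2 = π * (2 * s + κ) - π / 2 by ring,
    cos_sub_pi_div_two]

/-- In even rank the functional equation replaces `L(χ, 2s + κ)` by `L(χ, 1 - 2s - κ)`. -/
lemma coeffFun_eq_coeffEven (hr : Even r) {κ : ℝ} {j : ℤ}
    (hj : 2 * (κ : ℂ) - sigNeg Q + sigPos Q = 4 * j) {γ : dualLattice Q L} {n : ℚ} {D₀ : ℤ}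
    (hD₀ : IsFundamentalDiscriminant D₀) {s : ℂ} (hs : 1 - κ / 2 < s.re)
    (h0 : kroneckerL D₀ (1 - 2 * s - κ) ≠ 0) :
    coeffFun Q L b κ j γ n D₀ s = coeffEven Q L b κ γ n D₀ s := by
  have hpi : (π : ℂ) ≠ 0 := ofReal_ne_zero.mpr Real.pi_ne_zero
  have hF := kroneckerL_one_sub_even hD₀ hj hs
  rw [coeffFun, dirichletQuotient, if_pos hr, coeffEven, hF]
  rw [hF] at h0
  generalize kroneckerL D₀ (2 * s + κ) = ℓ at *
  generalize cos (π * (s - signDelta D₀ / 2 + ((sigNeg Q : ℂ) - sigPos Q) / 4)) = c at *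
  generalize (D₀.natAbs : ℂ) ^ (2 * s + κ - 1 / 2) = d at *
  generalize Gamma (2 * s + κ) = g at *
  simp only [mul_ne_zero_iff] at h0
  obtain ⟨⟨⟨⟨⟨_, hd⟩, hp⟩, hg⟩, ⟨hj0, hc⟩⟩, hl⟩ := h0
  have hJ : ((-1 : ℂ) ^ j) * (-1) ^ j = 1 := by
    rw [← mul_zpow]; simp
  have e1 : (2 : ℂ) ^ (2 - 2 * s) * (π : ℂ) ^ (-s) =
      2 * (2 * π : ℂ) ^ (-(2 * s + κ)) * ((2 : ℂ) ^ (κ + 1 : ℂ) * (π : ℂ) ^ (κ + s)) := by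
    rw [show ((2 : ℂ) * π) ^ (-(2 * s + κ)) = 2 ^ (-(2 * s + κ)) * (π : ℂ) ^ (-(2 * s + κ)) by
        have := mul_cpow_ofReal_nonneg (by norm_num : (0 : ℝ) ≤ 2) Real.pi_pos.le (-(2 * s + κ))
        simpa using this,
      show (2 - 2 * s : ℂ) = 1 + -(2 * s + κ) + (κ + 1) by ring,
      show (-s : ℂ) = -(2 * s + κ) + (κ + s) by ring,
      cpow_add _ _ two_ne_zero, cpow_add _ _ two_ne_zero, cpow_add _ _ hpi, cpow_one]
    ring
  rw [e1]
  generalize (2 : ℂ) ^ (κ + 1 : ℂ) * (π : ℂ) ^ (κ + s) = A at *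
  generalize (2 * π : ℂ) ^ (-(2 * s + κ)) = B at *
  generalize (Real.sqrt (Nat.card (DiscGroup Q L)) : ℂ) * gammaFactor κ n s = G at *
  generalize sigma Q L b γ n D₀ (2 * s + κ) = σ at *
  generalize ((|n| : ℚ) : ℂ) ^ (κ + s - 1) = m at *
  generalize (-1 : ℂ) ^ j = J at *
  rw [div_eq_mul_inv _ G, div_eq_mul_inv _ G]
  generalize G⁻¹ = G' at *
  field_simp
  grind

/-- In odd rank the functional equations of both `L(χ, ·)` and `ζ` are used, and their Gamma factors
are combined by Legendre's duplication formula. -/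
lemma coeffFun_eq_coeffOdd (hr : ¬ Even r) {κ : ℝ} {j : ℤ}
    (hj : 2 * (κ : ℂ) - sigNeg Q + sigPos Q = 4 * j) {γ : dualLattice Q L} {n : ℚ} {D₀ : ℤ}
    (hD₀ : IsFundamentalDiscriminant D₀) {s : ℂ} (hs : 1 - κ / 2 < s.re)
    (hc : cos (π * (s - signDelta D₀ / 2 + ((sigNeg Q : ℂ) - sigPos Q - 1) / 4)) ≠ 0)
    (hz : riemannZeta (2 - 4 * s - 2 * κ) ≠ 0) :
    coeffFun Q L b κ j γ n D₀ s = coeffOdd Q L b κ γ n D₀ s := by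
  have hpi : (π : ℂ) ≠ 0 := ofReal_ne_zero.mpr Real.pi_ne_zero
  have hd0 : (D₀.natAbs : ℂ) ≠ 0 :=
    Nat.cast_ne_zero.mpr (Int.natAbs_ne_zero.mpr (ne_zero_of_isFundamentalDiscriminant hD₀))
  have hF := kroneckerL_one_sub_odd hD₀ hj hs
  have hZ := riemannZeta_one_sub_odd hs
  have hG : Gamma (2 * s + κ - 1 / 2) * Gamma (2 * s + κ) =
      Gamma (2 * (2 * s + κ) - 1) * 2 ^ (2 - 2 * (2 * s + κ)) * (π : ℂ) ^ (1 / 2 : ℂ) := by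
    have h := Complex.Gamma_mul_Gamma_add_half (2 * s + κ - 1 / 2)
    rw [show (2 * s + κ - 1 / 2 + 1 / 2 : ℂ) = 2 * s + κ by ring,
      show (2 * (2 * s + κ - 1 / 2) : ℂ) = 2 * (2 * s + κ) - 1 by ring,
      show (1 - (2 * (2 * s + κ) - 1) : ℂ) = 2 - 2 * (2 * s + κ) by ring,
      Real.sqrt_eq_rpow, ofReal_cpow Real.pi_pos.le] at h
    rw [h]; norm_num
  have hdd : (D₀.natAbs : ℂ) ^ (1 - κ - 2 * s) * (D₀.natAbs : ℂ) ^ (2 * s + κ - 1) = 1 := by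
    rw [← cpow_add _ _ hd0, show (1 - κ - 2 * s + (2 * s + κ - 1) : ℂ) = 0 by ring, cpow_zero]
  have h2p : ∀ z : ℂ, ((2 : ℂ) * π) ^ z = 2 ^ z * (π : ℂ) ^ z := fun z => by
    have := mul_cpow_ofReal_nonneg (by norm_num : (0 : ℝ) ≤ 2) Real.pi_pos.le z
    simpa using this
  have e1 : (2 : ℂ) ^ (2 * s + 2 * κ - 1 / 2) * (π : ℂ) ^ (-s) *
      ((2 * π) ^ (-(2 * s + κ - 1 / 2)) *
        (2 ^ (2 - 2 * (2 * s + κ)) * (π : ℂ) ^ (1 / 2 : ℂ))) =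
      (2 * π) ^ (-(2 * (2 * s + κ) - 1)) * ((2 : ℂ) ^ (κ + 1 : ℂ) * (π : ℂ) ^ (κ + s)) := by
    rw [h2p, h2p]
    have a1 : (2 : ℂ) ^ (2 * s + 2 * κ - 1 / 2) * 2 ^ (-(2 * s + κ - 1 / 2)) *
        2 ^ (2 - 2 * (2 * s + κ)) = 2 ^ (-(2 * (2 * s + κ) - 1)) * (2 : ℂ) ^ (κ + 1 : ℂ) := by
      simp only [← cpow_add _ _ (two_ne_zero (α := ℂ))]
      congr 1; ring
    have a2 : (π : ℂ) ^ (-s) * π ^ (-(2 * s + κ - 1 / 2)) * (π : ℂ) ^ (1 / 2 : ℂ) =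
        π ^ (-(2 * (2 * s + κ) - 1)) * (π : ℂ) ^ (κ + s) := by
      simp only [← cpow_add _ _ hpi]
      congr 1; ring
    linear_combination (π : ℂ) ^ (-s) * π ^ (-(2 * s + κ - 1 / 2)) * (π : ℂ) ^ (1 / 2 : ℂ) * a1 +
      2 ^ (-(2 * (2 * s + κ) - 1)) * (2 : ℂ) ^ (κ + 1 : ℂ) * a2
  rw [coeffFun, dirichletQuotient, if_neg hr, coeffOdd, hF, hZ]
  rw [hZ] at hz
  have hJ : (-1 : ℂ) ^ j ≠ 0 := zpow_ne_zero _ (by norm_num)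
  generalize kroneckerL D₀ (2 * s + κ - 1 / 2) = ℓ at *
  generalize riemannZeta (2 * (2 * s + κ) - 1) = ζ' at *
  generalize cos (π * (s - signDelta D₀ / 2 + ((sigNeg Q : ℂ) - sigPos Q - 1) / 4)) = c at *
  generalize sin (π * (2 * s + κ)) = t at *
  generalize (D₀.natAbs : ℂ) ^ (2 * s + κ - 1) = d at *
  generalize (D₀.natAbs : ℂ) ^ (1 - κ - 2 * s) = d' at *
  generalize Gamma (2 * s + κ) = g at *
  generalize Gamma (2 * s + κ - 1 / 2) = g1 at *
  generalize Gamma (2 * (2 * s + κ) - 1) = g2 at *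
  generalize (2 : ℂ) ^ (2 - 2 * (2 * s + κ)) = A1 at *
  generalize (π : ℂ) ^ (1 / 2 : ℂ) = A2 at *
  generalize (2 * π : ℂ) ^ (-(2 * s + κ - 1 / 2)) = B at *
  generalize (2 * π : ℂ) ^ (-(2 * (2 * s + κ) - 1)) = B' at *
  generalize (2 : ℂ) ^ (2 * s + 2 * κ - 1 / 2) * (π : ℂ) ^ (-s) = A at *
  generalize (2 : ℂ) ^ (κ + 1 : ℂ) * (π : ℂ) ^ (κ + s) = A' at *
  rw [mul_assoc c]
  generalize (Real.sqrt (Nat.card (DiscGroup Q L)) : ℂ) * gammaFactor κ n s = G at *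
  generalize sigma Q L b γ n D₀ (2 * s + κ) = σ at *
  generalize ((|n| : ℚ) : ℂ) ^ (κ + s - 1) = m at *
  generalize (-1 : ℂ) ^ j = J at *
  simp only [mul_ne_zero_iff] at hz
  obtain ⟨⟨⟨⟨_, hB⟩, hg2⟩, ht⟩, hz'⟩ := hz
  rw [div_eq_mul_inv _ G, div_eq_mul_inv _ (c * G), mul_inv c G]
  generalize G⁻¹ = G' at *
  field_simp
  -- the duplication formula `hG` turns the quotient of the Gamma factors into `Γ(2s + κ)`
  have e2 : A' * B' * g2 = A * B * g * g1 * (d' * d) := by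
    rw [hdd]; linear_combination -g2 * e1 - A * B * hG
  linear_combination m * G' * ℓ * σ * e2

end Closed

/-! ### Meromorphic continuation -/

section Meromorphy

open Complex

variable {V : Type*} [AddCommGroup V] [Module ℝ V] (Q : QuadraticForm ℝ V) (L : Submodule ℤ V)
  {r : ℕ} (b : Module.Basis (Fin r) ℝ V)

lemma differentiable_const_cpow {a : ℂ} (ha : a ≠ 0) {f : ℂ → ℂ} (hf : Differentiable ℂ f) :
    Differentiable ℂ fun s => a ^ f s := fun s => (hf s).const_cpow (Or.inl ha)

lemma meromorphicAt_of_differentiable {f : ℂ → ℂ} (hf : Differentiable ℂ f) (s : ℂ) :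
    MeromorphicAt f s := (hf.analyticAt s).meromorphicAt

lemma meromorphic_riemannZeta (s : ℂ) : MeromorphicAt riemannZeta s := by
  rcases eq_or_ne s 1 with rfl | hs
  · exact meromorphicAt_of_tendsto_sub_mul (fun s hs => differentiableAt_riemannZeta hs)
      riemannZeta_residue_one
  · refine (DifferentiableOn.analyticAt (s := {1}ᶜ) (fun z hz =>
      (differentiableAt_riemannZeta hz).differentiableWithinAt)
      (isOpen_compl_singleton.mem_nhds hs)).meromorphicAt

lemma meromorphicAt_comp {F f : ℂ → ℂ} (hF : ∀ s, MeromorphicAt F s) (hf : Differentiable ℂ f)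
    (s : ℂ) : MeromorphicAt (fun z => F (f z)) s :=
  (hF (f s)).comp_analyticAt (hf.analyticAt s)

lemma differentiable_localPoly (γ : V) (n : ℚ) (p : ℕ) :
    Differentiable ℂ (localPoly Q L r γ n p) := by
  unfold localPoly
  fun_prop

lemma differentiable_gammaFactor_inv (κ : ℝ) (n : ℚ) :
    Differentiable ℂ fun s => (gammaFactor κ n s)⁻¹ := by
  unfold gammaFactor
  split_ifs
  · exact differentiable_one_div_Gamma.comp (differentiable_id.add_const _)
  · exact differentiable_one_div_Gamma

lemma prime_of_mem_badPrimes {γ : V} {n : ℚ} {p : ℕ} (hp : p ∈ badPrimes Q L b γ n) : p.Prime :=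
  Nat.prime_of_mem_primeFactors hp

lemma meromorphic_sigma (γ : V) (n : ℚ) (D₀ : ℤ) (s : ℂ) :
    MeromorphicAt (sigma Q L b γ n D₀) s := by
  unfold sigma
  split_ifs
  all_goals
    refine MeromorphicAt.fun_prod fun p hp => ?_
    have hp0 : (p : ℂ) ≠ 0 := Nat.cast_ne_zero.mpr (prime_of_mem_badPrimes Q L b hp).ne_zero
    have h1 : Differentiable ℂ fun z : ℂ => localPoly Q L r γ n p ((p : ℂ) ^ (1 - r / 2 - z)) :=
      (differentiable_localPoly Q L γ n p).comp (differentiable_const_cpow hp0 (by fun_prop))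
  · exact (meromorphicAt_of_differentiable h1 s).div (meromorphicAt_of_differentiable
      (((differentiable_const_cpow hp0 (by fun_prop)).const_mul _).const_sub _) s)
  · exact ((meromorphicAt_of_differentiable
      (((differentiable_const_cpow hp0 (by fun_prop)).const_mul _).const_sub _) s).div
      (meromorphicAt_of_differentiable
        ((differentiable_const_cpow hp0 (by fun_prop)).const_sub _) s)).mul
      (meromorphicAt_of_differentiable h1 s)

/-- The denominators in `σ` do not vanish for `Re S > 1`. -/
lemma differentiableAt_sigma (γ : V) (n : ℚ) {D₀ : ℤ} (hD₀ : IsFundamentalDiscriminant D₀) {S : ℂ}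
    (hS : 1 < S.re) : DifferentiableAt ℂ (sigma Q L b γ n D₀) S := by
  unfold sigma
  split_ifs
  all_goals
    refine DifferentiableAt.fun_finsetProd fun p hp => ?_
    have hp' := prime_of_mem_badPrimes Q L b hp
    have hp0 : (p : ℂ) ≠ 0 := Nat.cast_ne_zero.mpr hp'.ne_zero
    have h1 : Differentiable ℂ fun z : ℂ => localPoly Q L r γ n p ((p : ℂ) ^ (1 - r / 2 - z)) :=
      (differentiable_localPoly Q L γ n p).comp (differentiable_const_cpow hp0 (by fun_prop))
  · exact (h1 S).div ((((differentiable_const_cpow hp0 (by fun_prop)).const_mul _).const_sub _) S)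
      (one_sub_kroneckerSymbol_mul_ne_zero hD₀ hS hp')
  · refine DifferentiableAt.mul (DifferentiableAt.div
      ((((differentiable_const_cpow hp0 (by fun_prop)).const_mul _).const_sub _) S)
      (((differentiable_const_cpow hp0 (by fun_prop)).const_sub _) S) ?_) (h1 S)
    intro h
    have h2 : ‖(p : ℂ) ^ (1 - 2 * S)‖ = 1 := by rw [← sub_eq_zero.mp h, norm_one]
    rw [norm_natCast_cpow_of_pos hp'.pos] at h2
    have h3 : (p : ℝ) ^ (1 - 2 * S).re < 1 :=
      Real.rpow_lt_one_of_one_lt_of_neg (by exact_mod_cast hp'.one_lt) (by simp; linarith)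
    exact h3.ne h2

variable {Q L b}

lemma meromorphic_dirichletQuotient (γ : dualLattice Q L) (n : ℚ) (D₀ : ℤ) (s : ℂ) :
    MeromorphicAt (dirichletQuotient Q L b γ n D₀) s := by
  unfold dirichletQuotient
  split_ifs
  · exact (meromorphic_sigma Q L b _ n D₀ s).div (meromorphic_kroneckerL D₀ s)
  · exact ((meromorphicAt_comp (meromorphic_kroneckerL D₀) (by fun_prop) s).mul
      (meromorphic_sigma Q L b _ n D₀ s)).div
      (meromorphicAt_comp meromorphic_riemannZeta (by fun_prop) s)

lemma differentiableAt_dirichletQuotient (γ : dualLattice Q L) (n : ℚ) {D₀ : ℤ}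
    (hD₀ : IsFundamentalDiscriminant D₀) {S : ℂ} (hS : 2 < S.re) :
    DifferentiableAt ℂ (dirichletQuotient Q L b γ n D₀) S := by
  have hσ := differentiableAt_sigma Q L b γ n hD₀ (S := S) (by linarith)
  unfold dirichletQuotient
  split_ifs
  · refine hσ.div (differentiableAt_kroneckerL D₀ ?_) (kroneckerL_ne_zero hD₀ (by linarith))
    rintro rfl; norm_num at hS
  · have hre : (2 * S - 1).re = 2 * S.re - 1 := by simp
    have hre' : (S - 1 / 2).re = S.re - 1 / 2 := by simp
    have h2 : DifferentiableAt ℂ riemannZeta (2 * S - 1) := differentiableAt_riemannZeta fun h => by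
      rw [h, one_re] at hre; linarith
    have h1 : DifferentiableAt ℂ (kroneckerL D₀) (S - 1 / 2) :=
      differentiableAt_kroneckerL D₀ fun h => by rw [h, one_re] at hre'; linarith
    have h1' : DifferentiableAt ℂ (fun z : ℂ => kroneckerL D₀ (z - 1 / 2)) S :=
      DifferentiableAt.comp (g := kroneckerL D₀) (f := fun z : ℂ => z - 1 / 2) S h1 (by fun_prop)
    have h2' : DifferentiableAt ℂ (fun z : ℂ => riemannZeta (2 * z - 1)) S :=
      DifferentiableAt.comp (g := riemannZeta) (f := fun z : ℂ => 2 * z - 1) S h2 (by fun_prop)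
    exact (h1'.mul hσ).div h2'
      (riemannZeta_ne_zero_of_one_lt_re (by linarith))

/-- The coefficient function splits into an entire archimedean factor and the Dirichlet series. -/
lemma coeffFun_arch {κ : ℝ} {j : ℤ} {γ : dualLattice Q L} {n : ℚ} {D₀ : ℤ} :
    coeffFun Q L b κ j γ n D₀ = fun s : ℂ => ((-1) ^ j * (2 : ℂ) ^ (κ + 1 : ℂ) *
      ((Real.sqrt (Nat.card (DiscGroup Q L)) : ℂ))⁻¹ * ((π : ℂ) ^ (κ + s) *
        ((|n| : ℚ) : ℂ) ^ (κ + s - 1) * (gammaFactor κ n s)⁻¹)) *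
      dirichletQuotient Q L b γ n D₀ (2 * s + κ) := by
  funext s
  rw [coeffFun, div_eq_mul_inv, mul_inv]
  ring

lemma differentiable_coeffFun_arch (Q : QuadraticForm ℝ V) (L : Submodule ℤ V) (κ : ℝ) (j : ℤ)
    {n : ℚ} (hn : n ≠ 0) :
    Differentiable ℂ fun s : ℂ => (-1) ^ j * (2 : ℂ) ^ (κ + 1 : ℂ) *
      ((Real.sqrt (Nat.card (DiscGroup Q L)) : ℂ))⁻¹ * ((π : ℂ) ^ (κ + s) *
        ((|n| : ℚ) : ℂ) ^ (κ + s - 1) * (gammaFactor κ n s)⁻¹) := by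
  have hn' : ((|n| : ℚ) : ℂ) ≠ 0 := Rat.cast_ne_zero.mpr (abs_ne_zero.mpr hn)
  exact (((differentiable_const_cpow (ofReal_ne_zero.mpr Real.pi_ne_zero) (by fun_prop)).mul
    (differentiable_const_cpow hn' (by fun_prop))).mul
      (differentiable_gammaFactor_inv κ n)).const_mul _

lemma meromorphic_coeffFun (κ : ℝ) (j : ℤ) (γ : dualLattice Q L) {n : ℚ} (hn : n ≠ 0) (D₀ : ℤ)
    (s : ℂ) : MeromorphicAt (coeffFun Q L b κ j γ n D₀) s := by
  rw [coeffFun_arch]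
  exact (meromorphicAt_of_differentiable (differentiable_coeffFun_arch Q L κ j hn) s).mul
    (meromorphicAt_comp (meromorphic_dirichletQuotient γ n D₀) (by fun_prop) s)

lemma analyticOnNhd_coeffFun (κ : ℝ) (j : ℤ) (γ : dualLattice Q L) {n : ℚ} (hn : n ≠ 0) {D₀ : ℤ}
    (hD₀ : IsFundamentalDiscriminant D₀) :
    AnalyticOnNhd ℂ (coeffFun Q L b κ j γ n D₀) {s | 1 - κ / 2 < s.re} := by
  refine DifferentiableOn.analyticOnNhd (fun s hs => ?_) (isOpen_lt continuous_const continuous_re)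
  rw [coeffFun_arch]
  refine DifferentiableAt.differentiableWithinAt
    ((differentiable_coeffFun_arch Q L κ j hn s).mul ?_)
  exact DifferentiableAt.comp (g := dirichletQuotient Q L b γ n D₀) (f := fun z : ℂ => 2 * z + κ) s
    (differentiableAt_dirichletQuotient γ n hD₀ (two_lt_re hs)) (by fun_prop)

lemma meromorphic_coeffEven (κ : ℝ) (γ : dualLattice Q L) {n : ℚ} (hn : n ≠ 0) {D₀ : ℤ}
    (hD₀ : D₀ ≠ 0) (s : ℂ) : MeromorphicAt (coeffEven Q L b κ γ n D₀) s := by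
  have hn' : ((|n| : ℚ) : ℂ) ≠ 0 := Rat.cast_ne_zero.mpr (abs_ne_zero.mpr hn)
  have hd : (D₀.natAbs : ℂ) ≠ 0 := Nat.cast_ne_zero.mpr (Int.natAbs_ne_zero.mpr hD₀)
  have hcos : Differentiable ℂ fun s : ℂ => cos (π * (s - signDelta D₀ / 2 +
      ((sigNeg Q : ℂ) - sigPos Q) / 4)) := by fun_prop
  have key : coeffEven Q L b κ γ n D₀ = fun s : ℂ => (2 : ℂ) ^ (2 - 2 * s) * (π : ℂ) ^ (-s) *
      ((|n| : ℚ) : ℂ) ^ (κ + s - 1) * cos (π * (s - signDelta D₀ / 2 +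
      ((sigNeg Q : ℂ) - sigPos Q) / 4)) *
      ((D₀.natAbs : ℂ) ^ (2 * s + κ - 1 / 2) * Gamma (2 * s + κ) *
      (((Real.sqrt (Nat.card (DiscGroup Q L)) : ℂ))⁻¹ * (gammaFactor κ n s)⁻¹)) *
      (sigma Q L b γ n D₀ (2 * s + κ) / kroneckerL D₀ (1 - 2 * s - κ)) := by
    funext s
    rw [coeffEven, div_eq_mul_inv _ (_ * gammaFactor κ n s), mul_inv]
  rw [key]
  exact (((meromorphicAt_of_differentiable
      (((differentiable_const_cpow two_ne_zero (by fun_prop)).mul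
      (differentiable_const_cpow (ofReal_ne_zero.mpr Real.pi_ne_zero) (by fun_prop))).mul
      (differentiable_const_cpow hn' (by fun_prop))) s).mul
      (meromorphicAt_of_differentiable hcos s)).mul
    (((meromorphicAt_of_differentiable (differentiable_const_cpow hd (by fun_prop)) s).mul
      (meromorphicAt_comp Meromorphic.Gamma (by fun_prop) s)).mul
      (meromorphicAt_of_differentiable ((differentiable_gammaFactor_inv κ n).const_mul _) s))).mul
    ((meromorphicAt_comp (meromorphic_sigma Q L b _ n D₀) (by fun_prop) s).div
      (meromorphicAt_comp (meromorphic_kroneckerL D₀) (by fun_prop) s))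

lemma meromorphic_coeffOdd (κ : ℝ) (γ : dualLattice Q L) {n : ℚ} (hn : n ≠ 0) {D₀ : ℤ}
    (hD₀ : D₀ ≠ 0) (s : ℂ) : MeromorphicAt (coeffOdd Q L b κ γ n D₀) s := by
  have hn' : ((|n| : ℚ) : ℂ) ≠ 0 := Rat.cast_ne_zero.mpr (abs_ne_zero.mpr hn)
  have hd : (D₀.natAbs : ℂ) ≠ 0 := Nat.cast_ne_zero.mpr (Int.natAbs_ne_zero.mpr hD₀)
  have hcos : Differentiable ℂ fun s : ℂ => cos (π * (s - signDelta D₀ / 2 +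
      ((sigNeg Q : ℂ) - sigPos Q - 1) / 4)) := by fun_prop
  have hsin : Differentiable ℂ fun s : ℂ => sin (π * (2 * s + κ)) := by fun_prop
  have key : coeffOdd Q L b κ γ n D₀ = fun s : ℂ => (2 : ℂ) ^ (2 * s + 2 * κ - 1 / 2) *
      (π : ℂ) ^ (-s) * ((|n| : ℚ) : ℂ) ^ (κ + s - 1) *
      (sin (π * (2 * s + κ)) * (D₀.natAbs : ℂ) ^ (1 - κ - 2 * s) * Gamma (2 * s + κ) *
      ((cos (π * (s - signDelta D₀ / 2 + ((sigNeg Q : ℂ) - sigPos Q - 1) / 4)))⁻¹ *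
        ((Real.sqrt (Nat.card (DiscGroup Q L)) : ℂ))⁻¹ * (gammaFactor κ n s)⁻¹)) *
      (kroneckerL D₀ (3 / 2 - 2 * s - κ) / riemannZeta (2 - 4 * s - 2 * κ)) *
      sigma Q L b γ n D₀ (2 * s + κ) := by
    funext s
    rw [coeffOdd, div_eq_mul_inv _ (_ * gammaFactor κ n s), mul_inv, mul_inv]
  rw [key]
  exact ((((meromorphicAt_of_differentiable
      (((differentiable_const_cpow two_ne_zero (by fun_prop)).mul
      (differentiable_const_cpow (ofReal_ne_zero.mpr Real.pi_ne_zero) (by fun_prop))).mul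
      (differentiable_const_cpow hn' (by fun_prop))) s)).mul
    (((meromorphicAt_of_differentiable
        (hsin.mul (differentiable_const_cpow hd (by fun_prop))) s).mul
      (meromorphicAt_comp Meromorphic.Gamma (by fun_prop) s)).mul
      (((meromorphicAt_of_differentiable hcos s).inv.mul (MeromorphicAt.const _ s)).mul
      (meromorphicAt_of_differentiable (differentiable_gammaFactor_inv κ n) s)))).mul
    ((meromorphicAt_comp (meromorphic_kroneckerL D₀) (by fun_prop) s).div
      (meromorphicAt_comp meromorphic_riemannZeta (by fun_prop) s))).mul
    (meromorphicAt_comp (meromorphic_sigma Q L b _ n D₀) (by fun_prop) s)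

/-- The identity theorem for meromorphic functions in the plane. -/
lemma eventuallyEq_codiscrete_of_eqOn {F G : ℂ → ℂ} (hF : ∀ s, MeromorphicAt F s)
    (hG : ∀ s, MeromorphicAt G s) {U : Set ℂ} (hU : IsOpen U) {a : ℂ} (ha : a ∈ U)
    (h : Set.EqOn F G U) : F =ᶠ[Filter.codiscrete ℂ] G := by
  have hm : Meromorphic (F - G) := fun s => (hF s).sub (hG s)
  have h0 : meromorphicOrderAt (F - G) a = ⊤ := by
    rw [meromorphicOrderAt_eq_top_iff]
    exact (Filter.Eventually.filter_mono nhdsWithin_le_nhds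
      (Filter.mem_of_superset (hU.mem_nhds ha) fun z hz => by simp [h hz]))
  have h1 : ∀ s, meromorphicOrderAt (F - G) s = ⊤ := by
    by_contra! hne
    exact (hm.exists_meromorphicOrderAt_ne_top_iff_forall.mp hne a) h0
  refine mem_codiscreteWithin_iff_forall_mem_nhdsNE.mpr fun s _ => ?_
  have h2 := meromorphicOrderAt_eq_top_iff.mp (h1 s)
  filter_upwards [h2] with z hz
  exact Or.inl (sub_eq_zero.mp hz)

/-- The closed formula in even rank holds as an identity of meromorphic functions: on the open set
`Re s > 1 - κ/2`, `Im s > 0` its denominator does not vanish, since the cosine has only real zeros. -/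
lemma coeffFun_eventuallyEq_coeffEven (hr : Even r) {κ : ℝ} {j : ℤ}
    (hj : 2 * (κ : ℂ) - sigNeg Q + sigPos Q = 4 * j) {γ : dualLattice Q L} {n : ℚ} (hn : n ≠ 0)
    {D₀ : ℤ} (hD₀ : IsFundamentalDiscriminant D₀) :
    coeffFun Q L b κ j γ n D₀ =ᶠ[Filter.codiscrete ℂ] coeffEven Q L b κ γ n D₀ := by
  have hD0 := ne_zero_of_isFundamentalDiscriminant hD₀
  refine eventuallyEq_codiscrete_of_eqOn (meromorphic_coeffFun κ j γ hn D₀)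
    (meromorphic_coeffEven κ γ hn hD0) (U := {s | 1 - κ / 2 < s.re} ∩ {s | 0 < s.im})
    ((isOpen_lt continuous_const continuous_re).inter (isOpen_lt continuous_const continuous_im))
    (a := ⟨2 - κ / 2, 1⟩) ⟨?_, ?_⟩ fun s hs => ?_
  · change 1 - κ / 2 < 2 - κ / 2; linarith
  · change (0 : ℝ) < 1; exact one_pos
  obtain ⟨hs, hs' : 0 < s.im⟩ := hs
  refine coeffFun_eq_coeffEven hr hj hD₀ hs ?_
  have h2 := two_lt_re hs
  have hd : (D₀.natAbs : ℂ) ≠ 0 := Nat.cast_ne_zero.mpr (Int.natAbs_ne_zero.mpr hD0)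
  have hpi : (2 * π : ℂ) ≠ 0 := mul_ne_zero two_ne_zero (ofReal_ne_zero.mpr Real.pi_ne_zero)
  rw [kroneckerL_one_sub_even hD₀ hj hs]
  refine mul_ne_zero (mul_ne_zero (mul_ne_zero (mul_ne_zero (mul_ne_zero two_ne_zero ?_) ?_)
    (Gamma_ne_zero_of_re_pos (by linarith))) (mul_ne_zero (zpow_ne_zero _ (by norm_num))
    (cos_pi_mul_ne_zero ?_))) (kroneckerL_ne_zero hD₀ (by linarith))
  · exact (cpow_ne_zero_iff_of_exponent_ne_zero (fun h => by
      have := congrArg im h; simp at this; linarith)).mpr hd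
  · exact (cpow_ne_zero_iff_of_exponent_ne_zero (fun h => by
      have := congrArg im h; simp at this; linarith)).mpr hpi
  · have := signDelta_im D₀
    simp [this]
    exact hs'.ne'

/-- The closed formula in odd rank as an identity of meromorphic functions; the zeros of the cosine and
of the sine are real. -/
lemma coeffFun_eventuallyEq_coeffOdd (hr : ¬ Even r) {κ : ℝ} {j : ℤ}
    (hj : 2 * (κ : ℂ) - sigNeg Q + sigPos Q = 4 * j) {γ : dualLattice Q L} {n : ℚ} (hn : n ≠ 0)
    {D₀ : ℤ} (hD₀ : IsFundamentalDiscriminant D₀) :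
    coeffFun Q L b κ j γ n D₀ =ᶠ[Filter.codiscrete ℂ] coeffOdd Q L b κ γ n D₀ := by
  have hD0 := ne_zero_of_isFundamentalDiscriminant hD₀
  refine eventuallyEq_codiscrete_of_eqOn (meromorphic_coeffFun κ j γ hn D₀)
    (meromorphic_coeffOdd κ γ hn hD0) (U := {s | 1 - κ / 2 < s.re} ∩ {s | 0 < s.im})
    ((isOpen_lt continuous_const continuous_re).inter (isOpen_lt continuous_const continuous_im))
    (a := ⟨2 - κ / 2, 1⟩) ⟨?_, ?_⟩ fun s hs => ?_
  · change 1 - κ / 2 < 2 - κ / 2; linarith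
  · change (0 : ℝ) < 1; exact one_pos
  obtain ⟨hs, hs' : 0 < s.im⟩ := hs
  have h2 := two_lt_re hs
  have hre : (2 * (2 * s + κ) - 1 : ℂ).re = 2 * (2 * s + κ : ℂ).re - 1 := by simp
  have hpi : (2 * π : ℂ) ≠ 0 := mul_ne_zero two_ne_zero (ofReal_ne_zero.mpr Real.pi_ne_zero)
  refine coeffFun_eq_coeffOdd hr hj hD₀ hs (cos_pi_mul_ne_zero ?_) ?_
  · have := signDelta_im D₀
    simp [this]
    exact hs'.ne'
  rw [riemannZeta_one_sub_odd hs]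
  refine mul_ne_zero (mul_ne_zero (mul_ne_zero (mul_ne_zero two_ne_zero ?_)
    (Gamma_ne_zero_of_re_pos (by linarith))) (sin_pi_mul_ne_zero ?_))
    (riemannZeta_ne_zero_of_one_lt_re (by linarith))
  · exact (cpow_ne_zero_iff_of_exponent_ne_zero (fun h => by
      have := congrArg im h; simp at this; linarith)).mpr hpi
  · simp [hs'.ne']

end Meromorphy

/-! ### The Fourier coefficients -/

section Coefficients

open Complex

variable {V : Type*} [AddCommGroup V] [Module ℝ V] {Q : QuadraticForm ℝ V} {L : Submodule ℤ V}
  {r : ℕ} {b : Module.Basis (Fin r) ℝ V}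

/-- For `Re S > 2` the series converges to its continuation. -/
lemma tsum_term_eq_dirichletQuotient (hQ : (QuadraticMap.polarBilin Q).Nondegenerate)
    (hL : L = Submodule.span ℤ (Set.range b)) (heven : ∀ x ∈ L, ∃ m : ℤ, Q x = m)
    {γ : dualLattice Q L} {n : ℚ} (hn : n ≠ 0) {P : IntQuadPoly r}
    (hP : ∀ x : Fin r → ℤ, ((P.eval x : ℤ) : ℝ) = Q (∑ i, (x i : ℝ) • b i - (γ : V)) + n)
    (hN : (P.N : ℚ) = (level L (γ : V) : ℚ) ^ 2 * n) (hμ : (P.μ : ℚ) = 2 * n * level L (γ : V))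
    (hdet : (P.gram.det : ℝ) = gramDet Q b)
    (hprim : ∀ p : ℕ, p.Prime → p ∣ P.d → ∃ i, ¬ (p : ℤ) ∣ P.g i)
    {D₀ : ℤ} {f : ℕ} (hD₀ : IsFundamentalDiscriminant D₀)
    (hD : latticeDiscriminant Q L b γ n = D₀ * f ^ 2) {S : ℂ} (hS : 2 < S.re) :
    ∑' m, P.term S m = dirichletQuotient Q L b γ n D₀ S := by
  have hlev := (level_pos_and_mem hQ hL heven γ).1
  have hN0 : P.N ≠ 0 := fun h => by
    rw [h, Int.cast_zero] at hN
    exact mul_ne_zero (pow_ne_zero 2 (Nat.cast_ne_zero.mpr hlev.ne')) hn hN.symm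
  have hdet0 : P.gram.det ≠ 0 := fun h => by
    rw [h, Int.cast_zero] at hdet
    exact gramDet_ne_zero hQ b hdet.symm
  rw [dirichletQuotient]
  split_ifs with hr
  · rw [eq_div_iff (kroneckerL_ne_zero hD₀ (by linarith))]
    exact tsum_term_even hL hP hN hμ hdet hprim hN0 hdet0 hD₀ hD hr hS
  · rw [eq_div_iff (riemannZeta_ne_zero_of_one_lt_re (by simp; linarith))]
    exact tsum_term_odd hL hP hN hμ hdet hprim hN0 hdet0 hD₀ hD hr hS

/-- The root of unity of the Weil representation cancels against that of the archimedean integral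
up to the sign `(-1)^j`. -/
lemma weilConst_mul_exp {k j : ℤ} (hj : k - (sigNeg Q : ℤ) + (sigPos Q : ℤ) = 4 * j) :
    weilConst Q L * exp (π * I / 4) ^ (-k) =
      (-1) ^ j * ((Real.sqrt (Nat.card (DiscGroup Q L)) : ℂ))⁻¹ := by
  have h1 : exp (π * I / 4) ^ (4 : ℤ) = -1 := by
    rw [← exp_int_mul, show ((4 : ℤ) : ℂ) * (π * I / 4) = π * I by push_cast; ring, exp_pi_mul_I]
  have h2 : exp (π * I / 4) ^ ((sigNeg Q : ℤ) - (sigPos Q : ℤ)) * exp (π * I / 4) ^ (-k) =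
      (-1) ^ j := by
    rw [← zpow_add₀ (exp_ne_zero _), show (sigNeg Q : ℤ) - (sigPos Q : ℤ) + -k = 4 * -j by linarith,
      zpow_mul, h1, zpow_neg, ← inv_zpow]
    norm_num
  rw [weilConst, div_eq_mul_inv, ← h2]
  ring

/-- The Fourier coefficients of `E₀(τ, s)`, for `Re s > 1 - κ/2`. -/
lemma fourierCoefficient_eq_coeffFun (hQ : (QuadraticMap.polarBilin Q).Nondegenerate)
    (hL : L = Submodule.span ℤ (Set.range b)) (heven : ∀ x ∈ L, ∃ m : ℤ, Q x = m)
    (hW : IsWeilRep Q L (weilRep Q L)) [Finite (DiscGroup Q L)]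
    {κ : ℝ} {k : ℤ} (hk : 2 * κ = k) (hκ : 2 ≤ κ) {j : ℤ}
    (hj : k - (sigNeg Q : ℤ) + (sigPos Q : ℤ) = 4 * j)
    {γ : dualLattice Q L} {n : ℚ} (hn : n ≠ 0) (hnγ : ∃ m : ℤ, (n : ℝ) = m - Q (γ : V))
    {D₀ : ℤ} {f : ℕ} (hD₀ : IsFundamentalDiscriminant D₀)
    (hD : latticeDiscriminant Q L b γ n = D₀ * f ^ 2) {s : ℂ} (hs : 1 - κ / 2 < s.re)
    {y : ℝ} (hy : 0 < y) :
    fourierCoefficient (eisenstein Q L k 0 s) (Submodule.Quotient.mk γ) n y hy =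
      coeffFun Q L b κ j γ n D₀ s * calW κ s (4 * π * n * y) := by
  obtain ⟨P, hP, -, hN, hμ, hdet, hprim⟩ := exists_intQuadPoly hQ hL heven γ hnγ
  rw [fourierCoefficient_eisenstein hQ hL heven hW ⟨j, hj⟩ hk hs hn hnγ hP hy,
    tsum_term_eq_dirichletQuotient hQ hL heven hn hP hN hμ hdet hprim hD₀ hD (two_lt_re hs),
    integral_lineFun hy, integral_archimedean hκ hk hs hy hn, coeffFun,
    div_eq_mul_inv _ (gammaFactor κ n s), div_eq_mul_inv _ (_ * gammaFactor κ n s), mul_inv,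
    cpow_add _ _ (two_ne_zero (α := ℂ)), cpow_one]
  linear_combination 2 * dirichletQuotient Q L b γ n D₀ (2 * s + κ) * ((2 : ℂ) ^ (κ : ℂ) *
    (π : ℂ) ^ (κ + s) * ((|n| : ℚ) : ℂ) ^ (κ + s - 1) * (gammaFactor κ n s)⁻¹) *
    calW κ s (4 * π * n * y) * weilConst_mul_exp (L := L) hj

end Coefficients

end WeilEisenstein

end

/-- **Closed formula for the Fourier coefficients of the Eisenstein series.** -/
theorem theorem2 {V : Type*} [AddCommGroup V] [Module ℝ V] {r : ℕ}
    -- an even lattice `L` of rank `r` in a nondegenerate real quadratic space `(V, Q)`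
    (Q : QuadraticForm ℝ V) (hQ : (QuadraticMap.polarBilin Q).Nondegenerate)
    (b : Module.Basis (Fin r) ℝ V) (L : Submodule ℤ V)
    (hL : L = Submodule.span ℤ (Set.range b)) (heven : ∀ x ∈ L, ∃ m : ℤ, Q x = m)
    -- the weight `κ ∈ ½ℤ`, with `κ ≥ 2` and `2κ - b⁻ + b⁺ ≡ 0 mod 4`
    (κ : ℝ) (k : ℤ) (hk : 2 * κ = k) (hκ : 2 ≤ κ)
    (hsig : (4 : ℤ) ∣ k - (sigNeg Q : ℤ) + (sigPos Q : ℤ))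
    -- the index of the coefficient: `γ ∈ L'`, representing a class in `L'/L`, and
    -- `0 ≠ n ∈ ℤ - Q(γ)`
    (γ : dualLattice Q L) (n : ℚ) (hn : n ≠ 0) (hnγ : ∃ m : ℤ, (n : ℝ) = m - Q (γ : V))
    -- the decomposition `D = D₀ f²` with `D₀` a fundamental discriminant
    (D₀ : ℤ) (f : ℕ) (hD₀ : IsFundamentalDiscriminant D₀) (hf : 0 < f)
    (hD : latticeDiscriminant Q L b γ n = D₀ * f ^ 2) :
    -- convergence of the series that defines `E₀(τ, s)`
    (∀ s : ℂ, 1 - κ / 2 < s.re →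
      (∀ τ : ℍ, Summable fun c : CuspCosets => eisensteinTerm Q L k 0 s c τ) ∧
      Continuous (eisenstein Q L k 0 s)) ∧
    -- the function `C(γ, n, s)`, meromorphic in the plane and holomorphic for `Re s > 1 - κ/2`
    ∃ C : ℂ → ℂ, MeromorphicOn C Set.univ ∧
      AnalyticOnNhd ℂ C {s | 1 - κ / 2 < s.re} ∧
      (∀ s : ℂ, 1 - κ / 2 < s.re → ∀ (y : ℝ) (hy : 0 < y),
        fourierCoefficient (eisenstein Q L k 0 s) (Submodule.Quotient.mk γ) n y hy
          = C s * calW κ s (4 * π * n * y)) ∧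
      (Even r →
        C =ᶠ[Filter.codiscrete ℂ] coeffEven Q L b κ γ n D₀ ∧
        ∀ s : ℂ, 1 - κ / 2 < s.re →
          kroneckerL D₀ (1 - 2 * s - κ) ≠ 0 →
          C s = coeffEven Q L b κ γ n D₀ s) ∧
      (Odd r →
        C =ᶠ[Filter.codiscrete ℂ] coeffOdd Q L b κ γ n D₀ ∧
        ∀ s : ℂ, 1 - κ / 2 < s.re →
          Complex.cos (π * (s - signDelta D₀ / 2 + ((sigNeg Q : ℂ) - sigPos Q - 1) / 4)) ≠ 0 →
          riemannZeta (2 - 4 * s - 2 * κ) ≠ 0 →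
          C s = coeffOdd Q L b κ γ n D₀ s) := by
  obtain ⟨j, hj⟩ := hsig
  obtain ⟨F⟩ := exists_orthogonalFrame hQ b hL heven
  have : Finite (DiscGroup Q L) := F.finite_discGroup
  obtain ⟨R, hT, hS, -⟩ := F.exists_weil
  obtain ⟨ρ, hρ, -⟩ := F.exists_isWeilRep heven hT hS
  have hW := isWeilRep_weilRep ⟨ρ, hρ⟩
  have hj' : 2 * (κ : ℂ) - sigNeg Q + sigPos Q = 4 * j := by
    have h1 : ((2 * κ : ℝ) : ℂ) = ((k : ℝ) : ℂ) := congrArg _ hk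
    have h2 : (((k - (sigNeg Q : ℤ) + (sigPos Q : ℤ) : ℤ)) : ℂ) = ((4 * j : ℤ) : ℂ) :=
      congrArg _ hj
    push_cast at h1 h2
    rw [h1, h2]
  refine ⟨fun s hs => ⟨fun τ => summable_eisensteinTerm hW ⟨j, hj⟩
      (summable_rowTerm hQ hL heven hW ⟨j, hj⟩ hk hs τ),
      continuous_eisenstein hQ hL heven hW ⟨j, hj⟩ hk hs⟩,
    coeffFun Q L b κ j γ n D₀, fun s _ => meromorphic_coeffFun κ j γ hn D₀ s,
    analyticOnNhd_coeffFun κ j γ hn hD₀, fun s hs y hy =>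
      fourierCoefficient_eq_coeffFun hQ hL heven hW hk hκ hj hn hnγ hD₀ hD hs hy,
    fun hr => ⟨coeffFun_eventuallyEq_coeffEven hr hj' hn hD₀, fun s hs h0 =>
      coeffFun_eq_coeffEven hr hj' hD₀ hs h0⟩,
    fun hr => ?_⟩
  have hr' := Nat.not_even_iff_odd.mpr hr
  exact ⟨coeffFun_eventuallyEq_coeffOdd hr' hj' hn hD₀, fun s hs hc hz =>
    coeffFun_eq_coeffOdd hr' hj' hD₀ hs hc hz⟩
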